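/- **Setting.** Let $A\in\mathbb R^{d\times d}$ be invertible, $B\in\mathbb R^{d\times m}$, $\sigma\in\mathbb R$ and $\Delta t>0$. For an integer $i\ge 1$ let $a^{(i)}_1,\dots,a^{(i)}_i$ be the solution of $\sum_{j=1}^i a^{(i)}_j j^k=1$ for $k=1$ and $=0$ for $2\le k\le i$, and put $$\hat A_i=\frac1{\Delta t}\sum_{j=1}^i a^{(i)}_j\,(e^{Aj\Delta t}-I),\qquad \hat B_i=A^{-1}\hat A_iB .$$ The available data are the one-step transition laws (state after time $\Delta t$ under a constant action $a$, started at $s$) $$p_{\Delta t}(\cdot|s,a)=\mathcal N\big((\hat A_1\Delta t+I)s+\hat B_1a\,\Delta t,\ \sigma^2C_A\Delta t\big),\qquad C_A=\frac1{\Delta t}\int_0^{\Delta t}e^{A(\Delta t-u)}e^{A^\top(\Delta t-u)}\,du ,$$ and their iterates $p_{j\Delta t}(\cdot|s,a)=\int p_{\Delta t}(\cdot|\hat s,a)\,p_{(j-1)\Delta t}(d\hat s|s,a)$. Set $\hat b_i(s,a)=\frac1{\Delta t}\sum_{j=1}^i a^{(i)}_j\int(s'-s)\,p_{j\Delta t}(ds'|s,a)$.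 Control problems are posed on an arbitrary filtered probability space carrying a standard Brownian motion. A measurable feedback policy $\pi:\mathbb R^d\to\mathbb R^m$ is *optimal* for a control problem if from every initial state its closed-loop equation has a solution, and the expected discounted reward along any such solution is at least the one of every solution, from the same initial state, under any other measurable feedback policy (solutions are continuous and adapted, with state and action square integrable over $\Omega\times[0,T]$ for every $T$; rewards are extended real numbers). **(1) Optimal-PhiBE.** Let $Q,R$ be symmetric negative definite, $\beta\ge0$, and $\beta>0$ if $\sigma\ne0$. Let $i\ge1$ and assume that $(\hat A_i-\tfrac\beta2I,\hat B_i)$ is stabilizable. Consider the Optimal-PhiBE $$\beta\hat V(s)=\max_a\big[s^\top Qs+a^\top Ra+\hat b_i(s,a)\cdot\nabla\hat V(s)\big],$$ whose solutions are understood to be $C^1$, nonpositive and of at most quadratic growth, with $\hat V(0)=0$ if $\beta=0$; a policy obtained from it is one that selects, for each $s$, a maximiser of the right-hand side at a solution $\hat V$. Then there is exactly one policy $\hat\pi_i^*$ obtained from the Optimal-PhiBE. It is continuous, and among continuous policies it is exactly the optimal policy of $$\max_{a_t=\pi(s_t)}\mathbb E\Big[\int_0^\infty e^{-\beta t}(s_t^\top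 Qs_t+a_t^\top Ra_t)\,dt\Big],\qquad ds_t=(\hat A_is_t+\hat B_ia_t)\,dt+\sigma\,dB_t,$$ where $B_t$ is a standard $d$-dimensional Brownian motion. **(2) Optimal-BE.** Let $\tilde Q,\tilde R$ be symmetric negative definite, $0<\gamma\le1$, and $\gamma<1$ if $\sigma\ne0$. Put $$\hat\beta=\frac1{\Delta t\,\gamma}-\frac1{\Delta t},\qquad \hat Q=\frac1{\gamma\Delta t}\tilde Q,\qquad \hat R=\frac1{\gamma\Delta t}\tilde R,$$ and assume that $(\hat A_1-\tfrac{\hat\beta}2I,\ \hat B_1,\ \sqrt{\Delta t}\hat A_1,\ \sqrt{\Delta t}\hat B_1)$ is mean-square stabilizable, where $(A',B',C',D')$ is mean-square stabilizable if for some matrix $K$, with $a_t=Ks_t$, the solutions of $ds_t=(A's_t+B'a_t)\,dt+(C's_t+D'a_t)\,dB_t$ satisfy $\mathbb E|s_t|^2\to0$ from every initial state. Consider the Optimal-BE $$\tilde V(s)=\max_a\Big[s^\top\tilde Qs+a^\top\tilde Ra+\gamma\int\tilde V(s')\,p_{\Delta t}(ds'|s,a)\Big],$$ whose solutions are understood to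 be continuous, nonpositive and of at most quadratic growth, with $\tilde V(0)=0$ if $\gamma=1$; policies obtained from it are defined as in (1). Then there is exactly one policy $\tilde\pi^*$ obtained from the Optimal-BE. It is continuous, and among continuous policies it is exactly the optimal policy of $$\max_{a_t=\pi(s_t)}\mathbb E\Big[\int_0^\infty e^{-\hat\beta t}(s_t^\top\hat Qs_t+a_t^\top\hat Ra_t)\,dt\Big],\qquad ds_t=(\hat A_1s_t+\hat B_1a_t)\,dt+(\hat A_1s_t+\hat B_1a_t)\sqrt{\Delta t}\,dB_t,$$ where $B_t$ is a standard scalar Brownian motion. (In both parts, optimality is against all measurable feedback policies.) -/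

import Mathlib

open MeasureTheory ProbabilityTheory Filter Topology
open scoped NNReal ENNReal Matrix

noncomputable section

namespace PhiBE

/-! ### Stochastic integrals and controlled stochastic differential equations -/

section Stochastic

variable {Ω : Type*} {mΩ : MeasurableSpace Ω}

/-- `W` is a standard `n`-dimensional Brownian motion relative to the filtration `𝓕`: a continuous
adapted process started at `0`, whose increment over `[s, t]` is independent of `𝓕 s` and centred
Gaussian with covariance matrix `(t - s) I`. -/
structure IsBrownianMotion {n : ℕ} (𝓕 : Filtration ℝ≥0 mΩ)
    (W : ℝ≥0 → Ω → EuclideanSpace ℝ (Fin n)) (P : Measure Ω) : Prop where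
  adapted : ∀ t, Measurable[𝓕 t] (W t)
  continuous_paths : ∀ ω, Continuous fun t => W t ω
  start : ∀ᵐ ω ∂P, W 0 ω = 0
  increment_indep : ∀ s t : ℝ≥0, s ≤ t →
    Indep (MeasurableSpace.comap (fun ω => W t ω - W s ω) inferInstance) (𝓕 s) P
  increment_law : ∀ s t : ℝ≥0, s ≤ t →
    P.map (fun ω => W t ω - W s ω)
      = multivariateGaussian 0 (((t : ℝ) - (s : ℝ)) • (1 : Matrix (Fin n) (Fin n) ℝ))

/-- Simple (elementary predictable) integrands `∑ k < len, ξ k · 1_{(time k, time (k+1)]}` with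
`ξ k` bounded and measurable with respect to the information available at `time k`. -/
structure SimpleIntegrand (𝓕 : Filtration ℝ≥0 mΩ) where
  len : ℕ
  time : ℕ → ℝ≥0
  time_mono : Monotone time
  ξ : ℕ → Ω → ℝ
  measurable_ξ : ∀ k, Measurable[𝓕 (time k)] (ξ k)
  bounded_ξ : ∃ C : ℝ, ∀ k ω, |ξ k ω| ≤ C

/-- The value of a simple integrand at time `u`. -/
def SimpleIntegrand.eval {𝓕 : Filtration ℝ≥0 mΩ} (S : SimpleIntegrand 𝓕) (u : ℝ≥0) (ω : Ω) : ℝ :=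
  ∑ k ∈ Finset.range S.len,
    (Set.Ioc (S.time k) (S.time (k + 1))).indicator (fun _ => S.ξ k ω) u

/-- The elementary stochastic integral of a simple integrand over `[0, t]` against a scalar
process `w`. -/
def SimpleIntegrand.integral {𝓕 : Filtration ℝ≥0 mΩ} (S : SimpleIntegrand 𝓕) (w : ℝ≥0 → Ω → ℝ)
    (t : ℝ≥0) (ω : Ω) : ℝ :=
  ∑ k ∈ Finset.range S.len, S.ξ k ω * (w (min (S.time (k + 1)) t) ω - w (min (S.time k) t) ω)

/-- `M t` is (a version of) the Itô integral of `H` over `[0, t]` against the scalar Brownian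
motion `w`, for every `t`: simple integrands converge to `H` in `L²([0, T] × Ω)` for every `T`,
and their elementary integrals converge to `M t` in `L²(Ω)` for every `t`. -/
def IsItoIntegral (𝓕 : Filtration ℝ≥0 mΩ) (P : Measure Ω) (w : ℝ≥0 → Ω → ℝ)
    (H M : ℝ≥0 → Ω → ℝ) : Prop :=
  Measurable (Function.uncurry H) ∧ (∀ t, AEMeasurable (M t) P) ∧
  ∃ S : ℕ → SimpleIntegrand 𝓕,
    (∀ T : ℝ≥0, Tendsto
      (fun n => ∫⁻ ω, (∫⁻ u in Set.Ioc (0 : ℝ) T,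
        ‖(S n).eval u.toNNReal ω - H u.toNNReal ω‖ₑ ^ 2) ∂P) atTop (𝓝 0)) ∧
    (∀ t : ℝ≥0, Tendsto
      (fun n => ∫⁻ ω, ‖(S n).integral w t ω - M t ω‖ₑ ^ 2 ∂P) atTop (𝓝 0))

/-- Data of an infinite-horizon discounted control problem with states in `ℝ^d`, actions in `ℝ^m`
and an `n`-dimensional driving noise: maximise
`E ∫_0^∞ exp (-discount * t) * reward (s_t, a_t) dt` subject to
`ds_t = drift (s_t, a_t) dt + diffusion (s_t, a_t) dW_t`. -/
structure ControlProblem (d m n : ℕ) where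
  drift : EuclideanSpace ℝ (Fin d) → EuclideanSpace ℝ (Fin m) → EuclideanSpace ℝ (Fin d)
  diffusion : EuclideanSpace ℝ (Fin d) → EuclideanSpace ℝ (Fin m) → Matrix (Fin d) (Fin n) ℝ
  reward : EuclideanSpace ℝ (Fin d) → EuclideanSpace ℝ (Fin m) → ℝ
  discount : ℝ

variable {d m n : ℕ}

/-- `X` is an (admissible) solution, started at `s`, of the closed-loop equation
`dX_t = drift (X_t, π (X_t)) dt + diffusion (X_t, π (X_t)) dW_t`: a continuous adapted process,
square integrable together with the action process on every bounded time interval, which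
satisfies the integrated equation almost surely at every time. -/
structure IsClosedLoopSolution (C : ControlProblem d m n) (𝓕 : Filtration ℝ≥0 mΩ)
    (W : ℝ≥0 → Ω → EuclideanSpace ℝ (Fin n)) (P : Measure Ω)
    (π : EuclideanSpace ℝ (Fin d) → EuclideanSpace ℝ (Fin m))
    (s : EuclideanSpace ℝ (Fin d)) (X : ℝ≥0 → Ω → EuclideanSpace ℝ (Fin d)) : Prop where
  adapted : ∀ t, Measurable[𝓕 t] (X t)
  continuous_paths : ∀ ω, Continuous fun t => X t ω
  square_integrable : ∀ T : ℝ≥0,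
    ∫⁻ ω, (∫⁻ u in Set.Ioc (0 : ℝ) T,
      (‖X u.toNNReal ω‖ₑ ^ 2 + ‖π (X u.toNNReal ω)‖ₑ ^ 2)) ∂P < ∞
  equation : ∃ M : Fin d → Fin n → ℝ≥0 → Ω → ℝ,
    (∀ i j, IsItoIntegral 𝓕 P (fun t ω => W t ω j)
      (fun t ω => C.diffusion (X t ω) (π (X t ω)) i j) (M i j)) ∧
    ∀ t : ℝ≥0, ∀ᵐ ω ∂P, ∀ i,
      X t ω i = s i + (∫ u in (0 : ℝ)..t, C.drift (X u.toNNReal ω) (π (X u.toNNReal ω)) i)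
        + ∑ j, M i j t ω

/-- The discounted reward `exp (-discount * u) * reward (X_u, π (X_u))` at time `u`. -/
def discountedReward (C : ControlProblem d m n)
    (π : EuclideanSpace ℝ (Fin d) → EuclideanSpace ℝ (Fin m))
    (X : ℝ≥0 → Ω → EuclideanSpace ℝ (Fin d)) (u : ℝ) (ω : Ω) : ℝ :=
  Real.exp (-C.discount * u) * C.reward (X u.toNNReal ω) (π (X u.toNNReal ω))

/-- The expected discounted reward collected along the state process `X` under the feedback policy
`π`, as an extended real number (positive part minus negative part). -/
def payoff (C : ControlProblem d m n) (P : Measure Ω)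
    (π : EuclideanSpace ℝ (Fin d) → EuclideanSpace ℝ (Fin m))
    (X : ℝ≥0 → Ω → EuclideanSpace ℝ (Fin d)) : EReal :=
  ((∫⁻ ω, (∫⁻ u in Set.Ioi (0 : ℝ), ENNReal.ofReal (discountedReward C π X u ω)) ∂P : ℝ≥0∞) :
      EReal)
    - ((∫⁻ ω, (∫⁻ u in Set.Ioi (0 : ℝ), ENNReal.ofReal (-discountedReward C π X u ω)) ∂P : ℝ≥0∞) :
      EReal)

/-- `π` is an optimal feedback policy: from every initial state its closed-loop equation has a
solution, and no measurable feedback policy yields a larger expected discounted reward. -/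
def IsOptimalPolicy (C : ControlProblem d m n) (𝓕 : Filtration ℝ≥0 mΩ)
    (W : ℝ≥0 → Ω → EuclideanSpace ℝ (Fin n)) (P : Measure Ω)
    (π : EuclideanSpace ℝ (Fin d) → EuclideanSpace ℝ (Fin m)) : Prop :=
  Measurable π ∧ ∀ s,
    (∃ X, IsClosedLoopSolution C 𝓕 W P π s X) ∧
    ∀ X, IsClosedLoopSolution C 𝓕 W P π s X →
      ∀ π', Measurable π' → ∀ X', IsClosedLoopSolution C 𝓕 W P π' s X' →
        payoff C P π' X' ≤ payoff C P π X

end Stochastic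

/-! ### Linear-quadratic control problems -/

section LQ

variable {d m : ℕ}

/-- The quadratic form `xᵀ M x`. -/
def quad {k : ℕ} (M : Matrix (Fin k) (Fin k) ℝ) (x : EuclideanSpace ℝ (Fin k)) : ℝ :=
  x.ofLp ⬝ᵥ (M *ᵥ x.ofLp)

/-- The linear map `(s, a) ↦ A s + B a`. -/
def linDrift (A : Matrix (Fin d) (Fin d) ℝ) (B : Matrix (Fin d) (Fin m) ℝ)
    (s : EuclideanSpace ℝ (Fin d)) (a : EuclideanSpace ℝ (Fin m)) : EuclideanSpace ℝ (Fin d) :=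
  A.toEuclideanLin s + B.toEuclideanLin a

/-- The linear-quadratic problem with dynamics `ds = (A s + B a) dt + σ dW` (`W` a Brownian motion
in the state space), reward `sᵀ Q s + aᵀ R a` and discount `β`. -/
def additiveLQ (A : Matrix (Fin d) (Fin d) ℝ) (B : Matrix (Fin d) (Fin m) ℝ) (σ : ℝ)
    (Q : Matrix (Fin d) (Fin d) ℝ) (R : Matrix (Fin m) (Fin m) ℝ) (β : ℝ) :
    ControlProblem d m d where
  drift := linDrift A B
  diffusion := fun _ _ => σ • (1 : Matrix (Fin d) (Fin d) ℝ)
  reward := fun s a => quad Q s + quad R a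
  discount := β

/-- The linear-quadratic problem with dynamics `ds = (A s + B a) dt + (C s + D a) dW` (`W` a scalar
Brownian motion), reward `sᵀ Q s + aᵀ R a` and discount `β`. -/
def multiplicativeLQ (A : Matrix (Fin d) (Fin d) ℝ) (B : Matrix (Fin d) (Fin m) ℝ)
    (C : Matrix (Fin d) (Fin d) ℝ) (D : Matrix (Fin d) (Fin m) ℝ)
    (Q : Matrix (Fin d) (Fin d) ℝ) (R : Matrix (Fin m) (Fin m) ℝ) (β : ℝ) :
    ControlProblem d m 1 where
  drift := linDrift A B
  diffusion := fun s a => Matrix.of fun i _ => linDrift C D s a i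
  reward := fun s a => quad Q s + quad R a
  discount := β

/-- `(A, B)` is stabilizable: some linear feedback `a = K s` makes `ds = (A s + B a) dt`
asymptotically stable. -/
def Stabilizable (A : Matrix (Fin d) (Fin d) ℝ) (B : Matrix (Fin d) (Fin m) ℝ) : Prop :=
  ∃ K : Matrix (Fin m) (Fin d) ℝ, ∀ x : Fin d → ℝ,
    Tendsto (fun t : ℝ => NormedSpace.exp (t • (A + B * K)) *ᵥ x) atTop (𝓝 0)

/-- `(A, B, C, D)` is mean-square stabilizable: for some linear feedback `a = K s`, the solutions of
`ds = (A s + B a) dt + (C s + D a) dW` satisfy `E |s_t|² → 0`, from every initial state. -/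
def MeanSquareStabilizable {Ω : Type*} {mΩ : MeasurableSpace Ω} (𝓕 : Filtration ℝ≥0 mΩ)
    (W : ℝ≥0 → Ω → EuclideanSpace ℝ (Fin 1)) (P : Measure Ω)
    (A : Matrix (Fin d) (Fin d) ℝ) (B : Matrix (Fin d) (Fin m) ℝ)
    (C : Matrix (Fin d) (Fin d) ℝ) (D : Matrix (Fin d) (Fin m) ℝ) : Prop :=
  ∃ K : Matrix (Fin m) (Fin d) ℝ, ∀ s : EuclideanSpace ℝ (Fin d),
    ∃ X, IsClosedLoopSolution (multiplicativeLQ A B C D 0 0 0) 𝓕 W P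
        (fun x => K.toEuclideanLin x) s X ∧
      Tendsto (fun t => ∫⁻ ω, ‖X t ω‖ₑ ^ 2 ∂P) atTop (𝓝 0)

/-! ### Discrete-time transition data, Optimal-PhiBE and Optimal-BE -/

/-- The coefficients `(a_1, …, a_i)` of the order-`i` scheme (`a_{j+1}` is stored at index `j`): the
solution of `∑ j, a_j j ^ k = 1` for `k = 1` and `= 0` for `2 ≤ k ≤ i`. -/
def coef (i : ℕ) : Fin i → ℝ :=
  (Matrix.of fun k j : Fin i => ((j : ℝ) + 1) ^ ((k : ℕ) + 1))⁻¹ *ᵥ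
    (fun k => if (k : ℕ) = 0 then 1 else 0)

/-- `Â_i = (1/Δt) ∑_{j=1}^i a_j (exp (A j Δt) - I)`. -/
def Ahat (A : Matrix (Fin d) (Fin d) ℝ) (Δt : ℝ) (i : ℕ) : Matrix (Fin d) (Fin d) ℝ :=
  (1 / Δt) • ∑ j : Fin i, coef i j • (NormedSpace.exp ((((j : ℝ) + 1) * Δt) • A) - 1)

/-- `B̂_i = A⁻¹ Â_i B`. -/
def Bhat (A : Matrix (Fin d) (Fin d) ℝ) (B : Matrix (Fin d) (Fin m) ℝ) (Δt : ℝ) (i : ℕ) :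
    Matrix (Fin d) (Fin m) ℝ :=
  A⁻¹ * Ahat A Δt i * B

/-- `C_A = (1/Δt) ∫_0^Δt exp (A (Δt - u)) exp (Aᵀ (Δt - u)) du`. -/
def noiseCov (A : Matrix (Fin d) (Fin d) ℝ) (Δt : ℝ) : Matrix (Fin d) (Fin d) ℝ :=
  Matrix.of fun k l => (1 / Δt) * ∫ u in (0 : ℝ)..Δt,
    (NormedSpace.exp ((Δt - u) • A) * NormedSpace.exp ((Δt - u) • Aᵀ)) k l

/-- The one-step transition law `p_Δt(· | s, a)` of `ds = (A s + B a) dt + σ dW` under a constant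
action: the Gaussian law with mean `(Â_1 Δt + I) s + B̂_1 a Δt` and covariance `σ² C_A Δt`. -/
def transition (A : Matrix (Fin d) (Fin d) ℝ) (B : Matrix (Fin d) (Fin m) ℝ) (σ Δt : ℝ)
    (s : EuclideanSpace ℝ (Fin d)) (a : EuclideanSpace ℝ (Fin m)) :
    Measure (EuclideanSpace ℝ (Fin d)) :=
  multivariateGaussian
    (linDrift (Δt • Ahat A Δt 1 + 1) (Δt • Bhat A B Δt 1) s a)
    ((σ ^ 2 * Δt) • noiseCov A Δt)

/-- The `j`-step transition law `p_{jΔt}(· | s, a)` under a constant action, obtained from a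
one-step transition law `p` by iteration. -/
def iterTransition
    (p : EuclideanSpace ℝ (Fin d) → EuclideanSpace ℝ (Fin m) → Measure (EuclideanSpace ℝ (Fin d)))
    (s : EuclideanSpace ℝ (Fin d)) (a : EuclideanSpace ℝ (Fin m)) :
    ℕ → Measure (EuclideanSpace ℝ (Fin d))
  | 0 => Measure.dirac s
  | j + 1 => (iterTransition p s a j).bind fun x => p x a

/-- The order-`i` drift approximation
`b̂_i(s, a) = E[(1/Δt) ∑_{j=1}^i a_j (s_{jΔt} - s_0) | s_0 = s, a_τ = a]` computed from a one-step
transition law `p`. -/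
def bHat
    (p : EuclideanSpace ℝ (Fin d) → EuclideanSpace ℝ (Fin m) → Measure (EuclideanSpace ℝ (Fin d)))
    (Δt : ℝ) (i : ℕ) (s : EuclideanSpace ℝ (Fin d)) (a : EuclideanSpace ℝ (Fin m)) :
    EuclideanSpace ℝ (Fin d) :=
  (1 / Δt) • ∑ j : Fin i, coef i j • ∫ x, (x - s) ∂(iterTransition p s a ((j : ℕ) + 1))

/-- The expression `r(s, a) + b(s, a) · ∇V(s)` maximised in the (deterministic) Optimal-PhiBE. -/
def phibeObjective
    (r : EuclideanSpace ℝ (Fin d) → EuclideanSpace ℝ (Fin m) → ℝ)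
    (b : EuclideanSpace ℝ (Fin d) → EuclideanSpace ℝ (Fin m) → EuclideanSpace ℝ (Fin d))
    (V : EuclideanSpace ℝ (Fin d) → ℝ)
    (s : EuclideanSpace ℝ (Fin d)) (a : EuclideanSpace ℝ (Fin m)) : ℝ :=
  r s a + inner ℝ (b s a) (gradient V s)

/-- `V` is at most of quadratic growth. -/
def QuadraticGrowth (V : EuclideanSpace ℝ (Fin d) → ℝ) : Prop :=
  ∃ c : ℝ, ∀ s, |V s| ≤ c * (1 + ‖s‖ ^ 2)

/-- `V` solves the Optimal-PhiBE `β V(s) = max_a [r(s, a) + b(s, a) · ∇V(s)]` (for nonpositive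
rewards): a continuously differentiable, nonpositive solution of quadratic growth, normalised by
`V(0) = 0` in the undiscounted case, where the equation fixes `V` only up to a constant. -/
structure IsPhiBESolution
    (r : EuclideanSpace ℝ (Fin d) → EuclideanSpace ℝ (Fin m) → ℝ)
    (b : EuclideanSpace ℝ (Fin d) → EuclideanSpace ℝ (Fin m) → EuclideanSpace ℝ (Fin d))
    (β : ℝ) (V : EuclideanSpace ℝ (Fin d) → ℝ) : Prop where
  smooth : ContDiff ℝ 1 V
  nonpos : ∀ s, V s ≤ 0
  growth : QuadraticGrowth V
  normalized : β = 0 → V 0 = 0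
  equation : ∀ s, IsGreatest (Set.range fun a => phibeObjective r b V s a) (β * V s)

/-- `π` is an optimal policy obtained from the Optimal-PhiBE: `π s` maximises the right-hand side
of the equation at a solution. -/
def IsPhiBEPolicy
    (r : EuclideanSpace ℝ (Fin d) → EuclideanSpace ℝ (Fin m) → ℝ)
    (b : EuclideanSpace ℝ (Fin d) → EuclideanSpace ℝ (Fin m) → EuclideanSpace ℝ (Fin d))
    (β : ℝ) (π : EuclideanSpace ℝ (Fin d) → EuclideanSpace ℝ (Fin m)) : Prop :=
  ∃ V, IsPhiBESolution r b β V ∧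
    ∀ s a, phibeObjective r b V s a ≤ phibeObjective r b V s (π s)

/-- The expression `r(s, a) + γ ∫ V(s') p(ds' | s, a)` maximised in the Optimal-BE. -/
def beObjective
    (r : EuclideanSpace ℝ (Fin d) → EuclideanSpace ℝ (Fin m) → ℝ)
    (p : EuclideanSpace ℝ (Fin d) → EuclideanSpace ℝ (Fin m) → Measure (EuclideanSpace ℝ (Fin d)))
    (γ : ℝ) (V : EuclideanSpace ℝ (Fin d) → ℝ)
    (s : EuclideanSpace ℝ (Fin d)) (a : EuclideanSpace ℝ (Fin m)) : ℝ :=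
  r s a + γ * ∫ x, V x ∂(p s a)

/-- `V` solves the Optimal-BE `V(s) = max_a [r(s, a) + γ ∫ V(s') p(ds' | s, a)]` (for nonpositive
rewards): a continuous, nonpositive solution of quadratic growth, normalised by `V(0) = 0` in the
undiscounted case, where the equation fixes `V` only up to a constant. -/
structure IsBESolution
    (r : EuclideanSpace ℝ (Fin d) → EuclideanSpace ℝ (Fin m) → ℝ)
    (p : EuclideanSpace ℝ (Fin d) → EuclideanSpace ℝ (Fin m) → Measure (EuclideanSpace ℝ (Fin d)))
    (γ : ℝ) (V : EuclideanSpace ℝ (Fin d) → ℝ) : Prop where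
  continuous : Continuous V
  nonpos : ∀ s, V s ≤ 0
  growth : QuadraticGrowth V
  normalized : γ = 1 → V 0 = 0
  equation : ∀ s, IsGreatest (Set.range fun a => beObjective r p γ V s a) (V s)

/-- `π` is an optimal policy obtained from the Optimal-BE: `π s` maximises the right-hand side of
the equation at a solution. -/
def IsBEPolicy
    (r : EuclideanSpace ℝ (Fin d) → EuclideanSpace ℝ (Fin m) → ℝ)
    (p : EuclideanSpace ℝ (Fin d) → EuclideanSpace ℝ (Fin m) → Measure (EuclideanSpace ℝ (Fin d)))
    (γ : ℝ) (π : EuclideanSpace ℝ (Fin d) → EuclideanSpace ℝ (Fin m)) : Prop :=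
  ∃ V, IsBESolution r p γ V ∧ ∀ s a, beObjective r p γ V s a ≤ beObjective r p γ V s (π s)

end LQ

end PhiBE

end

/-!
Both equations are quadratic, and the optimal policy is the linear feedback of a Riccati equation.

*The common scheme.* Let `p` be a positive definite form, `p (x) = p (x, x)`, and `K` a linear
feedback such that the Riccati equation holds as a completed square: stage cost plus mean rate of
change of `p`, less discount, equals `Rb (a - K s)` for a positive definite form `Rb` in the action.
Stabilizability supplies a quadratic supersolution (`exists_stable_form`: decay of the second
moments makes a form `S` decrease in mean by at least `‖x‖²`), and value iteration from `0`
increases to `p` below it (`exists_riccati`). The continuous-time equation is the discrete one for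
an implicit midpoint step, along which quadratic forms change by exactly their rate at the midpoint
(`exists_care`).

*The equations determine the policy.* Let `Z ≥ 0` be minus a solution of the PhiBE or of the Bellman
equation. Following `K`, along whose closed loop `p` decays geometrically and `Z` grows at most
quadratically, gives `Z ≤ p` (`hjb_le`, `bellman_le`). Conversely `p ≤ Z`: for the Bellman equation
because value iteration from `0` stays below `Z` (`le_bellman`), for the PhiBE by a maximum
principle for the penalised ratio `Z / p`, the equation being quadratic in the gradient (`le_hjb`).
So the solution is `-p`, up to a constant from the noise in the Bellman case (`isPhiBEPolicy_iff`,
`isBEPolicy_iff`), and the completed square makes `K s` the only maximiser. The mean of the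
`j`-step transition law is affine with matrices `exp (j Δt A)` and `A⁻¹ (exp (j Δt A) - 1) B`, hence
`b̂_i (s, a) = Â_i s + B̂_i a` (`bHat_transition`).

*The control problems have the same Riccati equation.* The mean of `p (X_t)` along an arbitrary
admissible solution is computed from the Itô isometry and the martingale property alone
(`IsItoProcess.integral_mul`); no Itô formula is needed for a quadratic form. For additive noise the
noise contributes a constant. For multiplicative noise it contributes `Δt p (Â s + B̂ a)`, and
`2 p (s, v) + Δt p (v, v)` is, up to discounting, the increment `γ p (s + Δt v) - p (s)` divided by
`γ Δt` (`discounted_step_eq`): the Bellman equation is the Riccati equation of the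
multiplicative-noise problem. Verification (`continuous_optimal_iff`) reads off the cost of an
arbitrary policy as the value of `K` plus the discounted mean of `Rb (π (X) - K X)`; an optimal
continuous policy started at `s` therefore agrees with `K` along its path, in particular at `s`.

*Existence.* Verification needs a solution under `K` on the given filtered space. For additive noise
it is the variation-of-constants formula (`exists_additive_solution`). For multiplicative noise the
drift and diffusion matrices are proportional, hence commute, so the solution is the explicit
exponential `exp (w c L + t (L - c² L² / 2)) s`. That its martingale part is the Itô integral of
`c L X` is shown by hand: the Milstein error of one step is of order `3 / 2`, and the compensated
squared increments `(Δw)² - h` are orthogonal, so the Itô sums converge in `L²`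
(`exists_geometricBM_grid`, `isItoIntegral_geometricBM`).
-/

namespace PhiBE

/-! ### Quadratic forms and the discrete algebraic Riccati equation -/

section Riccati

open LinearMap (BilinForm)

section Algebra

variable {E F : Type*} [AddCommGroup E] [Module ℝ E] [AddCommGroup F] [Module ℝ F]

theorem bilin_add_self {b : BilinForm ℝ E} (hb : ∀ x y, b x y = b y x) (x y : E) :
    b (x + y) (x + y) = b x x + 2 * b x y + b y y := by
  simp only [map_add, LinearMap.add_apply, hb y x]; ring

theorem bilin_polar {b : BilinForm ℝ E} (hb : ∀ x y, b x y = b y x) (x y : E) :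
    b x y = (b (x + y) (x + y) - b x x - b y y) / 2 := by
  rw [bilin_add_self hb]; ring

/-- Completing the square: a symmetric form on `E × F` that is positive definite on `F` is minimised
over `F` by a linear feedback. -/
theorem exists_complete_square [FiniteDimensional ℝ F] (b : BilinForm ℝ (E × F))
    (hb : ∀ x y, b x y = b y x) (hpos : ∀ a : F, a ≠ 0 → 0 < b (0, a) (0, a)) :
    ∃ K : E →ₗ[ℝ] F, ∀ s a, b (s, a) (s, a)
      = b (s, K s) (s, K s) + b (0, a - K s) (0, a - K s) := by
  let D : F →ₗ[ℝ] Module.Dual ℝ F :=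
    (b.compl₁₂ (LinearMap.inr ℝ E F) (LinearMap.inr ℝ E F))
  have hD : Function.Injective D := by
    rw [injective_iff_map_eq_zero]
    intro a ha
    by_contra hne
    have := congrArg (fun f => f a) ha
    have h2 := hpos a hne
    simp [D] at this
    linarith
  let e : F ≃ₗ[ℝ] Module.Dual ℝ F :=
    LinearEquiv.ofInjectiveOfFinrankEq D hD (Subspace.dual_finrank_eq).symm
  let C : E →ₗ[ℝ] Module.Dual ℝ F :=
    (b.compl₁₂ (LinearMap.inl ℝ E F) (LinearMap.inr ℝ E F))
  refine ⟨-(e.symm.toLinearMap ∘ₗ C), fun s a => ?_⟩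
  set k := (-(e.symm.toLinearMap ∘ₗ C)) s with hk
  have hek : ∀ v, b (0, k) (0, v) = - b (s, 0) (0, v) := by
    intro v
    have h1 : D k = - C s := by
      have : D (e.symm (C s)) = C s := e.apply_symm_apply (C s)
      simp [hk, this]
    have := congrArg (fun f => f v) h1
    simpa [D, C] using this
  have h1 : ((s, a) : E × F) = (s, k) + (0, a - k) := by simp
  have h2 : b (s, k) (0, a - k) = 0 := by
    have : ((s, k) : E × F) = (s, 0) + (0, k) := by simp
    rw [this, map_add, LinearMap.add_apply, hek]; ring
  rw [h1, bilin_add_self hb, h2]; ring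

/-- One step of value iteration for quadratic value functions. -/
theorem exists_riccati_step [FiniteDimensional ℝ F] (N : BilinForm ℝ (E × F))
    (hN : ∀ x y, N x y = N y x) (hNpos : ∀ x, x ≠ 0 → 0 < N x x) (M : E × F →ₗ[ℝ] E)
    (p : BilinForm ℝ E) (hp : ∀ x y, p x y = p y x) (hp0 : ∀ x, 0 ≤ p x x) :
    ∃ p' : BilinForm ℝ E, (∀ x y, p' x y = p' y x) ∧ (∀ x, 0 ≤ p' x x) ∧
      (∀ s a, p' s s ≤ N (s, a) (s, a) + p (M (s, a)) (M (s, a))) ∧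
      ∃ K : E →ₗ[ℝ] F, ∀ s a, N (s, a) (s, a) + p (M (s, a)) (M (s, a)) = p' s s +
        (N (0, a - K s) (0, a - K s) + p (M (0, a - K s)) (M (0, a - K s))) := by
  let b : BilinForm ℝ (E × F) := N + p.compl₁₂ M M
  have hbv : ∀ x y, b x y = N x y + p (M x) (M y) := fun x y => by simp [b]
  have hN0 : ∀ x, 0 ≤ N x x := fun x => by
    rcases eq_or_ne x 0 with rfl | h
    · simp
    · exact (hNpos x h).le
  obtain ⟨K, hK⟩ := exists_complete_square b (fun x y => by rw [hbv, hbv, hN, hp])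
    (fun a ha => by
      rw [hbv]; exact add_pos_of_pos_of_nonneg (hNpos _ (by simpa using ha)) (hp0 _))
  let G : E →ₗ[ℝ] E × F := LinearMap.prod LinearMap.id K
  have hv : ∀ x y, b.compl₁₂ G G x y = N (x, K x) (y, K y) + p (M (x, K x)) (M (y, K y)) := by
    intro x y; rw [LinearMap.compl₁₂_apply, hbv]; rfl
  refine ⟨b.compl₁₂ G G, fun x y => ?_, fun x => ?_, fun s a => ?_, K, fun s a => ?_⟩
  · rw [hv, hv, hN, hp]
  · rw [hv]; exact add_nonneg (hN0 _) (hp0 _)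
  · have := hK s a
    simp only [hbv] at this
    rw [hv, this]
    linarith [hN0 (0, a - K s), hp0 (M (0, a - K s))]
  · have := hK s a
    simp only [hbv] at this
    rw [hv, this]

/-- A monotone pointwise-bounded sequence of symmetric forms converges to a symmetric form. -/
theorem exists_bilin_limit (p : ℕ → BilinForm ℝ E) (hp : ∀ n x y, p n x y = p n y x)
    (hmono : ∀ x, Monotone fun n => p n x x) (B : E → ℝ) (hB : ∀ n x, p n x x ≤ B x) :
    ∃ q : BilinForm ℝ E, (∀ x y, q x y = q y x) ∧
      ∀ x y, Tendsto (fun n => p n x y) atTop (𝓝 (q x y)) := by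
  have h1 : ∀ x, ∃ l, Tendsto (fun n => p n x x) atTop (𝓝 l) := fun x =>
    ⟨_, tendsto_atTop_ciSup (hmono x) ⟨B x, by rintro _ ⟨n, rfl⟩; exact hB n x⟩⟩
  have h2 : ∀ x y, ∃ l, Tendsto (fun n => p n x y) atTop (𝓝 l) := by
    intro x y
    obtain ⟨l1, hl1⟩ := h1 (x + y)
    obtain ⟨l2, hl2⟩ := h1 x
    obtain ⟨l3, hl3⟩ := h1 y
    refine ⟨(l1 - l2 - l3) / 2, ?_⟩
    simp_rw [fun n => bilin_polar (hp n) x y]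
    exact ((hl1.sub hl2).sub hl3).div_const 2
  choose l hl using h2
  refine ⟨LinearMap.mk₂ ℝ l ?_ ?_ ?_ ?_, fun x y => ?_, fun x y => hl x y⟩
  · intro x x' y
    refine tendsto_nhds_unique (hl (x + x') y) ?_
    simpa using (hl x y).add (hl x' y)
  · intro c x y
    refine tendsto_nhds_unique (hl (c • x) y) ?_
    simpa using (hl x y).const_mul c
  · intro x y y'
    refine tendsto_nhds_unique (hl x (y + y')) ?_
    simpa using (hl x y).add (hl x y')
  · intro c x y
    refine tendsto_nhds_unique (hl x (c • y)) ?_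
    simpa using (hl x y).const_mul c
  · refine tendsto_nhds_unique (hl x y) ?_
    simp_rw [hp _ x y]
    exact hl y x

end Algebra

section Normed

variable {E F : Type*} [NormedAddCommGroup E] [NormedSpace ℝ E] [FiniteDimensional ℝ E]
  [NormedAddCommGroup F] [NormedSpace ℝ F] [FiniteDimensional ℝ F]

theorem continuous_bilin_self (b : BilinForm ℝ E) : Continuous fun x => b x x := by
  have : (fun x => b x x) = fun x => LinearMap.toContinuousBilinearMap b x x := rfl
  rw [this]; fun_prop

theorem bilin_le_norm_sq (b : BilinForm ℝ E) : ∃ C, 0 < C ∧ ∀ x, |b x x| ≤ C * ‖x‖ ^ 2 := by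
  refine ⟨‖LinearMap.toContinuousBilinearMap b‖ + 1, by positivity, fun x => ?_⟩
  have := (LinearMap.toContinuousBilinearMap b).le_opNorm₂ x x
  rw [LinearMap.toContinuousBilinearMap_apply, Real.norm_eq_abs] at this
  nlinarith [sq_nonneg ‖x‖]

theorem bilin_coercive (b : BilinForm ℝ E) (hpos : ∀ x, x ≠ 0 → 0 < b x x) :
    ∃ c, 0 < c ∧ ∀ x, c * ‖x‖ ^ 2 ≤ b x x := by
  have hc : IsCompact (Metric.sphere (0 : E) 1) := isCompact_sphere 0 1
  rcases (Metric.sphere (0 : E) 1).eq_empty_or_nonempty with he | hne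
  · refine ⟨1, one_pos, fun x => ?_⟩
    have hx : x = 0 := by
      by_contra hx
      have : (‖x‖⁻¹ • x) ∈ Metric.sphere (0 : E) 1 := by
        simp [norm_smul, inv_mul_cancel₀ (norm_ne_zero_iff.2 hx)]
      rw [he] at this; exact this
    simp [hx]
  · obtain ⟨x0, hx0, hmin⟩ := hc.exists_isMinOn hne (continuous_bilin_self b).continuousOn
    have hx0' : x0 ≠ 0 := by rintro rfl; simp at hx0
    refine ⟨b x0 x0, hpos _ hx0', fun x => ?_⟩
    rcases eq_or_ne x 0 with rfl | hx
    · simp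
    have hn : ‖x‖ ≠ 0 := norm_ne_zero_iff.2 hx
    have h1 : (‖x‖⁻¹ • x) ∈ Metric.sphere (0 : E) 1 := by
      simp [norm_smul, inv_mul_cancel₀ hn]
    have h2 : b x0 x0 ≤ b (‖x‖⁻¹ • x) (‖x‖⁻¹ • x) := hmin h1
    have h3 : b x x = ‖x‖ ^ 2 * b (‖x‖⁻¹ • x) (‖x‖⁻¹ • x) := by
      simp only [map_smul, LinearMap.smul_apply, smul_eq_mul]; field_simp
    rw [h3, mul_comm]
    exact mul_le_mul_of_nonneg_left h2 (by positivity)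

/-- Existence for the discrete algebraic Riccati equation by value iteration from `0`: a
supersolution bounds the iterates, which increase to a solution. The iterates `q n` are kept in the
statement because they bound every nonnegative solution of the Bellman equation from below. -/
theorem exists_riccati (N : BilinForm ℝ (E × F)) (hN : ∀ x y, N x y = N y x)
    (hNpos : ∀ x, x ≠ 0 → 0 < N x x) (M : E × F →ₗ[ℝ] E) (S : BilinForm ℝ E)
    (hS : ∀ x, 0 ≤ S x x) (K₀ : E →ₗ[ℝ] F)
    (hsup : ∀ s, N (s, K₀ s) (s, K₀ s) + S (M (s, K₀ s)) (M (s, K₀ s)) ≤ S s s) :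
    ∃ (q : ℕ → BilinForm ℝ E) (p : BilinForm ℝ E) (K : E →ₗ[ℝ] F),
      q 0 = 0 ∧ (∀ n x y, q n x y = q n y x) ∧ (∀ n x, 0 ≤ q n x x) ∧
      (∀ n s a, q (n + 1) s s ≤ N (s, a) (s, a) + q n (M (s, a)) (M (s, a))) ∧
      (∀ s, Tendsto (fun n => q n s s) atTop (𝓝 (p s s))) ∧
      (∀ x y, p x y = p y x) ∧ (∀ x, x ≠ 0 → 0 < p x x) ∧
      ∀ s a, N (s, a) (s, a) + p (M (s, a)) (M (s, a)) = p s s +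
        (N (0, a - K s) (0, a - K s) + p (M (0, a - K s)) (M (0, a - K s))) := by
  have hN0 : ∀ x, 0 ≤ N x x := fun x => by
    rcases eq_or_ne x 0 with rfl | h
    · simp
    · exact (hNpos x h).le
  let T := {p : BilinForm ℝ E // (∀ x y, p x y = p y x) ∧ ∀ x, 0 ≤ p x x}
  have step : ∀ p : T, ∃ p' : T,
      (∀ s a, p'.1 s s ≤ N (s, a) (s, a) + p.1 (M (s, a)) (M (s, a))) ∧
      ∀ s, ∃ a, p'.1 s s = N (s, a) (s, a) + p.1 (M (s, a)) (M (s, a)) := by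
    intro p
    obtain ⟨p', h1, h2, h3, K, h4⟩ := exists_riccati_step N hN hNpos M p.1 p.2.1 p.2.2
    refine ⟨⟨p', h1, h2⟩, h3, fun s => ⟨K s, ?_⟩⟩
    have := h4 s (K s)
    simp [this, show ((0, 0) : E × F) = 0 from rfl]
  choose f hf1 hf2 using step
  let q : ℕ → T := fun n => Nat.rec ⟨0, by simp, by simp⟩ (fun _ p => f p) n
  have hq1 : ∀ n s a, (q (n + 1)).1 s s ≤ N (s, a) (s, a) + (q n).1 (M (s, a)) (M (s, a)) :=
    fun n => hf1 (q n)
  have hq2 : ∀ n s, ∃ a, (q (n + 1)).1 s s = N (s, a) (s, a) + (q n).1 (M (s, a)) (M (s, a)) :=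
    fun n => hf2 (q n)
  have hmono1 : ∀ n x, (q n).1 x x ≤ (q (n + 1)).1 x x := by
    intro n
    induction n with
    | zero => intro x; simpa [q] using (q 1).2.2 x
    | succ n ih =>
      intro x
      obtain ⟨a, ha⟩ := hq2 (n + 1) x
      rw [ha]
      exact (hq1 n x a).trans (by linarith [ih (M (x, a))])
  have hmono : ∀ x, Monotone fun n => (q n).1 x x := fun x =>
    monotone_nat_of_le_succ fun n => hmono1 n x
  have hbd : ∀ n x, (q n).1 x x ≤ S x x := by
    intro n
    induction n with
    | zero => intro x; simpa [q] using hS x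
    | succ n ih =>
      intro x
      exact (hq1 n x (K₀ x)).trans ((by linarith [ih (M (x, K₀ x))] :
        _ ≤ N (x, K₀ x) (x, K₀ x) + S (M (x, K₀ x)) (M (x, K₀ x))).trans (hsup x))
  obtain ⟨p, hps, hlim⟩ := exists_bilin_limit (fun n => (q n).1) (fun n => (q n).2.1) hmono
    (fun x => S x x) hbd
  have hqp : ∀ n x, (q n).1 x x ≤ p x x := fun n x =>
    (hmono x).ge_of_tendsto (hlim x x) n
  have hp0 : ∀ x, 0 ≤ p x x := fun x => ((q 0).2.2 x).trans (hqp 0 x)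
  obtain ⟨p', -, -, hp'le, K, hK⟩ := exists_riccati_step N hN hNpos M p hps hp0
  have hle : ∀ s a, p s s ≤ N (s, a) (s, a) + p (M (s, a)) (M (s, a)) := by
    intro s a
    refine le_of_tendsto_of_tendsto ((hlim s s).comp (tendsto_add_atTop_nat 1))
      (tendsto_const_nhds.add (hlim (M (s, a)) (M (s, a)))) (Eventually.of_forall fun n => ?_)
    exact hq1 n s a
  have hex : ∀ s, ∃ a, N (s, a) (s, a) + p (M (s, a)) (M (s, a)) ≤ p s s := by
    intro s
    choose a ha using fun n => hq2 n s
    obtain ⟨c, hc, hcoer⟩ := bilin_coercive N hNpos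
    have hbdd : ∀ n, a n ∈ Metric.closedBall (0 : F) (Real.sqrt (p s s / c)) := by
      intro n
      rw [mem_closedBall_zero_iff]
      apply Real.le_sqrt_of_sq_le
      rw [le_div_iff₀ hc]
      have h1 := hcoer (s, a n)
      have h2 : ‖a n‖ ≤ ‖((s, a n) : E × F)‖ := norm_snd_le (s, a n)
      have h3 : ‖a n‖ ^ 2 ≤ ‖((s, a n) : E × F)‖ ^ 2 := by gcongr
      have h4 := ha n
      have h5 := hqp (n + 1) s
      have h6 := (q n).2.2 (M (s, a n))
      nlinarith
    obtain ⟨a', -, φ, hφ, hφl⟩ := tendsto_subseq_of_bounded Metric.isBounded_closedBall hbdd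
    refine ⟨a', ?_⟩
    have hcont : ∀ r : BilinForm ℝ E, Continuous fun a : F =>
        N (s, a) (s, a) + r (M (s, a)) (M (s, a)) := by
      intro r
      have h1 : Continuous fun a : F => ((s, a) : E × F) := by fun_prop
      have h2 : Continuous M := M.continuous_of_finiteDimensional
      exact ((continuous_bilin_self N).comp h1).add
        ((continuous_bilin_self r).comp (h2.comp h1))
    have hm : ∀ m, N (s, a') (s, a') + (q m).1 (M (s, a')) (M (s, a')) ≤ p s s := by
      intro m
      refine le_of_tendsto (((hcont (q m).1).tendsto a').comp hφl) ?_
      filter_upwards [eventually_ge_atTop m] with n hn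
      have h1 : m ≤ φ n := hn.trans (hφ.id_le n)
      have h2 := hmono (M (s, a (φ n))) h1
      have h3 := hqp (φ n + 1) s
      rw [ha] at h3
      simp only [Function.comp]
      simp only at h2
      linarith
    exact le_of_tendsto (tendsto_const_nhds.add (hlim (M (s, a')) (M (s, a'))))
      (Eventually.of_forall hm)
  have hpp' : ∀ s, p s s = p' s s := by
    intro s
    apply le_antisymm
    · have := hK s (K s)
      simp only [sub_self, show ((0, 0) : E × F) = 0 from rfl, map_zero] at this
      linarith [hle s (K s)]
    · obtain ⟨a, ha⟩ := hex s
      exact (hp'le s a).trans ha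
  refine ⟨fun n => (q n).1, p, K, rfl, fun n => (q n).2.1, fun n => (q n).2.2, hq1, fun s => hlim s s, hps, fun x hx => ?_, fun s a => ?_⟩
  · obtain ⟨a, ha⟩ := hex x
    refine lt_of_lt_of_le ?_ ha
    exact add_pos_of_pos_of_nonneg (hNpos _ (by simp [hx])) (hp0 _)
  · rw [hK s a, hpp' s]

/-- The continuous-time algebraic Riccati equation, from the discrete one for the implicit midpoint
scheme `y = (s + s') / 2`, `s' - s = 2k (A y + B a)`: along it `p s' - p s = 4k p(y, A y + B a)`
exactly, so the discrete equation with running cost `2k (Q y + R a)` is the continuous one. -/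
theorem exists_care (Q : BilinForm ℝ E) (hQ : ∀ x y, Q x y = Q y x)
    (hQpos : ∀ x, x ≠ 0 → 0 < Q x x) (R : BilinForm ℝ F) (hR : ∀ x y, R x y = R y x)
    (hRpos : ∀ x, x ≠ 0 → 0 < R x x) (A : E →ₗ[ℝ] E) (B : F →ₗ[ℝ] E)
    (S : BilinForm ℝ E) (hSs : ∀ x y, S x y = S y x) (hS : ∀ x, 0 ≤ S x x) (K₀ : E →ₗ[ℝ] F)
    (hsup : ∀ y, Q y y + R (K₀ y) (K₀ y) + 2 * S y (A y + B (K₀ y)) ≤ 0) :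
    ∃ (p : BilinForm ℝ E) (K : E →ₗ[ℝ] F),
      (∀ x y, p x y = p y x) ∧ (∀ x, x ≠ 0 → 0 < p x x) ∧
      ∀ y a, Q y y + R a a + 2 * p y (A y + B a) = R (a - K y) (a - K y) := by
  -- a step size for which the implicit steps are solvable
  have hinv : ∀ (L : E →ₗ[ℝ] E) (k : ℝ), 0 < k → k * ‖LinearMap.toContinuousLinearMap L‖ < 1 →
      Function.Injective (LinearMap.id - k • L : E →ₗ[ℝ] E) := by
    intro L k hk hlt
    rw [injective_iff_map_eq_zero]
    intro x hx
    by_contra hne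
    have h1 : x = k • L x := by simpa [sub_eq_zero] using hx
    have h2 := (LinearMap.toContinuousLinearMap L).le_opNorm x
    have h3 : ‖x‖ = k * ‖L x‖ := by
      conv_lhs => rw [h1, norm_smul, Real.norm_of_nonneg hk.le]
    have h4 : 0 < ‖x‖ := norm_pos_iff.2 hne
    have h5 : k * ‖L x‖ ≤ k * (‖LinearMap.toContinuousLinearMap L‖ * ‖x‖) :=
      mul_le_mul_of_nonneg_left h2 hk.le
    nlinarith
  set n1 := ‖LinearMap.toContinuousLinearMap A‖ with hn1
  set n2 := ‖LinearMap.toContinuousLinearMap (A + B ∘ₗ K₀)‖ with hn2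
  have hn1' : 0 ≤ n1 := norm_nonneg _
  have hn2' : 0 ≤ n2 := norm_nonneg _
  set k : ℝ := 1 / (1 + n1 + n2) with hk
  have hkpos : 0 < k := by positivity
  have hk1 : k * n1 < 1 := by rw [hk, one_div_mul_eq_div, div_lt_one (by positivity)]; linarith
  have hk2 : k * n2 < 1 := by rw [hk, one_div_mul_eq_div, div_lt_one (by positivity)]; linarith
  let J := LinearEquiv.ofInjectiveEndo _ (hinv A k hkpos hk1)
  let J₀ := LinearEquiv.ofInjectiveEndo _ (hinv (A + B ∘ₗ K₀) k hkpos hk2)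
  have hJ : ∀ y, J y = y - k • A y := fun y => by
    simp [J, LinearEquiv.coe_ofInjectiveEndo]
  have hJ₀ : ∀ y, J₀ y = y - k • (A y + B (K₀ y)) := fun y => by
    simp [J₀, LinearEquiv.coe_ofInjectiveEndo]
  let Y : E × F →ₗ[ℝ] E := J.symm.toLinearMap ∘ₗ
    (LinearMap.fst ℝ E F + k • (B ∘ₗ LinearMap.snd ℝ E F))
  have hY : ∀ s a, Y (s, a) - k • A (Y (s, a)) = s + k • B a := by
    intro s a
    rw [← hJ]
    exact J.apply_symm_apply _
  have hY' : ∀ y a, Y (y - k • A y - k • B a, a) = y := by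
    intro y a
    apply J.injective
    rw [hJ, hY, hJ]; abel
  let M : E × F →ₗ[ℝ] E := (2 : ℝ) • Y - LinearMap.fst ℝ E F
  have hM : ∀ s a, M (s, a) = (2 : ℝ) • Y (s, a) - s := fun s a => by simp [M]
  let N : BilinForm ℝ (E × F) := (2 * k) • (Q.compl₁₂ Y Y +
    R.compl₁₂ (LinearMap.snd ℝ E F) (LinearMap.snd ℝ E F))
  have hNv : ∀ x y, N x y = 2 * k * (Q (Y x) (Y y) + R x.2 y.2) := fun x y => by
    simp [N, mul_add]
  have key : ∀ (p : BilinForm ℝ E), (∀ x y, p x y = p y x) → ∀ s a,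
      p (M (s, a)) (M (s, a)) - p s s
        = 4 * k * p (Y (s, a)) (A (Y (s, a)) + B a) := by
    intro p hp s a
    set y := Y (s, a) with hy
    have h1 : s = y - k • (A y + B a) := by
      have := hY s a
      rw [← hy] at this
      rw [smul_add, ← sub_sub, this]; abel
    rw [hM, ← hy]
    have h2 : (2 : ℝ) • y - s = y + k • (A y + B a) := by
      rw [h1, two_smul]; abel
    rw [h2, h1]
    simp only [map_sub, map_add, map_smul, LinearMap.sub_apply, LinearMap.add_apply,
      LinearMap.smul_apply, smul_eq_mul, hp (A y) y, hp (B a) y]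
    ring
  have hNpos : ∀ x, x ≠ 0 → 0 < N x x := by
    rintro ⟨s, a⟩ hne
    rw [hNv]
    have hQ0 : 0 ≤ Q (Y (s, a)) (Y (s, a)) := by
      rcases eq_or_ne (Y (s, a)) 0 with h | h
      · simp [h]
      · exact (hQpos _ h).le
    rcases eq_or_ne a 0 with rfl | ha
    · have : Y (s, 0) ≠ 0 := by
        intro h0
        have := hY s 0
        rw [h0] at this
        simp only [map_zero, smul_zero, sub_zero, add_zero] at this
        exact hne (by rw [← this]; rfl)
      have := hQpos _ this
      simp only [map_zero, add_zero]
      positivity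
    · have := hRpos a ha
      simp only
      positivity
  obtain ⟨-, p, K, -, -, -, -, -, hps, hppos, hpK⟩ := exists_riccati N
    (fun x y => by rw [hNv, hNv, hQ, hR]) hNpos M S hS
    (K₀ ∘ₗ J₀.symm.toLinearMap) (by
      intro s
      set y := J₀.symm s with hy
      have hKs : (K₀ ∘ₗ J₀.symm.toLinearMap) s = K₀ y := rfl
      have hs : s = y - k • A y - k • B (K₀ y) := by
        rw [← J₀.apply_symm_apply s, ← hy, hJ₀, smul_add]; abel
      have hYs : Y (s, K₀ y) = y := by
        conv_lhs => rw [hs]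
        exact hY' y (K₀ y)
      have h1 := key S hSs s (K₀ y)
      have h2 := hsup y
      rw [hKs, hNv]
      rw [hYs] at h1 ⊢
      nlinarith)
  -- the quadratic `g (y, a)` is nonnegative and vanishes somewhere over each `y`
  let g : BilinForm ℝ (E × F) :=
    let Z : E × F →ₗ[ℝ] E := A ∘ₗ LinearMap.fst ℝ E F + B ∘ₗ LinearMap.snd ℝ E F
    Q.compl₁₂ (LinearMap.fst ℝ E F) (LinearMap.fst ℝ E F) +
    R.compl₁₂ (LinearMap.snd ℝ E F) (LinearMap.snd ℝ E F) +
    p.compl₁₂ (LinearMap.fst ℝ E F) Z + p.compl₁₂ Z (LinearMap.fst ℝ E F)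
  have hgv : ∀ y a y' a', g (y, a) (y', a') = Q y y' + R a a' + p y (A y' + B a')
      + p (A y + B a) y' := fun y a y' a' => by simp [g]
  have hgself : ∀ y a, g (y, a) (y, a) = Q y y + R a a + 2 * p y (A y + B a) := fun y a => by
    rw [hgv, hps (A y + B a) y]; ring
  have hg1 : ∀ y a, 0 ≤ g (y, a) (y, a) := by
    intro y a
    have h1 := hpK (y - k • A y - k • B a) a
    have h2 := key p hps (y - k • A y - k • B a) a
    rw [hNv, hY'] at h1
    rw [hY'] at h2
    simp only at h1
    rw [hgself]
    set v := a - K (y - k • A y - k • B a)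
    have hN0 : 0 ≤ N (0, v) (0, v) := by
      rcases eq_or_ne ((0, v) : E × F) 0 with h | h
      · simp [h]
      · exact (hNpos _ h).le
    have hp0 : 0 ≤ p (M (0, v)) (M (0, v)) := by
      rcases eq_or_ne (M (0, v)) 0 with h | h
      · simp [h]
      · exact (hppos _ h).le
    have h3 : 0 ≤ 2 * k * (Q y y + R a a + 2 * p y (A y + B a)) := by nlinarith
    exact nonneg_of_mul_nonneg_right h3 (by positivity)
  let L : E →ₗ[ℝ] E := Y ∘ₗ LinearMap.prod LinearMap.id K
  have hL : ∀ s, L s = Y (s, K s) := fun s => rfl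
  have hzero : ∀ s, g (L s, K s) (L s, K s) = 0 := by
    intro s
    have h1 := hpK s (K s)
    have h2 := key p hps s (K s)
    have h0 : ((0, 0) : E × F) = 0 := rfl
    rw [hNv, sub_self, h0] at h1
    simp only [map_zero] at h1
    rw [hgself, hL]
    have h3 : 2 * k * (Q (Y (s, K s)) (Y (s, K s)) + R (K s) (K s)
        + 2 * p (Y (s, K s)) (A (Y (s, K s)) + B (K s))) = 0 := by
      linarith
    exact (mul_eq_zero.1 h3).resolve_left (by positivity)
  have hLinj : Function.Injective L := by
    rw [injective_iff_map_eq_zero]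
    intro s hs
    have h1 := hzero s
    rw [hs, hgself] at h1
    simp only [map_zero, LinearMap.zero_apply, mul_zero, add_zero, zero_add] at h1
    have h2 : K s = 0 := by
      by_contra hne
      exact (hRpos _ hne).ne' h1
    have h3 := hY s (K s)
    rw [← hL, hs, h2] at h3
    simpa using h3.symm
  have hLsurj : Function.Surjective L := LinearMap.injective_iff_surjective.1 hLinj
  obtain ⟨K', hK'⟩ := exists_complete_square g
    (fun x y => by
      obtain ⟨x1, x2⟩ := x; obtain ⟨y1, y2⟩ := y
      rw [hgv, hgv, hQ, hR, hps y1, hps (A y1 + B y2)]; ring)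
    (fun a ha => by rw [hgself]; simpa using hRpos a ha)
  refine ⟨p, K', hps, hppos, fun y a => ?_⟩
  have h1 := hK' y a
  have h2 : g (y, K' y) (y, K' y) = 0 := by
    obtain ⟨s, hs⟩ := hLsurj y
    have h3 := hK' y (K s)
    have h4 := hzero s
    rw [hs] at h4
    have h5 := hg1 y (K' y)
    have h6 := hg1 0 (K s - K' y)
    linarith
  rw [h2, hgself, hgself] at h1
  simpa using h1

end Normed

end Riccati

/-! ### Lyapunov functions from decaying moments -/

section Lyapunov

open LinearMap (BilinForm)

variable {V : Type*} [NormedAddCommGroup V] [NormedSpace ℝ V] [FiniteDimensional ℝ V]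

/-- An integral solution of the linear equation `m' = 𝓛 m` is given by the exponential flow. -/
theorem eq_exp_of_integral_eq (𝓛 : V →L[ℝ] V) (m : ℝ → V) (v : V)
    (hint : ∀ t, 0 ≤ t → IntervalIntegrable m volume 0 t)
    (hm : ∀ t, 0 ≤ t → m t = v + ∫ u in (0 : ℝ)..t, 𝓛 (m u)) (t : ℝ) (ht : 0 ≤ t) :
    m t = NormedSpace.exp (t • 𝓛) v := by
  have := FiniteDimensional.complete ℝ V
  -- continuity of `m`, read off from the integral equation
  have hcont : ContinuousOn m (Set.Icc 0 (t + 1)) := by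
    have h1 : IntegrableOn (fun u => 𝓛 (m u)) (Set.uIcc 0 (t + 1)) := by
      rw [Set.uIcc_of_le (by linarith), integrableOn_Icc_iff_integrableOn_Ioc]
      exact ((intervalIntegrable_iff_integrableOn_Ioc_of_le (by linarith)).1
        (show IntervalIntegrable (fun u => 𝓛 (m u)) volume 0 (t + 1) from
          ⟨𝓛.integrable_comp (hint (t + 1) (by linarith)).1,
            𝓛.integrable_comp (hint (t + 1) (by linarith)).2⟩))
    have h2 := intervalIntegral.continuousOn_primitive_interval h1
    rw [Set.uIcc_of_le (by linarith)] at h2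
    exact (continuousOn_const.add h2).congr fun x hx => hm x hx.1
  let g : ℝ → V := fun u => m (max 0 (min u (t + 1)))
  have hg : Continuous g :=
    hcont.comp_continuous (by fun_prop) fun x =>
      ⟨le_max_left _ _, max_le (by linarith) (min_le_right _ _)⟩
  let F : ℝ → V := fun s => v + ∫ u in (0 : ℝ)..s, 𝓛 (g u)
  have hF : ∀ s, HasDerivAt F (𝓛 (g s)) s := fun s =>
    (intervalIntegral.integral_hasDerivAt_right ((𝓛.continuous.comp hg).intervalIntegrable _ _)
      (𝓛.continuous.comp hg).aestronglyMeasurable.stronglyMeasurableAtFilter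
      (𝓛.continuous.comp hg).continuousAt).const_add v
  have hgm : ∀ s ∈ Set.Icc 0 (t + 1), g s = m s := fun s hs => by
    simp only [g]; rw [min_eq_left hs.2, max_eq_right hs.1]
  have hFm : ∀ s ∈ Set.Icc 0 (t + 1), F s = m s := by
    intro s hs
    rw [hm s hs.1]
    simp only [F]
    congr 1
    refine intervalIntegral.integral_congr fun u hu => ?_
    rw [Set.uIcc_of_le hs.1] at hu
    rw [hgm u ⟨hu.1, hu.2.trans hs.2⟩]
  have hexp : ∀ s, HasDerivAt (fun s : ℝ => NormedSpace.exp (s • 𝓛) v)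
      (𝓛 (NormedSpace.exp (s • 𝓛) v)) s := fun s => by
    have h1 := hasDerivAt_exp_smul_const' (𝕂 := ℝ) 𝓛 s
    have h2 := h1.clm_apply (hasDerivAt_const s v)
    simpa using h2
  have key : Set.EqOn F (fun s : ℝ => NormedSpace.exp (s • 𝓛) v) (Set.Icc 0 (t + 1)) := by
    refine ODE_solution_unique (v := fun _ x => 𝓛 x) (fun _ => 𝓛.lipschitz)
      (fun s _ => (hF s).continuousAt.continuousWithinAt) (fun s hs => ?_)
      (fun s _ => (hexp s).continuousAt.continuousWithinAt)
      (fun s _ => (hexp s).hasDerivWithinAt) (by simp [F])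
    have hs' : s ∈ Set.Icc 0 (t + 1) := ⟨hs.1, hs.2.le⟩
    have := (hF s).hasDerivWithinAt (s := Set.Ici s)
    rwa [hgm s hs', ← hFm s hs'] at this
  have ht' : t ∈ Set.Icc 0 (t + 1) := ⟨ht, by linarith⟩
  rw [← hFm t ht', key ht']

variable {E : Type*} [NormedAddCommGroup E] [InnerProductSpace ℝ E] [FiniteDimensional ℝ E]

/-- Symmetric forms that tend to `0` pointwise do so uniformly on the unit ball. -/
theorem eventually_bilin_le (b : ℝ → BilinForm ℝ E) (hb : ∀ t x y, b t x y = b t y x)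
    (hlim : ∀ x, Tendsto (fun t => b t x x) atTop (𝓝 0)) {ε : ℝ} (hε : 0 < ε) :
    ∀ᶠ t in atTop, ∀ x, b t x x ≤ ε * ‖x‖ ^ 2 := by
  let e := stdOrthonormalBasis ℝ E
  have h1 : ∀ i j, Tendsto (fun t => |b t (e i) (e j)|) atTop (𝓝 0) := by
    intro i j
    have h2 : Tendsto (fun t => b t (e i) (e j)) atTop (𝓝 0) := by
      simp_rw [fun t => bilin_polar (hb t) (e i) (e j)]
      simpa using (((hlim (e i + e j)).sub (hlim (e i))).sub (hlim (e j))).div_const 2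
    simpa using h2.abs
  have h3 : Tendsto (fun t => ∑ i, ∑ j, |b t (e i) (e j)|) atTop (𝓝 0) := by
    have := tendsto_finsetSum Finset.univ fun i _ =>
      tendsto_finsetSum Finset.univ fun j _ => h1 i j
    simpa using this
  filter_upwards [h3.eventually (gt_mem_nhds hε)] with t ht x
  have hcoord : ∀ i, |inner ℝ (e i) x| ≤ ‖x‖ := fun i => by
    have := abs_real_inner_le_norm (e i) x
    rwa [e.orthonormal.1 i, one_mul] at this
  calc b t x x = ∑ i, ∑ j, inner ℝ (e i) x * inner ℝ (e j) x * b t (e i) (e j) := by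
        conv_lhs => rw [← e.sum_repr' x]
        simp only [map_sum, map_smul, LinearMap.sum_apply, LinearMap.smul_apply, smul_eq_mul,
          Finset.mul_sum]
        exact Finset.sum_comm.trans (Finset.sum_congr rfl fun i _ =>
          Finset.sum_congr rfl fun j _ => by ring)
    _ ≤ ∑ i, ∑ j, ‖x‖ ^ 2 * |b t (e i) (e j)| := by
        refine Finset.sum_le_sum fun i _ => Finset.sum_le_sum fun j _ => ?_
        refine (le_abs_self _).trans ?_
        rw [abs_mul, abs_mul, sq]
        have := hcoord i
        have := hcoord j
        gcongr
    _ = ‖x‖ ^ 2 * ∑ i, ∑ j, |b t (e i) (e j)| := by simp only [Finset.mul_sum]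
    _ ≤ ε * ‖x‖ ^ 2 := by rw [mul_comm]; gcongr

/-- If the moments `m t`, `m' = 𝓛 m`, started at `O x x`, stay `τ`-nonnegative and tend to `0`, then
`2 ∫₀ᵀ τ ∘ exp (t 𝓛) dt` for a large time `T` is a Lyapunov functional. -/
theorem exists_lyapunov (𝓛 : V →L[ℝ] V) (τ : V →L[ℝ] ℝ) (O : E →ₗ[ℝ] E →ₗ[ℝ] V)
    (hO : ∀ x y, O x y = O y x) (hτ : ∀ x, τ (O x x) = ‖x‖ ^ 2)
    (h : ∀ x, ∃ m : ℝ → V, (∀ t, 0 ≤ t → IntervalIntegrable m volume 0 t) ∧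
      (∀ t, 0 ≤ t → m t = O x x + ∫ u in (0 : ℝ)..t, 𝓛 (m u)) ∧
      (∀ t, 0 ≤ t → 0 ≤ τ (m t)) ∧ Tendsto m atTop (𝓝 0)) :
    ∃ J : V →L[ℝ] ℝ, (∀ x, 0 ≤ J (O x x)) ∧ ∀ x, J (𝓛 (O x x)) ≤ - ‖x‖ ^ 2 := by
  have := FiniteDimensional.complete ℝ V
  have hpos : ∀ x (t : ℝ), 0 ≤ t → 0 ≤ τ (NormedSpace.exp (t • 𝓛) (O x x)) := by
    intro x t ht
    obtain ⟨m, h1, h2, h3, -⟩ := h x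
    rw [← eq_exp_of_integral_eq 𝓛 m _ h1 h2 t ht]
    exact h3 t ht
  have hlim : ∀ x, Tendsto (fun t : ℝ => τ (NormedSpace.exp (t • 𝓛) (O x x))) atTop (𝓝 0) := by
    intro x
    obtain ⟨m, h1, h2, -, h4⟩ := h x
    have h5 : Tendsto (fun t => τ (m t)) atTop (𝓝 0) := by
      simpa [Function.comp_def] using (τ.continuous.tendsto 0).comp h4
    refine h5.congr' ?_
    filter_upwards [eventually_ge_atTop (0 : ℝ)] with t ht
    rw [eq_exp_of_integral_eq 𝓛 m _ h1 h2 t ht]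
  obtain ⟨T, hT, hT0⟩ := ((eventually_bilin_le
    (fun t : ℝ => O.compr₂ ((τ ∘L NormedSpace.exp (t • 𝓛) : V →L[ℝ] ℝ) : V →ₗ[ℝ] ℝ))
    (fun t x y => by simp [hO x y]) (fun x => by simpa using hlim x)
    (half_pos one_pos)).and (eventually_ge_atTop (0 : ℝ))).exists
  have hderiv : ∀ v (s : ℝ), HasDerivAt (fun s : ℝ => NormedSpace.exp (s • 𝓛) v)
      (NormedSpace.exp (s • 𝓛) (𝓛 v)) s := fun v s => by
    have h1 := hasDerivAt_exp_smul_const (𝕂 := ℝ) 𝓛 s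
    have h2 := h1.clm_apply (hasDerivAt_const s v)
    simpa using h2
  have hcont : Continuous fun s : ℝ => NormedSpace.exp (s • 𝓛) :=
    continuous_iff_continuousAt.2 fun s =>
      (hasDerivAt_exp_smul_const (𝕂 := ℝ) 𝓛 s).continuousAt
  let I : V →L[ℝ] V := ∫ s in (0 : ℝ)..T, NormedSpace.exp (s • 𝓛)
  have hI : ∀ v, I v = ∫ s in (0 : ℝ)..T, NormedSpace.exp (s • 𝓛) v := fun v =>
    ContinuousLinearMap.intervalIntegral_apply (hcont.intervalIntegrable _ _) v
  refine ⟨(2 : ℝ) • (τ ∘L I), fun x => ?_, fun x => ?_⟩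
  · simp only [smul_apply, ContinuousLinearMap.comp_apply, smul_eq_mul]
    rw [hI, ← ContinuousLinearMap.intervalIntegral_comp_comm τ
      ((hcont.clm_apply continuous_const).intervalIntegrable _ _)]
    exact mul_nonneg two_pos.le
      (intervalIntegral.integral_nonneg hT0 fun u hu => hpos x u hu.1)
  · simp only [smul_apply, ContinuousLinearMap.comp_apply, smul_eq_mul]
    rw [hI, intervalIntegral.integral_eq_sub_of_hasDerivAt (fun s _ => hderiv (O x x) s)
      ((hcont.clm_apply continuous_const).intervalIntegrable _ _)]
    have h1 := hT x
    simp at h1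
    simp only [zero_smul, NormedSpace.exp_zero, one_apply_eq_self, map_sub, hτ]
    linarith

end Lyapunov

/-! ### Uniqueness for the Hamilton–Jacobi–Bellman equation -/

section HJB

open LinearMap (BilinForm)

variable {E F : Type*} [NormedAddCommGroup E] [NormedSpace ℝ E] [FiniteDimensional ℝ E]
  [NormedAddCommGroup F] [NormedSpace ℝ F]

theorem bilin_le_bilin (b c : BilinForm ℝ E) (hc : ∀ x, x ≠ 0 → 0 < c x x) :
    ∃ C, 0 < C ∧ ∀ x, b x x ≤ C * c x x := by
  obtain ⟨C, hC, h1⟩ := bilin_le_norm_sq b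
  obtain ⟨e, he, h2⟩ := bilin_coercive c hc
  refine ⟨C / e, by positivity, fun x => ?_⟩
  have h3 := (le_abs_self _).trans (h1 x)
  have h4 := h2 x
  rw [div_mul_eq_mul_div, le_div_iff₀ he]
  nlinarith

theorem hasDerivAt_bilin_self {b : BilinForm ℝ E} (hb : ∀ x y, b x y = b y x) {x : ℝ → E} {x' : E}
    {t : ℝ} (hx : HasDerivAt x x' t) :
    HasDerivAt (fun s => b (x s) (x s)) (2 * b (x t) x') t := by
  have h1 := ((LinearMap.toContinuousBilinearMap b).hasFDerivAt_of_bilinear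
    hx.hasFDerivAt hx.hasFDerivAt).hasDerivAt
  have h2 : (fun s => b (x s) (x s)) =
    fun s => LinearMap.toContinuousBilinearMap b (x s) (x s) := rfl
  rw [h2]
  refine h1.congr_deriv ?_
  simp [hb x' (x t)]
  ring_nf

/-- Upper bound: along the closed loop of the optimal linear feedback the discounted gap to the
quadratic solution is monotone and vanishes at infinity. -/
theorem hjb_le (Q : BilinForm ℝ E) (hQpos : ∀ x, x ≠ 0 → 0 < Q x x) (R : BilinForm ℝ F)
    (hRpos : ∀ x, x ≠ 0 → 0 < R x x) (A : E →ₗ[ℝ] E) (B : F →ₗ[ℝ] E) {β : ℝ} (hβ : 0 ≤ β)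
    (p : BilinForm ℝ E) (K : E →ₗ[ℝ] F) (hps : ∀ x y, p x y = p y x)
    (hppos : ∀ x, x ≠ 0 → 0 < p x x)
    (hp : ∀ y a, Q y y + R a a + 2 * p y (A y + B a) - β * p y y = R (a - K y) (a - K y))
    (Z : E → ℝ) (hZ : Differentiable ℝ Z) {c : ℝ} (hgrowth : ∀ s, |Z s| ≤ c * (1 + ‖s‖ ^ 2))
    (hZ0 : β = 0 → Z 0 = 0)
    (hle : ∀ s a, β * Z s ≤ Q s s + R a a + fderiv ℝ Z s (A s + B a)) (s : E) :
    Z s ≤ p s s := by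
  have := FiniteDimensional.complete ℝ E
  let L : E →L[ℝ] E := LinearMap.toContinuousLinearMap (A + B ∘ₗ K)
  have hL : ∀ x, L x = A x + B (K x) := fun x => rfl
  let x : ℝ → E := fun t => NormedSpace.exp (t • L) s
  have hx : ∀ t, HasDerivAt x (A (x t) + B (K (x t))) t := fun t => by
    have h1 := hasDerivAt_exp_smul_const' (𝕂 := ℝ) L t
    have h2 := h1.clm_apply (hasDerivAt_const t s)
    simpa [hL] using h2
  have hpt := fun t => hasDerivAt_bilin_self hps (hx t)
  have hZt : ∀ t, HasDerivAt (fun t => Z (x t)) (fderiv ℝ Z (x t) (A (x t) + B (K (x t)))) t :=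
    fun t => (hZ (x t)).hasFDerivAt.comp_hasDerivAt t (hx t)
  have hexp : ∀ t, HasDerivAt (fun t : ℝ => Real.exp (-β * t)) (Real.exp (-β * t) * (-β)) t :=
    fun t => by simpa using ((hasDerivAt_id t).const_mul (-β)).exp
  have hpK : ∀ y, 2 * p y (A y + B (K y)) = β * p y y - Q y y - R (K y) (K y) := fun y => by
    have := hp y (K y)
    simp only [sub_self, map_zero] at this
    linarith
  have hR0 : ∀ a, 0 ≤ R a a := fun a => by
    rcases eq_or_ne a 0 with rfl | h
    · simp
    · exact (hRpos a h).le
  have hp0 : ∀ a, 0 ≤ p a a := fun a => by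
    rcases eq_or_ne a 0 with rfl | h
    · simp
    · exact (hppos a h).le
  -- exponential decay of the discounted quadratic value
  obtain ⟨C, hC, hpQ⟩ := bilin_le_bilin p Q hQpos
  have hdecay : ∀ t, 0 ≤ t →
      Real.exp (-β * t) * p (x t) (x t) ≤ Real.exp (-(1 / C) * t) * p s s := by
    intro t ht
    have hd : ∀ t, HasDerivAt
        (fun t : ℝ => Real.exp (1 / C * t) * (Real.exp (-β * t) * p (x t) (x t)))
        (Real.exp (1 / C * t) * (1 / C) * (Real.exp (-β * t) * p (x t) (x t)) +
        Real.exp (1 / C * t) * (Real.exp (-β * t) * (-β) * p (x t) (x t) + Real.exp (-β * t) *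
          (2 * p (x t) (A (x t) + B (K (x t)))))) t := fun t =>
      HasDerivAt.mul (by simpa using ((hasDerivAt_id t).const_mul (1 / C)).exp)
        ((hexp t).mul (hpt t))
    have hanti : Antitone
        (fun t : ℝ => Real.exp (1 / C * t) * (Real.exp (-β * t) * p (x t) (x t))) := by
      refine antitone_of_deriv_nonpos (fun t => (hd t).differentiableAt) fun t => ?_
      rw [(hd t).deriv, hpK]
      have h1 : Real.exp (1 / C * t) * (1 / C) * (Real.exp (-β * t) * p (x t) (x t)) +
        Real.exp (1 / C * t) * (Real.exp (-β * t) * (-β) * p (x t) (x t) + Real.exp (-β * t) *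
          (β * p (x t) (x t) - Q (x t) (x t) - R (K (x t)) (K (x t)))) =
        - (Real.exp (1 / C * t) * Real.exp (-β * t) *
          ((Q (x t) (x t) - p (x t) (x t) / C) + R (K (x t)) (K (x t)))) := by ring
      rw [h1]
      have h2 : p (x t) (x t) / C ≤ Q (x t) (x t) := by
        rw [div_le_iff₀ hC, mul_comm]; exact hpQ _
      have h3 := hR0 (K (x t))
      have : 0 ≤ Real.exp (1 / C * t) * Real.exp (-β * t) *
          ((Q (x t) (x t) - p (x t) (x t) / C) + R (K (x t)) (K (x t))) :=
        mul_nonneg (by positivity) (by linarith)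
      linarith
    have h0 := hanti ht
    have hx0 : x 0 = s := by simp [x]
    simp only [mul_zero, Real.exp_zero, one_mul, hx0] at h0
    rw [neg_mul (1 / C), Real.exp_neg, ← div_eq_inv_mul, le_div_iff₀' (by positivity)]
    exact h0
  have hlimexp : Tendsto (fun t : ℝ => Real.exp (-(1 / C) * t)) atTop (𝓝 0) := by
    refine Real.tendsto_exp_atBot.comp ?_
    exact (tendsto_const_mul_atBot_of_neg (by simpa using hC)).2 tendsto_id
  have hlimp : Tendsto (fun t : ℝ => Real.exp (-β * t) * p (x t) (x t)) atTop (𝓝 0) := by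
    refine squeeze_zero' (Eventually.of_forall fun t =>
      mul_nonneg (Real.exp_pos _).le (hp0 _)) ?_ (by simpa only [zero_mul] using hlimexp.mul_const (p s s))
    filter_upwards [eventually_ge_atTop 0] with t ht using hdecay t ht
  obtain ⟨e, he, hcoer⟩ := bilin_coercive p hppos
  have hlimx : Tendsto (fun t : ℝ => Real.exp (-β * t) * ‖x t‖ ^ 2) atTop (𝓝 0) := by
    refine squeeze_zero (fun t => by positivity) (fun t => ?_)
      (by simpa only [zero_div] using hlimp.div_const e)
    rw [le_div_iff₀ he, mul_assoc]
    have := hcoer (x t)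
    refine mul_le_mul_of_nonneg_left ?_ (Real.exp_pos _).le
    linarith
  have hlimZ : Tendsto (fun t : ℝ => Real.exp (-β * t) * Z (x t)) atTop (𝓝 0) := by
    rcases hβ.eq_or_lt with h0 | h0
    · subst h0
      have h1 : Tendsto x atTop (𝓝 0) := by
        rw [tendsto_zero_iff_norm_tendsto_zero]
        have := hlimx.sqrt
        simpa using this
      have h2 := (hZ.continuous.tendsto 0).comp h1
      rw [hZ0 rfl] at h2
      simpa [Function.comp_def] using h2
    · have h1 : Tendsto (fun t : ℝ => Real.exp (-β * t)) atTop (𝓝 0) := by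
        refine Real.tendsto_exp_atBot.comp ?_
        exact (tendsto_const_mul_atBot_of_neg (by simpa using h0)).2 tendsto_id
      refine squeeze_zero_norm (fun t => ?_) (by simpa using (h1.add hlimx).const_mul c)
      rw [norm_mul, Real.norm_of_nonneg (Real.exp_pos _).le, Real.norm_eq_abs]
      calc _ ≤ Real.exp (-β * t) * (c * (1 + ‖x t‖ ^ 2)) :=
            mul_le_mul_of_nonneg_left (hgrowth _) (Real.exp_pos _).le
        _ = _ := by ring
  -- the gap is monotone
  have hd : ∀ t, HasDerivAt (fun t : ℝ => Real.exp (-β * t) * (p (x t) (x t) - Z (x t)))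
      (Real.exp (-β * t) * (-β) * (p (x t) (x t) - Z (x t)) + Real.exp (-β * t) *
        (2 * p (x t) (A (x t) + B (K (x t))) - fderiv ℝ Z (x t) (A (x t) + B (K (x t))))) t :=
    fun t => (hexp t).mul ((hpt t).sub (hZt t))
  have hanti : Antitone (fun t : ℝ => Real.exp (-β * t) * (p (x t) (x t) - Z (x t))) := by
    refine antitone_of_deriv_nonpos (fun t => (hd t).differentiableAt) fun t => ?_
    rw [(hd t).deriv, hpK]
    have h1 := hle (x t) (K (x t))
    have h2 := Real.exp_pos (-β * t)
    nlinarith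
  have h1 : 0 ≤ Real.exp (-β * 0) * (p (x 0) (x 0) - Z (x 0)) := by
    refine hanti.le_of_tendsto ?_ 0
    simp_rw [mul_sub]
    simpa using hlimp.sub hlimZ
  have hx0 : x 0 = s := by simp [x]
  rw [hx0] at h1
  simpa using h1

/-- Lower bound, by a maximum principle: the ratio `Z / p`, penalised by a function of `log p` that
forces a minimum away from `0` and infinity, has a critical point where `∇Z` is nearly
`(Z / p) ∇p`. The equation is quadratic in the gradient, so there `Z / p < 1` is impossible. -/
theorem le_hjb (Q : BilinForm ℝ E) (hQpos : ∀ x, x ≠ 0 → 0 < Q x x) (R : BilinForm ℝ F)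
    (hR : ∀ x y, R x y = R y x)
    (hRpos : ∀ x, x ≠ 0 → 0 < R x x) (A : E →ₗ[ℝ] E) (B : F →ₗ[ℝ] E) {β : ℝ} (hβ : 0 ≤ β)
    (p : BilinForm ℝ E) (K : E →ₗ[ℝ] F) (hps : ∀ x y, p x y = p y x)
    (hppos : ∀ x, x ≠ 0 → 0 < p x x)
    (hp : ∀ y a, Q y y + R a a + 2 * p y (A y + B a) - β * p y y = R (a - K y) (a - K y))
    (Z : E → ℝ) (hZ : Differentiable ℝ Z) (hZnn : ∀ s, 0 ≤ Z s)
    (hex : ∀ s, ∃ a, β * Z s = Q s s + R a a + fderiv ℝ Z s (A s + B a)) (s : E) :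
    p s s ≤ Z s := by
  by_contra! hlt
  have hR0 : ∀ a, 0 ≤ R a a := fun a => by
    rcases eq_or_ne a 0 with rfl | h
    · simp
    · exact (hRpos a h).le
  have hs0 : s ≠ 0 := by
    rintro rfl
    simp only [map_zero] at hlt
    exact absurd (hZnn 0) (not_le.2 hlt)
  have hps0 := hppos s hs0
  let g : E → ℝ := fun x => Real.sqrt (1 + Real.log (p x x) ^ 2)
  have hg1 : ∀ x, 1 ≤ g x := fun x => by
    simp only [g]; rw [Real.one_le_sqrt]; nlinarith [sq_nonneg (Real.log (p x x))]
  set δ := 1 - Z s / p s s with hδ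
  have hδ0 : 0 < δ := by rw [hδ, sub_pos, div_lt_one hps0]; exact hlt
  have hδ1 : δ ≤ 1 := by rw [hδ]; have := div_nonneg (hZnn s) hps0.le; linarith
  obtain ⟨C, hC, hpQ⟩ := bilin_le_bilin p Q hQpos
  obtain ⟨D, hD, hRQ⟩ := bilin_le_bilin (R.compl₁₂ K K) Q hQpos
  simp only [LinearMap.compl₁₂_apply] at hRQ
  -- a penalisation parameter
  obtain ⟨ε, hε, e1, e2, e3, e4⟩ : ∃ ε : ℝ, 0 < ε ∧ ε * g s ≤ δ / 4 ∧ ε * D ≤ 1 / 8 ∧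
      ε * (β * C) ≤ δ / 4 ∧ ε ≤ δ / 4 := by
    refine ⟨δ / 8 / (g s + D + β * C + 1), ?_, ?_, ?_, ?_, ?_⟩
    · have := hg1 s; positivity
    all_goals
      have h1 := hg1 s
      have h2 : 0 ≤ β * C := by positivity
      have h3 : 0 < g s + D + β * C + 1 := by positivity
    · rw [div_mul_eq_mul_div, div_le_iff₀ h3]; nlinarith
    · rw [div_mul_eq_mul_div, div_le_iff₀ h3]; nlinarith
    · rw [div_mul_eq_mul_div, div_le_iff₀ h3]; nlinarith
    · rw [div_le_iff₀ h3]; nlinarith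
  let f : E → ℝ := fun x => Z x / p x x + ε * g x
  -- sublevel sets lie in an annulus
  obtain ⟨k, hk⟩ : ∃ k, k = f s / ε := ⟨_, rfl⟩
  let U : Set E := {x | Real.exp (-k) ≤ p x x ∧ p x x ≤ Real.exp k}
  have hpcont := continuous_bilin_self p
  have hUne : ∀ x ∈ U, x ≠ 0 := by
    rintro x hx rfl
    have := hx.1
    simp only [map_zero] at this
    exact absurd (Real.exp_pos (-k)) (not_lt.2 this)
  have hUc : IsCompact U := by
    obtain ⟨e, he, hcoer⟩ := bilin_coercive p hppos
    refine Metric.isCompact_of_isClosed_isBounded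
      ((isClosed_le continuous_const hpcont).inter (isClosed_le hpcont continuous_const)) ?_
    refine (Metric.isBounded_closedBall (x := (0 : E)) (r := Real.sqrt (Real.exp k / e))).subset ?_
    intro x hx
    rw [mem_closedBall_zero_iff]
    apply Real.le_sqrt_of_sq_le
    rw [le_div_iff₀ he]
    linarith [hcoer x, hx.2]
  have hsub : ∀ x, x ≠ 0 → f x ≤ f s → x ∈ U := by
    intro x hx hfx
    have hpx := hppos x hx
    have h1 : |Real.log (p x x)| ≤ g x := by
      apply Real.le_sqrt_of_sq_le; rw [sq_abs]; linarith
    have h2 : ε * g x ≤ f s := by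
      have := div_nonneg (hZnn x) hpx.le
      simp only [f] at hfx ⊢
      linarith
    have h3 : |Real.log (p x x)| ≤ k := by
      rw [hk, le_div_iff₀ hε]; nlinarith
    rw [abs_le] at h3
    constructor
    · rw [← Real.le_log_iff_exp_le hpx]; exact h3.1
    · rw [← Real.log_le_iff_le_exp hpx]; exact h3.2
  have hfcont : ContinuousOn f U := by
    have hne : ∀ x ∈ U, p x x ≠ 0 := fun x hx => (hppos x (hUne x hx)).ne'
    refine ContinuousOn.add (hZ.continuous.continuousOn.div hpcont.continuousOn hne) ?_
    refine continuousOn_const.mul (Real.continuous_sqrt.comp_continuousOn ?_)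
    exact continuousOn_const.add ((hpcont.continuousOn.log hne).pow 2)
  obtain ⟨y, hyU, hymin⟩ := hUc.exists_isMinOn ⟨s, hsub s hs0 le_rfl⟩ hfcont
  have hy0 := hUne y hyU
  have hpy := hppos y hy0
  have hys : f y ≤ f s := hymin (hsub s hs0 le_rfl)
  have hmin : ∀ x, x ≠ 0 → f y ≤ f x := by
    intro x hx
    by_cases h : f x ≤ f s
    · exact hymin (hsub x hx h)
    · exact hys.trans (not_le.1 h).le
  -- first-order condition at the minimum
  set h := Real.log (p y y) / g y with hh
  have hhabs : |h| ≤ 1 := by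
    have := hg1 y
    rw [hh, abs_div, abs_of_pos (by linarith : 0 < g y), div_le_one (by linarith)]
    apply Real.le_sqrt_of_sq_le; rw [sq_abs]; linarith
  set ρ := Z y / p y y with hρ
  have hcrit : ∀ v, fderiv ℝ Z y v = (ρ - ε * h) * (2 * p y v) := by
    intro v
    have hlin : HasDerivAt (fun t : ℝ => y + t • v) v 0 := by
      simpa using ((hasDerivAt_id (0 : ℝ)).smul_const v).const_add y
    have hZl : HasDerivAt (fun t : ℝ => Z (y + t • v)) (fderiv ℝ Z y v) 0 := by
      have : HasFDerivAt Z (fderiv ℝ Z y) (y + (0 : ℝ) • v) := by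
        simpa using (hZ y).hasFDerivAt
      exact this.comp_hasDerivAt 0 hlin
    have hpl : HasDerivAt (fun t : ℝ => p (y + t • v) (y + t • v)) (2 * p y v) 0 := by
      simpa using hasDerivAt_bilin_self hps hlin
    have hy1 : p (y + (0 : ℝ) • v) (y + (0 : ℝ) • v) ≠ 0 := by simpa using hpy.ne'
    have hgl : HasDerivAt (fun t : ℝ => g (y + t • v)) (h * (2 * p y v / p y y)) 0 := by
      have h1 := (((hpl.log hy1).fun_pow 2).const_add 1).sqrt
        (add_pos_of_pos_of_nonneg one_pos (sq_nonneg _)).ne'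
      refine h1.congr_deriv ?_
      simp only [zero_smul, add_zero, hh, g]
      have := hpy.ne'
      have h3 : Real.sqrt (1 + Real.log (p y y) ^ 2) ≠ 0 :=
        (Real.sqrt_pos.2 (by positivity)).ne'
      push_cast
      field_simp
    have hfl : HasDerivAt (fun t : ℝ => f (y + t • v))
        ((fderiv ℝ Z y v * p y y - Z y * (2 * p y v)) / p y y ^ 2
          + ε * (h * (2 * p y v / p y y))) 0 := by
      have h1 := (hZl.fun_div hpl hy1).fun_add (hgl.const_mul ε)
      refine h1.congr_deriv ?_
      simp only [zero_smul, add_zero]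
    have hloc : IsLocalMin (fun t : ℝ => f (y + t • v)) 0 := by
      have hev : ∀ᶠ t in 𝓝 (0 : ℝ), y + t • v ≠ 0 := by
        refine hlin.continuousAt.eventually_ne ?_
        simpa using hy0
      filter_upwards [hev] with t ht
      simpa using hmin _ ht
    have h2 := hloc.hasDerivAt_eq_zero hfl
    rw [hρ]
    field_simp at h2 ⊢
    linarith
  obtain ⟨a, ha⟩ := hex y
  rw [hcrit] at ha
  have hid := hp y a
  set ρ' := ρ - ε * h with hρ'
  have hZy : Z y = ρ * p y y := by rw [hρ]; field_simp
  have hεh : |ε * h| ≤ ε := by rw [abs_mul, abs_of_pos hε]; nlinarith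
  rw [abs_le] at hεh
  have hρ0 : 0 ≤ ρ := div_nonneg (hZnn y) hpy.le
  have hρ1 : ρ ≤ 1 - δ + ε * g s := by
    have h1 : f s = 1 - δ + ε * g s := by simp only [f, hδ]; ring
    have h2 : ρ ≤ f y := by
      have := hg1 y
      simp only [f, hρ]; nlinarith
    linarith
  have hbal : β * (ε * h) * p y y
      = (1 - ρ') * (Q y y + R a a) + ρ' * R (a - K y) (a - K y) := by
    have h1 : 2 * p y (A y + B a) = R (a - K y) (a - K y) + β * p y y - Q y y - R a a := by
      linarith
    rw [h1, hZy] at ha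
    have h2 : ε * h = ρ - ρ' := by rw [hρ']; ring
    rw [h2]
    linarith
  have hQy := hQpos y hy0
  have hRa := hR0 a
  have hlhs : β * (ε * h) * p y y ≤ δ / 4 * Q y y := by
    have h1 : β * (ε * h) * p y y ≤ β * ε * p y y := by
      have : β * (ε * h) ≤ β * ε := mul_le_mul_of_nonneg_left hεh.2 hβ
      exact mul_le_mul_of_nonneg_right this hpy.le
    have h2 : β * ε * p y y ≤ β * ε * (C * Q y y) :=
      mul_le_mul_of_nonneg_left (hpQ y) (by positivity)
    have h3 : ε * (β * C) * Q y y ≤ δ / 4 * Q y y := mul_le_mul_of_nonneg_right e3 hQy.le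
    linarith
  rcases le_or_gt 0 ρ' with hc | hc
  · have h1 : δ / 2 ≤ 1 - ρ' := by linarith
    have h2 : 0 ≤ ρ' * R (a - K y) (a - K y) := mul_nonneg hc (hR0 _)
    have h3 : δ / 2 * (Q y y + R a a) ≤ (1 - ρ') * (Q y y + R a a) :=
      mul_le_mul_of_nonneg_right h1 (by linarith)
    have h4 : 0 ≤ δ / 2 * R a a := by positivity
    have h5 : 0 < δ / 4 * Q y y := by positivity
    linarith
  · have h1 : -ε ≤ ρ' := by linarith
    have h2 : R (a - K y) (a - K y) ≤ 2 * R a a + 2 * (D * Q y y) := by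
      have h3 := hR0 (a + K y)
      rw [bilin_add_self hR] at h3
      have h4 : R (a - K y) (a - K y) = R a a - 2 * R a (K y) + R (K y) (K y) := by
        rw [sub_eq_add_neg, bilin_add_self hR]; simp; ring
      have h5 := hRQ y
      linarith
    have h3 : -ε * (2 * R a a + 2 * (D * Q y y)) ≤ ρ' * R (a - K y) (a - K y) := by
      exact (mul_le_mul_of_nonpos_left h2 (by linarith)).trans
        (mul_le_mul_of_nonneg_right h1 (hR0 _))
    have h4 : Q y y + R a a ≤ (1 - ρ') * (Q y y + R a a) :=
      le_mul_of_one_le_left (by linarith) (by linarith)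
    have h5 : ε * D * Q y y ≤ 1 / 8 * Q y y := mul_le_mul_of_nonneg_right e2 hQy.le
    have h6 : ε * R a a ≤ 1 / 4 * R a a := mul_le_mul_of_nonneg_right (by linarith) hRa
    have h7 : δ / 4 * Q y y ≤ 1 / 4 * Q y y := mul_le_mul_of_nonneg_right (by linarith) hQy.le
    linarith

end HJB

/-! ### Uniqueness for the Bellman equation -/

section Bellman

open LinearMap (BilinForm)

theorem integrable_of_quadratic_growth {E : Type*} [NormedAddCommGroup E] [MeasurableSpace E]
    [BorelSpace E] {μ : Measure E} [IsProbabilityMeasure μ]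
    (hμ2 : Integrable (fun x => ‖x‖ ^ 2) μ) {Z : E → ℝ} (hZ : Continuous Z) {c : ℝ}
    (hgrowth : ∀ s, |Z s| ≤ c * (1 + ‖s‖ ^ 2)) (y : E) : Integrable (fun x => Z (y + x)) μ := by
  have hc : 0 ≤ c := by
    have := (abs_nonneg _).trans (hgrowth 0)
    simpa using this
  refine Integrable.mono' (g := fun x => c * (1 + 2 * ‖y‖ ^ 2 + 2 * ‖x‖ ^ 2))
    (((integrable_const _).add (hμ2.const_mul 2)).const_mul c)
    (hZ.comp (by fun_prop)).aestronglyMeasurable (Eventually.of_forall fun x => ?_)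
  refine (hgrowth (y + x)).trans (mul_le_mul_of_nonneg_left ?_ hc)
  have h1 := norm_add_le y x
  nlinarith [norm_nonneg (y + x), sq_nonneg (‖y‖ - ‖x‖), norm_nonneg x, norm_nonneg y]

variable {E F : Type*} [NormedAddCommGroup E] [NormedSpace ℝ E] [FiniteDimensional ℝ E]
  [NormedAddCommGroup F] [NormedSpace ℝ F]

theorem bilin_growth (p : BilinForm ℝ E) : ∃ c, ∀ s, |p s s| ≤ c * (1 + ‖s‖ ^ 2) := by
  obtain ⟨C, hC, h⟩ := bilin_le_norm_sq p
  exact ⟨C, fun s => (h s).trans (mul_le_mul_of_nonneg_left (by linarith) hC.le)⟩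

variable [MeasurableSpace E] [BorelSpace E]

/-- The mean of a quadratic form under a translated centred law. -/
theorem integral_bilin_add {μ : Measure E} [IsProbabilityMeasure μ]
    (hμ1 : Integrable (fun x => x) μ) (hμ0 : ∫ x, x ∂μ = 0)
    (hμ2 : Integrable (fun x => ‖x‖ ^ 2) μ) (p : BilinForm ℝ E)
    (hps : ∀ x y, p x y = p y x) (y : E) :
    ∫ x, p (y + x) (y + x) ∂μ = p y y + ∫ x, p x x ∂μ := by
  have := FiniteDimensional.complete ℝ E
  obtain ⟨c, hc⟩ := bilin_growth p
  have h1 : Integrable (fun x => p x x) μ := by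
    simpa using integrable_of_quadratic_growth hμ2 (continuous_bilin_self p) hc 0
  have h2 : Integrable (fun x => 2 * p y x) μ :=
    ((LinearMap.toContinuousLinearMap (p y)).integrable_comp hμ1).const_mul 2
  have h3 : ∫ x, p y x ∂μ = 0 := by
    have := (LinearMap.toContinuousLinearMap (p y)).integral_comp_comm hμ1
    rw [hμ0, map_zero] at this
    exact this
  simp_rw [bilin_add_self hps]
  have h4 : Integrable (fun x => p y y + 2 * p y x) μ := (integrable_const _).add h2
  rw [integral_add h4 h1, integral_add (integrable_const _) h2, integral_const_mul, h3]
  simp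

variable {μ : Measure E} [IsProbabilityMeasure μ] {γ : ℝ}

/-- Lower bound: value iteration started at `0` stays below every nonnegative solution; the additive
constant produced by the noise is then recovered by a contraction argument. -/
theorem le_bellman (hμ1 : Integrable (fun x => x) μ) (hμ0 : ∫ x, x ∂μ = 0)
    (hμ2 : Integrable (fun x => ‖x‖ ^ 2) μ) (hγ : 0 < γ) (hγ1 : γ < 1 ∨ γ = 1 ∧ μ = Measure.dirac 0)
    (N : E → F → ℝ) (M : E × F →ₗ[ℝ] E)
    (q : ℕ → BilinForm ℝ E) (p : BilinForm ℝ E) (hps : ∀ x y, p x y = p y x)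
    (hq0 : q 0 = 0) (hp0 : ∀ x, 0 ≤ p x x)
    (hq : ∀ n s a, q (n + 1) s s ≤ N s a + γ * q n (M (s, a)) (M (s, a)))
    (hqs : ∀ n x y, q n x y = q n y x) (hqn : ∀ n x, 0 ≤ q n x x)
    (hlim : ∀ s, Tendsto (fun n => q n s s) atTop (𝓝 (p s s))) {c : ℝ}
    (hpN : ∀ s a, p s s ≤ N s a + γ * p (M (s, a)) (M (s, a)))
    (hc : c = γ * (∫ x, p x x ∂μ + c)) (hc1 : γ = 1 → c = 0)
    (Z : E → ℝ) (hZ : Continuous Z) (hZnn : ∀ s, 0 ≤ Z s)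
    {C : ℝ} (hgrowth : ∀ s, |Z s| ≤ C * (1 + ‖s‖ ^ 2))
    (hex : ∀ s, ∃ a, Z s = N s a + γ * ∫ x, Z (M (s, a) + x) ∂μ) (s : E) :
    p s s + c ≤ Z s := by
  have hZint := integrable_of_quadratic_growth hμ2 hZ hgrowth
  have hbint : ∀ (r : BilinForm ℝ E) y, Integrable (fun x => r (y + x) (y + x)) μ := fun r y => by
    obtain ⟨c, hc⟩ := bilin_growth r
    exact integrable_of_quadratic_growth hμ2 (continuous_bilin_self r) hc y
  have h1 : ∀ n s, q n s s ≤ Z s := by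
    intro n
    induction n with
    | zero => intro s; simpa [hq0] using hZnn s
    | succ n ih =>
      intro s
      obtain ⟨a, ha⟩ := hex s
      have h2 : ∫ x, q n (M (s, a) + x) (M (s, a) + x) ∂μ ≤ ∫ x, Z (M (s, a) + x) ∂μ :=
        integral_mono (hbint _ _) (hZint _) fun x => ih _
      rw [integral_bilin_add hμ1 hμ0 hμ2 (q n) (hqs n)] at h2
      have h3 : 0 ≤ ∫ x, q n x x ∂μ := integral_nonneg fun x => hqn n x
      have h4 := hq n s a
      rw [ha]
      have h5 : γ * q n (M (s, a)) (M (s, a)) ≤ γ * ∫ x, Z (M (s, a) + x) ∂μ :=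
        mul_le_mul_of_nonneg_left (by linarith) hγ.le
      linarith
  have h2 : ∀ s, p s s ≤ Z s := fun s => le_of_tendsto (hlim s) (Eventually.of_forall fun n => h1 n s)
  rcases hγ1 with hγ1 | ⟨hγ1, -⟩
  · have hc0 : 0 ≤ c := by
      have : 0 ≤ ∫ x, p x x ∂μ := integral_nonneg hp0
      nlinarith
    have h3 : ∀ n : ℕ, ∀ s, p s s + c - γ ^ n * c ≤ Z s := by
      intro n
      induction n with
      | zero => intro s; simpa using h2 s
      | succ n ih =>
        intro s
        obtain ⟨a, ha⟩ := hex s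
        have h4 : ∫ x, (p (M (s, a) + x) (M (s, a) + x) + (c - γ ^ n * c)) ∂μ
            ≤ ∫ x, Z (M (s, a) + x) ∂μ :=
          integral_mono ((hbint _ _).add (integrable_const _)) (hZint _) fun x => by
            have := ih (M (s, a) + x)
            simp only
            linarith
        rw [integral_add (hbint _ _) (integrable_const _),
          integral_bilin_add hμ1 hμ0 hμ2 p hps] at h4
        simp only [integral_const, probReal_univ, one_smul] at h4
        have h5 := mul_le_mul_of_nonneg_left h4 hγ.le
        have h6 := hpN s a
        rw [ha, pow_succ]
        nlinarith
    have h4 : Tendsto (fun n : ℕ => p s s + c - γ ^ n * c) atTop (𝓝 (p s s + c - 0 * c)) :=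
      tendsto_const_nhds.sub ((tendsto_pow_atTop_nhds_zero_of_lt_one hγ.le hγ1).mul_const c)
    simpa using le_of_tendsto h4 (Eventually.of_forall fun n => h3 n s)
  · rw [hc1 hγ1, add_zero]; exact h2 s

/-- Upper bound: the optimal linear feedback contracts the excess over the quadratic solution, in a
weighted sup norm if there is discounting and along the stable deterministic closed loop otherwise. -/
theorem bellman_le (hμ1 : Integrable (fun x => x) μ) (hμ0 : ∫ x, x ∂μ = 0)
    (hμ2 : Integrable (fun x => ‖x‖ ^ 2) μ) (hγ : 0 < γ) (hγ1 : γ < 1 ∨ γ = 1 ∧ μ = Measure.dirac 0)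
    (Q : BilinForm ℝ E) (hQpos : ∀ x, x ≠ 0 → 0 < Q x x)
    (L : E →ₗ[ℝ] E) (N : E → ℝ) (hNQ : ∀ s, Q s s ≤ N s)
    (p : BilinForm ℝ E) (hps : ∀ x y, p x y = p y x) (hppos : ∀ x, x ≠ 0 → 0 < p x x) {c : ℝ}
    (hpN : ∀ s, p s s = N s + γ * p (L s) (L s))
    (hc : c = γ * (∫ x, p x x ∂μ + c)) (hc1 : γ = 1 → c = 0)
    (Z : E → ℝ) (hZ : Continuous Z) (hZ0 : γ = 1 → Z 0 = 0)
    {C : ℝ} (hgrowth : ∀ s, |Z s| ≤ C * (1 + ‖s‖ ^ 2))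
    (hle : ∀ s, Z s ≤ N s + γ * ∫ x, Z (L s + x) ∂μ) (s : E) :
    Z s ≤ p s s + c := by
  have hZint := integrable_of_quadratic_growth hμ2 hZ hgrowth
  have hbint : ∀ y, Integrable (fun x => p (y + x) (y + x)) μ := fun y => by
    obtain ⟨c, hc⟩ := bilin_growth p
    exact integrable_of_quadratic_growth hμ2 (continuous_bilin_self p) hc y
  have hp0 : ∀ a, 0 ≤ p a a := fun a => by
    rcases eq_or_ne a 0 with rfl | h
    · simp
    · exact (hppos a h).le
  obtain ⟨D, hD, hpQ⟩ := bilin_le_bilin p Q hQpos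
  obtain ⟨e, he, hcoer⟩ := bilin_coercive p hppos
  -- contraction factor of the noiseless closed loop
  obtain ⟨θ, hθ0, hθ1, hθ⟩ : ∃ θ : ℝ, 0 ≤ θ ∧ θ < 1 ∧ ∀ s, γ * p (L s) (L s) ≤ θ * p s s := by
    refine ⟨1 - 1 / (D + 1), ?_, ?_, fun s => ?_⟩
    · rw [sub_nonneg, div_le_one (by positivity)]; linarith
    · have : 0 < 1 / (D + 1) := by positivity
      linarith
    · have h1 : p s s / (D + 1) ≤ N s := by
        rw [div_le_iff₀ (by positivity)]
        have h2 := hpQ s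
        have h3 : 0 ≤ Q s s := by
          rcases eq_or_ne s 0 with rfl | h
          · simp
          · exact (hQpos s h).le
        have := hNQ s
        nlinarith
      have := hpN s
      rw [sub_mul, one_mul, one_div_mul_eq_div]
      linarith
  rcases hγ1 with hγ1 | ⟨hγ1, hμ⟩
  · -- weighted contraction
    set e0 := ∫ x, p x x ∂μ with he0
    have he00 : 0 ≤ e0 := integral_nonneg hp0
    set r := max ((1 + γ) / 2) θ with hr
    have hr1 : r < 1 := max_lt (by linarith) hθ1
    have hr0 : 0 ≤ r := hθ0.trans (le_max_right _ _)
    have hrγ : γ < r := lt_of_lt_of_le (by linarith) (le_max_left _ _)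
    set κ := 1 + γ * e0 / (r - γ) with hκ
    have hκ1 : 1 ≤ κ := by
      have : 0 ≤ γ * e0 / (r - γ) := div_nonneg (by positivity) (by linarith)
      linarith
    have hκ2 : γ * κ + γ * e0 ≤ r * κ := by
      have h1 : (r - γ) * κ = (r - γ) + γ * e0 := by
        rw [hκ]; field_simp [(by linarith : r - γ ≠ 0)]
      nlinarith
    have hbase : ∃ G, 0 ≤ G ∧ ∀ s, Z s - p s s - c ≤ G * (κ + p s s) := by
      have hC : 0 ≤ C := by
        have := (abs_nonneg _).trans (hgrowth 0)
        simpa using this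
      refine ⟨C + C / e + |c|, by positivity, fun s => ?_⟩
      have h1 := (le_abs_self _).trans (hgrowth s)
      have h2 : C * ‖s‖ ^ 2 ≤ C / e * p s s := by
        rw [div_mul_eq_mul_div, le_div_iff₀ he, mul_assoc, mul_comm _ e]
        exact mul_le_mul_of_nonneg_left (hcoer s) hC
      have h3 := hp0 s
      have h4 := neg_abs_le c
      have h5 : 0 ≤ C / e := by positivity
      have h6 : 0 ≤ |c| := abs_nonneg c
      have h7 : C ≤ C * κ := le_mul_of_one_le_right hC hκ1
      have h8 : |c| ≤ |c| * κ := le_mul_of_one_le_right h6 hκ1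
      have h9 : 0 ≤ C / e * κ := by positivity
      have h10 : 0 ≤ C * p s s := by positivity
      have h11 : 0 ≤ |c| * p s s := by positivity
      have : (C + C / e + |c|) * (κ + p s s) = C * κ + C / e * κ + |c| * κ + C * p s s
        + C / e * p s s + |c| * p s s := by ring
      linarith
    obtain ⟨G, hG, hbase⟩ := hbase
    have hiter : ∀ n : ℕ, ∀ s, Z s - p s s - c ≤ r ^ n * (G * (κ + p s s)) := by
      intro n
      induction n with
      | zero => intro s; simpa using hbase s
      | succ n ih =>
        intro s
        set g := r ^ n * G with hg
        have hg0 : 0 ≤ g := by positivity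
        have h4 : ∫ x, Z (L s + x) ∂μ ≤
            ∫ x, ((1 + g) * p (L s + x) (L s + x) + (c + g * κ)) ∂μ :=
          integral_mono (hZint _) (((hbint _).const_mul _).add (integrable_const _)) fun x => by
            have := ih (L s + x)
            rw [← mul_assoc, ← hg] at this
            simp only
            linarith
        rw [integral_add ((hbint _).const_mul _) (integrable_const _), integral_const_mul,
          integral_bilin_add hμ1 hμ0 hμ2 p hps, ← he0] at h4
        simp only [integral_const, probReal_univ, one_smul] at h4
        have h5 := mul_le_mul_of_nonneg_left h4 hγ.le
        have h6 := hle s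
        have h7 := hpN s
        have h8 : g * (γ * p (L s) (L s)) ≤ g * (r * p s s) :=
          mul_le_mul_of_nonneg_left ((hθ s).trans
            (mul_le_mul_of_nonneg_right (le_max_right _ _) (hp0 s))) hg0
        have h9 : g * (γ * κ + γ * e0) ≤ g * (r * κ) := mul_le_mul_of_nonneg_left hκ2 hg0
        have h10 : r ^ (n + 1) * (G * (κ + p s s)) = g * (r * κ) + g * (r * p s s) := by
          rw [hg, pow_succ]; ring
        rw [h10]
        linarith
    have h4 : Tendsto (fun n : ℕ => r ^ n * (G * (κ + p s s))) atTop (𝓝 (0 * (G * (κ + p s s)))) :=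
      (tendsto_pow_atTop_nhds_zero_of_lt_one hr0 hr1).mul_const _
    have h5 := ge_of_tendsto h4 (Eventually.of_forall fun n => hiter n s)
    linarith
  · -- no noise, no discount: follow the stable closed loop to the origin
    subst hγ1
    rw [hc1 rfl, add_zero]
    simp only [hμ, integral_dirac, add_zero, one_mul] at hle
    have h1 : ∀ n : ℕ, Z s - p s s ≤ Z ((L ^ n) s) - p ((L ^ n) s) ((L ^ n) s) := by
      intro n
      induction n with
      | zero => simp
      | succ n ih =>
        refine ih.trans ?_
        rw [pow_succ', Module.End.mul_apply]
        have h2 := hle ((L ^ n) s)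
        have h3 := hpN ((L ^ n) s)
        linarith
    have h2 : ∀ n : ℕ, p ((L ^ n) s) ((L ^ n) s) ≤ θ ^ n * p s s := by
      intro n
      induction n with
      | zero => simp
      | succ n ih =>
        rw [pow_succ', Module.End.mul_apply]
        have h3 := hθ ((L ^ n) s)
        have h4 := mul_le_mul_of_nonneg_left ih hθ0
        rw [pow_succ]
        linarith
    have h3 : Tendsto (fun n : ℕ => (L ^ n) s) atTop (𝓝 0) := by
      rw [tendsto_zero_iff_norm_tendsto_zero]
      have h5 : Tendsto (fun n : ℕ => θ ^ n * p s s / e) atTop (𝓝 0) := by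
        simpa using ((tendsto_pow_atTop_nhds_zero_of_lt_one hθ0 hθ1).mul_const (p s s)).div_const e
      have h6 : Tendsto (fun n : ℕ => ‖(L ^ n) s‖ ^ 2) atTop (𝓝 0) :=
        squeeze_zero (fun n => by positivity) (fun n => by
          rw [le_div_iff₀ he, mul_comm]; exact (hcoer _).trans (h2 n)) h5
      simpa using h6.sqrt
    have h4 : Tendsto (fun n : ℕ => Z ((L ^ n) s) - p ((L ^ n) s) ((L ^ n) s)) atTop
        (𝓝 (Z 0 - p 0 0)) :=
      ((hZ.sub (continuous_bilin_self p)).tendsto 0).comp h3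
    have h5 := ge_of_tendsto h4 (Eventually.of_forall h1)
    rw [hZ0 rfl] at h5
    simp only [map_zero, sub_zero] at h5
    linarith

end Bellman

/-! ### Policies obtained from the two equations -/

section Policies

open LinearMap (BilinForm)

variable {d m : ℕ}

/-- The bilinear form `(x, y) ↦ xᵀ M y` on Euclidean space. -/
noncomputable def matForm {k : ℕ} (M : Matrix (Fin k) (Fin k) ℝ) :
    BilinForm ℝ (EuclideanSpace ℝ (Fin k)) :=
  (Matrix.toBilin' M).compl₁₂ (WithLp.linearEquiv 2 ℝ (Fin k → ℝ)).toLinearMap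
    (WithLp.linearEquiv 2 ℝ (Fin k → ℝ)).toLinearMap

theorem matForm_apply {k : ℕ} (M : Matrix (Fin k) (Fin k) ℝ) (x y : EuclideanSpace ℝ (Fin k)) :
    matForm M x y = x.ofLp ⬝ᵥ (M *ᵥ y.ofLp) := by
  simp [matForm, Matrix.toBilin'_apply']

theorem matForm_self {k : ℕ} (M : Matrix (Fin k) (Fin k) ℝ) (x : EuclideanSpace ℝ (Fin k)) :
    matForm M x x = quad M x := matForm_apply M x x

theorem matForm_neg_self {k : ℕ} (M : Matrix (Fin k) (Fin k) ℝ) (x : EuclideanSpace ℝ (Fin k)) :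
    matForm (-M) x x = - quad M x := by
  rw [matForm_self]; simp [quad, Matrix.neg_mulVec]

theorem matForm_symm {k : ℕ} {M : Matrix (Fin k) (Fin k) ℝ} (hM : M.PosDef)
    (x y : EuclideanSpace ℝ (Fin k)) : matForm M x y = matForm M y x := by
  have h : Mᵀ = M := by simpa [Matrix.IsHermitian] using hM.1
  rw [matForm_apply, matForm_apply, Matrix.dotProduct_mulVec, dotProduct_comm,
    ← Matrix.mulVec_transpose, h]

theorem matForm_pos {k : ℕ} {M : Matrix (Fin k) (Fin k) ℝ} (hM : M.PosDef)
    (x : EuclideanSpace ℝ (Fin k)) (hx : x ≠ 0) : 0 < matForm M x x := by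
  rw [matForm_apply]
  have := hM.re_dotProduct_pos (x := x.ofLp) (by simpa using hx)
  simpa using this

theorem contDiff_bilin_self {E : Type*} [NormedAddCommGroup E] [NormedSpace ℝ E]
    [FiniteDimensional ℝ E] (b : BilinForm ℝ E) : ContDiff ℝ 1 fun x => b x x := by
  have : (fun x => b x x) = fun x => LinearMap.toContinuousBilinearMap b x x := rfl
  rw [this]; fun_prop

theorem fderiv_bilin_self {E : Type*} [NormedAddCommGroup E] [NormedSpace ℝ E]
    [FiniteDimensional ℝ E] {b : BilinForm ℝ E} (hb : ∀ x y, b x y = b y x) (s v : E) :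
    fderiv ℝ (fun x => b x x) s v = 2 * b s v := by
  have h1 : HasFDerivAt (fun x => b x x) (fderiv ℝ (fun x => b x x) s) (s + (0 : ℝ) • v) := by
    simpa using ((contDiff_bilin_self b).differentiable one_ne_zero s).hasFDerivAt
  have h2 : HasDerivAt (fun t : ℝ => s + t • v) v 0 := by
    simpa using ((hasDerivAt_id (0 : ℝ)).smul_const v).const_add s
  have h3 := h1.comp_hasDerivAt 0 h2
  have h4 := hasDerivAt_bilin_self hb h2
  simpa using h3.unique h4

/-- The policy obtained from the Optimal-PhiBE is the linear feedback of the continuous-time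
Riccati equation. -/
theorem isPhiBEPolicy_iff {Q : Matrix (Fin d) (Fin d) ℝ} {R : Matrix (Fin m) (Fin m) ℝ}
    (hQ : (-Q).PosDef) (hR : (-R).PosDef) {β : ℝ} (hβ : 0 ≤ β)
    (A : Matrix (Fin d) (Fin d) ℝ) (B : Matrix (Fin d) (Fin m) ℝ)
    {b : EuclideanSpace ℝ (Fin d) → EuclideanSpace ℝ (Fin m) → EuclideanSpace ℝ (Fin d)}
    (hb : ∀ s a, b s a = linDrift A B s a)
    (p : BilinForm ℝ (EuclideanSpace ℝ (Fin d)))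
    (K : EuclideanSpace ℝ (Fin d) →ₗ[ℝ] EuclideanSpace ℝ (Fin m))
    (hps : ∀ x y, p x y = p y x) (hppos : ∀ x, x ≠ 0 → 0 < p x x)
    (hp : ∀ y a, matForm (-Q) y y + matForm (-R) a a
      + 2 * p y (A.toEuclideanLin y + B.toEuclideanLin a) - β * p y y
      = matForm (-R) (a - K y) (a - K y))
    (π : EuclideanSpace ℝ (Fin d) → EuclideanSpace ℝ (Fin m)) :
    IsPhiBEPolicy (fun s a => quad Q s + quad R a) b β π ↔ π = K := by
  have hobj : ∀ (V : EuclideanSpace ℝ (Fin d) → ℝ) s a,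
      phibeObjective (fun s a => quad Q s + quad R a) b V s a
        = quad Q s + quad R a + fderiv ℝ V s (A.toEuclideanLin s + B.toEuclideanLin a) := by
    intro V s a
    simp only [phibeObjective, hb, linDrift]
    rw [inner_gradient_right]; rfl
  have hobjp : ∀ s a, phibeObjective (fun s a => quad Q s + quad R a) b (fun x => - p x x) s a
      = - (β * p s s) - matForm (-R) (a - K s) (a - K s) := by
    intro s a
    have h1 : fderiv ℝ (fun x => - p x x) s = - fderiv ℝ (fun x => p x x) s := fderiv_fun_neg
    rw [hobj, h1, neg_apply, fderiv_bilin_self hps, ← hp s a, matForm_neg_self, matForm_neg_self]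
    ring
  have hR0 : ∀ a, 0 ≤ matForm (-R) a a := fun a => by
    rcases eq_or_ne a 0 with rfl | h
    · simp
    · exact (matForm_pos hR a h).le
  constructor
  · rintro ⟨V, hV, hmax⟩
    have hVp : V = fun s => - p s s := by
      have hd : Differentiable ℝ V := hV.smooth.differentiable one_ne_zero
      have hfd : ∀ s, fderiv ℝ (fun s => - V s) s = - fderiv ℝ V s := fun s => fderiv_fun_neg
      obtain ⟨c, hc⟩ := hV.growth
      funext s
      have hle : - V s ≤ p s s := hjb_le (matForm (-Q)) (matForm_pos hQ) (matForm (-R))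
        (matForm_pos hR) A.toEuclideanLin B.toEuclideanLin hβ p K hps hppos hp (fun s => - V s)
        hd.fun_neg (c := c) (fun s => by simpa using hc s)
        (fun h => by simpa using hV.normalized h) (fun s a => by
          have := (hV.equation s).2 ⟨a, rfl⟩
          simp only [hobj] at this
          rw [hfd, neg_apply, matForm_neg_self, matForm_neg_self]
          linarith) s
      have hge : p s s ≤ - V s := le_hjb (matForm (-Q)) (matForm_pos hQ) (matForm (-R))
        (matForm_symm hR) (matForm_pos hR) A.toEuclideanLin B.toEuclideanLin hβ p K hps hppos hp
        (fun s => - V s) hd.fun_neg (fun s => by simpa using hV.nonpos s) (fun s => by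
          obtain ⟨a, ha⟩ := (hV.equation s).1
          simp only [hobj] at ha
          refine ⟨a, ?_⟩
          rw [hfd, neg_apply, matForm_neg_self, matForm_neg_self]
          linarith) s
      linarith
    subst hVp
    funext s
    have h1 := hmax s (K s)
    rw [hobjp, hobjp] at h1
    simp only [sub_self, map_zero] at h1
    by_contra hne
    have := matForm_pos hR (π s - K s) (sub_ne_zero.2 hne)
    linarith
  · rintro rfl
    obtain ⟨c, hc⟩ := bilin_growth p
    refine ⟨fun s => - p s s, ⟨(contDiff_bilin_self p).neg, fun s => ?_, ⟨c, fun s => ?_⟩,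
      fun _ => by simp, fun s => ⟨⟨K s, ?_⟩, ?_⟩⟩, fun s a => ?_⟩
    · rcases eq_or_ne s 0 with rfl | h
      · simp
      · linarith [hppos s h]
    · simpa using hc s
    · simp only [hobjp]; simp
    · rintro _ ⟨a, rfl⟩
      simp only [hobjp]
      linarith [hR0 (a - K s)]
    · rw [hobjp, hobjp]
      simp only [sub_self, map_zero]
      linarith [hR0 (a - K s)]

/-- The policy obtained from the Optimal-BE is the linear feedback of the discrete-time Riccati
equation; the noise `μ` only adds the constant `c` to the value. -/
theorem isBEPolicy_iff {Q : Matrix (Fin d) (Fin d) ℝ} {R : Matrix (Fin m) (Fin m) ℝ}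
    (hQ : (-Q).PosDef) (hR : (-R).PosDef) {γ : ℝ} (hγ : 0 < γ)
    {μ : Measure (EuclideanSpace ℝ (Fin d))} [IsProbabilityMeasure μ]
    (hμ1 : Integrable (fun x => x) μ) (hμ0 : ∫ x, x ∂μ = 0)
    (hμ2 : Integrable (fun x => ‖x‖ ^ 2) μ) (hγ1 : γ < 1 ∨ γ = 1 ∧ μ = Measure.dirac 0)
    (M : EuclideanSpace ℝ (Fin d) × EuclideanSpace ℝ (Fin m) →ₗ[ℝ] EuclideanSpace ℝ (Fin d))
    {P : EuclideanSpace ℝ (Fin d) → EuclideanSpace ℝ (Fin m) →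
      Measure (EuclideanSpace ℝ (Fin d))}
    (hP : ∀ s a, P s a = μ.map (fun x => M (s, a) + x))
    (q : ℕ → BilinForm ℝ (EuclideanSpace ℝ (Fin d))) (p : BilinForm ℝ (EuclideanSpace ℝ (Fin d)))
    (K : EuclideanSpace ℝ (Fin d) →ₗ[ℝ] EuclideanSpace ℝ (Fin m))
    (hq0 : q 0 = 0)
    (hq : ∀ n s a, q (n + 1) s s ≤ (matForm (-Q) s s + matForm (-R) a a)
      + γ * q n (M (s, a)) (M (s, a)))
    (hqs : ∀ n x y, q n x y = q n y x) (hqn : ∀ n x, 0 ≤ q n x x)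
    (hlim : ∀ s, Tendsto (fun n => q n s s) atTop (𝓝 (p s s)))
    (hps : ∀ x y, p x y = p y x) (hppos : ∀ x, x ≠ 0 → 0 < p x x)
    (hp : ∀ s a, (matForm (-Q) s s + matForm (-R) a a) + γ * p (M (s, a)) (M (s, a))
      = p s s + (matForm (-R) (a - K s) (a - K s) + γ * p (M (0, a - K s)) (M (0, a - K s))))
    (π : EuclideanSpace ℝ (Fin d) → EuclideanSpace ℝ (Fin m)) :
    IsBEPolicy (fun s a => quad Q s + quad R a) P γ π ↔ π = K := by
  have hobj : ∀ (V : EuclideanSpace ℝ (Fin d) → ℝ), Continuous V → ∀ s a,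
      beObjective (fun s a => quad Q s + quad R a) P γ V s a
        = quad Q s + quad R a + γ * ∫ x, V (M (s, a) + x) ∂μ := by
    intro V hV s a
    simp only [beObjective, hP]
    rw [integral_map (by fun_prop) hV.aestronglyMeasurable]
  have hp0 : ∀ x, 0 ≤ p x x := fun x => by
    rcases eq_or_ne x 0 with rfl | h
    · simp
    · exact (hppos x h).le
  have hR0 : ∀ a, 0 ≤ matForm (-R) a a := fun a => by
    rcases eq_or_ne a 0 with rfl | h
    · simp
    · exact (matForm_pos hR a h).le
  obtain ⟨c, hc, hc1, hc0⟩ : ∃ c, c = γ * (∫ x, p x x ∂μ + c) ∧ (γ = 1 → c = 0) ∧ 0 ≤ c := by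
    rcases hγ1 with h | ⟨h, hμ⟩
    · refine ⟨γ * (∫ x, p x x ∂μ) / (1 - γ), ?_, fun h' => absurd h' h.ne, ?_⟩
      · have : 1 - γ ≠ 0 := by linarith
        field_simp
        ring
      · have : 0 ≤ ∫ x, p x x ∂μ := integral_nonneg hp0
        exact div_nonneg (by positivity) (by linarith)
    · refine ⟨0, ?_, fun _ => rfl, le_rfl⟩
      rw [hμ, integral_dirac]; simp
  have hVc : Continuous fun x => - (p x x + c) :=
    ((continuous_bilin_self p).add continuous_const).neg
  have hobjp : ∀ s a, beObjective (fun s a => quad Q s + quad R a) P γ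
      (fun x => - (p x x + c)) s a = - (p s s + c) - (matForm (-R) (a - K s) (a - K s)
        + γ * p (M (0, a - K s)) (M (0, a - K s))) := by
    intro s a
    have hint : Integrable (fun x => p (M (s, a) + x) (M (s, a) + x)) μ := by
      obtain ⟨c, hc⟩ := bilin_growth p
      exact integrable_of_quadratic_growth hμ2 (continuous_bilin_self p) hc _
    rw [hobj _ hVc, integral_neg, integral_add hint (integrable_const _),
      integral_bilin_add hμ1 hμ0 hμ2 p hps, integral_const, probReal_univ, one_smul]
    have h1 := hp s a
    rw [matForm_neg_self Q s, matForm_neg_self R a] at h1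
    linarith
  have hZnn : ∀ s a, 0 ≤ matForm (-R) (a - K s) (a - K s)
        + γ * p (M (0, a - K s)) (M (0, a - K s)) := fun s a =>
    add_nonneg (hR0 _) (mul_nonneg hγ.le (hp0 _))
  have hzero : ((0, 0) : EuclideanSpace ℝ (Fin d) × EuclideanSpace ℝ (Fin m)) = 0 := rfl
  constructor
  · rintro ⟨V, hV, hmax⟩
    have hVp : V = fun s => - (p s s + c) := by
      obtain ⟨C, hC⟩ := hV.growth
      funext s
      have hle : - V s ≤ p s s + c := by
        refine bellman_le hμ1 hμ0 hμ2 hγ hγ1 (matForm (-Q)) (matForm_pos hQ)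
          (M ∘ₗ LinearMap.prod LinearMap.id K)
          (fun s => matForm (-Q) s s + matForm (-R) (K s) (K s))
          (fun s => le_add_of_nonneg_right (hR0 _)) p hps hppos (fun s => ?_) hc hc1
          (fun s => - V s) hV.continuous.neg (fun h => by simpa using hV.normalized h)
          (C := C) (fun s => by simpa using hC s) (fun s => ?_) s
        · have := hp s (K s)
          simp only [sub_self, hzero, map_zero, mul_zero, add_zero] at this
          exact this.symm
        · have := (hV.equation s).2 ⟨K s, rfl⟩
          simp only [hobj V hV.continuous] at this
          rw [matForm_neg_self, matForm_neg_self, integral_neg]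
          change _ ≤ -quad Q s + -quad R (K s) + γ * -∫ x, V (M (s, K s) + x) ∂μ
          linarith
      have hge : p s s + c ≤ - V s := by
        refine le_bellman hμ1 hμ0 hμ2 hγ hγ1 (fun s a => matForm (-Q) s s + matForm (-R) a a)
          M q p hps hq0 hp0 hq hqs hqn hlim (fun s a => ?_) hc hc1 (fun s => - V s)
          hV.continuous.neg (fun s => by simpa using hV.nonpos s) (C := C)
          (fun s => by simpa using hC s) (fun s => ?_) s
        · rw [hp s a]; linarith [hZnn s a]
        · obtain ⟨a, ha⟩ := (hV.equation s).1
          simp only [hobj V hV.continuous] at ha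
          refine ⟨a, ?_⟩
          rw [matForm_neg_self, matForm_neg_self, integral_neg]
          linarith
      linarith
    subst hVp
    funext s
    have h1 := hmax s (K s)
    rw [hobjp, hobjp] at h1
    simp only [sub_self, hzero, map_zero, mul_zero] at h1
    by_contra hne
    have := matForm_pos hR (π s - K s) (sub_ne_zero.2 hne)
    have := mul_nonneg hγ.le (hp0 (M (0, π s - K s)))
    linarith
  · rintro rfl
    obtain ⟨C, hC⟩ := bilin_growth p
    refine ⟨fun s => - (p s s + c), ⟨hVc, fun s => ?_, ⟨C + c, fun s => ?_⟩,
      fun h => by simp [hc1 h], fun s => ⟨⟨K s, ?_⟩, ?_⟩⟩, fun s a => ?_⟩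
    · linarith [hp0 s]
    · rw [abs_neg]
      refine (abs_add_le _ _).trans ?_
      rw [abs_of_nonneg hc0]
      have := hC s
      nlinarith [mul_nonneg hc0 (sq_nonneg ‖s‖)]
    · simp only [hobjp, sub_self, hzero, map_zero]
      simp
    · rintro _ ⟨a, rfl⟩
      simp only [hobjp]
      linarith [hZnn s a]
    · rw [hobjp, hobjp]
      simp only [sub_self, hzero, map_zero, mul_zero]
      linarith [hZnn s a]

end Policies

/-! ### The transition data -/

section Data

variable {d m : ℕ}

theorem continuous_linDrift (A : Matrix (Fin d) (Fin d) ℝ) (B : Matrix (Fin d) (Fin m) ℝ) :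
    Continuous fun x : EuclideanSpace ℝ (Fin d) × EuclideanSpace ℝ (Fin m) =>
      linDrift A B x.1 x.2 := by
  have h1 : Continuous A.toEuclideanLin := LinearMap.continuous_of_finiteDimensional _
  have h2 : Continuous B.toEuclideanLin := LinearMap.continuous_of_finiteDimensional _
  unfold linDrift
  fun_prop

theorem multivariateGaussian_eq_map {ι : Type*} [Fintype ι] [DecidableEq ι]
    (μ : EuclideanSpace ℝ ι) (S : Matrix ι ι ℝ) :
    multivariateGaussian μ S = (multivariateGaussian 0 S).map (fun x => μ + x) := by
  simp only [multivariateGaussian]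
  rw [Measure.map_map (by fun_prop) (by fun_prop)]
  congr 1
  ext x
  simp

theorem coef_one : coef 1 0 = 1 := by
  simp [coef, Matrix.mulVec, dotProduct]

theorem Ahat_one (A : Matrix (Fin d) (Fin d) ℝ) {Δt : ℝ} (hΔt : Δt ≠ 0) :
    Δt • Ahat A Δt 1 = NormedSpace.exp (Δt • A) - 1 := by
  simp only [Ahat, Finset.univ_unique, Fin.default_eq_zero, Finset.sum_singleton, coef_one]
  simp [smul_smul, hΔt]

/-- The law of the state after one more step is the convolution of the propagated law with the
noise. -/
theorem bind_transition_eq (A : Matrix (Fin d) (Fin d) ℝ) (B : Matrix (Fin d) (Fin m) ℝ) (σ Δt : ℝ)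
    (a : EuclideanSpace ℝ (Fin m)) (ρ : Measure (EuclideanSpace ℝ (Fin d))) [SFinite ρ] :
    (ρ.bind fun x => transition A B σ Δt x a)
      = (ρ.prod (multivariateGaussian 0 ((σ ^ 2 * Δt) • noiseCov A Δt))).map
        (fun z => linDrift (Δt • Ahat A Δt 1 + 1) (Δt • Bhat A B Δt 1) z.1 a + z.2) := by
  set ν := multivariateGaussian (0 : EuclideanSpace ℝ (Fin d)) ((σ ^ 2 * Δt) • noiseCov A Δt)
  set f : EuclideanSpace ℝ (Fin d) → EuclideanSpace ℝ (Fin d) := fun x =>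
    linDrift (Δt • Ahat A Δt 1 + 1) (Δt • Bhat A B Δt 1) x a with hf
  have hfm : Measurable f :=
    ((continuous_linDrift _ _).comp (by fun_prop : Continuous fun x => (x, a))).measurable
  have htr : ∀ x (U : Set (EuclideanSpace ℝ (Fin d))), MeasurableSet U →
      transition A B σ Δt x a U = ν (Prod.mk x ⁻¹' {z : _ × _ | f z.1 + z.2 ∈ U}) := by
    intro x U hU
    rw [transition, multivariateGaussian_eq_map, Measure.map_apply (by fun_prop) hU]
    rfl
  have hms : ∀ U : Set (EuclideanSpace ℝ (Fin d)), MeasurableSet U → MeasurableSet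
      {z : EuclideanSpace ℝ (Fin d) × EuclideanSpace ℝ (Fin d) | f z.1 + z.2 ∈ U} :=
    fun U hU => ((hfm.comp measurable_fst).add measurable_snd) hU
  have hmeas : Measurable fun x => transition A B σ Δt x a := by
    refine Measure.measurable_of_measurable_coe _ fun U hU => ?_
    simp_rw [fun x => htr x U hU]
    exact measurable_measure_prodMk_left (hms U hU)
  ext U hU
  have hfs : Measurable fun z : EuclideanSpace ℝ (Fin d) × EuclideanSpace ℝ (Fin d) =>
      f z.1 + z.2 := (hfm.comp measurable_fst).add measurable_snd
  rw [Measure.bind_apply hU hmeas.aemeasurable, Measure.map_apply hfs hU]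
  change _ = (ρ.prod ν) {z | f z.1 + z.2 ∈ U}
  rw [Measure.prod_apply (hms U hU)]
  exact lintegral_congr fun x => htr x U hU

/-- The mean of the `j`-step law is that of the deterministic linear system at time `j Δt`; the noise
is centred and drops out. -/
theorem iterTransition_mean (A : Matrix (Fin d) (Fin d) ℝ) (B : Matrix (Fin d) (Fin m) ℝ)
    (σ : ℝ) {Δt : ℝ} (hΔt : Δt ≠ 0) (hA : IsUnit A.det) (s : EuclideanSpace ℝ (Fin d))
    (a : EuclideanSpace ℝ (Fin m)) (j : ℕ) :
    IsProbabilityMeasure (iterTransition (transition A B σ Δt) s a j) ∧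
    Integrable (fun x => x) (iterTransition (transition A B σ Δt) s a j) ∧
    ∫ x, x ∂(iterTransition (transition A B σ Δt) s a j)
      = s + linDrift (NormedSpace.exp (Δt • A) ^ j - 1)
        (A⁻¹ * (NormedSpace.exp (Δt • A) ^ j - 1) * B) s a := by
  induction j with
  | zero =>
    refine ⟨by simp only [iterTransition]; infer_instance, ?_, ?_⟩
    · simp only [iterTransition]; exact integrable_dirac (by simp)
    · simp [iterTransition, linDrift]
  | succ j ih =>
    obtain ⟨hprob, hint, hmean⟩ := ih
    set ρ := iterTransition (transition A B σ Δt) s a j with hρ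
    set ν := multivariateGaussian (0 : EuclideanSpace ℝ (Fin d)) ((σ ^ 2 * Δt) • noiseCov A Δt)
      with hν
    set G := NormedSpace.exp (Δt • A) with hG
    have hstep : iterTransition (transition A B σ Δt) s a (j + 1) = (ρ.prod ν).map
        (fun z => linDrift (Δt • Ahat A Δt 1 + 1) (Δt • Bhat A B Δt 1) z.1 a + z.2) := by
      simp only [iterTransition]
      exact bind_transition_eq A B σ Δt a ρ
    have hcoef1 : Δt • Ahat A Δt 1 + 1 = G := by rw [Ahat_one A hΔt, ← hG]; simp
    have hcoef2 : Δt • Bhat A B Δt 1 = A⁻¹ * (G - 1) * B := by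
      rw [hG, Bhat, ← Ahat_one A hΔt]; simp
    rw [hcoef1, hcoef2] at hstep
    have hcont : Continuous fun z : EuclideanSpace ℝ (Fin d) × EuclideanSpace ℝ (Fin d) =>
        linDrift G (A⁻¹ * (G - 1) * B) z.1 a + z.2 :=
      ((continuous_linDrift _ _).comp (by fun_prop : Continuous fun z :
        EuclideanSpace ℝ (Fin d) × EuclideanSpace ℝ (Fin d) => (z.1, a))).add continuous_snd
    have hlin : ∀ x, linDrift G (A⁻¹ * (G - 1) * B) x a
        = LinearMap.toContinuousLinearMap G.toEuclideanLin x
          + (A⁻¹ * (G - 1) * B).toEuclideanLin a := fun x => rfl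
    have hνint : Integrable (fun x => x) ν := IsGaussian.integrable_fun_id
    have hi0 : Integrable (fun x => LinearMap.toContinuousLinearMap G.toEuclideanLin x) ρ :=
      ContinuousLinearMap.integrable_comp _ hint
    have hi1 : Integrable (fun x => linDrift G (A⁻¹ * (G - 1) * B) x a) ρ := by
      simp_rw [hlin]
      exact hi0.add (integrable_const _)
    have hi2 := hi1.comp_fst ν
    have hi3 := hνint.comp_snd ρ
    refine ⟨?_, ?_, ?_⟩
    · rw [hstep]; exact Measure.isProbabilityMeasure_map hcont.aemeasurable
    · rw [hstep, integrable_map_measure (by fun_prop) hcont.aemeasurable]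
      exact hi2.add hi3
    · rw [hstep, integral_map hcont.aemeasurable (by fun_prop), integral_add hi2 hi3,
        integral_fun_fst (fun x => linDrift G (A⁻¹ * (G - 1) * B) x a),
        integral_fun_snd (fun x => x), probReal_univ, probReal_univ, one_smul, one_smul, hν, integral_id_multivariateGaussian, add_zero]
      simp_rw [hlin]
      rw [integral_add hi0 (integrable_const _), ContinuousLinearMap.integral_comp_comm _ hint,
        hmean, integral_const, probReal_univ, one_smul]
      have hcomm : G * A⁻¹ = A⁻¹ * G := by
        have h1 : G * A = A * G :=
          ((Commute.refl A).smul_right Δt).exp_right.eq.symm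
        calc G * A⁻¹ = A⁻¹ * A * (G * A⁻¹) := by rw [Matrix.nonsing_inv_mul _ hA, one_mul]
          _ = A⁻¹ * (A * G) * A⁻¹ := by simp only [mul_assoc]
          _ = A⁻¹ * G * (A * A⁻¹) := by rw [← h1]; simp only [mul_assoc]
          _ = A⁻¹ * G := by rw [Matrix.mul_nonsing_inv _ hA, mul_one]
      have h1 : ∀ x, LinearMap.toContinuousLinearMap G.toEuclideanLin x = G.toEuclideanLin x :=
        fun x => rfl
      have h2 : ∀ (M N : Matrix (Fin d) (Fin d) ℝ) x, (M * N).toEuclideanLin x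
          = M.toEuclideanLin (N.toEuclideanLin x) := fun M N x => by
        rw [Matrix.toLpLin_mul_same]; rfl
      have h3 : ∀ (M : Matrix (Fin d) (Fin d) ℝ) (N : Matrix (Fin d) (Fin m) ℝ) x,
          (M * N).toEuclideanLin x = M.toEuclideanLin (N.toEuclideanLin x) := fun M N x => by
        rw [Matrix.toLpLin_mul (q := 2)]; rfl
      have h4 : G.toEuclideanLin (A⁻¹.toEuclideanLin (B.toEuclideanLin a))
          = A⁻¹.toEuclideanLin (G.toEuclideanLin (B.toEuclideanLin a)) := by
        rw [← h2, hcomm, h2]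
      have h5 : G.toEuclideanLin (A⁻¹.toEuclideanLin ((G ^ j).toEuclideanLin (B.toEuclideanLin a)))
          = A⁻¹.toEuclideanLin ((G ^ (j + 1)).toEuclideanLin (B.toEuclideanLin a)) := by
        rw [← h2, hcomm, h2, ← h2 G, pow_succ']
      have h6 : G.toEuclideanLin ((G ^ j).toEuclideanLin s) = (G ^ (j + 1)).toEuclideanLin s := by
        rw [← h2, pow_succ']
      rw [h1]
      simp only [linDrift, h3, h2, map_add, map_sub, LinearMap.sub_apply, Matrix.toLpLin_one,
        LinearMap.id_apply, h4, h5, h6]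
      abel

/-- The drift reconstructed from the transition data is linear with coefficients `Â_i`, `B̂_i`. -/
theorem bHat_transition (A : Matrix (Fin d) (Fin d) ℝ) (B : Matrix (Fin d) (Fin m) ℝ)
    (σ : ℝ) {Δt : ℝ} (hΔt : Δt ≠ 0) (hA : IsUnit A.det) (i : ℕ) (s : EuclideanSpace ℝ (Fin d))
    (a : EuclideanSpace ℝ (Fin m)) :
    bHat (transition A B σ Δt) Δt i s a = linDrift (Ahat A Δt i) (Bhat A B Δt i) s a := by
  have hterm : ∀ j : Fin i,
      ∫ x, (x - s) ∂(iterTransition (transition A B σ Δt) s a ((j : ℕ) + 1))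
      = linDrift (NormedSpace.exp ((((j : ℝ) + 1) * Δt) • A) - 1)
        (A⁻¹ * (NormedSpace.exp ((((j : ℝ) + 1) * Δt) • A) - 1) * B) s a := by
    intro j
    obtain ⟨h1, h2, h3⟩ := iterTransition_mean A B σ hΔt hA s a ((j : ℕ) + 1)
    have hpow : NormedSpace.exp (Δt • A) ^ ((j : ℕ) + 1)
        = NormedSpace.exp ((((j : ℝ) + 1) * Δt) • A) := by
      rw [← Matrix.exp_nsmul, ← Nat.cast_smul_eq_nsmul ℝ, smul_smul]
      push_cast; rfl
    rw [integral_sub h2 (integrable_const _), h3, hpow]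
    simp
  simp only [bHat, hterm, Bhat, Ahat, linDrift, map_smul, map_sum, LinearMap.smul_apply,
    LinearMap.sum_apply, Matrix.mul_smul, Matrix.smul_mul, Matrix.mul_sum, Matrix.sum_mul,
    smul_add, Finset.sum_add_distrib]

end Data

/-! ### Scalar Brownian increments and the Itô isometry -/

section Ito

variable {Ω : Type*} {mΩ : MeasurableSpace Ω}

/-- Products of `L²`-convergent sequences have convergent integrals. -/
theorem tendsto_integral_mul_of_L2 {α : Type*} {mα : MeasurableSpace α} {μ : Measure α}
    {f g : ℕ → α → ℝ} {f' g' : α → ℝ} (hf : ∀ n, MemLp (f n) 2 μ) (hg : ∀ n, MemLp (g n) 2 μ)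
    (hf' : MemLp f' 2 μ) (hg' : MemLp g' 2 μ)
    (hfl : Tendsto (fun n => ∫⁻ x, ‖f n x - f' x‖ₑ ^ 2 ∂μ) atTop (𝓝 0))
    (hgl : Tendsto (fun n => ∫⁻ x, ‖g n x - g' x‖ₑ ^ 2 ∂μ) atTop (𝓝 0)) :
    Tendsto (fun n => ∫ x, f n x * g n x ∂μ) atTop (𝓝 (∫ x, f' x * g' x ∂μ)) := by
  have key : ∀ {f : ℕ → α → ℝ} {f' : α → ℝ} (hf : ∀ n, MemLp (f n) 2 μ) (hf' : MemLp f' 2 μ),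
      Tendsto (fun n => ∫⁻ x, ‖f n x - f' x‖ₑ ^ 2 ∂μ) atTop (𝓝 0) →
      Tendsto (fun n => (hf n).toLp) atTop (𝓝 hf'.toLp) := by
    intro f f' hf hf' h
    refine (Lp.tendsto_Lp_iff_tendsto_eLpNorm'' f hf f' hf').2 ?_
    have h1 : ∀ n, eLpNorm (f n - f') 2 μ = (∫⁻ x, ‖f n x - f' x‖ₑ ^ 2 ∂μ) ^ (1 / 2 : ℝ) := by
      intro n
      rw [eLpNorm_eq_lintegral_rpow_enorm_toReal (by norm_num) (by norm_num)]
      simp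
    simp_rw [h1]
    simpa using h.ennrpow_const (1 / 2)
  have h1 := (key hf hf' hfl).inner (𝕜 := ℝ) (key hg hg' hgl)
  have h2 : ∀ {f g : α → ℝ} (hf : MemLp f 2 μ) (hg : MemLp g 2 μ),
      inner ℝ hf.toLp hg.toLp = ∫ x, f x * g x ∂μ := by
    intro f g hf hg
    rw [L2.inner_def]
    refine integral_congr_ae ?_
    filter_upwards [hf.coeFn_toLp, hg.coeFn_toLp] with x h1 h2
    rw [h1, h2]
    simp [mul_comm]
  simpa only [h2] using h1

theorem integrable_mul_of_memLp_two {α : Type*} {mα : MeasurableSpace α} {μ : Measure α}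
    {f g : α → ℝ} (hf : MemLp f 2 μ) (hg : MemLp g 2 μ) : Integrable (fun x => f x * g x) μ :=
  hf.integrable_mul hg

/-- A scalar standard Brownian motion relative to a filtration, not necessarily started at `0`. -/
structure IsScalarBM (𝓕 : Filtration ℝ≥0 mΩ) (w : ℝ≥0 → Ω → ℝ) (P : Measure Ω) : Prop where
  adapted : ∀ t, Measurable[𝓕 t] (w t)
  continuous_paths : ∀ ω, Continuous fun t => w t ω
  increment_indep : ∀ s t : ℝ≥0, s ≤ t →
    Indep (MeasurableSpace.comap (fun ω => w t ω - w s ω) inferInstance) (𝓕 s) P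
  increment_law : ∀ s t : ℝ≥0, s ≤ t →
    P.map (fun ω => w t ω - w s ω) = gaussianReal 0 (t - s)

theorem posSemidef_smul_one {n : ℕ} {c : ℝ} (hc : 0 ≤ c) :
    (c • (1 : Matrix (Fin n) (Fin n) ℝ)).PosSemidef :=
  Matrix.PosSemidef.one.smul hc

theorem IsBrownianMotion.component {n : ℕ} {𝓕 : Filtration ℝ≥0 mΩ}
    {W : ℝ≥0 → Ω → EuclideanSpace ℝ (Fin n)} {P : Measure Ω} (hW : IsBrownianMotion 𝓕 W P)
    (j : Fin n) : IsScalarBM 𝓕 (fun t ω => W t ω j) P where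
  adapted t := (by fun_prop : Measurable fun x : EuclideanSpace ℝ (Fin n) => x j).comp (hW.adapted t)
  continuous_paths ω := (by fun_prop : Continuous fun x : EuclideanSpace ℝ (Fin n) => x j).comp
    (hW.continuous_paths ω)
  increment_indep s t hst := by
    refine indep_of_indep_of_le_left (hW.increment_indep s t hst) ?_
    have hm : Measurable fun x : EuclideanSpace ℝ (Fin n) => x j := by fun_prop
    have h1 : (fun ω => W t ω j - W s ω j)
        = (fun x : EuclideanSpace ℝ (Fin n) => x j) ∘ (fun ω => W t ω - W s ω) := by
      ext ω; simp
    rw [h1, ← MeasurableSpace.comap_comp]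
    exact MeasurableSpace.comap_mono hm.comap_le
  increment_law s t hst := by
    have h0 : (0 : ℝ) ≤ (t : ℝ) - s := sub_nonneg.2 (by exact_mod_cast hst)
    have hm : Measurable fun x : EuclideanSpace ℝ (Fin n) => x j := by fun_prop
    have h1 : (fun ω => W t ω j - W s ω j)
        = (fun x : EuclideanSpace ℝ (Fin n) => x j) ∘ (fun ω => W t ω - W s ω) := by
      ext ω; simp
    have hmW : Measurable fun ω => W t ω - W s ω :=
      ((hW.adapted t).mono (𝓕.le t) le_rfl).sub ((hW.adapted s).mono (𝓕.le s) le_rfl)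
    rw [h1, ← Measure.map_map hm hmW, hW.increment_law s t hst,
      (measurePreserving_eval_multivariateGaussian (posSemidef_smul_one h0)).map_eq]
    congr 1
    ext
    simp [NNReal.coe_sub hst, h0]

namespace IsScalarBM

variable {𝓕 : Filtration ℝ≥0 mΩ} {w : ℝ≥0 → Ω → ℝ} {P : Measure Ω}

theorem measurable (hw : IsScalarBM 𝓕 w P) (t : ℝ≥0) : Measurable (w t) :=
  (hw.adapted t).mono (𝓕.le t) le_rfl

theorem measurable_inc (hw : IsScalarBM 𝓕 w P) (s t : ℝ≥0) :
    Measurable fun ω => w t ω - w s ω := (hw.measurable t).sub (hw.measurable s)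

theorem indepFun (hw : IsScalarBM 𝓕 w P) {s t : ℝ≥0} (hst : s ≤ t) {β : Type*}
    {mβ : MeasurableSpace β} {ξ : Ω → β}
    (hξ : Measurable[𝓕 s] ξ) : IndepFun ξ (fun ω => w t ω - w s ω) P :=
  (indep_of_indep_of_le_right (hw.increment_indep s t hst) hξ.comap_le).symm

theorem memLp_inc (hw : IsScalarBM 𝓕 w P) {s t : ℝ≥0} (hst : s ≤ t) (p : ℝ≥0) :
    MemLp (fun ω => w t ω - w s ω) p P := by
  have h1 := memLp_id_gaussianReal (μ := 0) (v := t - s) p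
  rw [← hw.increment_law s t hst, memLp_map_measure_iff aestronglyMeasurable_id
    (hw.measurable_inc s t).aemeasurable] at h1
  exact h1

theorem integral_inc (hw : IsScalarBM 𝓕 w P) {s t : ℝ≥0} (hst : s ≤ t) :
    ∫ ω, (w t ω - w s ω) ∂P = 0 := by
  have h1 : ∫ x, x ∂(gaussianReal 0 (t - s)) = 0 := integral_id_gaussianReal
  rwa [← hw.increment_law s t hst, integral_map (f := fun x => x)
    (hw.measurable_inc s t).aemeasurable (by fun_prop)] at h1

theorem integral_inc_sq (hw : IsScalarBM 𝓕 w P) {s t : ℝ≥0} (hst : s ≤ t) :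
    ∫ ω, (w t ω - w s ω) ^ 2 ∂P = ((t - s : ℝ≥0) : ℝ) := by
  have h1 := variance_id_gaussianReal (μ := 0) (v := t - s)
  rw [variance_of_integral_eq_zero (by fun_prop) (by simp), ← hw.increment_law s t hst,
    integral_map (hw.measurable_inc s t).aemeasurable (by fun_prop)] at h1
  exact h1

theorem integral_mul_inc (hw : IsScalarBM 𝓕 w P) {s t : ℝ≥0} (hst : s ≤ t) {ξ : Ω → ℝ}
    (hξ : Measurable[𝓕 s] ξ) : ∫ ω, ξ ω * (w t ω - w s ω) ∂P = 0 := by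
  rw [(hw.indepFun hst hξ).integral_fun_mul_eq_mul_integral
    (hξ.mono (𝓕.le s) le_rfl).aestronglyMeasurable (hw.measurable_inc s t).aestronglyMeasurable,
    hw.integral_inc hst, mul_zero]

theorem integral_mul_inc_sq (hw : IsScalarBM 𝓕 w P) {s t : ℝ≥0} (hst : s ≤ t) {ξ : Ω → ℝ}
    (hξ : Measurable[𝓕 s] ξ) :
    ∫ ω, ξ ω * (w t ω - w s ω) ^ 2 ∂P = (∫ ω, ξ ω ∂P) * ((t - s : ℝ≥0) : ℝ) := by
  have h1 := (hw.indepFun hst hξ).comp measurable_id (measurable_id.pow_const 2)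
  have h2 := h1.integral_fun_mul_eq_mul_integral
    (hξ.mono (𝓕.le s) le_rfl).aestronglyMeasurable
    ((hw.measurable_inc s t).pow_const 2).aestronglyMeasurable
  simp only [Function.comp_def, id] at h2
  rw [h2, hw.integral_inc_sq hst]

theorem memLp_mul_inc (hw : IsScalarBM 𝓕 w P) {s t : ℝ≥0} (hst : s ≤ t) {ξ : Ω → ℝ}
    (hξ : Measurable[𝓕 s] ξ) (hξ2 : MemLp ξ 2 P) :
    MemLp (fun ω => ξ ω * (w t ω - w s ω)) 2 P := by
  have hm : Measurable fun ω => ξ ω * (w t ω - w s ω) :=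
    (hξ.mono (𝓕.le s) le_rfl).mul (hw.measurable_inc s t)
  rw [memLp_two_iff_integrable_sq hm.aestronglyMeasurable]
  have h1 := (hw.indepFun hst hξ).comp (measurable_id.pow_const 2) (measurable_id.pow_const 2)
  have h2 := h1.integrable_mul (by exact hξ2.integrable_sq)
    (by exact (hw.memLp_inc hst 2).integrable_sq)
  refine h2.congr (Eventually.of_forall fun ω => ?_)
  simp [mul_pow]

/-- The covariance of two weighted increments is the mean product of the weights times the length of
the overlap (truncated subtraction: the overlap may be empty). -/
theorem integral_inc_mul_inc (hw : IsScalarBM 𝓕 w P) {a b a' b' : ℝ≥0} (hab : a ≤ b)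
    (hab' : a' ≤ b') {ξ ξ' : Ω → ℝ} (hξ : Measurable[𝓕 a] ξ) (hξ2 : MemLp ξ 2 P)
    (hξ' : Measurable[𝓕 a'] ξ') (hξ2' : MemLp ξ' 2 P) :
    ∫ ω, (ξ ω * (w b ω - w a ω)) * (ξ' ω * (w b' ω - w a' ω)) ∂P
      = (∫ ω, ξ ω * ξ' ω ∂P) * ((min b b' - max a a' : ℝ≥0) : ℝ) := by
  wlog h : a ≤ a' generalizing a b a' b' ξ ξ'
  · have h1 := this hab' hab hξ' hξ2' hξ hξ2 (le_of_not_ge h)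
    rw [min_comm, max_comm]
    simp_rw [mul_comm (ξ _) (ξ' _)]
    rw [← h1]
    exact integral_congr_ae (Eventually.of_forall fun ω => mul_comm _ _)
  have hξa : Measurable[𝓕 a'] ξ := hξ.mono (𝓕.mono h) le_rfl
  have hwa : ∀ {s t}, s ≤ t → Measurable[𝓕 t] (w s) :=
    fun hs => (hw.adapted _).mono (𝓕.mono hs) le_rfl
  -- the part of the first increment before `a'` does not contribute
  have hzero : ∀ c, a ≤ c → c ≤ a' →
      ∫ ω, (ξ ω * (w c ω - w a ω)) * (ξ' ω * (w b' ω - w a' ω)) ∂P = 0 := by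
    intro c hac hca
    have hm : Measurable[𝓕 a'] fun ω => ξ ω * (w c ω - w a ω) * ξ' ω :=
      (hξa.mul ((hwa hca).sub (hwa h))).mul hξ'
    rw [← hw.integral_mul_inc hab' hm]
    exact integral_congr_ae (Eventually.of_forall fun ω => by ring)
  rcases le_or_gt b a' with hb | hb
  · rw [hzero b hab hb, max_eq_right h, tsub_eq_zero_of_le ((min_le_left _ _).trans hb)]
    simp
  · rw [max_eq_right h]
    set c := min b b' with hc
    have hac : a' ≤ c := le_min hb.le hab'
    have hi1 := integrable_mul_of_memLp_two (hw.memLp_mul_inc h hξ hξ2) (hw.memLp_mul_inc hab' hξ' hξ2')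
    have hi2 := integrable_mul_of_memLp_two (hw.memLp_mul_inc hb.le hξa hξ2)
      (hw.memLp_mul_inc hab' hξ' hξ2')
    have h1 : ∫ ω, (ξ ω * (w b ω - w a ω)) * (ξ' ω * (w b' ω - w a' ω)) ∂P
        = ∫ ω, (ξ ω * (w b ω - w a' ω)) * (ξ' ω * (w b' ω - w a' ω)) ∂P := by
      rw [← zero_add (∫ ω, (ξ ω * (w b ω - w a' ω)) * (ξ' ω * (w b' ω - w a' ω)) ∂P),
        ← hzero a' h le_rfl, ← integral_add hi1 hi2]
      exact integral_congr_ae (Eventually.of_forall fun ω => by ring)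
    have hcm : c ≤ max b b' := (min_le_left _ _).trans (le_max_left _ _)
    have hi3 := integrable_mul_of_memLp_two (hw.memLp_mul_inc hac hξa hξ2)
      (hw.memLp_mul_inc hac hξ' hξ2')
    have hi4 := integrable_mul_of_memLp_two (hw.memLp_mul_inc hac hξa hξ2)
      (hw.memLp_mul_inc hcm (hξ'.mono (𝓕.mono hac) le_rfl) hξ2')
    have h2 : ∫ ω, (ξ ω * (w b ω - w a' ω)) * (ξ' ω * (w b' ω - w a' ω)) ∂P
        = ∫ ω, (ξ ω * (w c ω - w a' ω)) * (ξ' ω * (w c ω - w a' ω)) ∂P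
          + ∫ ω, (ξ ω * (w c ω - w a' ω)) * (ξ' ω * (w (max b b') ω - w c ω)) ∂P := by
      rw [← integral_add hi3 hi4]
      refine integral_congr_ae (Eventually.of_forall fun ω => ?_)
      rcases le_total b b' with hbb | hbb
      · simp only [hc, min_eq_left hbb, max_eq_right hbb]; ring
      · simp only [hc, min_eq_right hbb, max_eq_left hbb]; ring
    have h3 : ∫ ω, (ξ ω * (w c ω - w a' ω)) * (ξ' ω * (w (max b b') ω - w c ω)) ∂P = 0 := by
      have hm : Measurable[𝓕 c] fun ω => ξ ω * (w c ω - w a' ω) * ξ' ω :=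
        ((hξa.mono (𝓕.mono hac) le_rfl).mul ((hwa le_rfl).sub (hwa hac))).mul
          (hξ'.mono (𝓕.mono hac) le_rfl)
      rw [← hw.integral_mul_inc hcm hm]
      exact integral_congr_ae (Eventually.of_forall fun ω => by ring)
    rw [h1, h2, h3, add_zero, ← hw.integral_mul_inc_sq hac (ξ := fun ω => ξ ω * ξ' ω) (hξa.mul hξ')]
    exact integral_congr_ae (Eventually.of_forall fun ω => by ring)

end IsScalarBM

/-- The value at time `u` of the step process `∑ k < len, ξ k · 1_{(time k, time (k+1)]}`. -/
noncomputable def stepEval (len : ℕ) (time : ℕ → ℝ≥0) (ξ : ℕ → Ω → ℝ) (u : ℝ≥0) (ω : Ω) : ℝ :=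
  ∑ k ∈ Finset.range len, (Set.Ioc (time k) (time (k + 1))).indicator (fun _ => ξ k ω) u

/-- The elementary stochastic integral of a step process over `[0, t]`. -/
noncomputable def stepIntegral (len : ℕ) (time : ℕ → ℝ≥0) (ξ : ℕ → Ω → ℝ) (w : ℝ≥0 → Ω → ℝ)
    (t : ℝ≥0) (ω : Ω) : ℝ :=
  ∑ k ∈ Finset.range len, ξ k ω * (w (min (time (k + 1)) t) ω - w (min (time k) t) ω)

/-- Lebesgue measure on `(0, T]` times `P`. -/
noncomputable abbrev prodMeasure (P : Measure Ω) (T : ℝ≥0) : Measure (Ω × ℝ) :=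
  P.prod (volume.restrict (Set.Ioc (0 : ℝ) T))

section Step

variable {𝓕 : Filtration ℝ≥0 mΩ} {w : ℝ≥0 → Ω → ℝ} {P : Measure Ω}

theorem measurable_indicator_Ioc_toNNReal (a b : ℝ≥0) :
    Measurable fun u : ℝ => (Set.Ioc a b).indicator (fun _ => (1 : ℝ)) u.toNNReal :=
  (measurable_const.indicator measurableSet_Ioc).comp measurable_real_toNNReal

theorem stepEval_eq (len : ℕ) (time : ℕ → ℝ≥0) (ξ : ℕ → Ω → ℝ) (u : ℝ≥0) (ω : Ω) :
    stepEval len time ξ u ω = ∑ k ∈ Finset.range len, ξ k ω *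
      (Set.Ioc (time k) (time (k + 1))).indicator (fun _ => (1 : ℝ)) u := by
  refine Finset.sum_congr rfl fun k _ => ?_
  by_cases h : u ∈ Set.Ioc (time k) (time (k + 1)) <;> simp [h]

theorem measurable_stepEval (len : ℕ) (time : ℕ → ℝ≥0) {ξ : ℕ → Ω → ℝ}
    (hξ : ∀ k, Measurable (ξ k)) :
    Measurable fun z : Ω × ℝ => stepEval len time ξ z.2.toNNReal z.1 := by
  simp_rw [stepEval_eq]
  refine Finset.measurable_fun_sum _ fun k _ => ?_
  exact ((hξ k).comp measurable_fst).mul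
    ((measurable_indicator_Ioc_toNNReal _ _).comp measurable_snd)

theorem memLp_stepEval_term {ξ : Ω → ℝ} (hξ2 : MemLp ξ 2 P) (a b T : ℝ≥0) :
    MemLp (fun z : Ω × ℝ => ξ z.1 * (Set.Ioc a b).indicator (fun _ => (1 : ℝ)) z.2.toNNReal) 2
      (prodMeasure P T) := by
  have h1 : MemLp (fun u : ℝ => (Set.Ioc a b).indicator (fun _ => (1 : ℝ)) u.toNNReal) 2
      (volume.restrict (Set.Ioc (0 : ℝ) T)) := by
    refine MemLp.of_bound (measurable_indicator_Ioc_toNNReal _ _).aestronglyMeasurable 1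
      (Eventually.of_forall fun u => ?_)
    by_cases h : u.toNNReal ∈ Set.Ioc a b <;> simp [h]
  have h2 : AEStronglyMeasurable (fun z : Ω × ℝ => ξ z.1 *
      (Set.Ioc a b).indicator (fun _ => (1 : ℝ)) z.2.toNNReal) (prodMeasure P T) :=
    (hξ2.1.comp_fst).mul (h1.1.comp_snd)
  rw [memLp_two_iff_integrable_sq h2]
  refine (hξ2.integrable_sq.mul_prod h1.integrable_sq).congr (Eventually.of_forall fun z => ?_)
  simp [mul_pow]

theorem memLp_stepEval (len : ℕ) (time : ℕ → ℝ≥0) {ξ : ℕ → Ω → ℝ}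
    (hξ2 : ∀ k, MemLp (ξ k) 2 P) (T : ℝ≥0) :
    MemLp (fun z : Ω × ℝ => stepEval len time ξ z.2.toNNReal z.1) 2 (prodMeasure P T) := by
  simp_rw [stepEval_eq]
  exact memLp_finsetSum _ fun k _ => memLp_stepEval_term (hξ2 k) _ _ _

theorem memLp_stepIntegral_term (hw : IsScalarBM 𝓕 w P) {a b : ℝ≥0} (hab : a ≤ b) {ξ : Ω → ℝ}
    (hξ : Measurable[𝓕 a] ξ) (hξ2 : MemLp ξ 2 P) (t : ℝ≥0) :
    MemLp (fun ω => ξ ω * (w (min b t) ω - w (min a t) ω)) 2 P := by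
  rcases le_or_gt a t with h | h
  · rw [min_eq_left h]
    exact hw.memLp_mul_inc (le_min hab h) hξ hξ2
  · rw [min_eq_right h.le, min_eq_right (h.le.trans hab)]
    simp

theorem memLp_stepIntegral (hw : IsScalarBM 𝓕 w P) (len : ℕ) {time : ℕ → ℝ≥0}
    (htime : Monotone time) {ξ : ℕ → Ω → ℝ} (hξ : ∀ k, Measurable[𝓕 (time k)] (ξ k))
    (hξ2 : ∀ k, MemLp (ξ k) 2 P) (t : ℝ≥0) :
    MemLp (stepIntegral len time ξ w t) 2 P := by
  have : stepIntegral len time ξ w t = fun ω => ∑ k ∈ Finset.range len,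
    ξ k ω * (w (min (time (k + 1)) t) ω - w (min (time k) t) ω) := rfl
  rw [this]
  exact memLp_finsetSum _ fun k _ =>
    memLp_stepIntegral_term hw (htime (Nat.le_succ k)) (hξ k) (hξ2 k) t

theorem integral_overlap (a b a' b' t : ℝ≥0) :
    ∫ u in Set.Ioc (0 : ℝ) t, (Set.Ioc a b).indicator (fun _ => (1 : ℝ)) u.toNNReal *
      (Set.Ioc a' b').indicator (fun _ => (1 : ℝ)) u.toNNReal
      = ((min (min b t) (min b' t) - max (min a t) (min a' t) : ℝ≥0) : ℝ) := by
  have h1 : ∀ u ∈ Set.Ioc (0 : ℝ) t, (Set.Ioc a b).indicator (fun _ => (1 : ℝ)) u.toNNReal *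
      (Set.Ioc a' b').indicator (fun _ => (1 : ℝ)) u.toNNReal =
      (Set.Ioc (max (min a t) (min a' t) : ℝ) (min (min b t) (min b' t))).indicator
        (fun _ => (1 : ℝ)) u := by
    intro u hu
    have e1 : ∀ c : ℝ≥0, c < u.toNNReal ↔ (c : ℝ) < u := fun c => Real.lt_toNNReal_iff_coe_lt
    have e2 : ∀ c : ℝ≥0, u.toNNReal ≤ c ↔ u ≤ c := fun c => Real.toNNReal_le_iff_le_coe
    have hiff : (u ∈ Set.Ioc (max (min a t) (min a' t) : ℝ) (min (min b t) (min b' t))) ↔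
        (u.toNNReal ∈ Set.Ioc a b ∧ u.toNNReal ∈ Set.Ioc a' b') := by
      simp only [Set.mem_Ioc, e1, e2, max_lt_iff, le_min_iff, min_lt_iff]
      have := hu.2
      have := not_lt.2 hu.2
      tauto
    by_cases h : u.toNNReal ∈ Set.Ioc a b <;> by_cases h' : u.toNNReal ∈ Set.Ioc a' b' <;>
      simp [Set.indicator, hiff, h, h']
  rw [setIntegral_congr_fun measurableSet_Ioc h1, setIntegral_indicator measurableSet_Ioc,
    setIntegral_const, smul_eq_mul, mul_one, Set.Ioc_inter_Ioc]
  simp only [measureReal_def, Real.volume_Ioc]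
  rw [ENNReal.toReal_ofReal', NNReal.coe_sub_def]
  simp only [NNReal.coe_min, NNReal.coe_max]
  congr 2
  · exact min_eq_right ((min_le_left _ _).trans (min_le_right _ _))
  · exact max_eq_right (le_max_of_le_left (le_min a.2 t.2))

/-- The Itô isometry, in bilinear form, for two step processes on unrelated grids. -/
theorem integral_stepIntegral_mul [IsProbabilityMeasure P] (hw : IsScalarBM 𝓕 w P) {len len' : ℕ} {time time' : ℕ → ℝ≥0}
    (htime : Monotone time) (htime' : Monotone time') {ξ ξ' : ℕ → Ω → ℝ}
    (hξ : ∀ k, Measurable[𝓕 (time k)] (ξ k)) (hξ2 : ∀ k, MemLp (ξ k) 2 P)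
    (hξ' : ∀ k, Measurable[𝓕 (time' k)] (ξ' k)) (hξ2' : ∀ k, MemLp (ξ' k) 2 P) (t : ℝ≥0) :
    ∫ ω, stepIntegral len time ξ w t ω * stepIntegral len' time' ξ' w t ω ∂P
      = ∫ z, stepEval len time ξ z.2.toNNReal z.1 * stepEval len' time' ξ' z.2.toNNReal z.1
          ∂(prodMeasure P t) := by
  have hterm : ∀ k l, ∫ ω, (ξ k ω * (w (min (time (k + 1)) t) ω - w (min (time k) t) ω)) *
      (ξ' l ω * (w (min (time' (l + 1)) t) ω - w (min (time' l) t) ω)) ∂P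
      = ∫ z, (ξ k z.1 * (Set.Ioc (time k) (time (k + 1))).indicator (fun _ => (1 : ℝ))
          z.2.toNNReal) * (ξ' l z.1 * (Set.Ioc (time' l) (time' (l + 1))).indicator
          (fun _ => (1 : ℝ)) z.2.toNNReal) ∂(prodMeasure P t) := by
    intro k l
    have h1 : ∀ z : Ω × ℝ, (ξ k z.1 * (Set.Ioc (time k) (time (k + 1))).indicator (fun _ => (1 : ℝ))
          z.2.toNNReal) * (ξ' l z.1 * (Set.Ioc (time' l) (time' (l + 1))).indicator
          (fun _ => (1 : ℝ)) z.2.toNNReal) = (ξ k z.1 * ξ' l z.1) *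
          ((Set.Ioc (time k) (time (k + 1))).indicator (fun _ => (1 : ℝ)) z.2.toNNReal *
          (Set.Ioc (time' l) (time' (l + 1))).indicator (fun _ => (1 : ℝ)) z.2.toNNReal) :=
      fun z => by ring
    simp_rw [h1]
    rw [integral_prod_mul (fun ω => ξ k ω * ξ' l ω) (fun u : ℝ =>
      (Set.Ioc (time k) (time (k + 1))).indicator (fun _ => (1 : ℝ)) u.toNNReal *
          (Set.Ioc (time' l) (time' (l + 1))).indicator (fun _ => (1 : ℝ)) u.toNNReal),
      integral_overlap]
    have hk := htime (Nat.le_succ k)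
    have hl := htime' (Nat.le_succ l)
    simp only [Nat.succ_eq_add_one] at hk hl
    rcases lt_or_ge t (time k) with h | h
    · rw [min_eq_right h.le, min_eq_right (h.le.trans hk)]
      have : (min t (min (time' (l + 1)) t) - max t (min (time' l) t) : ℝ≥0) = 0 :=
        tsub_eq_zero_of_le ((min_le_left _ _).trans (le_max_left _ _))
      rw [this]; simp
    rcases lt_or_ge t (time' l) with h' | h'
    · rw [min_eq_right h'.le, min_eq_right (h'.le.trans hl)]
      have : (min (min (time (k + 1)) t) t - max (min (time k) t) t : ℝ≥0) = 0 :=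
        tsub_eq_zero_of_le ((min_le_right _ _).trans (le_max_right _ _))
      rw [this]; simp
    rw [min_eq_left h, min_eq_left h']
    exact hw.integral_inc_mul_inc (le_min hk h) (le_min hl h') (hξ k) (hξ2 k) (hξ' l) (hξ2' l)
  simp_rw [stepEval_eq, stepIntegral, Finset.sum_mul_sum]
  have hA : ∀ k, MemLp (fun ω => ξ k ω * (w (min (time (k + 1)) t) ω - w (min (time k) t) ω)) 2 P :=
    fun k => memLp_stepIntegral_term hw (htime (Nat.le_succ k)) (hξ k) (hξ2 k) t
  have hA' : ∀ k, MemLp (fun ω => ξ' k ω * (w (min (time' (k + 1)) t) ω - w (min (time' k) t) ω))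
      2 P := fun k => memLp_stepIntegral_term hw (htime' (Nat.le_succ k)) (hξ' k) (hξ2' k) t
  have hB := fun k => memLp_stepEval_term (hξ2 k) (time k) (time (k + 1)) t
  have hB' := fun k => memLp_stepEval_term (hξ2' k) (time' k) (time' (k + 1)) t
  rw [integral_finsetSum _ fun k _ => integrable_finsetSum _ fun l _ =>
      integrable_mul_of_memLp_two (hA k) (hA' l),
    integral_finsetSum _ fun k _ => integrable_finsetSum _ fun l _ =>
      integrable_mul_of_memLp_two (hB k) (hB' l)]
  refine Finset.sum_congr rfl fun k _ => ?_
  rw [integral_finsetSum _ fun l _ => integrable_mul_of_memLp_two (hA k) (hA' l),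
    integral_finsetSum _ fun l _ => integrable_mul_of_memLp_two (hB k) (hB' l)]
  exact Finset.sum_congr rfl fun l _ => hterm k l

/-- Elementary integrals are martingales: the increment over `[u, t]` is orthogonal to the
information at time `u`. -/
theorem integral_mul_stepIntegral (hw : IsScalarBM 𝓕 w P) {len : ℕ} {time : ℕ → ℝ≥0}
    (htime : Monotone time) {ξ : ℕ → Ω → ℝ}
    (hξ : ∀ k, Measurable[𝓕 (time k)] (ξ k)) (hξ2 : ∀ k, MemLp (ξ k) 2 P) {u t : ℝ≥0}
    (hut : u ≤ t) {η : Ω → ℝ} (hη : Measurable[𝓕 u] η) (hη2 : MemLp η 2 P) :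
    ∫ ω, η ω * stepIntegral len time ξ w t ω ∂P = ∫ ω, η ω * stepIntegral len time ξ w u ω ∂P := by
  simp_rw [stepIntegral, Finset.mul_sum]
  have hA : ∀ t k, Integrable
      (fun ω => η ω * (ξ k ω * (w (min (time (k + 1)) t) ω - w (min (time k) t) ω))) P :=
    fun t k => integrable_mul_of_memLp_two hη2
      (memLp_stepIntegral_term hw (htime (Nat.le_succ k)) (hξ k) (hξ2 k) t)
  rw [integral_finsetSum _ fun k _ => hA t k, integral_finsetSum _ fun k _ => hA u k]
  refine Finset.sum_congr rfl fun k _ => ?_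
  rw [← sub_eq_zero, ← integral_sub (hA t k) (hA u k)]
  have hk := htime (Nat.le_succ k)
  simp only [Nat.succ_eq_add_one] at hk
  rcases le_or_gt t (time k) with h | h
  · simp [min_eq_right h, min_eq_right (h.trans hk), min_eq_right (hut.trans h),
      min_eq_right ((hut.trans h).trans hk)]
  · have hle : max (time k) u ≤ min (max (time (k + 1)) u) t :=
      le_min (max_le_max_right u hk) (max_le h.le hut)
    have hm : Measurable[𝓕 (max (time k) u)] fun ω => η ω * ξ k ω :=
      (hη.mono (𝓕.mono (le_max_right _ _)) le_rfl).mul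
        ((hξ k).mono (𝓕.mono (le_max_left _ _)) le_rfl)
    rw [← hw.integral_mul_inc hle hm]
    refine integral_congr_ae (Eventually.of_forall fun ω => ?_)
    simp only
    rcases le_total u (time k) with h1 | h1
    · rw [max_eq_left h1, max_eq_left (h1.trans hk), min_eq_left h.le, min_eq_right h1,
        min_eq_right (h1.trans hk)]
      ring
    · rw [max_eq_right h1, min_eq_left h.le, min_eq_left h1]
      rcases le_total u (time (k + 1)) with h2 | h2
      · rw [max_eq_left h2, min_eq_right h2]; ring
      · rw [max_eq_right h2, min_eq_left h2, min_eq_left (h2.trans hut), min_eq_left hut]; ring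

end Step

/-! ### Properties of Itô integrals -/

section ItoIntegral

variable {𝓕 : Filtration ℝ≥0 mΩ} {w : ℝ≥0 → Ω → ℝ} {P : Measure Ω}

theorem lintegral_prodMeasure {f : Ω × ℝ → ℝ} (hf : Measurable f) (T : ℝ≥0) :
    ∫⁻ z, ‖f z‖ₑ ^ 2 ∂(prodMeasure P T)
      = ∫⁻ ω, (∫⁻ u in Set.Ioc (0 : ℝ) T, ‖f (ω, u)‖ₑ ^ 2) ∂P :=
  lintegral_prod _ (by fun_prop)

theorem IsItoIntegral.measurable_integrand {H M : ℝ≥0 → Ω → ℝ} (h : IsItoIntegral 𝓕 P w H M) :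
    Measurable fun z : Ω × ℝ => H z.2.toNNReal z.1 :=
  h.1.comp ((measurable_real_toNNReal.comp measurable_snd).prodMk measurable_fst)

theorem SimpleIntegrand.memLp_ξ [IsProbabilityMeasure P] (S : SimpleIntegrand 𝓕) (k : ℕ) : MemLp (S.ξ k) 2 P := by
  obtain ⟨C, hC⟩ := S.bounded_ξ
  exact MemLp.of_bound ((S.measurable_ξ k).mono (𝓕.le _) le_rfl).aestronglyMeasurable C
    (Eventually.of_forall fun ω => by simpa using hC k ω)

theorem memLp_two_of_lintegral_sub {α : Type*} {mα : MeasurableSpace α} {μ : Measure α}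
    {f : ℕ → α → ℝ} {g : α → ℝ} (hf : ∀ n, MemLp (f n) 2 μ) (hg : AEStronglyMeasurable g μ)
    (h : Tendsto (fun n => ∫⁻ x, ‖f n x - g x‖ₑ ^ 2 ∂μ) atTop (𝓝 0)) : MemLp g 2 μ := by
  obtain ⟨n, hn⟩ := ((tendsto_order.1 h).2 1 one_pos).exists
  have h1 : MemLp (fun x => f n x - g x) 2 μ := by
    refine ⟨(hf n).1.sub hg, ?_⟩
    rw [eLpNorm_lt_top_iff_lintegral_rpow_enorm_lt_top (by norm_num) (by norm_num)]
    refine lt_of_le_of_lt (le_of_eq ?_) (hn.trans ENNReal.one_lt_top)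
    simp
  have h2 := (hf n).sub h1
  refine h2.ae_eq (Eventually.of_forall fun x => by simp)

namespace IsItoIntegral

variable {H M H' M' : ℝ≥0 → Ω → ℝ}

/-- The data of an Itô integral in terms of step processes on the product space. -/
theorem exists_approx (h : IsItoIntegral 𝓕 P w H M) :
    ∃ S : ℕ → SimpleIntegrand 𝓕,
      (∀ T : ℝ≥0, Tendsto (fun n => ∫⁻ z, ‖stepEval (S n).len (S n).time (S n).ξ z.2.toNNReal z.1
        - H z.2.toNNReal z.1‖ₑ ^ 2 ∂(prodMeasure P T)) atTop (𝓝 0)) ∧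
      ∀ t, Tendsto (fun n => ∫⁻ ω, ‖stepIntegral (S n).len (S n).time (S n).ξ w t ω
        - M t ω‖ₑ ^ 2 ∂P) atTop (𝓝 0) := by
  obtain ⟨S, h1, h2⟩ := h.2.2
  refine ⟨S, fun T => ?_, h2⟩
  refine (h1 T).congr fun n => ?_
  have hm : Measurable fun z : Ω × ℝ => stepEval (S n).len (S n).time (S n).ξ z.2.toNNReal z.1
      - H z.2.toNNReal z.1 := (measurable_stepEval _ _ fun k =>
    ((S n).measurable_ξ k).mono (𝓕.le _) le_rfl).sub h.measurable_integrand
  rw [lintegral_prodMeasure hm]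
  rfl

theorem ae_eq_zero (h : IsItoIntegral 𝓕 P w H M) : ∀ᵐ ω ∂P, M 0 ω = 0 := by
  obtain ⟨S, -, h2⟩ := h.exists_approx
  have h3 := h2 0
  have h4 : ∀ n ω, stepIntegral (S n).len (S n).time (S n).ξ w 0 ω = 0 := fun n ω => by
    simp [stepIntegral]
  simp only [h4, zero_sub, enorm_neg] at h3
  have h5 : ∫⁻ ω, ‖M 0 ω‖ₑ ^ 2 ∂P = 0 := tendsto_nhds_unique tendsto_const_nhds h3
  rw [lintegral_eq_zero_iff' ((h.2.1 0).enorm.pow_const 2)] at h5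
  filter_upwards [h5] with ω hω
  simpa using hω

variable [IsProbabilityMeasure P]

theorem memLp_integrand (h : IsItoIntegral 𝓕 P w H M) (T : ℝ≥0) :
    MemLp (fun z : Ω × ℝ => H z.2.toNNReal z.1) 2 (prodMeasure P T) := by
  obtain ⟨S, h1, -⟩ := h.exists_approx
  exact memLp_two_of_lintegral_sub (fun n => memLp_stepEval _ _ (S n).memLp_ξ T)
    h.measurable_integrand.aestronglyMeasurable (h1 T)

theorem memLp (hw : IsScalarBM 𝓕 w P) (h : IsItoIntegral 𝓕 P w H M) (t : ℝ≥0) :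
    MemLp (M t) 2 P := by
  obtain ⟨S, -, h2⟩ := h.exists_approx
  exact memLp_two_of_lintegral_sub (fun n => memLp_stepIntegral hw _ (S n).time_mono
    (S n).measurable_ξ (S n).memLp_ξ t) (h.2.1 t).aestronglyMeasurable (h2 t)

/-- The Itô isometry in bilinear form. -/
theorem integral_mul (hw : IsScalarBM 𝓕 w P) (h : IsItoIntegral 𝓕 P w H M)
    (h' : IsItoIntegral 𝓕 P w H' M') (t : ℝ≥0) :
    ∫ ω, M t ω * M' t ω ∂P
      = ∫ z, H z.2.toNNReal z.1 * H' z.2.toNNReal z.1 ∂(prodMeasure P t) := by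
  obtain ⟨S, h1, h2⟩ := h.exists_approx
  obtain ⟨S', h1', h2'⟩ := h'.exists_approx
  have hl := tendsto_integral_mul_of_L2 (fun n => memLp_stepIntegral hw _ (S n).time_mono
    (S n).measurable_ξ (S n).memLp_ξ t) (fun n => memLp_stepIntegral hw _ (S' n).time_mono
    (S' n).measurable_ξ (S' n).memLp_ξ t) (h.memLp hw t) (h'.memLp hw t) (h2 t) (h2' t)
  have hr := tendsto_integral_mul_of_L2 (fun n => memLp_stepEval _ _ (S n).memLp_ξ t)
    (fun n => memLp_stepEval _ _ (S' n).memLp_ξ t) (h.memLp_integrand t) (h'.memLp_integrand t)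
    (h1 t) (h1' t)
  refine tendsto_nhds_unique hl (hr.congr fun n => ?_)
  exact (integral_stepIntegral_mul hw (S n).time_mono (S' n).time_mono (S n).measurable_ξ
    (S n).memLp_ξ (S' n).measurable_ξ (S' n).memLp_ξ t).symm

theorem integral_mul_eq (hw : IsScalarBM 𝓕 w P) (h : IsItoIntegral 𝓕 P w H M) {u t : ℝ≥0}
    (hut : u ≤ t) {η : Ω → ℝ} (hη : Measurable[𝓕 u] η) (hη2 : MemLp η 2 P) :
    ∫ ω, η ω * M t ω ∂P = ∫ ω, η ω * M u ω ∂P := by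
  obtain ⟨S, -, h2⟩ := h.exists_approx
  have hl : ∀ t, Tendsto (fun n => ∫ ω, η ω * stepIntegral (S n).len (S n).time (S n).ξ w t ω ∂P)
      atTop (𝓝 (∫ ω, η ω * M t ω ∂P)) := fun t =>
    tendsto_integral_mul_of_L2 (fun _ => hη2) (fun n => memLp_stepIntegral hw _ (S n).time_mono
      (S n).measurable_ξ (S n).memLp_ξ t) hη2 (h.memLp hw t) (by simp) (h2 t)
  refine tendsto_nhds_unique (hl t) ((hl u).congr fun n => ?_)
  exact (integral_mul_stepIntegral hw (S n).time_mono (S n).measurable_ξ (S n).memLp_ξ hut hη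
    hη2).symm

/-- Itô integrals are unique up to versions. -/
theorem ae_eq (hw : IsScalarBM 𝓕 w P) (h : IsItoIntegral 𝓕 P w H M)
    (h' : IsItoIntegral 𝓕 P w H M') (t : ℝ≥0) : M t =ᵐ[P] M' t := by
  have hm := h.memLp hw t
  have hm' := h'.memLp hw t
  have h1 : ∫ ω, (M t ω - M' t ω) ^ 2 ∂P = 0 := by
    have e1 := h.integral_mul hw h t
    have e2 := h.integral_mul hw h' t
    have e3 := h'.integral_mul hw h' t
    have h2 : ∀ ω, (M t ω - M' t ω) ^ 2 = M t ω * M t ω - (2 * (M t ω * M' t ω)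
        - M' t ω * M' t ω) := fun ω => by ring
    simp_rw [h2]
    have i1 := integrable_mul_of_memLp_two hm hm
    have i2 := (integrable_mul_of_memLp_two hm hm').const_mul 2
    have i3 := integrable_mul_of_memLp_two hm' hm'
    have i4 : Integrable (fun ω => 2 * (M t ω * M' t ω) - M' t ω * M' t ω) P := i2.sub i3
    rw [integral_sub i1 i4, integral_sub i2 i3,
      integral_const_mul, e1, e2, e3]
    ring
  have h3 := (integral_eq_zero_iff_of_nonneg (fun ω => sq_nonneg _) (hm.sub hm').integrable_sq).1 h1
  filter_upwards [h3] with ω hω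
  have : (M t ω - M' t ω) ^ 2 = 0 := hω
  exact sub_eq_zero.1 (pow_eq_zero_iff two_ne_zero |>.1 this)

end IsItoIntegral

/-- The Itô integral of a constant. -/
theorem isItoIntegral_const (hw : IsScalarBM 𝓕 w P) (c : ℝ) :
    IsItoIntegral 𝓕 P w (fun _ _ => c) (fun t ω => c * (w t ω - w 0 ω)) := by
  refine ⟨measurable_const, fun t => ((hw.measurable_inc 0 t).const_mul c).aemeasurable, ?_⟩
  let S : ℕ → SimpleIntegrand 𝓕 := fun n =>
    { len := 1
      time := fun k => if k = 0 then 0 else n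
      time_mono := by
        intro a b hab
        by_cases ha : a = 0
        · simp [ha]
        · have : b ≠ 0 := by omega
          simp [ha, this]
      ξ := fun _ _ => c
      measurable_ξ := fun k => measurable_const
      bounded_ξ := ⟨|c|, fun _ _ => le_rfl⟩ }
  refine ⟨S, fun T => ?_, fun t => ?_⟩
  · refine tendsto_const_nhds.congr' ?_
    obtain ⟨N, hN⟩ := exists_nat_ge T
    filter_upwards [eventually_ge_atTop N] with n hn
    symm
    rw [lintegral_eq_zero_iff' (by
      refine Measurable.aemeasurable ?_
      have : ∀ ω, (∫⁻ u in Set.Ioc (0 : ℝ) T, ‖(S n).eval u.toNNReal ω - c‖ₑ ^ 2)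
        = ∫⁻ u in Set.Ioc (0 : ℝ) T, ‖(Set.Ioc (0 : ℝ≥0) n).indicator (fun _ => c) u.toNNReal
          - c‖ₑ ^ 2 := by
        intro ω; simp [SimpleIntegrand.eval, S]
      simp_rw [this]
      exact measurable_const)]
    refine Eventually.of_forall fun ω => ?_
    simp only [Pi.zero_apply]
    rw [← lintegral_zero (μ := volume.restrict (Set.Ioc (0 : ℝ) T))]
    refine setLIntegral_congr_fun measurableSet_Ioc fun u hu => ?_
    have hmem : u.toNNReal ∈ Set.Ioc (0 : ℝ≥0) n := by
      constructor
      · simpa using hu.1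
      · have h1 : u.toNNReal ≤ T := Real.toNNReal_le_iff_le_coe.2 hu.2
        exact h1.trans (hN.trans (by exact_mod_cast hn))
    simp [SimpleIntegrand.eval, S, hmem.1, hmem.2, Set.indicator]
  · refine tendsto_const_nhds.congr' ?_
    obtain ⟨N, hN⟩ := exists_nat_ge t
    filter_upwards [eventually_ge_atTop N] with n hn
    have h1 : min (n : ℝ≥0) t = t := min_eq_right (hN.trans (by exact_mod_cast hn))
    simp [SimpleIntegrand.integral, S, h1]

end ItoIntegral

end Ito

/-! ### Second moments of Itô processes -/

/-- Integration by parts for two primitives. -/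
theorem primitive_mul_primitive {f g : ℝ → ℝ} (a b : ℝ) {t : ℝ} (hf : IntervalIntegrable f volume 0 t)
    (hg : IntervalIntegrable g volume 0 t) :
    (a + ∫ u in (0 : ℝ)..t, f u) * (b + ∫ u in (0 : ℝ)..t, g u)
      = a * b + ∫ u in (0 : ℝ)..t, (f u * (b + ∫ v in (0 : ℝ)..u, g v)
        + (a + ∫ v in (0 : ℝ)..u, f v) * g u) := by
  have hac : ∀ {f : ℝ → ℝ} (a : ℝ), IntervalIntegrable f volume 0 t →
      AbsolutelyContinuousOnInterval (fun x => a + ∫ u in (0 : ℝ)..x, f u) 0 t := fun {f} a hf => by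
    have h1 : AbsolutelyContinuousOnInterval (fun _ : ℝ => a) 0 t :=
      (LipschitzWith.const a).lipschitzOnWith.absolutelyContinuousOnInterval
    exact h1.add (hf.absolutelyContinuousOnInterval_intervalIntegral Set.left_mem_uIcc)
  have h := (hac a hf).integral_deriv_mul_eq_sub (hac b hg)
  simp only [intervalIntegral.integral_same, add_zero] at h
  rw [← sub_eq_iff_eq_add', ← h]
  refine intervalIntegral.integral_congr_ae ?_
  filter_upwards [hf.ae_hasDerivAt_integral, hg.ae_hasDerivAt_integral] with x h1 h2 hx
  have hx' := Set.uIoc_subset_uIcc hx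
  rw [((h1 hx' 0 Set.left_mem_uIcc).const_add a).deriv,
    ((h2 hx' 0 Set.left_mem_uIcc).const_add b).deriv]

theorem sq_integral_le {μ : Measure ℝ} [IsFiniteMeasure μ] {g : ℝ → ℝ} (hg : MemLp g 2 μ) :
    (∫ u, |g u| ∂μ) ^ 2 ≤ μ.real Set.univ * ∫ u, g u ^ 2 ∂μ := by
  have h1 : Integrable (fun u => |g u|) μ := (hg.integrable (by norm_num)).abs
  have h2 : Integrable (fun u => g u ^ 2) μ := hg.integrable_sq
  rcases eq_or_ne μ 0 with rfl | hμ
  · simp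
  have hpos : 0 < μ.real Set.univ := by
    rw [measureReal_def, ENNReal.toReal_pos_iff]
    exact ⟨pos_iff_ne_zero.2 (by simpa using hμ), measure_lt_top _ _⟩
  set m := μ.real Set.univ
  set I := ∫ u, |g u| ∂μ
  have h3 : 0 ≤ ∫ u, (|g u| - I / m) ^ 2 ∂μ := integral_nonneg fun u => sq_nonneg _
  have h4 : ∫ u, (|g u| - I / m) ^ 2 ∂μ = ∫ u, g u ^ 2 ∂μ - 2 * (I / m) * I + (I / m) ^ 2 * m := by
    have e : ∀ u, (|g u| - I / m) ^ 2 = (g u ^ 2 - 2 * (I / m) * |g u|) + (I / m) ^ 2 := fun u => by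
      rw [sub_sq, sq_abs]; ring
    simp_rw [e]
    have h5 : Integrable (fun u => g u ^ 2 - 2 * (I / m) * |g u|) μ := h2.sub (h1.const_mul _)
    rw [integral_add h5 (integrable_const _), integral_sub h2 (h1.const_mul _), integral_const_mul,
      integral_const, smul_eq_mul]
    ring
  rw [h4] at h3
  have h5 : ∫ u, g u ^ 2 ∂μ - 2 * (I / m) * I + (I / m) ^ 2 * m = ∫ u, g u ^ 2 ∂μ - I ^ 2 / m := by
    field_simp; ring
  rw [h5] at h3
  have h6 : I ^ 2 / m ≤ ∫ u, g u ^ 2 ∂μ := by linarith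
  rwa [div_le_iff₀' hpos] at h6

section Moments

variable {Ω : Type*} {mΩ : MeasurableSpace Ω} {P : Measure Ω} {𝓕 : Filtration ℝ≥0 mΩ}

theorem measurable_primitive {g : Ω × ℝ → ℝ} (hg : Measurable g) :
    Measurable fun z : Ω × ℝ => ∫ v in (0 : ℝ)..z.2, g (z.1, v) := by
  have key : ∀ l r : Ω × ℝ → ℝ, Measurable l → Measurable r →
      Measurable fun z : Ω × ℝ => ∫ v in Set.Ioc (l z) (r z), g (z.1, v) := by
    intro l r hl hr
    have hS : MeasurableSet {p : (Ω × ℝ) × ℝ | p.2 ∈ Set.Ioc (l p.1) (r p.1)} :=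
      (measurableSet_lt (hl.comp measurable_fst) measurable_snd).inter
        (measurableSet_le measurable_snd (hr.comp measurable_fst))
    have hm : Measurable ({p : (Ω × ℝ) × ℝ | p.2 ∈ Set.Ioc (l p.1) (r p.1)}.indicator
        fun p => g (p.1.1, p.2)) := Measurable.indicator (by fun_prop) hS
    have h1 := (hm.stronglyMeasurable.integral_prod_right' (ν := volume)).measurable
    convert h1 using 2 with z
    rw [← integral_indicator measurableSet_Ioc]
    rfl
  simp only [intervalIntegral]
  exact (key (fun _ => 0) (fun z => z.2) measurable_const measurable_snd).sub
    (key (fun z => z.2) (fun _ => 0) measurable_snd measurable_const)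

theorem ae_prodMeasure_mem [SFinite P] (T : ℝ≥0) :
    ∀ᵐ z ∂(prodMeasure P T), z.2 ∈ Set.Ioc (0 : ℝ) T :=
  Measure.quasiMeasurePreserving_snd.ae (ae_restrict_mem measurableSet_Ioc)

theorem memLp_slice_left [SFinite P] {g : Ω × ℝ → ℝ} (hm : Measurable g) {T : ℝ≥0}
    (hg : MemLp g 2 (prodMeasure P T)) :
    ∀ᵐ ω ∂P, MemLp (fun u => g (ω, u)) 2 (volume.restrict (Set.Ioc (0 : ℝ) T)) := by
  filter_upwards [hg.integrable_sq.prod_right_ae] with ω hω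
  exact (memLp_two_iff_integrable_sq (by
    exact (hm.comp measurable_prodMk_left).aestronglyMeasurable)).2 hω

theorem memLp_slice_right [SFinite P] {g : Ω × ℝ → ℝ} (hm : Measurable g) {T : ℝ≥0}
    (hg : MemLp g 2 (prodMeasure P T)) :
    ∀ᵐ u ∂(volume.restrict (Set.Ioc (0 : ℝ) T)), MemLp (fun ω => g (ω, u)) 2 P := by
  filter_upwards [hg.integrable_sq.prod_left_ae] with u hu
  exact (memLp_two_iff_integrable_sq (by
    exact (hm.comp measurable_prodMk_right).aestronglyMeasurable)).2 hu

theorem sq_primitive_le {g : ℝ → ℝ} {T : ℝ≥0}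
    (hg : MemLp g 2 (volume.restrict (Set.Ioc (0 : ℝ) T))) {u : ℝ} (hu0 : 0 ≤ u) (hu : u ≤ T) :
    (∫ v in (0 : ℝ)..u, g v) ^ 2 ≤ T * ∫ v in Set.Ioc (0 : ℝ) T, g v ^ 2 := by
  have h1 := sq_integral_le hg
  have h2 : (volume.restrict (Set.Ioc (0 : ℝ) T)).real Set.univ = T := by
    simp [measureReal_def]
  rw [h2] at h1
  refine le_trans ?_ h1
  rw [← sq_abs]
  gcongr
  rw [intervalIntegral.integral_of_le hu0]
  refine (abs_integral_le_integral_abs).trans ?_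
  refine setIntegral_mono_set (hg.integrable (by norm_num)).abs
    (Eventually.of_forall fun _ => abs_nonneg _)
    (LE.le.eventuallyLE (Set.Ioc_subset_Ioc_right hu))

theorem memLp_primitive [SFinite P] {g : Ω × ℝ → ℝ} (hm : Measurable g) {T : ℝ≥0}
    (hg : MemLp g 2 (prodMeasure P T)) :
    MemLp (fun z : Ω × ℝ => ∫ v in (0 : ℝ)..z.2, g (z.1, v)) 2 (prodMeasure P T) := by
  refine (memLp_two_iff_integrable_sq (measurable_primitive hm).aestronglyMeasurable).2 ?_
  have h1 : Integrable (fun z : Ω × ℝ => (T : ℝ) * ∫ v in Set.Ioc (0 : ℝ) T, g (z.1, v) ^ 2)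
      (prodMeasure P T) :=
    ((hg.integrable_sq.integral_prod_left).const_mul (T : ℝ)).comp_fst _
  refine h1.mono' ((measurable_primitive hm).pow_const 2).aestronglyMeasurable ?_
  filter_upwards [ae_prodMeasure_mem T, Measure.quasiMeasurePreserving_fst.ae (memLp_slice_left hm hg)]
    with z hz hz2
  rw [Real.norm_of_nonneg (sq_nonneg _)]
  exact sq_primitive_le hz2 hz.1.le hz.2

theorem memLp_primitive_right [SFinite P] {g : Ω × ℝ → ℝ} (hm : Measurable g) {T : ℝ≥0}
    (hg : MemLp g 2 (prodMeasure P T)) :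
    MemLp (fun ω => ∫ v in (0 : ℝ)..T, g (ω, v)) 2 P := by
  have hm' : Measurable fun ω => ∫ v in (0 : ℝ)..T, g (ω, v) :=
    (measurable_primitive hm).comp (measurable_prodMk_right (y := (T : ℝ)))
  refine (memLp_two_iff_integrable_sq hm'.aestronglyMeasurable).2 ?_
  refine ((hg.integrable_sq.integral_prod_left).const_mul (T : ℝ)).mono'
    (hm'.pow_const 2).aestronglyMeasurable ?_
  filter_upwards [memLp_slice_left hm hg] with ω hω
  rw [Real.norm_of_nonneg (sq_nonneg _)]
  exact sq_primitive_le hω T.2 le_rfl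

/-- `x t = x₀ + ∫₀ᵗ b + M t` with a square-integrable drift `b` and a square-integrable martingale
`M`. The martingale property is recorded in its weak form, as orthogonality of increments to the
past; all identities hold almost surely at each fixed time. -/
structure IsItoProcess (𝓕 : Filtration ℝ≥0 mΩ) (P : Measure Ω) (x b M : ℝ≥0 → Ω → ℝ) (x₀ : ℝ) :
    Prop where
  measurable_drift : Measurable fun z : Ω × ℝ => b z.2.toNNReal z.1
  adapted_drift : ∀ t, Measurable[𝓕 t] (b t)
  memLp : ∀ T, MemLp (fun z : Ω × ℝ => x z.2.toNNReal z.1) 2 (prodMeasure P T)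
  memLp_drift : ∀ T, MemLp (fun z : Ω × ℝ => b z.2.toNNReal z.1) 2 (prodMeasure P T)
  memLp_mart : ∀ t, MemLp (M t) 2 P
  mart : ∀ u t, u ≤ t → ∀ η : Ω → ℝ, Measurable[𝓕 u] η → MemLp η 2 P →
    ∫ ω, η ω * M t ω ∂P = ∫ ω, η ω * M u ω ∂P
  mart_zero : ∀ᵐ ω ∂P, M 0 ω = 0
  eq : ∀ t : ℝ≥0, ∀ᵐ ω ∂P, x t ω = x₀ + (∫ u in (0 : ℝ)..t, b u.toNNReal ω) + M t ω

namespace IsItoProcess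

variable [IsProbabilityMeasure P] {x b M x' b' M' : ℝ≥0 → Ω → ℝ} {x₀ x₀' : ℝ}

theorem integral_mart (h : IsItoProcess 𝓕 P x b M x₀) (t : ℝ≥0) : ∫ ω, M t ω ∂P = 0 := by
  have h1 := h.mart 0 t zero_le (fun _ => 1) measurable_const (memLp_const 1)
  simp only [one_mul] at h1
  rw [h1]
  exact integral_eq_zero_of_ae h.mart_zero

theorem memLp_at (h : IsItoProcess 𝓕 P x b M x₀) (t : ℝ≥0) : MemLp (x t) 2 P := by
  have h1 := ((memLp_const x₀).add (memLp_primitive_right h.measurable_drift (h.memLp_drift t))).add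
    (h.memLp_mart t)
  refine h1.ae_eq ?_
  filter_upwards [h.eq t] with ω hω
  rw [hω]
  simp

/-- The martingale part at the final time may be replaced, under the integral against an adapted
drift, by the martingale part at the running time. -/
theorem integral_primitive_mul_mart (h : IsItoProcess 𝓕 P x b M x₀)
    (h' : IsItoProcess 𝓕 P x' b' M' x₀') (t : ℝ≥0) :
    ∫ ω, (∫ u in (0 : ℝ)..t, b u.toNNReal ω) * M' t ω ∂P
      = ∫ z, b z.2.toNNReal z.1 * (x' z.2.toNNReal z.1 - x₀'
          - ∫ v in (0 : ℝ)..z.2, b' v.toNNReal z.1) ∂(prodMeasure P t) := by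
  have hM : MemLp (fun z : Ω × ℝ => M' t z.1) 2 (prodMeasure P t) := by
    exact (h'.memLp_mart t).comp_fst _
  have hprim := memLp_primitive h'.measurable_drift (h'.memLp_drift t)
  have hx : MemLp (fun z : Ω × ℝ => x' z.2.toNNReal z.1 - x₀'
          - ∫ v in (0 : ℝ)..z.2, b' v.toNNReal z.1) 2 (prodMeasure P t) :=
    ((h'.memLp t).sub (memLp_const x₀')).sub hprim
  have hi1 := integrable_mul_of_memLp_two (h.memLp_drift t) hM
  have hi2 := integrable_mul_of_memLp_two (h.memLp_drift t) hx
  have h1 : ∫ ω, (∫ u in (0 : ℝ)..t, b u.toNNReal ω) * M' t ω ∂P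
      = ∫ z, b z.2.toNNReal z.1 * M' t z.1 ∂(prodMeasure P t) := by
    rw [integral_prod _ hi1]
    refine integral_congr_ae (Eventually.of_forall fun ω => ?_)
    simp only
    rw [intervalIntegral.integral_of_le t.coe_nonneg, ← integral_mul_const]
  rw [h1, integral_prod_symm _ hi1, integral_prod_symm _ hi2]
  refine integral_congr_ae ?_
  filter_upwards [memLp_slice_right h.measurable_drift (h.memLp_drift t),
    ae_restrict_mem measurableSet_Ioc] with u hu hmem
  have hut : u.toNNReal ≤ t := Real.toNNReal_le_iff_le_coe.2 hmem.2
  rw [h'.mart u.toNNReal t hut (b u.toNNReal) (h.adapted_drift _) hu]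
  refine integral_congr_ae ?_
  filter_upwards [h'.eq u.toNNReal] with ω hω
  rw [Real.coe_toNNReal _ hmem.1.le] at hω
  rw [hω]
  ring

/-- The evolution of the second moments of two Itô processes. -/
theorem integral_mul (h : IsItoProcess 𝓕 P x b M x₀)
    (h' : IsItoProcess 𝓕 P x' b' M' x₀') (t : ℝ≥0) :
    ∫ ω, x t ω * x' t ω ∂P = x₀ * x₀'
      + ∫ z, (x z.2.toNNReal z.1 * b' z.2.toNNReal z.1 + b z.2.toNNReal z.1 * x' z.2.toNNReal z.1)
          ∂(prodMeasure P t)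
      + ∫ ω, M t ω * M' t ω ∂P := by
  have hG := memLp_primitive h.measurable_drift (h.memLp_drift t)
  have hG' := memLp_primitive h'.measurable_drift (h'.memLp_drift t)
  have hGt := memLp_primitive_right h.measurable_drift (h.memLp_drift t)
  have hGt' := memLp_primitive_right h'.measurable_drift (h'.memLp_drift t)
  have hc : ∀ c : ℝ, MemLp (fun _ : Ω => c) 2 P := fun c => memLp_const c
  -- the product of the two drift parts, by integration by parts along each path
  have hcG : MemLp (fun z : Ω × ℝ => x₀ + ∫ v in (0 : ℝ)..z.2, b v.toNNReal z.1) 2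
    (prodMeasure P t) := (memLp_const x₀).add hG
  have hcG' : MemLp (fun z : Ω × ℝ => x₀' + ∫ v in (0 : ℝ)..z.2, b' v.toNNReal z.1) 2
    (prodMeasure P t) := (memLp_const x₀').add hG'
  have i1 := integrable_mul_of_memLp_two (h.memLp_drift t) hcG'
  have i2 := integrable_mul_of_memLp_two hcG (h'.memLp_drift t)
  have i12 : Integrable (fun z : Ω × ℝ => b z.2.toNNReal z.1 *
      (x₀' + ∫ v in (0 : ℝ)..z.2, b' v.toNNReal z.1)
      + (x₀ + ∫ v in (0 : ℝ)..z.2, b v.toNNReal z.1) * b' z.2.toNNReal z.1)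
      (prodMeasure P t) := i1.add i2
  have e1 : ∫ ω, (x₀ + ∫ u in (0 : ℝ)..t, b u.toNNReal ω) *
      (x₀' + ∫ u in (0 : ℝ)..t, b' u.toNNReal ω) ∂P = x₀ * x₀' +
      ∫ z, (b z.2.toNNReal z.1 * (x₀' + ∫ v in (0 : ℝ)..z.2, b' v.toNNReal z.1)
      + (x₀ + ∫ v in (0 : ℝ)..z.2, b v.toNNReal z.1) * b' z.2.toNNReal z.1)
      ∂(prodMeasure P t) := by
    rw [integral_prod _ i12]
    have hconst : x₀ * x₀' = ∫ _, x₀ * x₀' ∂P := by simp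
    rw [hconst, ← integral_add (integrable_const _) i12.integral_prod_left]
    refine integral_congr_ae ?_
    filter_upwards [memLp_slice_left h.measurable_drift (h.memLp_drift t),
      memLp_slice_left h'.measurable_drift (h'.memLp_drift t)] with ω h1 h2
    have hint : ∀ {g : ℝ → ℝ}, MemLp g 2 (volume.restrict (Set.Ioc (0 : ℝ) t)) →
        IntervalIntegrable g volume 0 t := fun hg =>
      (intervalIntegrable_iff_integrableOn_Ioc_of_le t.2).2 (hg.integrable (by norm_num))
    have h3 := primitive_mul_primitive x₀ x₀' (hint h1) (hint h2)
    rw [h3, intervalIntegral.integral_of_le t.coe_nonneg]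
  -- the cross terms
  have hcGt : MemLp (fun ω => x₀ + ∫ u in (0 : ℝ)..t, b u.toNNReal ω) 2 P := (hc x₀).add hGt
  have hcGt' : MemLp (fun ω => x₀' + ∫ u in (0 : ℝ)..t, b' u.toNNReal ω) 2 P := (hc x₀').add hGt'
  have e2 : ∫ ω, (x₀ + ∫ u in (0 : ℝ)..t, b u.toNNReal ω) * M' t ω ∂P
      = ∫ z, b z.2.toNNReal z.1 * (x' z.2.toNNReal z.1 - x₀'
          - ∫ v in (0 : ℝ)..z.2, b' v.toNNReal z.1) ∂(prodMeasure P t) := by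
    rw [← h.integral_primitive_mul_mart h' t]
    simp_rw [add_mul]
    rw [integral_add (integrable_mul_of_memLp_two (hc x₀) (h'.memLp_mart t))
      (integrable_mul_of_memLp_two hGt (h'.memLp_mart t)), integral_const_mul, h'.integral_mart]
    ring
  have e3 : ∫ ω, M t ω * (x₀' + ∫ u in (0 : ℝ)..t, b' u.toNNReal ω) ∂P
      = ∫ z, (x z.2.toNNReal z.1 - x₀ - ∫ v in (0 : ℝ)..z.2, b v.toNNReal z.1) *
          b' z.2.toNNReal z.1 ∂(prodMeasure P t) := by
    have h2 := h'.integral_primitive_mul_mart h t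
    simp_rw [mul_add]
    rw [integral_add (integrable_mul_of_memLp_two (h.memLp_mart t) (hc x₀'))
      (integrable_mul_of_memLp_two (h.memLp_mart t) hGt'), integral_mul_const, h.integral_mart]
    simp_rw [mul_comm (M t _), h2]
    rw [zero_mul, zero_add]
    simp_rw [mul_comm (b' _ _)]
  have hx : MemLp (fun z : Ω × ℝ => x z.2.toNNReal z.1 - x₀
          - ∫ v in (0 : ℝ)..z.2, b v.toNNReal z.1) 2 (prodMeasure P t) :=
    ((h.memLp t).sub (memLp_const x₀)).sub hG
  have hx' : MemLp (fun z : Ω × ℝ => x' z.2.toNNReal z.1 - x₀'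
          - ∫ v in (0 : ℝ)..z.2, b' v.toNNReal z.1) 2 (prodMeasure P t) :=
    ((h'.memLp t).sub (memLp_const x₀')).sub hG'
  have i3 := integrable_mul_of_memLp_two (h.memLp_drift t) hx'
  have i4 := integrable_mul_of_memLp_two hx (h'.memLp_drift t)
  have e4 : ∫ ω, x t ω * x' t ω ∂P =
      ∫ ω, (x₀ + ∫ u in (0 : ℝ)..t, b u.toNNReal ω) *
        (x₀' + ∫ u in (0 : ℝ)..t, b' u.toNNReal ω) ∂P
      + ∫ ω, (x₀ + ∫ u in (0 : ℝ)..t, b u.toNNReal ω) * M' t ω ∂P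
      + ∫ ω, M t ω * (x₀' + ∫ u in (0 : ℝ)..t, b' u.toNNReal ω) ∂P
      + ∫ ω, M t ω * M' t ω ∂P := by
    have j1 := integrable_mul_of_memLp_two hcGt hcGt'
    have j2 := integrable_mul_of_memLp_two hcGt (h'.memLp_mart t)
    have j3 := integrable_mul_of_memLp_two (h.memLp_mart t) hcGt'
    have j4 := integrable_mul_of_memLp_two (h.memLp_mart t) (h'.memLp_mart t)
    rw [← integral_add j1 j2, ← integral_add (by exact j1.add j2) j3,
      ← integral_add (by exact (j1.add j2).add j3) j4]
    refine integral_congr_ae ?_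
    filter_upwards [h.eq t, h'.eq t] with ω h1 h2
    rw [h1, h2]
    ring
  rw [e4, e1, e2, e3, add_assoc (x₀ * x₀'), add_assoc (x₀ * x₀'), ← integral_add i12 i3,
    ← integral_add (by exact i12.add i3) i4]
  congr 2
  refine integral_congr_ae (Eventually.of_forall fun z => ?_)
  simp only
  ring

end IsItoProcess

end Moments

/-! ### The discounted value balance -/

/-- The discounted balance: if `f' = β f + r + k - c`, then the discounted running cost is the
initial value minus the discounted present value, plus the discounted excess. -/
theorem discounted_balance {β k f₀ : ℝ} {f c r : ℝ → ℝ}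
    (hf : ∀ t, 0 ≤ t → IntervalIntegrable f volume 0 t)
    (hc : ∀ t, 0 ≤ t → IntervalIntegrable c volume 0 t)
    (hr : ∀ t, 0 ≤ t → IntervalIntegrable r volume 0 t)
    (h : ∀ t, 0 ≤ t → f t = f₀ + ∫ u in (0 : ℝ)..t, (β * f u + r u + k - c u)) {t : ℝ} (ht : 0 ≤ t) :
    ∫ u in (0 : ℝ)..t, Real.exp (-β * u) * c u = f₀ - Real.exp (-β * t) * f t
      + (∫ u in (0 : ℝ)..t, Real.exp (-β * u) * r u)
      + k * ∫ u in (0 : ℝ)..t, Real.exp (-β * u) := by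
  have hexpc : Continuous fun u : ℝ => Real.exp (-β * u) := by fun_prop
  have hexp : ∀ x : ℝ, Real.exp (-β * x) = 1 + ∫ u in (0 : ℝ)..x, -β * Real.exp (-β * u) := by
    intro x
    have h1 : ∀ u ∈ Set.uIcc 0 x, HasDerivAt (fun u : ℝ => Real.exp (-β * u))
        (-β * Real.exp (-β * u)) u := by
      intro u _
      have := ((hasDerivAt_id u).const_mul (-β)).exp
      simpa [mul_comm] using this
    rw [intervalIntegral.integral_eq_sub_of_hasDerivAt h1
      ((hexpc.const_mul (-β)).intervalIntegrable _ _)]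
    simp
  have hg : IntervalIntegrable (fun u => β * f u + r u + k - c u) volume 0 t :=
    ((((hf t ht).const_mul β).add (hr t ht)).add intervalIntegrable_const).sub (hc t ht)
  have h1 := primitive_mul_primitive 1 f₀ ((hexpc.const_mul (-β)).intervalIntegrable 0 t) hg
  rw [← hexp, ← h t ht] at h1
  have hm : ∀ {g : ℝ → ℝ}, IntervalIntegrable g volume 0 t →
      IntervalIntegrable (fun u => Real.exp (-β * u) * g u) volume 0 t := fun hg =>
    hg.continuousOn_mul hexpc.continuousOn
  have h2 : ∫ u in (0 : ℝ)..t, (-β * Real.exp (-β * u) *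
        (f₀ + ∫ v in (0 : ℝ)..u, (β * f v + r v + k - c v))
        + (1 + ∫ v in (0 : ℝ)..u, -β * Real.exp (-β * v)) * (β * f u + r u + k - c u))
      = ∫ u in (0 : ℝ)..t, (Real.exp (-β * u) * r u + k * Real.exp (-β * u)
          - Real.exp (-β * u) * c u) := by
    refine intervalIntegral.integral_congr fun u hu => ?_
    rw [Set.uIcc_of_le ht] at hu
    rw [← hexp, ← h u hu.1]
    ring
  rw [h2, intervalIntegral.integral_sub ((hm (hr t ht)).add
    ((hexpc.intervalIntegrable 0 t).const_mul k)) (hm (hc t ht)), intervalIntegral.integral_add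
    (hm (hr t ht)) ((hexpc.intervalIntegrable 0 t).const_mul k),
    intervalIntegral.integral_const_mul] at h1
  linarith

theorem mul_integral_exp {β k : ℝ} (hk : k ≠ 0 → β ≠ 0) (t : ℝ) :
    k * ∫ u in (0 : ℝ)..t, Real.exp (-β * u) = k / β * (1 - Real.exp (-β * t)) := by
  by_cases h : k = 0
  · simp [h]
  have hβ := hk h
  have h1 : ∀ u ∈ Set.uIcc 0 t, HasDerivAt (fun u : ℝ => -(Real.exp (-β * u)) / β)
      (Real.exp (-β * u)) u := by
    intro u _
    have h2 : HasDerivAt (fun u : ℝ => -(Real.exp (-β * u)) / β)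
        (-(Real.exp (-β * u) * (-β * 1)) / β) u :=
      (((hasDerivAt_id u).const_mul (-β)).exp.neg).div_const β
    exact h2.congr_deriv (by field_simp)
  rw [intervalIntegral.integral_eq_sub_of_hasDerivAt h1
    ((by fun_prop : Continuous fun u : ℝ => Real.exp (-β * u)).intervalIntegrable _ _)]
  simp only [mul_zero, Real.exp_zero]
  field_simp
  ring

section Balance

variable {β k f₀ C : ℝ} {f c r : ℝ → ℝ}

/-- Without excess, the total discounted cost is at most the value. -/
theorem discounted_cost_le (hβ : 0 ≤ β) (hk0 : 0 ≤ k) (hk : k ≠ 0 → β ≠ 0)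
    (hf : ∀ t, 0 ≤ t → IntervalIntegrable f volume 0 t)
    (hc : ∀ t, 0 ≤ t → IntervalIntegrable c volume 0 t)
    (hf0 : ∀ t, 0 ≤ f t)
    (h : ∀ t, 0 ≤ t → f t = f₀ + ∫ u in (0 : ℝ)..t, (β * f u + 0 + k - c u)) {t : ℝ} (ht : 0 ≤ t) :
    ∫ u in (0 : ℝ)..t, Real.exp (-β * u) * c u ≤ f₀ + k / β := by
  rw [discounted_balance (r := fun _ => 0) hf hc (fun _ _ => by simp) h ht, mul_integral_exp hk]
  have h1 : 0 ≤ Real.exp (-β * t) * f t := mul_nonneg (Real.exp_pos _).le (hf0 t)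
  have h2 : 0 ≤ k / β * Real.exp (-β * t) := by positivity
  simp only [mul_zero, intervalIntegral.integral_zero]
  linarith

/-- A bound on the total discounted cost is at least the value plus the discounted excess:
coercivity of the cost makes the discounted present value small at arbitrarily late times. -/
theorem le_discounted_cost (hβ : 0 ≤ β) (hk0 : 0 ≤ k) (hk : k ≠ 0 → β ≠ 0)
    (hf : ∀ t, 0 ≤ t → IntervalIntegrable f volume 0 t)
    (hc : ∀ t, 0 ≤ t → IntervalIntegrable c volume 0 t)
    (hr : ∀ t, 0 ≤ t → IntervalIntegrable r volume 0 t)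
    (hfc : ∀ᵐ t, 0 < t → f t ≤ C * c t) (hr0 : ∀ t, 0 ≤ r t) (hc0 : ∀ t, 0 ≤ c t)
    (hC : 0 ≤ C)
    (h : ∀ t, 0 ≤ t → f t = f₀ + ∫ u in (0 : ℝ)..t, (β * f u + r u + k - c u)) {J : ℝ}
    (hJ : ∀ t, 0 ≤ t → ∫ u in (0 : ℝ)..t, Real.exp (-β * u) * c u ≤ J) {t : ℝ} (ht : 0 ≤ t) :
    f₀ + k / β + ∫ u in (0 : ℝ)..t, Real.exp (-β * u) * r u ≤ J := by
  have hexpc : Continuous fun u : ℝ => Real.exp (-β * u) := by fun_prop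
  have hm : ∀ {g : ℝ → ℝ} {t : ℝ}, IntervalIntegrable g volume 0 t →
      IntervalIntegrable (fun u => Real.exp (-β * u) * g u) volume 0 t := fun hg =>
    hg.continuousOn_mul hexpc.continuousOn
  -- the discounted present value is small at some late time
  have hsmall : ∀ ε : ℝ, 0 < ε → ∀ T, 0 ≤ T → ∃ t, T ≤ t ∧ Real.exp (-β * t) * f t ≤ ε := by
    intro ε hε T hT
    by_contra! hcon
    have hJ0 : 0 ≤ J := by simpa using hJ 0 le_rfl
    obtain ⟨N, hN⟩ : ∃ N : ℝ, 0 ≤ N ∧ C * J < ε * N :=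
      ⟨(C * J + 1) / ε, by positivity, by rw [mul_div_cancel₀ _ hε.ne']; linarith⟩
    have hTN : T ≤ T + N := by linarith [hN.1]
    have hi := hm (hc (T + N) (by linarith [hN.1]))
    have hiT := hm (hc T hT)
    have hiTN : IntervalIntegrable (fun u => Real.exp (-β * u) * c u) volume T (T + N) :=
      hiT.symm.trans hi
    have h1 : ∫ u in T..(T + N), ε ≤ ∫ u in T..(T + N), C * (Real.exp (-β * u) * c u) := by
      refine intervalIntegral.integral_mono_ae_restrict hTN intervalIntegrable_const
        (hiTN.const_mul C) ?_
      filter_upwards [ae_restrict_mem measurableSet_Icc, ae_restrict_of_ae hfc,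
        ae_restrict_of_ae (compl_mem_ae_iff.2 (measure_singleton (0 : ℝ)))] with u hu hfu hne
      refine (hcon u hu.1).le.trans ?_
      have := mul_le_mul_of_nonneg_left (hfu (lt_of_le_of_ne (hT.trans hu.1) (Ne.symm hne)))
        (Real.exp_pos (-β * u)).le
      linarith
    rw [intervalIntegral.integral_const, intervalIntegral.integral_const_mul, smul_eq_mul,
      ← intervalIntegral.integral_interval_sub_left hi hiT] at h1
    have h2 : 0 ≤ ∫ u in (0 : ℝ)..T, Real.exp (-β * u) * c u :=
      intervalIntegral.integral_nonneg hT fun u _ => mul_nonneg (Real.exp_pos _).le (hc0 u)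
    have h3 := hJ (T + N) (by linarith [hN.1])
    have h4 := mul_le_mul_of_nonneg_left (sub_le_self _ h2 |>.trans h3) hC
    nlinarith [hN.2]
  have hkey : ∀ T, t ≤ T → ∀ ε : ℝ, 0 < ε →
      f₀ + k / β * (1 - Real.exp (-β * T)) + (∫ u in (0 : ℝ)..t, Real.exp (-β * u) * r u)
        ≤ J + ε := by
    intro T hT ε hε
    obtain ⟨T', hT', hsm⟩ := hsmall ε hε T (ht.trans hT)
    have h0 : 0 ≤ T' := ht.trans (hT.trans hT')
    have h1 := hJ T' h0
    rw [discounted_balance hf hc hr h h0, mul_integral_exp hk] at h1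
    have h2 : ∫ u in (0 : ℝ)..t, Real.exp (-β * u) * r u
        ≤ ∫ u in (0 : ℝ)..T', Real.exp (-β * u) * r u :=
      intervalIntegral.integral_mono_interval le_rfl ht (hT.trans hT')
        (Eventually.of_forall fun u => mul_nonneg (Real.exp_pos _).le (hr0 u)) (hm (hr T' h0))
    have h3 : k / β * (1 - Real.exp (-β * T)) ≤ k / β * (1 - Real.exp (-β * T')) := by
      have : Real.exp (-β * T') ≤ Real.exp (-β * T) := Real.exp_le_exp.2 (by nlinarith)
      have hkb : 0 ≤ k / β := by positivity
      gcongr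
    linarith
  have hkey2 : ∀ T, t ≤ T →
      f₀ + k / β * (1 - Real.exp (-β * T)) + (∫ u in (0 : ℝ)..t, Real.exp (-β * u) * r u) ≤ J :=
    fun T hT => le_of_forall_pos_le_add (hkey T hT)
  have hlim : Tendsto (fun T => f₀ + k / β * (1 - Real.exp (-β * T))
      + ∫ u in (0 : ℝ)..t, Real.exp (-β * u) * r u) atTop
      (𝓝 (f₀ + k / β + ∫ u in (0 : ℝ)..t, Real.exp (-β * u) * r u)) := by
    by_cases hk' : k = 0
    · simp [hk']
    · have hβ' : 0 < β := lt_of_le_of_ne hβ (hk hk').symm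
      have h1 : Tendsto (fun T : ℝ => Real.exp (-β * T)) atTop (𝓝 0) :=
        Real.tendsto_exp_atBot.comp (tendsto_id.const_mul_atTop_of_neg (by linarith))
      have h2 := (((h1.const_sub 1).const_mul (k / β)).const_add f₀).add_const
        (∫ u in (0 : ℝ)..t, Real.exp (-β * u) * r u)
      simpa using h2
  exact le_of_tendsto hlim (eventually_atTop.2 ⟨t, hkey2⟩)

end Balance

/-! ### Closed-loop solutions as Itô processes -/

open LinearMap (BilinForm)

theorem bilin_eq_sum {k : ℕ} (p : BilinForm ℝ (EuclideanSpace ℝ (Fin k)))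
    (x y : EuclideanSpace ℝ (Fin k)) :
    p x y = ∑ i, ∑ j, p (EuclideanSpace.single i 1) (EuclideanSpace.single j 1) * (x i * y j) := by
  have h : ∀ x : EuclideanSpace ℝ (Fin k), x = ∑ i, x i • EuclideanSpace.single i (1 : ℝ) := by
    intro x
    have := (EuclideanSpace.basisFun (Fin k) ℝ).sum_repr x
    simpa using this.symm
  conv_lhs => rw [h x, h y]
  simp only [map_sum, LinearMap.sum_apply, map_smul, LinearMap.smul_apply, smul_eq_mul,
    Finset.mul_sum]
  rw [Finset.sum_comm]
  refine Finset.sum_congr rfl fun i _ => Finset.sum_congr rfl fun j _ => ?_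
  ring

theorem memLp_component {k : ℕ} {α : Type*} {mα : MeasurableSpace α} {μ : Measure α}
    {f : α → EuclideanSpace ℝ (Fin k)} (hf : MemLp f 2 μ) (i : Fin k) :
    MemLp (fun x => f x i) 2 μ :=
  (EuclideanSpace.proj (𝕜 := ℝ) i : EuclideanSpace ℝ (Fin k) →L[ℝ] ℝ).comp_memLp' hf

theorem integrable_bilin {k : ℕ} {α : Type*} {mα : MeasurableSpace α} {μ : Measure α}
    (p : BilinForm ℝ (EuclideanSpace ℝ (Fin k))) {f g : α → EuclideanSpace ℝ (Fin k)}
    (hf : MemLp f 2 μ) (hg : MemLp g 2 μ) : Integrable (fun x => p (f x) (g x)) μ := by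
  rw [funext fun x => bilin_eq_sum p (f x) (g x)]
  exact integrable_finsetSum _ fun i _ => integrable_finsetSum _ fun j _ =>
    (integrable_mul_of_memLp_two (memLp_component hf i) (memLp_component hg j)).const_mul _

theorem integral_bilin {k : ℕ} {α : Type*} {mα : MeasurableSpace α} {μ : Measure α}
    (p : BilinForm ℝ (EuclideanSpace ℝ (Fin k))) {f g : α → EuclideanSpace ℝ (Fin k)}
    (hf : MemLp f 2 μ) (hg : MemLp g 2 μ) :
    ∫ x, p (f x) (g x) ∂μ = ∑ i, ∑ j,
      p (EuclideanSpace.single i 1) (EuclideanSpace.single j 1) * ∫ x, f x i * g x j ∂μ := by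
  have h1 := fun i j => (integrable_mul_of_memLp_two (memLp_component hf i)
    (memLp_component hg j)).const_mul
      (p (EuclideanSpace.single i 1) (EuclideanSpace.single j 1))
  rw [funext fun x => bilin_eq_sum p (f x) (g x), integral_finsetSum _ fun i _ => integrable_finsetSum _ fun j _ => h1 i j]
  refine Finset.sum_congr rfl fun i _ => ?_
  rw [integral_finsetSum _ fun j _ => h1 i j]
  exact Finset.sum_congr rfl fun j _ => integral_const_mul _ _

section ClosedLoop

variable {Ω : Type*} {mΩ : MeasurableSpace Ω} {P : Measure Ω}
  {𝓕 : Filtration ℝ≥0 mΩ} {d m n : ℕ} {C : ControlProblem d m n}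
  {W : ℝ≥0 → Ω → EuclideanSpace ℝ (Fin n)}
  {π : EuclideanSpace ℝ (Fin d) → EuclideanSpace ℝ (Fin m)} {s : EuclideanSpace ℝ (Fin d)}
  {X : ℝ≥0 → Ω → EuclideanSpace ℝ (Fin d)}

namespace IsClosedLoopSolution

theorem measurable_path (hX : IsClosedLoopSolution C 𝓕 W P π s X) :
    Measurable fun z : Ω × ℝ => X z.2.toNNReal z.1 :=
  (measurable_uncurry_of_continuous_of_measurable hX.continuous_paths fun t =>
    (hX.adapted t).mono (𝓕.le t) le_rfl).comp
      ((measurable_real_toNNReal.comp measurable_snd).prodMk measurable_fst)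

theorem memLp_pair (hX : IsClosedLoopSolution C 𝓕 W P π s X) (hπ : Measurable π) (T : ℝ≥0) :
    MemLp (fun z : Ω × ℝ => X z.2.toNNReal z.1) 2 (prodMeasure P T) ∧
    MemLp (fun z : Ω × ℝ => π (X z.2.toNNReal z.1)) 2 (prodMeasure P T) := by
  have hm := hX.measurable_path
  have hmp := hπ.comp hm
  have h1 : ∫⁻ z, (‖X z.2.toNNReal z.1‖ₑ ^ 2 + ‖π (X z.2.toNNReal z.1)‖ₑ ^ 2) ∂(prodMeasure P T)
      < ∞ := by
    rw [lintegral_prod _ (by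
      exact ((hm.enorm.pow_const 2).add (hmp.enorm.pow_const 2)).aemeasurable)]
    exact hX.square_integrable T
  have key : ∀ {k : ℕ} {f : Ω × ℝ → EuclideanSpace ℝ (Fin k)}, Measurable f →
      (∀ z, ‖f z‖ₑ ^ 2 ≤ ‖X z.2.toNNReal z.1‖ₑ ^ 2 + ‖π (X z.2.toNNReal z.1)‖ₑ ^ 2) →
      MemLp f 2 (prodMeasure P T) := by
    intro k f hf hle
    refine ⟨hf.aestronglyMeasurable, ?_⟩
    rw [eLpNorm_lt_top_iff_lintegral_rpow_enorm_lt_top (by norm_num) (by norm_num)]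
    refine lt_of_le_of_lt (lintegral_mono fun z => ?_) h1
    simpa using hle z
  exact ⟨key hm fun z => le_self_add, key hmp fun z => le_add_self⟩

/-- The solution starts at the prescribed state. -/
theorem ae_start (hX : IsClosedLoopSolution C 𝓕 W P π s X) : ∀ᵐ ω ∂P, X 0 ω = s := by
  obtain ⟨M, hM, heq⟩ := hX.equation
  have h1 : ∀ᵐ ω ∂P, ∀ i j, M i j 0 ω = 0 :=
    ae_all_iff.2 fun i => ae_all_iff.2 fun j => (hM i j).ae_eq_zero
  filter_upwards [h1, heq 0] with ω h1 h2
  ext i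
  simpa [h1] using h2 i

variable [IsProbabilityMeasure P]

theorem exists_isItoProcess (hW : IsBrownianMotion 𝓕 W P)
    (hX : IsClosedLoopSolution C 𝓕 W P π s X) (hπ : Measurable π)
    {A : Matrix (Fin d) (Fin d) ℝ} {B : Matrix (Fin d) (Fin m) ℝ} (hC : C.drift = linDrift A B) :
    ∃ M : Fin d → Fin n → ℝ≥0 → Ω → ℝ,
      (∀ i j, IsItoIntegral 𝓕 P (fun t ω => W t ω j)
        (fun t ω => C.diffusion (X t ω) (π (X t ω)) i j) (M i j)) ∧
      ∀ i, IsItoProcess 𝓕 P (fun t ω => X t ω i)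
        (fun t ω => linDrift A B (X t ω) (π (X t ω)) i) (fun t ω => ∑ j, M i j t ω) (s i) := by
  obtain ⟨M, hM, heq⟩ := hX.equation
  rw [hC] at heq
  have hproj : ∀ i, Measurable fun x : EuclideanSpace ℝ (Fin d) => x i := fun i => by fun_prop
  have hlin : ∀ i, Measurable fun p : EuclideanSpace ℝ (Fin d) × EuclideanSpace ℝ (Fin m) =>
      linDrift A B p.1 p.2 i := fun i =>
    (hproj i).comp (continuous_linDrift A B).measurable
  refine ⟨M, hM, fun i => ?_⟩
  have hdr : ∀ T, MemLp (fun z : Ω × ℝ => linDrift A B (X z.2.toNNReal z.1)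
      (π (X z.2.toNNReal z.1))) 2 (prodMeasure P T) := by
    intro T
    obtain ⟨h1, h2⟩ := hX.memLp_pair hπ T
    exact ((LinearMap.toContinuousLinearMap A.toEuclideanLin).comp_memLp' h1).add
      ((LinearMap.toContinuousLinearMap B.toEuclideanLin).comp_memLp' h2)
  have hmart : ∀ t, MemLp (fun ω => ∑ j, M i j t ω) 2 P := fun t =>
    memLp_finsetSum _ fun j _ => (hM i j).memLp (hW.component j) t
  constructor
  · have h1 : Measurable fun z : Ω × ℝ => (X z.2.toNNReal z.1, π (X z.2.toNNReal z.1)) :=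
      hX.measurable_path.prodMk (hπ.comp hX.measurable_path)
    have h2 := (hlin i).comp h1
    exact h2
  · intro t
    have h1 : Measurable[𝓕 t] fun ω => (X t ω, π (X t ω)) :=
      Measurable.prodMk (hX.adapted t) (hπ.comp (hX.adapted t))
    have h2 := Measurable.comp (hlin i) h1
    exact h2
  · intro T
    have h1 := memLp_component (hX.memLp_pair hπ T).1 i
    exact h1
  · intro T
    have h1 := memLp_component (hdr T) i
    exact h1
  · exact hmart
  · intro u t hut η hη hη2
    simp_rw [Finset.mul_sum]
    rw [integral_finsetSum _ fun j _ => integrable_mul_of_memLp_two hη2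
        ((hM i j).memLp (hW.component j) t),
      integral_finsetSum _ fun j _ => integrable_mul_of_memLp_two hη2
        ((hM i j).memLp (hW.component j) u)]
    exact Finset.sum_congr rfl fun j _ => (hM i j).integral_mul_eq (hW.component j) hut hη hη2
  · have h1 : ∀ᵐ ω ∂P, ∀ j, M i j 0 ω = 0 := ae_all_iff.2 fun j => (hM i j).ae_eq_zero
    filter_upwards [h1] with ω hω
    simp [hω]
  · intro t
    filter_upwards [heq t] with ω hω
    exact hω i

theorem memLp_at (hW : IsBrownianMotion 𝓕 W P)
    (hX : IsClosedLoopSolution C 𝓕 W P π s X) (hπ : Measurable π)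
    {A : Matrix (Fin d) (Fin d) ℝ} {B : Matrix (Fin d) (Fin m) ℝ} (hC : C.drift = linDrift A B)
    (t : ℝ≥0) : MemLp (X t) 2 P := by
  obtain ⟨M, -, hI⟩ := hX.exists_isItoProcess hW hπ hC
  exact MemLp.of_eval_piLp fun i => (hI i).memLp_at t

/-- Evolution of the mean of a quadratic form along a solution, in terms of the second moments of
the martingale parts. -/
theorem integral_bilin_eq (hW : IsBrownianMotion 𝓕 W P)
    (hX : IsClosedLoopSolution C 𝓕 W P π s X) (hπ : Measurable π)
    {A : Matrix (Fin d) (Fin d) ℝ} {B : Matrix (Fin d) (Fin m) ℝ} (hC : C.drift = linDrift A B)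
    {p : BilinForm ℝ (EuclideanSpace ℝ (Fin d))} (hp : ∀ x y, p x y = p y x)
    {M : Fin d → Fin n → ℝ≥0 → Ω → ℝ}
    (hI : ∀ i, IsItoProcess 𝓕 P (fun t ω => X t ω i)
        (fun t ω => linDrift A B (X t ω) (π (X t ω)) i) (fun t ω => ∑ j, M i j t ω) (s i))
    {G : Ω × ℝ → ℝ} (t : ℝ≥0) (hG : Integrable G (prodMeasure P t))
    (hMG : ∑ i, ∑ k, p (EuclideanSpace.single i 1) (EuclideanSpace.single k 1) *
      ∫ ω, (∑ j, M i j t ω) * (∑ j, M k j t ω) ∂P = ∫ z, G z ∂(prodMeasure P t)) :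
    ∫ ω, p (X t ω) (X t ω) ∂P = p s s + ∫ z, (2 * p (X z.2.toNNReal z.1)
      (linDrift A B (X z.2.toNNReal z.1) (π (X z.2.toNNReal z.1))) + G z) ∂(prodMeasure P t) := by
  obtain ⟨h1, h2⟩ := hX.memLp_pair hπ t
  have hdr : MemLp (fun z : Ω × ℝ => linDrift A B (X z.2.toNNReal z.1)
      (π (X z.2.toNNReal z.1))) 2 (prodMeasure P t) :=
    ((LinearMap.toContinuousLinearMap A.toEuclideanLin).comp_memLp' h1).add
      ((LinearMap.toContinuousLinearMap B.toEuclideanLin).comp_memLp' h2)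
  have hXt := hX.memLp_at hW hπ hC t
  have j1 := integrable_bilin p h1 hdr
  have j2 := integrable_bilin p hdr h1
  have e1 : ∫ z, (2 * p (X z.2.toNNReal z.1)
      (linDrift A B (X z.2.toNNReal z.1) (π (X z.2.toNNReal z.1))) + G z) ∂(prodMeasure P t)
      = ∫ z, p (X z.2.toNNReal z.1) (linDrift A B (X z.2.toNNReal z.1) (π (X z.2.toNNReal z.1)))
          ∂(prodMeasure P t)
        + ∫ z, p (linDrift A B (X z.2.toNNReal z.1) (π (X z.2.toNNReal z.1))) (X z.2.toNNReal z.1)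
          ∂(prodMeasure P t) + ∫ z, G z ∂(prodMeasure P t) := by
    rw [← integral_add j1 j2, ← integral_add (by exact j1.add j2) hG]
    refine integral_congr_ae (Eventually.of_forall fun z => ?_)
    simp only
    rw [hp (linDrift A B _ _)]
    ring
  rw [e1, integral_bilin p hXt hXt, integral_bilin p h1 hdr, integral_bilin p hdr h1, ← hMG,
    bilin_eq_sum p s s]
  simp_rw [← Finset.sum_add_distrib, ← mul_add]
  refine Finset.sum_congr rfl fun i _ => Finset.sum_congr rfl fun k _ => ?_
  congr 1
  rw [(hI i).integral_mul (hI k) t, integral_add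
    (integrable_mul_of_memLp_two ((hI i).memLp t) ((hI k).memLp_drift t))
    (integrable_mul_of_memLp_two ((hI i).memLp_drift t) ((hI k).memLp t))]
  ring

end IsClosedLoopSolution

end ClosedLoop

/-! ### Verification -/

section Verification

variable {Ω : Type*} {mΩ : MeasurableSpace Ω} {P : Measure Ω} [IsProbabilityMeasure P]
  {𝓕 : Filtration ℝ≥0 mΩ} {d m n : ℕ} {C : ControlProblem d m n}
  {W : ℝ≥0 → Ω → EuclideanSpace ℝ (Fin n)}
  {π : EuclideanSpace ℝ (Fin d) → EuclideanSpace ℝ (Fin m)} {s : EuclideanSpace ℝ (Fin d)}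
  {X : ℝ≥0 → Ω → EuclideanSpace ℝ (Fin d)}

theorem intervalIntegrable_mean {g : Ω × ℝ → ℝ} (hg : ∀ T, Integrable g (prodMeasure P T)) (t : ℝ)
    (ht : 0 ≤ t) : IntervalIntegrable (fun u => ∫ ω, g (ω, u) ∂P) volume 0 t := by
  lift t to ℝ≥0 using ht
  rw [intervalIntegrable_iff_integrableOn_Ioc_of_le t.coe_nonneg]
  exact (hg t).integral_prod_right

theorem integral_prodMeasure_eq {g : Ω × ℝ → ℝ} (T : ℝ≥0) (hg : Integrable g (prodMeasure P T)) :
    ∫ z, g z ∂(prodMeasure P T) = ∫ u in (0 : ℝ)..T, ∫ ω, g (ω, u) ∂P := by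
  rw [integral_prod_symm _ hg, intervalIntegral.integral_of_le T.coe_nonneg]

/-- A bound on the discounted cost over the infinite horizon, an extended nonnegative number, is a
bound on all finite-horizon costs. -/
theorem lintegral_Ioi_le_iff {g : Ω × ℝ → ℝ} (hm : Measurable g) (hg0 : ∀ z, 0 ≤ g z)
    (hg : ∀ T, Integrable g (prodMeasure P T)) {β v : ℝ} (hv : 0 ≤ v) :
    ∫⁻ ω, (∫⁻ u in Set.Ioi (0 : ℝ), ENNReal.ofReal (Real.exp (-β * u) * g (ω, u))) ∂P
        ≤ ENNReal.ofReal v ↔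
      ∀ t : ℝ, 0 ≤ t → ∫ u in (0 : ℝ)..t, Real.exp (-β * u) * ∫ ω, g (ω, u) ∂P ≤ v := by
  have hexpc : Continuous fun u : ℝ => Real.exp (-β * u) := by fun_prop
  have hm' : Measurable fun z : Ω × ℝ => Real.exp (-β * z.2) * g z :=
    (hexpc.measurable.comp measurable_snd).mul hm
  have hmo : Measurable fun z : Ω × ℝ => ENNReal.ofReal (Real.exp (-β * z.2) * g z) :=
    ENNReal.measurable_ofReal.comp hm'
  have hint : ∀ T, Integrable (fun z : Ω × ℝ => Real.exp (-β * z.2) * g z) (prodMeasure P T) := by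
    intro T
    obtain ⟨c, hc⟩ := (isCompact_Icc (a := (0 : ℝ)) (b := T)).exists_bound_of_continuousOn
      hexpc.continuousOn
    refine (hg T).bdd_mul (c := c)
      (hexpc.measurable.comp measurable_snd).aestronglyMeasurable ?_
    filter_upwards [ae_prodMeasure_mem T] with z hz
    exact hc _ ⟨hz.1.le, hz.2⟩
  have hfin : ∀ T : ℝ≥0, ∫⁻ u in Set.Ioc (0 : ℝ) T,
      ∫⁻ ω, ENNReal.ofReal (Real.exp (-β * u) * g (ω, u)) ∂P
      = ENNReal.ofReal (∫ u in (0 : ℝ)..T, Real.exp (-β * u) * ∫ ω, g (ω, u) ∂P) := by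
    intro T
    rw [← lintegral_prod_symm _ hmo.aemeasurable, ← ofReal_integral_eq_lintegral_ofReal (hint T)
      (Eventually.of_forall fun z => mul_nonneg (Real.exp_pos _).le (hg0 z)),
      integral_prodMeasure_eq T (hint T)]
    simp_rw [integral_const_mul]
  have hU : Set.Ioi (0 : ℝ) = ⋃ N : ℕ, Set.Ioc (0 : ℝ) ((N : ℝ≥0) : ℝ) := by
    ext x
    simp only [Set.mem_Ioi, Set.mem_iUnion, Set.mem_Ioc, NNReal.coe_natCast]
    exact ⟨fun h => (exists_nat_ge x).imp fun N hN => ⟨h, hN⟩, fun ⟨_, h⟩ => h.1⟩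
  rw [lintegral_lintegral_swap hmo.aemeasurable, hU, setLIntegral_iUnion_of_directed _
    (Monotone.directed_le fun a b hab => Set.Ioc_subset_Ioc_right (by simpa using hab)), iSup_le_iff]
  simp_rw [hfin]
  simp_rw [ENNReal.ofReal_le_ofReal_iff hv]
  constructor
  · intro h t ht
    obtain ⟨N, hN⟩ := exists_nat_ge t
    refine le_trans ?_ (h N)
    refine intervalIntegral.integral_mono_interval le_rfl ht (by simpa using hN)
      (Eventually.of_forall fun u => mul_nonneg (Real.exp_pos _).le
        (integral_nonneg fun ω => hg0 _)) ?_
    exact (intervalIntegrable_mean hg _ (by simp)).continuousOn_mul hexpc.continuousOn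
  · exact fun h N => h _ (by simp)

/-- Verification. Suppose the quadratic form `p` satisfies, along every closed-loop solution, the
energy balance with discount rate `β`, running cost `Q + R`, excess `Rb (a - K s)` and constant
noise input `k`. If the linear feedback `K` admits solutions, it is the only continuous optimal
policy. -/
theorem continuous_optimal_iff
    {Q p : BilinForm ℝ (EuclideanSpace ℝ (Fin d))} {R Rb : BilinForm ℝ (EuclideanSpace ℝ (Fin m))}
    (hQ : ∀ x, x ≠ 0 → 0 < Q x x) (hR : ∀ x, x ≠ 0 → 0 < R x x) (hRb : ∀ x, x ≠ 0 → 0 < Rb x x)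
    (hp : ∀ x, x ≠ 0 → 0 < p x x) (hr : ∀ s a, C.reward s a = -(Q s s + R a a))
    (hβ : 0 ≤ C.discount) {k : ℝ} (hk0 : 0 ≤ k) (hk : k ≠ 0 → C.discount ≠ 0)
    (K : EuclideanSpace ℝ (Fin d) →ₗ[ℝ] EuclideanSpace ℝ (Fin m))
    (hbal : ∀ π, Measurable π → ∀ s X, IsClosedLoopSolution C 𝓕 W P π s X → ∀ t : ℝ≥0,
      ∫ ω, p (X t ω) (X t ω) ∂P = p s s + ∫ z, (C.discount * p (X z.2.toNNReal z.1)
        (X z.2.toNNReal z.1) + Rb (π (X z.2.toNNReal z.1) - K (X z.2.toNNReal z.1))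
          (π (X z.2.toNNReal z.1) - K (X z.2.toNNReal z.1)) + k
        - (Q (X z.2.toNNReal z.1) (X z.2.toNNReal z.1) + R (π (X z.2.toNNReal z.1))
          (π (X z.2.toNNReal z.1)))) ∂(prodMeasure P t))
    (hex : ∀ s, ∃ X, IsClosedLoopSolution C 𝓕 W P K s X)
    (π : EuclideanSpace ℝ (Fin d) → EuclideanSpace ℝ (Fin m)) :
    (Continuous π ∧ IsOptimalPolicy C 𝓕 W P π) ↔ π = K := by
  have nn : ∀ {E : Type _} [AddCommGroup E] [Module ℝ E] {b : BilinForm ℝ E},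
      (∀ x, x ≠ 0 → 0 < b x x) → ∀ x, 0 ≤ b x x := fun {E} _ _ {b} h x => by
    rcases eq_or_ne x 0 with rfl | hx
    · simp
    · exact (h x hx).le
  have hKc : Continuous K := K.continuous_of_finiteDimensional
  set β := C.discount with hβdef
  let J : (EuclideanSpace ℝ (Fin d) → EuclideanSpace ℝ (Fin m)) →
      (ℝ≥0 → Ω → EuclideanSpace ℝ (Fin d)) → ℝ≥0∞ := fun π X =>
    ∫⁻ ω, (∫⁻ u in Set.Ioi (0 : ℝ), ENNReal.ofReal (Real.exp (-β * u) *
      (Q (X u.toNNReal ω) (X u.toNNReal ω) + R (π (X u.toNNReal ω)) (π (X u.toNNReal ω))))) ∂P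
  have hpay : ∀ π X, payoff C P π X = -((J π X : ℝ≥0∞) : EReal) := by
    intro π X
    have h0 : ∀ u ω, discountedReward C π X u ω = -(Real.exp (-β * u) *
      (Q (X u.toNNReal ω) (X u.toNNReal ω) + R (π (X u.toNNReal ω)) (π (X u.toNNReal ω)))) := by
      intro u ω
      rw [discountedReward, hr]
      ring
    have h1 : ∀ u ω, ENNReal.ofReal (discountedReward C π X u ω) = 0 := by
      intro u ω
      rw [h0, ENNReal.ofReal_eq_zero, neg_nonpos]
      exact mul_nonneg (Real.exp_pos _).le (add_nonneg (nn hQ _) (nn hR _))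
    simp only [payoff, h1, lintegral_zero]
    simp only [h0, neg_neg, J]
    simp
  obtain ⟨c₀, hc₀, hdom⟩ := bilin_le_bilin p Q hQ
  -- the two halves of the value comparison
  have hval : ∀ π, Measurable π → ∀ s X, IsClosedLoopSolution C 𝓕 W P π s X →
      ((∀ x, π x = K x) → J π X ≤ ENNReal.ofReal (p s s + k / β)) ∧
      ∀ v : ℝ, 0 ≤ v → J π X ≤ ENNReal.ofReal v → ∀ t : ℝ, 0 ≤ t →
        p s s + k / β + ∫ u in (0 : ℝ)..t, Real.exp (-β * u) *
          ∫ ω, Rb (π (X u.toNNReal ω) - K (X u.toNNReal ω))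
            (π (X u.toNNReal ω) - K (X u.toNNReal ω)) ∂P ≤ v := by
    intro π hπ s X hX
    have hm := hX.measurable_path
    have hml := hX.memLp_pair hπ
    have hmd : ∀ T, MemLp (fun z : Ω × ℝ => π (X z.2.toNNReal z.1) - K (X z.2.toNNReal z.1)) 2
        (prodMeasure P T) := fun T =>
      (hml T).2.sub ((LinearMap.toContinuousLinearMap K).comp_memLp' (hml T).1)
    have if' := fun T => integrable_bilin p (hml T).1 (hml T).1
    have ir := fun T => integrable_bilin Rb (hmd T) (hmd T)
    have ic : ∀ T, Integrable (fun z : Ω × ℝ => Q (X z.2.toNNReal z.1) (X z.2.toNNReal z.1)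
        + R (π (X z.2.toNNReal z.1)) (π (X z.2.toNNReal z.1))) (prodMeasure P T) := fun T =>
      (integrable_bilin Q (hml T).1 (hml T).1).add (integrable_bilin R (hml T).2 (hml T).2)
    have hcm : Measurable (fun z : Ω × ℝ => Q (X z.2.toNNReal z.1) (X z.2.toNNReal z.1)
        + R (π (X z.2.toNNReal z.1)) (π (X z.2.toNNReal z.1))) :=
      ((continuous_bilin_self Q).measurable.comp hm).add
        ((continuous_bilin_self R).measurable.comp (hπ.comp hm))
    let f : ℝ → ℝ := fun u => ∫ ω, p (X u.toNNReal ω) (X u.toNNReal ω) ∂P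
    let r : ℝ → ℝ := fun u => ∫ ω, Rb (π (X u.toNNReal ω) - K (X u.toNNReal ω))
            (π (X u.toNNReal ω) - K (X u.toNNReal ω)) ∂P
    let c : ℝ → ℝ := fun u => ∫ ω, (Q (X u.toNNReal ω) (X u.toNNReal ω)
        + R (π (X u.toNNReal ω)) (π (X u.toNNReal ω))) ∂P
    have hfi : ∀ t, 0 ≤ t → IntervalIntegrable f volume 0 t := intervalIntegrable_mean if'
    have hri : ∀ t, 0 ≤ t → IntervalIntegrable r volume 0 t := intervalIntegrable_mean ir
    have hci : ∀ t, 0 ≤ t → IntervalIntegrable c volume 0 t := intervalIntegrable_mean ic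
    have hf : ∀ t, 0 ≤ t → f t = p s s + ∫ u in (0 : ℝ)..t, (β * f u + r u + k - c u) := by
      intro t ht
      lift t to ℝ≥0 using ht
      have i1 := ((if' t).const_mul β).add (ir t)
      have i2 := i1.add (integrable_const k)
      have h1 := hbal π hπ s X hX t
      have j := integral_prodMeasure_eq t (i2.sub (ic t))
      simp only [Pi.add_apply, Pi.sub_apply] at j
      simp only [f, Real.toNNReal_coe]
      rw [h1, j]
      congr 1
      rw [intervalIntegral.integral_of_le t.coe_nonneg, intervalIntegral.integral_of_le t.coe_nonneg]
      refine integral_congr_ae ?_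
      filter_upwards [(if' t).prod_left_ae, (ir t).prod_left_ae, (ic t).prod_left_ae]
        with u h1 h2 h3
      have k1 := h1.const_mul β
      rw [integral_sub (by exact (k1.add h2).add (integrable_const k)) h3,
        integral_add (by exact k1.add h2) (integrable_const k), integral_add k1 h2,
        integral_const_mul]
      simp [r, c]
    have hf0 : ∀ t, 0 ≤ f t := fun t => integral_nonneg fun ω => nn hp _
    have hr0 : ∀ t, 0 ≤ r t := fun t => integral_nonneg fun ω => nn hRb _
    have hc0 : ∀ t, 0 ≤ c t := fun t => integral_nonneg fun ω => add_nonneg (nn hQ _) (nn hR _)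
    have hiff := fun v (hv : 0 ≤ v) => lintegral_Ioi_le_iff hcm
      (fun z => add_nonneg (nn hQ _) (nn hR _)) ic (β := β) (v := v) hv
    refine ⟨fun hK => ?_, fun v hv hJ t ht => ?_⟩
    · refine (hiff _ (add_nonneg (nn hp s) (by positivity))).2 fun t ht => ?_
      have hr00 : ∀ u, r u = 0 := fun u => by simp [r, hK]
      simp only [hr00] at hf
      exact discounted_cost_le hβ hk0 hk hfi hci hf0 hf ht
    · have hfc : ∀ᵐ u, 0 < u → f u ≤ c₀ * c u := by
        have h1 : ∀ N : ℕ, ∀ᵐ u, u ∈ Set.Ioc (0 : ℝ) ((N : ℝ≥0) : ℝ) → f u ≤ c₀ * c u := by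
          intro N
          rw [← ae_restrict_iff' measurableSet_Ioc]
          filter_upwards [(if' N).prod_left_ae, (ic N).prod_left_ae] with u h1 h2
          rw [← integral_const_mul]
          refine integral_mono h1 (h2.const_mul c₀) fun ω => ?_
          refine (hdom _).trans ?_
          have := nn hR (π (X u.toNNReal ω))
          exact mul_le_mul_of_nonneg_left (by linarith) hc₀.le
        filter_upwards [ae_all_iff.2 h1] with u hu h0
        obtain ⟨N, hN⟩ := exists_nat_ge u
        exact hu N ⟨h0, by simpa using hN⟩
      exact le_discounted_cost hβ hk0 hk hfi hci hri hfc hr0 hc0 hc₀.le hf ((hiff v hv).1 hJ) ht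
  have hv0 : ∀ s, 0 ≤ p s s + k / β := fun s => add_nonneg (nn hp s) (by positivity)
  have hlow : ∀ π, Measurable π → ∀ s X, IsClosedLoopSolution C 𝓕 W P π s X →
      ENNReal.ofReal (p s s + k / β) ≤ J π X := by
    intro π hπ s X hX
    by_cases htop : J π X = ∞
    · simp [htop]
    have h1 := (hval π hπ s X hX).2 (J π X).toReal ENNReal.toReal_nonneg
      (by rw [ENNReal.ofReal_toReal htop]) 0 le_rfl
    rw [← ENNReal.ofReal_toReal htop]
    exact ENNReal.ofReal_le_ofReal (by simpa using h1)
  constructor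
  · rintro ⟨hπc, hπm, hopt⟩
    funext s
    obtain ⟨⟨X, hX⟩, hX'⟩ := hopt s
    obtain ⟨Y, hY⟩ := hex s
    have h1 := hX' X hX K hKc.measurable Y hY
    rw [hpay, hpay, EReal.neg_le_neg_iff, EReal.coe_ennreal_le_coe_ennreal_iff] at h1
    have h2 := h1.trans ((hval K hKc.measurable s Y hY).1 fun _ => rfl)
    have h3 := (hval π hπm s X hX).2 _ (hv0 s) h2 1 zero_le_one
    -- the excess vanishes almost everywhere
    have hml := hX.memLp_pair hπm 1
    have hmd : MemLp (fun z : Ω × ℝ => π (X z.2.toNNReal z.1) - K (X z.2.toNNReal z.1)) 2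
        (prodMeasure P 1) :=
      hml.2.sub ((LinearMap.toContinuousLinearMap K).comp_memLp' hml.1)
    have ir := integrable_bilin Rb hmd hmd
    have hexpc : Continuous fun u : ℝ => Real.exp (-β * u) := by fun_prop
    have irr : IntegrableOn (fun u => Real.exp (-β * u) *
          ∫ ω, Rb (π (X u.toNNReal ω) - K (X u.toNNReal ω))
            (π (X u.toNNReal ω) - K (X u.toNNReal ω)) ∂P) (Set.Ioc (0 : ℝ) 1) := by
      have h4 : IntervalIntegrable (fun u => ∫ ω, Rb (π (X u.toNNReal ω) - K (X u.toNNReal ω))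
            (π (X u.toNNReal ω) - K (X u.toNNReal ω)) ∂P) volume 0 1 := by
        rw [intervalIntegrable_iff_integrableOn_Ioc_of_le zero_le_one]
        exact ir.integral_prod_right
      exact (intervalIntegrable_iff_integrableOn_Ioc_of_le zero_le_one).1
        (h4.continuousOn_mul hexpc.continuousOn)
    have hnn : ∀ u : ℝ, 0 ≤ ∫ ω, Rb (π (X u.toNNReal ω) - K (X u.toNNReal ω))
            (π (X u.toNNReal ω) - K (X u.toNNReal ω)) ∂P := fun u =>
      integral_nonneg fun ω => nn hRb _
    have h4 : ∫ u in Set.Ioc (0 : ℝ) 1, Real.exp (-β * u) *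
          ∫ ω, Rb (π (X u.toNNReal ω) - K (X u.toNNReal ω))
            (π (X u.toNNReal ω) - K (X u.toNNReal ω)) ∂P = 0 := by
      refine le_antisymm ?_ (integral_nonneg fun u => mul_nonneg (Real.exp_pos _).le (hnn u))
      rw [← intervalIntegral.integral_of_le zero_le_one]
      linarith
    have h5 := (integral_eq_zero_iff_of_nonneg
      (fun u => mul_nonneg (Real.exp_pos _).le (hnn u)) irr).1 h4
    have h6 : ∀ᵐ u ∂(volume.restrict (Set.Ioc (0 : ℝ) 1)), ∀ᵐ ω ∂P,
        π (X u.toNNReal ω) = K (X u.toNNReal ω) := by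
      filter_upwards [h5, ir.prod_left_ae] with u hu hi
      have hu' := (mul_eq_zero.1 hu).resolve_left (Real.exp_pos _).ne'
      have h7 := (integral_eq_zero_iff_of_nonneg (fun ω => nn hRb _) hi).1 hu'
      filter_upwards [h7] with ω hω
      by_contra hne
      exact (hRb _ (sub_ne_zero.2 hne)).ne' hω
    have hset : MeasurableSet {z : Ω × ℝ | π (X z.2.toNNReal z.1) = K (X z.2.toNNReal z.1)} :=
      measurableSet_eq_fun (hπm.comp hX.measurable_path) (hKc.measurable.comp hX.measurable_path)
    have h7 : ∀ᵐ ω ∂P, ∀ᵐ u ∂(volume.restrict (Set.Ioc (0 : ℝ) 1)),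
        π (X u.toNNReal ω) = K (X u.toNNReal ω) :=
      (Measure.ae_ae_comm hset).2 h6
    obtain ⟨ω, hω, hω0⟩ := (h7.and hX.ae_start).exists
    -- agreement on a set of times accumulating at `0`, hence at `0`
    have hcX : Continuous fun u : ℝ => X u.toNNReal ω :=
      (hX.continuous_paths ω).comp continuous_real_toNNReal
    have hcl : IsClosed {u : ℝ | π (X u.toNNReal ω) = K (X u.toNNReal ω)} :=
      isClosed_eq (hπc.comp hcX) (hKc.comp hcX)
    have h8 : (0 : ℝ) ∈ {u : ℝ | π (X u.toNNReal ω) = K (X u.toNNReal ω)} :=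
by
      refine hcl.closure_subset (Metric.mem_closure_iff.2 fun ε hε => ?_)
      have hpos : 0 < min ε 1 := lt_min hε one_pos
      have hsub : Set.Ioo (0 : ℝ) (min ε 1) ⊆ Set.Ioc 0 1 := fun u hu =>
        ⟨hu.1, hu.2.le.trans (min_le_right _ _)⟩
      have hne : (ae (volume.restrict (Set.Ioo (0 : ℝ) (min ε 1)))).NeBot := by
        rw [ae_neBot, Ne, Measure.restrict_eq_zero, Real.volume_Ioo]
        simpa using hpos
      obtain ⟨u, hu, hmem⟩ := ((ae_restrict_of_ae_restrict_of_subset hsub hω).and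
        (ae_restrict_mem measurableSet_Ioo)).exists
      refine ⟨u, hu, ?_⟩
      rw [dist_comm, Real.dist_0_eq_abs, abs_of_pos hmem.1]
      exact hmem.2.trans_le (min_le_left _ _)
    simpa [hω0] using h8
  · rintro rfl
    refine ⟨hKc, hKc.measurable, fun s => ⟨hex s, fun X hX π' hπ' X' hX' => ?_⟩⟩
    rw [hpay, hpay, EReal.neg_le_neg_iff, EReal.coe_ennreal_le_coe_ennreal_iff]
    exact ((hval K hKc.measurable s X hX).1 fun _ => rfl).trans (hlow π' hπ' s X' hX')

end Verification

/-! ### Solutions under linear feedback: additive noise -/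

section Additive

variable {Ω : Type*} {mΩ : MeasurableSpace Ω} {P : Measure Ω} {𝓕 : Filtration ℝ≥0 mΩ} {d m : ℕ}

theorem measurable_real_path {k : ℕ} {X : ℝ → Ω → EuclideanSpace ℝ (Fin k)}
    (hc : ∀ ω, Continuous fun u => X u ω) (hm : ∀ u, Measurable (X u)) :
    Measurable fun z : Ω × ℝ => X z.2 z.1 :=
  (measurable_uncurry_of_continuous_of_measurable hc hm).comp measurable_swap

/-- Primitives of continuous adapted processes are adapted. -/
theorem measurable_primitive_adapted {k : ℕ} {g : ℝ → Ω → EuclideanSpace ℝ (Fin k)}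
    (hc : ∀ ω, Continuous fun u => g u ω) (hm : ∀ t : ℝ≥0, Measurable[𝓕 t] (g t))
    (hm0 : ∀ u ≤ 0, g u = g 0) (t : ℝ≥0) :
    Measurable[𝓕 t] fun ω => ∫ u in (0 : ℝ)..t, g u ω := by
  have h1 : ∀ u : ℝ, Measurable[𝓕 t] (g (min u t)) := by
    intro u
    rcases le_total u 0 with h | h
    · rw [hm0 _ ((min_le_left _ _).trans h)]
      exact (hm 0).mono (𝓕.mono zero_le) le_rfl
    · lift u to ℝ≥0 using h
      rw [← NNReal.coe_min]
      exact (hm _).mono (𝓕.mono (min_le_right _ _)) le_rfl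
  have h2 := @measurable_uncurry_of_continuous_of_measurable Ω (EuclideanSpace ℝ (Fin k)) ℝ _ _ _ _ _
    _ _ _ _ (𝓕 t) (fun u ω => g (min u t) ω) (fun ω => (hc ω).comp (by fun_prop)) h1
  have h3 := @StronglyMeasurable.integral_prod_left' ℝ Ω (EuclideanSpace ℝ (Fin k)) _ (𝓕 t)
    (volume.restrict (Set.Ioc (0 : ℝ) t)) _ _ _ _ h2.stronglyMeasurable
  have h4 : (fun ω => ∫ u in (0 : ℝ)..t, g u ω)
      = fun ω => ∫ u in Set.Ioc (0 : ℝ) t, g (min u t) ω := by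
    funext ω
    rw [intervalIntegral.integral_of_le t.coe_nonneg]
    refine setIntegral_congr_fun measurableSet_Ioc fun u hu => ?_
    rw [min_eq_left hu.2]
  rw [h4]
  exact h3.measurable

theorem memLp_clm_apply [SFinite P] {T : ℝ≥0} {k l : ℕ}
    {Φ : ℝ → EuclideanSpace ℝ (Fin k) →L[ℝ] EuclideanSpace ℝ (Fin l)} (hΦ : Continuous Φ)
    {f : Ω × ℝ → EuclideanSpace ℝ (Fin k)} (hf : MemLp f 2 (prodMeasure P T)) :
    MemLp (fun z => Φ z.2 (f z)) 2 (prodMeasure P T) := by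
  obtain ⟨c, hc⟩ := (isCompact_Icc (a := (0 : ℝ)) (b := T)).exists_bound_of_continuousOn
    hΦ.continuousOn
  have hm : AEStronglyMeasurable (fun z : Ω × ℝ => Φ z.2 (f z)) (prodMeasure P T) := by
    have h1 : Continuous fun q : (EuclideanSpace ℝ (Fin k) →L[ℝ] EuclideanSpace ℝ (Fin l)) ×
      EuclideanSpace ℝ (Fin k) => q.1 q.2 := by fun_prop
    exact h1.comp_aestronglyMeasurable
      (((hΦ.comp continuous_id).stronglyMeasurable.comp_measurable
        measurable_snd).aestronglyMeasurable.prodMk hf.1)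
  refine hf.of_le_mul (c := c) hm ?_
  filter_upwards [ae_prodMeasure_mem T] with z hz
  exact ((Φ z.2).le_opNorm _).trans
    (mul_le_mul_of_nonneg_right (hc _ ⟨hz.1.le, hz.2⟩) (norm_nonneg _))

theorem IsBrownianMotion.memLp_prodMeasure [IsProbabilityMeasure P] {n : ℕ}
    {W : ℝ≥0 → Ω → EuclideanSpace ℝ (Fin n)} (hW : IsBrownianMotion 𝓕 W P) (T : ℝ≥0) :
    MemLp (fun z : Ω × ℝ => W z.2.toNNReal z.1 - W 0 z.1) 2 (prodMeasure P T) := by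
  refine MemLp.of_eval_piLp fun j => ?_
  have hw := hW.component j
  have hm : Measurable fun z : Ω × ℝ => W z.2.toNNReal z.1 j - W 0 z.1 j := by
    have h1 : Measurable fun z : Ω × ℝ => W z.2.toNNReal z.1 j :=
      (measurable_uncurry_of_continuous_of_measurable hw.continuous_paths hw.measurable).comp
        ((measurable_real_toNNReal.comp measurable_snd).prodMk measurable_fst)
    exact h1.sub ((hw.measurable 0).comp measurable_fst)
  have : MemLp (fun z : Ω × ℝ => W z.2.toNNReal z.1 j - W 0 z.1 j) 2 (prodMeasure P T) := by
    rw [memLp_two_iff_integrable_sq hm.aestronglyMeasurable,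
      integrable_prod_iff' (hm.pow_const 2).aestronglyMeasurable]
    constructor
    · exact Eventually.of_forall fun u => (hw.memLp_inc (zero_le (a := u.toNNReal)) 2).integrable_sq
    · have h1 : ∀ u : ℝ, ∫ ω, ‖(W u.toNNReal ω j - W 0 ω j) ^ 2‖ ∂P = u.toNNReal := by
        intro u
        simp_rw [Real.norm_of_nonneg (sq_nonneg _)]
        rw [hw.integral_inc_sq zero_le, tsub_zero]
      simp_rw [h1]
      have h2 : Continuous fun u : ℝ => ((u.toNNReal : ℝ≥0) : ℝ) := by fun_prop
      exact (intervalIntegrable_iff_integrableOn_Ioc_of_le T.coe_nonneg).1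
        (h2.intervalIntegrable 0 T)
  simpa using this

theorem lintegral_sq_add_sq_lt_top [SFinite P] {T : ℝ≥0} {k l : ℕ}
    {f : Ω × ℝ → EuclideanSpace ℝ (Fin k)} {g : Ω × ℝ → EuclideanSpace ℝ (Fin l)}
    (hf : MemLp f 2 (prodMeasure P T)) (hg : MemLp g 2 (prodMeasure P T)) :
    ∫⁻ ω, (∫⁻ u in Set.Ioc (0 : ℝ) T, (‖f (ω, u)‖ₑ ^ 2 + ‖g (ω, u)‖ₑ ^ 2)) ∂P < ∞ := by
  have key : ∀ {k : ℕ} {f : Ω × ℝ → EuclideanSpace ℝ (Fin k)}, MemLp f 2 (prodMeasure P T) →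
      ∫⁻ z, ‖f z‖ₑ ^ 2 ∂(prodMeasure P T) < ∞ := by
    intro k f hf
    have h1 := hf.2
    rw [eLpNorm_lt_top_iff_lintegral_rpow_enorm_lt_top (by norm_num) (by norm_num)] at h1
    simpa using h1
  rw [← lintegral_prod (fun z => ‖f z‖ₑ ^ 2 + ‖g z‖ₑ ^ 2)
    ((hf.1.enorm.pow_const 2).add (hg.1.enorm.pow_const 2)),
    lintegral_add_left' (hf.1.enorm.pow_const 2)]
  exact ENNReal.add_lt_top.2 ⟨key hf, key hg⟩

theorem exp_add_clm {E : Type*} [NormedAddCommGroup E] [NormedSpace ℝ E] [CompleteSpace E]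
    {S T : E →L[ℝ] E} (h : Commute S T) :
    NormedSpace.exp (S + T) = NormedSpace.exp S * NormedSpace.exp T := by
  let _ : NormedAlgebra ℚ (E →L[ℝ] E) := NormedAlgebra.restrictScalars ℚ ℝ (E →L[ℝ] E)
  exact NormedSpace.exp_add_of_commute h

theorem exp_smul_mul_exp_neg_smul {E : Type*} [NormedAddCommGroup E] [NormedSpace ℝ E]
    [CompleteSpace E] (L : E →L[ℝ] E) (t : ℝ) :
    NormedSpace.exp (t • L) * NormedSpace.exp (-t • L) = 1 := by
  rw [neg_smul, ← exp_add_clm (Commute.refl (t • L)).neg_right, add_neg_cancel,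
    NormedSpace.exp_zero]

theorem exp_zero_smul {E : Type*} [NormedAddCommGroup E] [NormedSpace ℝ E]
    (L : E →L[ℝ] E) : NormedSpace.exp ((0 : ℝ) • L) = 1 := by
  rw [zero_smul, NormedSpace.exp_zero]

/-- Under linear feedback `K` put `L = A + B K`. Variation of constants and integration by parts,
`X t = exp (t L) (s + ∫₀ᵗ exp (-u L) L σ (W u - W 0) du) + σ (W t - W 0)`, express the solution
without a stochastic integral. -/
theorem exists_additive_solution [IsProbabilityMeasure P] {W : ℝ≥0 → Ω → EuclideanSpace ℝ (Fin d)}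
    (hW : IsBrownianMotion 𝓕 W P) (A : Matrix (Fin d) (Fin d) ℝ) (B : Matrix (Fin d) (Fin m) ℝ)
    (σ : ℝ) (Q : Matrix (Fin d) (Fin d) ℝ) (R : Matrix (Fin m) (Fin m) ℝ) (β : ℝ)
    (K : EuclideanSpace ℝ (Fin d) →ₗ[ℝ] EuclideanSpace ℝ (Fin m))
    (s : EuclideanSpace ℝ (Fin d)) :
    ∃ X, IsClosedLoopSolution (additiveLQ A B σ Q R β) 𝓕 W P K s X := by
  set L : EuclideanSpace ℝ (Fin d) →L[ℝ] EuclideanSpace ℝ (Fin d) :=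
    LinearMap.toContinuousLinearMap (A.toEuclideanLin + B.toEuclideanLin ∘ₗ K) with hL
  have hLx : ∀ x, linDrift A B x (K x) = L x := fun x => by simp [linDrift, hL]
  have hKc : Continuous K := K.continuous_of_finiteDimensional
  let b : ℝ → Ω → EuclideanSpace ℝ (Fin d) := fun u ω => σ • (W u.toNNReal ω - W 0 ω)
  let Φ : ℝ → EuclideanSpace ℝ (Fin d) →L[ℝ] EuclideanSpace ℝ (Fin d) := fun u =>
    NormedSpace.exp (u • L)
  let g : ℝ → Ω → EuclideanSpace ℝ (Fin d) := fun u ω => Φ (-u) (L (b u ω))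
  have hΦd : ∀ t, HasDerivAt Φ (L * Φ t) t := fun t => hasDerivAt_exp_smul_const' L t
  have hΦc : Continuous Φ := continuous_iff_continuousAt.2 fun t => (hΦd t).continuousAt
  have hΦn : ∀ t, Φ t * Φ (-t) = 1 := by
    intro t
    exact exp_smul_mul_exp_neg_smul L t
  have hΦ0 : Φ 0 = 1 := exp_zero_smul L
  have hbc : ∀ ω, Continuous fun u => b u ω := fun ω =>
    (((hW.continuous_paths ω).comp continuous_real_toNNReal).sub continuous_const).const_smul σ
  have hbm : ∀ t : ℝ≥0, Measurable[𝓕 t] (b t) := fun t => by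
    have h1 := (hW.adapted t).sub ((hW.adapted 0).mono (𝓕.mono (zero_le (a := t))) le_rfl)
    have h2 : b t = σ • (W t - W 0) := by ext ω; simp [b]
    rw [h2]
    exact h1.const_smul σ
  have hgc : ∀ ω, Continuous fun u => g u ω := fun ω =>
    (hΦc.comp continuous_neg).clm_apply (L.continuous.comp (hbc ω))
  have hgm : ∀ t : ℝ≥0, Measurable[𝓕 t] (g t) := fun t =>
    ((Φ (-t)).continuous.comp L.continuous).measurable.comp (hbm t)
  have hg0 : ∀ u ≤ 0, g u = g 0 := fun u hu => by
    ext1 ω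
    simp [g, b, Real.toNNReal_of_nonpos hu]
  let I : ℝ → Ω → EuclideanSpace ℝ (Fin d) := fun t ω => ∫ u in (0 : ℝ)..t, g u ω
  let X' : ℝ → Ω → EuclideanSpace ℝ (Fin d) := fun t ω => Φ t (s + I t ω) + b t ω
  have hId : ∀ t ω, HasDerivAt (fun t => I t ω) (g t ω) t := fun t ω =>
    intervalIntegral.integral_hasDerivAt_right ((hgc ω).intervalIntegrable _ _)
      ((hgc ω).stronglyMeasurableAtFilter _ _) (hgc ω).continuousAt
  have hIc : ∀ ω, Continuous fun t => I t ω := fun ω =>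
    continuous_iff_continuousAt.2 fun t => (hId t ω).continuousAt
  have hXc : ∀ ω, Continuous fun t => X' t ω := fun ω =>
    (hΦc.clm_apply (continuous_const.add (hIc ω))).add (hbc ω)
  have hIm : ∀ t : ℝ≥0, Measurable[𝓕 t] (I t) := fun t =>
    measurable_primitive_adapted hgc hgm hg0 t
  have hXm : ∀ t : ℝ≥0, Measurable[𝓕 t] (X' t) := fun t =>
    ((Φ t).continuous.measurable.comp ((hIm t).const_add s)).add (hbm t)
  -- the drift equation along each path
  have hpath : ∀ (t : ℝ≥0) ω, X' t ω = s + (∫ u in (0 : ℝ)..t, L (X' u ω)) + b t ω := by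
    intro t ω
    have h1 : ∀ u ∈ Set.uIcc (0 : ℝ) t, HasDerivAt (fun t => Φ t (s + I t ω)) (L (X' u ω)) u := by
      intro u _
      have h2 := (hΦd u).clm_apply ((hId u ω).const_add s)
      refine h2.congr_deriv ?_
      have h3 : Φ u (g u ω) = L (b u ω) := by
        have := congrArg (fun T => T (L (b u ω))) (hΦn u)
        simpa [g] using this
      rw [h3]
      simp [X']
    have h2 := intervalIntegral.integral_eq_sub_of_hasDerivAt h1
      ((L.continuous.comp (hXc ω)).intervalIntegrable _ _)
    rw [h2]
    simp [X', I, hΦ0]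
  -- square integrability
  have hml : ∀ T, MemLp (fun z : Ω × ℝ => X' z.2 z.1) 2 (prodMeasure P T) := by
    intro T
    have hb : MemLp (fun z : Ω × ℝ => b z.2 z.1) 2 (prodMeasure P T) :=
      (hW.memLp_prodMeasure T).const_smul σ
    have hg : MemLp (fun z : Ω × ℝ => g z.2 z.1) 2 (prodMeasure P T) :=
      memLp_clm_apply (Φ := fun u => (Φ (-u)).comp L)
        ((hΦc.comp continuous_neg).clm_comp continuous_const) hb
    have hgmm : Measurable fun z : Ω × ℝ => g z.2 z.1 := by
      refine measurable_real_path hgc fun u => ?_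
      rcases le_total u 0 with h | h
      · rw [hg0 u h]
        exact (hgm 0).mono (𝓕.le _) le_rfl
      · lift u to ℝ≥0 using h
        exact (hgm u).mono (𝓕.le _) le_rfl
    have hI : MemLp (fun z : Ω × ℝ => I z.2 z.1) 2 (prodMeasure P T) := by
      refine MemLp.of_eval_piLp fun i => ?_
      have h1 := memLp_primitive (g := fun z : Ω × ℝ => g z.2 z.1 i)
        ((by fun_prop : Measurable fun x : EuclideanSpace ℝ (Fin d) => x i).comp hgmm)
        (memLp_component hg i)
      have h2 : ∀ z : Ω × ℝ, I z.2 z.1 i = ∫ v in (0 : ℝ)..z.2, g v z.1 i := fun z =>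
        ((EuclideanSpace.proj (𝕜 := ℝ) i :
          EuclideanSpace ℝ (Fin d) →L[ℝ] ℝ).intervalIntegral_comp_comm
            ((hgc z.1).intervalIntegrable _ _)).symm
      rw [funext h2]
      exact h1
    exact (memLp_clm_apply hΦc ((memLp_const s).add hI)).add hb
  refine ⟨fun t ω => X' t ω, ?_, ?_, ?_, ?_⟩
  · exact hXm
  · exact fun ω => (hXc ω).comp NNReal.continuous_coe
  · intro T
    have h1 : ∀ ω, ∫⁻ u in Set.Ioc (0 : ℝ) T, (‖X' u.toNNReal ω‖ₑ ^ 2 + ‖K (X' u.toNNReal ω)‖ₑ ^ 2)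
        = ∫⁻ u in Set.Ioc (0 : ℝ) T, (‖X' u ω‖ₑ ^ 2 + ‖K (X' u ω)‖ₑ ^ 2) := fun ω =>
      setLIntegral_congr_fun measurableSet_Ioc fun u hu => by
        rw [Real.coe_toNNReal _ hu.1.le]
    have h2 : ∫⁻ ω, (∫⁻ u in Set.Ioc (0 : ℝ) T, (‖X' u ω‖ₑ ^ 2 + ‖K (X' u ω)‖ₑ ^ 2)) ∂P < ∞ :=
      lintegral_sq_add_sq_lt_top (f := fun z => X' z.2 z.1) (g := fun z => K (X' z.2 z.1)) (hml T)
        ((LinearMap.toContinuousLinearMap K).comp_memLp' (hml T))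
    exact (lintegral_congr h1).trans_lt h2
  · refine ⟨fun i j t ω => (σ • (1 : Matrix (Fin d) (Fin d) ℝ)) i j * (W t ω j - W 0 ω j),
      fun i j => isItoIntegral_const (hW.component j) _, fun t => Eventually.of_forall fun ω i => ?_⟩
    have h1 := congrArg (fun x : EuclideanSpace ℝ (Fin d) => x i) (hpath t ω)
    have h2 : ∀ i, (∫ u in (0 : ℝ)..t, L (X' u ω)) i = ∫ u in (0 : ℝ)..t, L (X' u ω) i := fun i =>
      ((EuclideanSpace.proj (𝕜 := ℝ) i : EuclideanSpace ℝ (Fin d) →L[ℝ] ℝ).intervalIntegral_comp_comm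
        ((L.continuous.comp (hXc ω)).intervalIntegrable _ _)).symm
    simp only [PiLp.add_apply, h2] at h1
    rw [h1]
    congr 1
    · congr 1
      simp only [additiveLQ, hLx]
      refine intervalIntegral.integral_congr fun u hu => ?_
      rw [Set.uIcc_of_le t.coe_nonneg] at hu
      rw [Real.coe_toNNReal _ hu.1]
    · simp [b, Matrix.one_apply]

end Additive

/-! ### Exponential remainders and Gaussian moments -/

section ExpBounds

variable {E : Type*} [NormedAddCommGroup E] [NormedSpace ℝ E] [CompleteSpace E]

theorem norm_exp_sub_sum_le (T : E →L[ℝ] E) {n : ℕ} (hn : 0 < n) :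
    ‖NormedSpace.exp T - ∑ k ∈ Finset.range n, ((k.factorial : ℝ)⁻¹) • T ^ k‖
      ≤ ‖T‖ ^ n * Real.exp ‖T‖ := by
  have h1 := (hasSum_nat_add_iff' n).2 (NormedSpace.exp_series_hasSum_exp' (𝕂 := ℝ) T)
  have h2 : HasSum (fun k : ℕ => ‖T‖ ^ n * (((k.factorial : ℝ)⁻¹) * ‖T‖ ^ k))
      (‖T‖ ^ n * Real.exp ‖T‖) := by
    have h3 := (NormedSpace.exp_series_hasSum_exp' (𝕂 := ℝ) (‖T‖ : ℝ)).mul_left (‖T‖ ^ n)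
    rw [← Real.exp_eq_exp_ℝ] at h3
    simpa using h3
  refine h1.norm_le_of_bounded h2 fun k => ?_
  rw [norm_smul, norm_inv, Real.norm_natCast]
  have h3 : ‖T ^ (k + n)‖ ≤ ‖T‖ ^ (k + n) := norm_pow_le' T (by omega)
  have h4 : ((k + n).factorial : ℝ)⁻¹ ≤ (k.factorial : ℝ)⁻¹ := by
    apply inv_anti₀ (by positivity)
    exact_mod_cast Nat.factorial_le (Nat.le_add_right k n)
  calc _ ≤ (k.factorial : ℝ)⁻¹ * ‖T‖ ^ (k + n) := by gcongr
    _ = _ := by rw [pow_add]; ring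

/-- The exponent of the fundamental solution of `dX = L X dt + c L X dw`, over a time step `h` with
Brownian increment `z`. -/
noncomputable def gbmExponent (L : E →L[ℝ] E) (c h z : ℝ) : E →L[ℝ] E :=
  z • (c • L) + h • (L - (c ^ 2 / 2) • (L * L))

/-- A constant controlling the operators in `gbmExponent`. -/
noncomputable def gbmConst (L : E →L[ℝ] E) (c : ℝ) : ℝ :=
  ‖c • L‖ + ‖L - (c ^ 2 / 2) • (L * L)‖

variable (L : E →L[ℝ] E) (c : ℝ)

theorem gbmConst_nonneg {E : Type*} [NormedAddCommGroup E] [NormedSpace ℝ E] (L : E →L[ℝ] E)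
    (c : ℝ) : 0 ≤ gbmConst L c := by unfold gbmConst; positivity

theorem norm_gbmExponent_le {E : Type*} [NormedAddCommGroup E] [NormedSpace ℝ E] (L : E →L[ℝ] E)
    (c : ℝ) {h : ℝ} (hh : 0 ≤ h) (z : ℝ) :
    ‖gbmExponent L c h z‖ ≤ gbmConst L c * (|z| + h) := by
  unfold gbmExponent gbmConst
  refine (norm_add_le _ _).trans ?_
  rw [norm_smul z, norm_smul h, Real.norm_eq_abs, Real.norm_of_nonneg hh]
  nlinarith [norm_nonneg (c • L), norm_nonneg (L - (c ^ 2 / 2) • (L * L)), abs_nonneg z]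

theorem commute_gbmExponent {E : Type*} [NormedAddCommGroup E] [NormedSpace ℝ E] (L : E →L[ℝ] E)
    (c h z h' z' : ℝ) : Commute (gbmExponent L c h z) (gbmExponent L c h' z') := by
  have hL : Commute L (L - (c ^ 2 / 2) • (L * L)) :=
    (Commute.refl L).sub_right (((Commute.refl L).mul_right (Commute.refl L)).smul_right _)
  have key : ∀ a b a' b' : ℝ, Commute (a • L + b • (L - (c ^ 2 / 2) • (L * L)))
      (a' • L + b' • (L - (c ^ 2 / 2) • (L * L))) := fun a b a' b' =>
    Commute.add_right
      ((((Commute.refl L).smul_right _).smul_left _).add_left ((hL.symm.smul_right _).smul_left _))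
      (((hL.smul_right _).smul_left _).add_left (((Commute.refl _).smul_right _).smul_left _))
  have h1 := key (z * c) h (z' * c) h'
  rwa [← smul_smul, ← smul_smul] at h1

theorem exp_gbmExponent_add (h z h' z' : ℝ) :
    NormedSpace.exp (gbmExponent L c (h + h') (z + z'))
      = NormedSpace.exp (gbmExponent L c h z) * NormedSpace.exp (gbmExponent L c h' z') := by
  rw [← exp_add_clm (commute_gbmExponent L c h z h' z')]
  congr 1
  unfold gbmExponent
  rw [add_smul, add_smul]
  abel

theorem norm_exp_gbmExponent_sub_le {h : ℝ} (hh : 0 ≤ h) (z : ℝ) (x : E) :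
    ‖NormedSpace.exp (gbmExponent L c h z) x - x‖
      ≤ gbmConst L c * (|z| + h) * Real.exp (gbmConst L c * (|z| + h)) * ‖x‖ := by
  have h1 := norm_exp_sub_sum_le (gbmExponent L c h z) one_pos
  simp only [Finset.range_one, Finset.sum_singleton, Nat.factorial_zero, Nat.cast_one, inv_one,
    pow_zero, one_smul, pow_one] at h1
  have h2 := norm_gbmExponent_le L c hh z
  have h3 := ((NormedSpace.exp (gbmExponent L c h z) - 1).le_opNorm x).trans
    (mul_le_mul_of_nonneg_right h1 (norm_nonneg x))
  have h4 : 0 ≤ gbmConst L c * (|z| + h) := (norm_nonneg _).trans h2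
  refine le_trans (by simpa using h3) ?_
  gcongr

theorem norm_exp_gbmExponent_le {h : ℝ} (hh : 0 ≤ h) (z : ℝ) (x : E) :
    ‖NormedSpace.exp (gbmExponent L c h z) x‖
      ≤ Real.exp (2 * gbmConst L c * (|z| + h)) * ‖x‖ := by
  have h1 := norm_exp_gbmExponent_sub_le L c hh z x
  have h2 := norm_le_norm_add_norm_sub' (NormedSpace.exp (gbmExponent L c h z) x) x
  set y := gbmConst L c * (|z| + h) with hy
  have hy0 : 0 ≤ y := mul_nonneg (gbmConst_nonneg L c) (by positivity)
  have h3 : 1 + y * Real.exp y ≤ Real.exp (2 * gbmConst L c * (|z| + h)) := by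
    have e1 : 2 * gbmConst L c * (|z| + h) = y + y := by rw [hy]; ring
    rw [e1, Real.exp_add]
    have e2 := Real.add_one_le_exp y
    have e3 : 1 ≤ Real.exp y := Real.one_le_exp hy0
    nlinarith
  calc _ ≤ ‖x‖ + y * Real.exp y * ‖x‖ := h2.trans (by gcongr)
    _ = (1 + y * Real.exp y) * ‖x‖ := by ring
    _ ≤ _ := by gcongr

/-- One step of the Itô-Taylor expansion. -/
theorem norm_exp_gbmExponent_remainder_le {h : ℝ} (hh : 0 ≤ h) (z : ℝ) (x : E) :
    ‖NormedSpace.exp (gbmExponent L c h z) x - x - h • L x - z • (c • L) x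
        - ((z ^ 2 - h) / 2) • (c • L) ((c • L) x)‖
      ≤ (gbmConst L c ^ 3 * ((|z| + h) ^ 3 * Real.exp (gbmConst L c * (|z| + h)))
        + gbmConst L c ^ 2 * (h * (|z| + h))) * ‖x‖ := by
  have h1 := norm_exp_sub_sum_le (gbmExponent L c h z) three_pos
  set θ := gbmConst L c with hθ
  set y := |z| + h with hy
  set T := gbmExponent L c h z with hT
  have hθ0 : 0 ≤ θ := gbmConst_nonneg L c
  have hy0 : 0 ≤ y := by positivity
  have h2 : ‖T‖ ≤ θ * y := norm_gbmExponent_le L c hh z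
  set N := c • L with hN
  set L' := L - (c ^ 2 / 2) • (L * L) with hL'
  have hNθ : ‖N‖ ≤ θ := by rw [hθ]; unfold gbmConst; linarith [norm_nonneg L']
  have hLθ : ‖L'‖ ≤ θ := by rw [hθ]; unfold gbmConst; linarith [norm_nonneg N]
  have hNN : N * N = c ^ 2 • (L * L) := by
    rw [hN, smul_mul_smul_comm, sq]
  have hTe : T = z • N + h • L' := rfl
  -- the second-order terms which do not belong to the Itô-Taylor expansion
  have e1 : NormedSpace.exp T x - x - h • L x - z • N x - ((z ^ 2 - h) / 2) • N (N x)
      = (NormedSpace.exp T - ∑ k ∈ Finset.range 3, ((k.factorial : ℝ)⁻¹) • T ^ k) x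
        + ((1 / 2 : ℝ) • ((z * h) • (N * L' + L' * N) + h ^ 2 • (L' * L'))) x := by
    have e2 : N (N x) = c ^ 2 • L (L x) := congrArg (fun S : E →L[ℝ] E => S x) hNN
    have e3 : L' x = L x - (1 / 2 : ℝ) • N (N x) := by
      rw [e2, hL']; simp [smul_smul]; ring_nf
    have e4 : T x = z • N x + h • L x - (h / 2) • N (N x) := by
      rw [hTe]; simp only [add_apply, smul_apply, e3]; module
    have e5 : T (T x) = z ^ 2 • N (N x) + (z * h) • (N (L' x) + L' (N x)) + h ^ 2 • L' (L' x) := by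
      rw [hTe]
      simp only [add_apply, smul_apply, map_add, map_smul]
      module
    have e6 : (NormedSpace.exp T - ∑ k ∈ Finset.range 3, ((k.factorial : ℝ)⁻¹) • T ^ k) x
        = NormedSpace.exp T x - x - T x - (1 / 2 : ℝ) • T (T x) := by
      simp [Finset.sum_range_succ, pow_two, Nat.factorial]
      abel
    have e7 : ((1 / 2 : ℝ) • ((z * h) • (N * L' + L' * N) + h ^ 2 • (L' * L'))) x
        = (1 / 2 : ℝ) • ((z * h) • (N (L' x) + L' (N x)) + h ^ 2 • L' (L' x)) := by simp
    rw [e6, e7, e5, e4]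
    module
  have h3 : ‖(1 / 2 : ℝ) • ((z * h) • (N * L' + L' * N) + h ^ 2 • (L' * L'))‖
      ≤ θ ^ 2 * (h * y) := by
    rw [norm_smul]
    have k1 : ‖N * L' + L' * N‖ ≤ 2 * θ ^ 2 := by
      refine (norm_add_le _ _).trans ?_
      have := (norm_mul_le N L').trans (mul_le_mul hNθ hLθ (norm_nonneg _) hθ0)
      have := (norm_mul_le L' N).trans (mul_le_mul hLθ hNθ (norm_nonneg _) hθ0)
      nlinarith
    have k2 : ‖L' * L'‖ ≤ θ ^ 2 := by
      have := (norm_mul_le L' L').trans (mul_le_mul hLθ hLθ (norm_nonneg _) hθ0)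
      nlinarith
    have k3 : ‖(z * h) • (N * L' + L' * N) + h ^ 2 • (L' * L')‖
        ≤ |z| * h * (2 * θ ^ 2) + h ^ 2 * θ ^ 2 := by
      refine (norm_add_le _ _).trans ?_
      rw [norm_smul, norm_smul, Real.norm_eq_abs, abs_mul, abs_of_nonneg hh,
        Real.norm_of_nonneg (sq_nonneg h)]
      gcongr
    have k4 : 0 ≤ h ^ 2 * θ ^ 2 := by positivity
    have : ‖(1 / 2 : ℝ)‖ = 1 / 2 := by norm_num
    rw [this]
    rw [hy]
    nlinarith
  rw [e1]
  refine (norm_add_le _ _).trans ?_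
  rw [add_mul]
  refine add_le_add (((ContinuousLinearMap.le_opNorm _ x)).trans ?_)
    (((ContinuousLinearMap.le_opNorm _ x)).trans (by gcongr))
  gcongr
  refine h1.trans ?_
  calc ‖T‖ ^ 3 * Real.exp ‖T‖ ≤ (θ * y) ^ 3 * Real.exp (θ * y) := by gcongr
    _ = _ := by ring

end ExpBounds

/-- Gaussian moments with exponential weights scale like powers of the standard deviation. -/
theorem exists_gaussian_moment_bound (p : ℕ) {c : ℝ} (hc : 0 ≤ c) (V : ℝ) :
    ∃ C : ℝ, 0 ≤ C ∧ ∀ v : ℝ≥0, (v : ℝ) ≤ V →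
      ∫⁻ x, ENNReal.ofReal ((|x| + v) ^ p * Real.exp (c * (|x| + v))) ∂(gaussianReal 0 v)
        ≤ ENNReal.ofReal (C * Real.sqrt v ^ p) := by
  set a := Real.sqrt V with ha
  have ha0 : 0 ≤ a := Real.sqrt_nonneg _
  set e := c * a + 1 with he
  have he0 : 0 ≤ e := by positivity
  let F : ℝ → ℝ := fun g => p.factorial * Real.exp (e * a) * (Real.exp (e * g) + Real.exp (-e * g))
  have hF : Integrable F (gaussianReal 0 1) :=
    ((integrable_exp_mul_gaussianReal e).add (integrable_exp_mul_gaussianReal (-e))).const_mul _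
  have hF0 : ∀ g, 0 ≤ F g := fun g => by positivity
  refine ⟨∫ g, F g ∂(gaussianReal 0 1), integral_nonneg hF0, fun v hv => ?_⟩
  have hmap : gaussianReal 0 v = (gaussianReal 0 1).map (fun g => Real.sqrt v * g) := by
    rw [gaussianReal_map_const_mul]
    congr 1
    · simp
    · ext; simp [Real.sq_sqrt]
  have hm : Measurable fun x : ℝ => ENNReal.ofReal ((|x| + v) ^ p * Real.exp (c * (|x| + v))) := by
    fun_prop
  rw [hmap, lintegral_map hm (by fun_prop)]
  have hpt : ∀ g : ℝ, (|Real.sqrt v * g| + v) ^ p * Real.exp (c * (|Real.sqrt v * g| + v))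
      ≤ F g * Real.sqrt v ^ p := by
    intro g
    have hsv : Real.sqrt v ≤ a := Real.sqrt_le_sqrt hv
    have hs0 := Real.sqrt_nonneg (v : ℝ)
    have e1 : |Real.sqrt v * g| + v = Real.sqrt v * (|g| + Real.sqrt v) := by
      rw [abs_mul, abs_of_nonneg hs0, mul_add, Real.mul_self_sqrt v.coe_nonneg]
    set y := |g| + a with hy
    have hy0 : 0 ≤ y := by positivity
    have e2 : |Real.sqrt v * g| + v ≤ Real.sqrt v * y := by rw [e1, hy]; gcongr
    have e3 : |Real.sqrt v * g| + v ≤ a * y := e2.trans (by gcongr)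
    have e4 : y ^ p ≤ p.factorial * Real.exp y := by
      have := Real.pow_div_factorial_le_exp y hy0 p
      rwa [div_le_iff₀' (by positivity)] at this
    have e5 : Real.exp y * Real.exp (c * (a * y)) ≤ Real.exp (e * a) *
        (Real.exp (e * g) + Real.exp (-e * g)) := by
      rw [← Real.exp_add]
      have : y + c * (a * y) = e * a + e * |g| := by rw [hy, he]; ring
      rw [this, Real.exp_add]
      gcongr
      rcases abs_cases g with ⟨h, -⟩ | ⟨h, -⟩
      · rw [h]; linarith [Real.exp_pos (-e * g)]
      · rw [h, mul_neg, ← neg_mul]; linarith [Real.exp_pos (e * g)]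
    calc (|Real.sqrt v * g| + v) ^ p * Real.exp (c * (|Real.sqrt v * g| + v))
        ≤ (Real.sqrt v * y) ^ p * Real.exp (c * (a * y)) := by gcongr
      _ = y ^ p * Real.exp (c * (a * y)) * Real.sqrt v ^ p := by rw [mul_pow]; ring
      _ ≤ (p.factorial * Real.exp y) * Real.exp (c * (a * y)) * Real.sqrt v ^ p := by gcongr
      _ = p.factorial * (Real.exp y * Real.exp (c * (a * y))) * Real.sqrt v ^ p := by ring
      _ ≤ p.factorial * (Real.exp (e * a) * (Real.exp (e * g) + Real.exp (-e * g)))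
          * Real.sqrt v ^ p := by gcongr
      _ = _ := by simp only [F]; ring
  calc _ ≤ ∫⁻ g, ENNReal.ofReal (F g * Real.sqrt v ^ p) ∂(gaussianReal 0 1) :=
        lintegral_mono fun g => ENNReal.ofReal_le_ofReal (hpt g)
    _ = ENNReal.ofReal (∫ g, F g * Real.sqrt v ^ p ∂(gaussianReal 0 1)) :=
        (ofReal_integral_eq_lintegral_ofReal (hF.mul_const _)
          (Eventually.of_forall fun g => by positivity)).symm
    _ = _ := by rw [integral_mul_const]

theorem IsScalarBM.exists_moment_bound {Ω : Type*} {mΩ : MeasurableSpace Ω} {P : Measure Ω}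
    {𝓕 : Filtration ℝ≥0 mΩ} {w : ℝ≥0 → Ω → ℝ} (hw : IsScalarBM 𝓕 w P) (p : ℕ) {c : ℝ}
    (hc : 0 ≤ c) (V : ℝ) :
    ∃ C : ℝ, 0 ≤ C ∧ ∀ a b : ℝ≥0, a ≤ b → (b : ℝ) ≤ V →
      ∫⁻ ω, ENNReal.ofReal ((|w b ω - w a ω| + (b - a)) ^ p *
        Real.exp (c * (|w b ω - w a ω| + (b - a)))) ∂P
        ≤ ENNReal.ofReal (C * Real.sqrt (b - a) ^ p) := by
  obtain ⟨C, hC, h⟩ := exists_gaussian_moment_bound p hc V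
  refine ⟨C, hC, fun a b hab hb => ?_⟩
  have e : ((b - a : ℝ≥0) : ℝ) = b - a := NNReal.coe_sub hab
  have h1 := h (b - a) (by rw [e]; linarith [a.coe_nonneg])
  rw [← hw.increment_law a b hab, lintegral_map (by fun_prop) (hw.measurable_inc a b), e] at h1
  exact h1

/-! ### Geometric Brownian motion -/

section Geometric

variable {Ω : Type*} {mΩ : MeasurableSpace Ω} {P : Measure Ω} {𝓕 : Filtration ℝ≥0 mΩ} {d : ℕ}
  {w : ℝ≥0 → Ω → ℝ}

theorem eLpNorm_two_le_iff {E : Type*} [NormedAddCommGroup E] {f : Ω → E} {c : ℝ} (hc : 0 ≤ c) :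
    eLpNorm f 2 P ≤ ENNReal.ofReal c ↔ ∫⁻ ω, ‖f ω‖ₑ ^ 2 ∂P ≤ ENNReal.ofReal (c ^ 2) := by
  rw [eLpNorm_eq_lintegral_rpow_enorm_toReal (by norm_num) (by norm_num), ENNReal.ofReal_pow hc,
    ← ENNReal.rpow_natCast (ENNReal.ofReal c)]
  simp only [ENNReal.toReal_ofNat, Nat.cast_ofNat]
  rw [one_div, ENNReal.rpow_inv_le_iff (by norm_num)]
  simp

/-- The explicit solution `exp (w c L + t (L - c² L² / 2)) s` of `dX = L X dt + c L X dw`. -/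
noncomputable def geometricBM (L : EuclideanSpace ℝ (Fin d) →L[ℝ] EuclideanSpace ℝ (Fin d)) (c : ℝ)
    (w : ℝ≥0 → Ω → ℝ) (s : EuclideanSpace ℝ (Fin d)) (t : ℝ≥0) (ω : Ω) :
    EuclideanSpace ℝ (Fin d) :=
  NormedSpace.exp (gbmExponent L c t (w t ω - w 0 ω)) s

variable (L : EuclideanSpace ℝ (Fin d) →L[ℝ] EuclideanSpace ℝ (Fin d)) (c : ℝ)
  (s : EuclideanSpace ℝ (Fin d))

theorem geometricBM_eq (a b : ℝ≥0) (ω : Ω) :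
    geometricBM L c w s b ω
      = NormedSpace.exp (gbmExponent L c (b - a) (w b ω - w a ω)) (geometricBM L c w s a ω) := by
  unfold geometricBM
  rw [← mul_apply_eq_comp, ← exp_gbmExponent_add]
  congr 3 <;> ring

theorem geometricBM_zero (ω : Ω) : geometricBM L c w s 0 ω = s := by
  have h : gbmExponent L c ((0 : ℝ≥0) : ℝ) (w 0 ω - w 0 ω) = 0 := by simp [gbmExponent]
  unfold geometricBM
  rw [h, NormedSpace.exp_zero]
  rfl

theorem continuous_exp_gbmExponent :
    Continuous fun q : ℝ × ℝ => NormedSpace.exp (gbmExponent L c q.1 q.2) s := by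
  let _ : NormedAlgebra ℚ (EuclideanSpace ℝ (Fin d) →L[ℝ] EuclideanSpace ℝ (Fin d)) :=
    NormedAlgebra.restrictScalars ℚ ℝ _
  have h1 : Continuous fun q : ℝ × ℝ => gbmExponent L c q.1 q.2 :=
    (continuous_snd.smul continuous_const).add (continuous_fst.smul continuous_const)
  exact (NormedSpace.exp_continuous.comp h1).clm_apply continuous_const

variable {L c s}

theorem continuous_geometricBM (hw : IsScalarBM 𝓕 w P) (ω : Ω) :
    Continuous fun t => geometricBM L c w s t ω := by
  have h1 := (continuous_exp_gbmExponent L c s).comp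
    (NNReal.continuous_coe.prodMk ((hw.continuous_paths ω).sub (continuous_const (y := w 0 ω))))
  exact h1

theorem measurable_geometricBM (hw : IsScalarBM 𝓕 w P) (t : ℝ≥0) :
    Measurable[𝓕 t] (geometricBM L c w s t) := by
  have h0 : Measurable[𝓕 t] fun ω => w t ω - w 0 ω :=
    (hw.adapted t).sub ((hw.adapted 0).mono (𝓕.mono zero_le) le_rfl)
  have h1 : Measurable[𝓕 t] fun ω => ((t : ℝ), w t ω - w 0 ω) :=
    Measurable.prodMk measurable_const h0
  have h2 := Measurable.comp (continuous_exp_gbmExponent L c s).measurable h1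
  exact h2

/-- A Brownian increment is independent of the past, so weighted second moments factor. -/
theorem lintegral_sq_le_of_norm_le (hw : IsScalarBM 𝓕 w P) {a b : ℝ≥0} (hab : a ≤ b)
    {E : Type*} [NormedAddCommGroup E] {f : Ω → E} {Y : Ω → EuclideanSpace ℝ (Fin d)}
    (hY : Measurable[𝓕 a] Y) {φ : ℝ → ℝ} (hφ : Measurable φ)
    (hf : ∀ ω, ‖f ω‖ ≤ φ (w b ω - w a ω) * ‖Y ω‖) (q : ℕ) :
    ∫⁻ ω, ‖f ω‖ₑ ^ q ∂P
      ≤ (∫⁻ ω, ENNReal.ofReal (|φ (w b ω - w a ω)| ^ q) ∂P) * ∫⁻ ω, ‖Y ω‖ₑ ^ q ∂P := by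
  have h1 : IndepFun (fun ω => ENNReal.ofReal (|φ (w b ω - w a ω)| ^ q)) (fun ω => ‖Y ω‖ₑ ^ q) P :=
    (hw.indepFun hab hY).symm.comp
      (φ := fun z => ENNReal.ofReal (|φ z| ^ q)) (ψ := fun y => ‖y‖ₑ ^ q)
      (by fun_prop) (by fun_prop)
  have hY' : Measurable Y := hY.mono (𝓕.le a) le_rfl
  have h2 := lintegral_mul_eq_lintegral_mul_lintegral_of_indepFun
    (μ := P) (f := fun ω => ENNReal.ofReal (|φ (w b ω - w a ω)| ^ q)) (g := fun ω => ‖Y ω‖ₑ ^ q)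
    (by have := hw.measurable_inc a b; fun_prop) (by fun_prop) h1
  rw [← h2]
  refine lintegral_mono fun ω => ?_
  simp only [Pi.mul_apply]
  rw [ENNReal.ofReal_pow (abs_nonneg _), ← mul_pow]
  gcongr
  rw [← ofReal_norm, ← ofReal_norm, ← ENNReal.ofReal_mul (abs_nonneg _)]
  exact ENNReal.ofReal_le_ofReal ((hf ω).trans
    (mul_le_mul_of_nonneg_right (le_abs_self _) (norm_nonneg _)))

theorem exists_geometricBM_moment (hw : IsScalarBM 𝓕 w P) (q : ℕ) (V : ℝ) :
    ∃ C : ℝ, 0 ≤ C ∧ ∀ t : ℝ≥0, (t : ℝ) ≤ V →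
      ∫⁻ ω, ‖geometricBM L c w s t ω‖ₑ ^ q ∂P ≤ ENNReal.ofReal C := by
  have hθ := gbmConst_nonneg L c
  obtain ⟨C, hC, h⟩ := hw.exists_moment_bound 0 (c := q * (2 * gbmConst L c)) (by positivity) V
  refine ⟨C * ‖s‖ ^ q, by positivity, fun t ht => ?_⟩
  have h1 := h 0 t zero_le ht
  simp only [pow_zero, one_mul, mul_one, NNReal.coe_zero, sub_zero] at h1
  have h2 : ∀ ω, ‖geometricBM L c w s t ω‖ₑ ^ q
      ≤ ENNReal.ofReal (Real.exp (q * (2 * gbmConst L c) * (|w t ω - w 0 ω| + t)))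
        * ENNReal.ofReal (‖s‖ ^ q) := by
    intro ω
    rw [← ofReal_norm, ← ENNReal.ofReal_pow (norm_nonneg _), ← ENNReal.ofReal_mul (by positivity)]
    refine ENNReal.ofReal_le_ofReal ?_
    calc ‖geometricBM L c w s t ω‖ ^ q
        ≤ (Real.exp (2 * gbmConst L c * (|w t ω - w 0 ω| + t)) * ‖s‖) ^ q := by
          gcongr
          exact norm_exp_gbmExponent_le L c t.coe_nonneg _ s
      _ = _ := by rw [mul_pow, ← Real.exp_nat_mul]; ring_nf
  calc _ ≤ ∫⁻ ω, ENNReal.ofReal (Real.exp (q * (2 * gbmConst L c) * (|w t ω - w 0 ω| + t)))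
        * ENNReal.ofReal (‖s‖ ^ q) ∂P := lintegral_mono h2
    _ = (∫⁻ ω, ENNReal.ofReal (Real.exp (q * (2 * gbmConst L c) * (|w t ω - w 0 ω| + t))) ∂P)
        * ENNReal.ofReal (‖s‖ ^ q) := lintegral_mul_const' _ _ ENNReal.ofReal_ne_top
    _ ≤ ENNReal.ofReal C * ENNReal.ofReal (‖s‖ ^ q) := by gcongr
    _ = _ := (ENNReal.ofReal_mul hC).symm

/-- The increments over a time step `h` are of order `√h` in mean square. -/
theorem exists_geometricBM_increment (hw : IsScalarBM 𝓕 w P) (V : ℝ) :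
    ∃ C : ℝ, 0 ≤ C ∧ ∀ a b : ℝ≥0, a ≤ b → (b : ℝ) ≤ V →
      ∫⁻ ω, ‖geometricBM L c w s b ω - geometricBM L c w s a ω‖ₑ ^ 2 ∂P
        ≤ ENNReal.ofReal (C * (b - a)) := by
  have hθ := gbmConst_nonneg L c
  set θ := gbmConst L c with hθd
  obtain ⟨C, hC, h⟩ := hw.exists_moment_bound 2 (c := 2 * θ) (by positivity) V
  obtain ⟨D, hD, hX⟩ := exists_geometricBM_moment (L := L) (c := c) (s := s) hw 2 V
  refine ⟨θ ^ 2 * C * D, by positivity, fun a b hab hb => ?_⟩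
  have hba : 0 ≤ (b : ℝ) - a := sub_nonneg.2 hab
  have h1 := lintegral_sq_le_of_norm_le hw hab (measurable_geometricBM (L := L) (c := c) (s := s) hw a)
    (f := fun ω => geometricBM L c w s b ω - geometricBM L c w s a ω)
    (φ := fun z => θ * (|z| + (b - a)) * Real.exp (θ * (|z| + (b - a))))
    (by fun_prop) (fun ω => by
      rw [geometricBM_eq L c s a b]
      exact norm_exp_gbmExponent_sub_le L c hba _ _) 2
  refine h1.trans ?_
  have h2 : ∀ z : ℝ, |θ * (|z| + (b - a)) * Real.exp (θ * (|z| + (b - a)))| ^ 2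
      = θ ^ 2 * ((|z| + (b - a)) ^ 2 * Real.exp (2 * θ * (|z| + (b - a)))) := by
    intro z
    rw [sq_abs, mul_pow, mul_pow, ← Real.exp_nat_mul]
    push_cast
    ring_nf
  simp_rw [h2, ENNReal.ofReal_mul (sq_nonneg θ)]
  rw [lintegral_const_mul' _ _ ENNReal.ofReal_ne_top]
  have hle : (a : ℝ) ≤ V := le_trans (by exact_mod_cast hab) hb
  calc _ ≤ ENNReal.ofReal (θ ^ 2) * ENNReal.ofReal (C * Real.sqrt (b - a) ^ 2)
        * ENNReal.ofReal D := by
        gcongr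
        · exact h a b hab hb
        · exact hX a hle
    _ = _ := by
        rw [← ENNReal.ofReal_mul (by positivity), ← ENNReal.ofReal_mul (by positivity),
          Real.sq_sqrt hba]
        ring_nf

/-- The mean-square size of the Itô-Taylor remainder over one step is cubic in the step. -/
theorem exists_geometricBM_remainder (hw : IsScalarBM 𝓕 w P) (V : ℝ) :
    ∃ C : ℝ, 0 ≤ C ∧ ∀ a b : ℝ≥0, a ≤ b → (b : ℝ) ≤ V →
      ∫⁻ ω, ‖geometricBM L c w s b ω - geometricBM L c w s a ω
        - ((b : ℝ) - a) • L (geometricBM L c w s a ω)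
        - (w b ω - w a ω) • (c • L) (geometricBM L c w s a ω)
        - (((w b ω - w a ω) ^ 2 - ((b : ℝ) - a)) / 2) •
          (c • L) ((c • L) (geometricBM L c w s a ω))‖ₑ ^ 2 ∂P
        ≤ ENNReal.ofReal (C * (b - a) ^ 3) := by
  have hθ := gbmConst_nonneg L c
  set θ := gbmConst L c with hθd
  obtain ⟨C6, hC6, h6⟩ := hw.exists_moment_bound 6 (c := 2 * θ) (by positivity) V
  obtain ⟨C2, hC2, h2⟩ := hw.exists_moment_bound 2 (c := 0) le_rfl V
  obtain ⟨D, hD, hX⟩ := exists_geometricBM_moment (L := L) (c := c) (s := s) hw 2 V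
  refine ⟨(2 * θ ^ 6 * C6 + 2 * θ ^ 4 * C2) * D, by positivity, fun a b hab hb => ?_⟩
  have hba : 0 ≤ (b : ℝ) - a := sub_nonneg.2 hab
  set h := (b : ℝ) - a with hh
  have h1 := lintegral_sq_le_of_norm_le hw hab (measurable_geometricBM (L := L) (c := c) (s := s) hw a)
    (f := fun ω => geometricBM L c w s b ω - geometricBM L c w s a ω
        - h • L (geometricBM L c w s a ω)
        - (w b ω - w a ω) • (c • L) (geometricBM L c w s a ω)
        - (((w b ω - w a ω) ^ 2 - h) / 2) •
          (c • L) ((c • L) (geometricBM L c w s a ω)))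
    (φ := fun z => θ ^ 3 * ((|z| + h) ^ 3 * Real.exp (θ * (|z| + h))) + θ ^ 2 * (h * (|z| + h)))
    (by fun_prop) (fun ω => by
      rw [geometricBM_eq L c s a b]
      exact norm_exp_gbmExponent_remainder_le L c hba _ _) 2
  refine h1.trans ?_
  have h3 : ∀ z : ℝ, ENNReal.ofReal (|θ ^ 3 * ((|z| + h) ^ 3 * Real.exp (θ * (|z| + h)))
        + θ ^ 2 * (h * (|z| + h))| ^ 2)
      ≤ ENNReal.ofReal (2 * θ ^ 6) * ENNReal.ofReal ((|z| + h) ^ 6 * Real.exp (2 * θ * (|z| + h)))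
        + ENNReal.ofReal (2 * θ ^ 4 * h ^ 2) *
          ENNReal.ofReal ((|z| + h) ^ 2 * Real.exp (0 * (|z| + h))) := by
    intro z
    rw [← ENNReal.ofReal_mul (by positivity), ← ENNReal.ofReal_mul (by positivity),
      ← ENNReal.ofReal_add (by positivity) (by positivity)]
    refine ENNReal.ofReal_le_ofReal ?_
    rw [sq_abs, zero_mul, Real.exp_zero, mul_one]
    have e1 : Real.exp (2 * θ * (|z| + h)) = Real.exp (θ * (|z| + h)) ^ 2 := by
      rw [← Real.exp_nat_mul]; push_cast; ring_nf
    rw [e1]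
    nlinarith [sq_nonneg (θ ^ 3 * ((|z| + h) ^ 3 * Real.exp (θ * (|z| + h)))
      - θ ^ 2 * (h * (|z| + h)))]
  have hle : (a : ℝ) ≤ V := le_trans (by exact_mod_cast hab) hb
  have hm := hw.measurable_inc a b
  calc _ ≤ (ENNReal.ofReal (2 * θ ^ 6) * ENNReal.ofReal (C6 * Real.sqrt h ^ 6)
        + ENNReal.ofReal (2 * θ ^ 4 * h ^ 2) * ENNReal.ofReal (C2 * Real.sqrt h ^ 2))
        * ENNReal.ofReal D := by
        gcongr
        · refine (lintegral_mono fun ω => h3 (w b ω - w a ω)).trans ?_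
          rw [lintegral_add_left (by fun_prop), lintegral_const_mul' _ _ ENNReal.ofReal_ne_top,
            lintegral_const_mul' _ _ ENNReal.ofReal_ne_top]
          gcongr
          · exact h6 a b hab hb
          · exact h2 a b hab hb
        · exact hX a hle
    _ = _ := by
        have e6 : Real.sqrt h ^ 6 = h ^ 3 := by
          rw [show (6 : ℕ) = 2 * 3 from rfl, pow_mul, Real.sq_sqrt hba]
        rw [e6, Real.sq_sqrt hba, ← ENNReal.ofReal_mul (by positivity),
          ← ENNReal.ofReal_mul (by positivity), ← ENNReal.ofReal_add (by positivity)
          (by positivity), ← ENNReal.ofReal_mul (by positivity)]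
        ring_nf

end Geometric

/-! ### The Itô equation of geometric Brownian motion -/

section GeometricEquation

variable {Ω : Type*} {mΩ : MeasurableSpace Ω} {P : Measure Ω} {𝓕 : Filtration ℝ≥0 mΩ} {d : ℕ}
  {w : ℝ≥0 → Ω → ℝ}

/-- Minkowski's integral inequality for second moments, with a uniform bound on the integrand. -/
theorem lintegral_enorm_intervalIntegral_sq_le [IsProbabilityMeasure P] {E : Type*}
    [NormedAddCommGroup E] [NormedSpace ℝ E] [MeasurableSpace E] [OpensMeasurableSpace E]
    {g : ℝ → Ω → E} (hg : Measurable fun z : Ω × ℝ => g z.2 z.1) {a b : ℝ} (hab : a ≤ b)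
    {C : ℝ≥0∞} (h : ∀ u ∈ Set.Ioc a b, ∫⁻ ω, ‖g u ω‖ₑ ^ 2 ∂P ≤ C) :
    ∫⁻ ω, ‖∫ u in a..b, g u ω‖ₑ ^ 2 ∂P ≤ ENNReal.ofReal (b - a) ^ 2 * C := by
  have hgm : Measurable fun z : Ω × ℝ => ‖g z.2 z.1‖ₑ := hg.enorm
  have h1 : ∀ ω, ‖∫ u in a..b, g u ω‖ₑ ^ 2
      ≤ ENNReal.ofReal (b - a) * ∫⁻ u in Set.Ioc a b, ‖g u ω‖ₑ ^ 2 := by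
    intro ω
    have hm : Measurable fun u => ‖g u ω‖ₑ := hgm.comp measurable_prodMk_left
    have h2 : ‖∫ u in a..b, g u ω‖ₑ ≤ ∫⁻ u in Set.Ioc a b, ‖g u ω‖ₑ := by
      rw [intervalIntegral.integral_of_le hab]
      exact enorm_integral_le_lintegral_enorm _
    have h3 := ENNReal.lintegral_mul_le_Lp_mul_Lq (volume.restrict (Set.Ioc a b))
      (Real.HolderConjugate.two_two) hm.aemeasurable (aemeasurable_const (b := (1 : ℝ≥0∞)))
    simp only [Pi.mul_apply, mul_one, lintegral_const, one_pow, one_mul,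
      Measure.restrict_apply_univ, Real.volume_Ioc, ENNReal.rpow_two] at h3
    have h4 : ∀ x : ℝ≥0∞, (x ^ (1 / 2 : ℝ)) ^ 2 = x := fun x => by
      rw [← ENNReal.rpow_two, ← ENNReal.rpow_mul]; norm_num
    calc _ ≤ ((∫⁻ u in Set.Ioc a b, ‖g u ω‖ₑ ^ 2) ^ (1 / 2 : ℝ)
          * ENNReal.ofReal (b - a) ^ (1 / 2 : ℝ)) ^ 2 := by
          gcongr
          exact h2.trans h3
      _ = _ := by rw [mul_pow, h4, h4, mul_comm]
  calc _ ≤ ∫⁻ ω, ENNReal.ofReal (b - a) * (∫⁻ u in Set.Ioc a b, ‖g u ω‖ₑ ^ 2) ∂P :=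
        lintegral_mono h1
    _ = ENNReal.ofReal (b - a) * ∫⁻ u in Set.Ioc a b, (∫⁻ ω, ‖g u ω‖ₑ ^ 2 ∂P) := by
        rw [lintegral_const_mul' _ _ ENNReal.ofReal_ne_top, lintegral_lintegral_swap]
        exact (hgm.pow_const 2).aemeasurable
    _ ≤ ENNReal.ofReal (b - a) * ∫⁻ u in Set.Ioc a b, C := by
        gcongr 1
        exact setLIntegral_mono' measurableSet_Ioc h
    _ = _ := by
        rw [setLIntegral_const, Real.volume_Ioc]
        ring

/-- The compensated squared increments of a Brownian motion are quadratically small. -/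
theorem IsScalarBM.exists_sq_inc_bound [IsProbabilityMeasure P] (hw : IsScalarBM 𝓕 w P) (V : ℝ) :
    ∃ C : ℝ, 0 ≤ C ∧ ∀ a b : ℝ≥0, a ≤ b → (b : ℝ) ≤ V →
      MemLp (fun ω => (w b ω - w a ω) ^ 2 - ((b : ℝ) - a)) 2 P ∧
      ∫ ω, ((w b ω - w a ω) ^ 2 - ((b : ℝ) - a)) ^ 2 ∂P ≤ C * ((b : ℝ) - a) ^ 2 := by
  obtain ⟨C, hC, h⟩ := hw.exists_moment_bound 4 (c := 0) le_rfl V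
  refine ⟨2 * C + 2, by positivity, fun a b hab hb => ?_⟩
  have hba : 0 ≤ (b : ℝ) - a := sub_nonneg.2 hab
  have h4 : MemLp (fun ω => w b ω - w a ω) 4 P := hw.memLp_inc hab 4
  have hi4 : Integrable (fun ω => (w b ω - w a ω) ^ 4) P := by
    have := h4.integrable_norm_pow (p := 4) (by norm_num)
    refine this.congr (Eventually.of_forall fun ω => ?_)
    simp only [Real.norm_eq_abs]
    rw [Even.pow_abs (by decide)]
  have hm := hw.measurable_inc a b
  have hmz : Measurable fun ω => (w b ω - w a ω) ^ 2 - ((b : ℝ) - a) := by fun_prop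
  have hle : ∀ ω, ((w b ω - w a ω) ^ 2 - ((b : ℝ) - a)) ^ 2
      ≤ 2 * (w b ω - w a ω) ^ 4 + 2 * ((b : ℝ) - a) ^ 2 := fun ω => by
    nlinarith [sq_nonneg ((w b ω - w a ω) ^ 2 + ((b : ℝ) - a))]
  have hid : Integrable (fun ω => 2 * (w b ω - w a ω) ^ 4 + 2 * ((b : ℝ) - a) ^ 2) P :=
    (hi4.const_mul 2).add (integrable_const _)
  have hiz : Integrable (fun ω => ((w b ω - w a ω) ^ 2 - ((b : ℝ) - a)) ^ 2) P :=
    hid.mono' (hmz.pow_const 2).aestronglyMeasurable (Eventually.of_forall fun ω => by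
      rw [Real.norm_of_nonneg (sq_nonneg _)]; exact hle ω)
  refine ⟨(memLp_two_iff_integrable_sq hmz.aestronglyMeasurable).2 hiz, ?_⟩
  have h5 : ∫ ω, (w b ω - w a ω) ^ 4 ∂P ≤ C * ((b : ℝ) - a) ^ 2 := by
    rw [integral_eq_lintegral_of_nonneg_ae (Eventually.of_forall fun ω => by positivity)
      hi4.aestronglyMeasurable]
    refine ENNReal.toReal_le_of_le_ofReal (by positivity) ?_
    have e4 : Real.sqrt ((b : ℝ) - a) ^ 4 = ((b : ℝ) - a) ^ 2 := by
      rw [show (4 : ℕ) = 2 * 2 from rfl, pow_mul, Real.sq_sqrt hba]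
    rw [← e4]
    refine le_trans (lintegral_mono fun ω => ENNReal.ofReal_le_ofReal ?_) (h a b hab hb)
    rw [zero_mul, Real.exp_zero, mul_one, ← Even.pow_abs (n := 4) (by decide)]
    gcongr
    linarith
  calc _ ≤ ∫ ω, (2 * (w b ω - w a ω) ^ 4 + 2 * ((b : ℝ) - a) ^ 2) ∂P := integral_mono hiz hid hle
    _ = 2 * ∫ ω, (w b ω - w a ω) ^ 4 ∂P + 2 * ((b : ℝ) - a) ^ 2 := by
        rw [integral_add (hi4.const_mul 2) (integrable_const _), integral_const_mul]
        simp
    _ ≤ _ := by linarith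

/-- Weighted compensated squared increments over disjoint intervals are orthogonal, so their second
moments add up. -/
theorem IsScalarBM.exists_sum_sq_inc_bound [IsProbabilityMeasure P] (hw : IsScalarBM 𝓕 w P)
    (V : ℝ) :
    ∃ C : ℝ, 0 ≤ C ∧ ∀ (τ : ℕ → ℝ≥0), Monotone τ → (∀ k, (τ k : ℝ) ≤ V) →
      ∀ (Y : ℕ → Ω → ℝ), (∀ k, Measurable[𝓕 (τ k)] (Y k)) → (∀ k, MemLp (Y k) 2 P) →
      ∀ D : ℝ, (∀ k, ∫ ω, Y k ω ^ 2 ∂P ≤ D) → ∀ n,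
        Measurable[𝓕 (τ n)] (fun ω => ∑ k ∈ Finset.range n,
          Y k ω * ((w (τ (k + 1)) ω - w (τ k) ω) ^ 2 - ((τ (k + 1) : ℝ) - τ k))) ∧
        MemLp (fun ω => ∑ k ∈ Finset.range n,
          Y k ω * ((w (τ (k + 1)) ω - w (τ k) ω) ^ 2 - ((τ (k + 1) : ℝ) - τ k))) 2 P ∧
        ∫ ω, (∑ k ∈ Finset.range n,
          Y k ω * ((w (τ (k + 1)) ω - w (τ k) ω) ^ 2 - ((τ (k + 1) : ℝ) - τ k))) ^ 2 ∂P
          ≤ C * D * ∑ k ∈ Finset.range n, ((τ (k + 1) : ℝ) - τ k) ^ 2 := by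
  obtain ⟨C, hC, h⟩ := hw.exists_sq_inc_bound V
  refine ⟨C, hC, fun τ hτ hτV Y hY hY2 D hD n => ?_⟩
  induction n with
  | zero => simp
  | succ n ih =>
    obtain ⟨im, il, ib⟩ := ih
    simp_rw [Finset.sum_range_succ]
    set S : Ω → ℝ := fun ω => ∑ k ∈ Finset.range n,
          Y k ω * ((w (τ (k + 1)) ω - w (τ k) ω) ^ 2 - ((τ (k + 1) : ℝ) - τ k)) with hS
    have hn : τ n ≤ τ (n + 1) := hτ (Nat.le_succ n)
    obtain ⟨hz2, hzb⟩ := h (τ n) (τ (n + 1)) hn (hτV _)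
    set η : ℝ := (τ (n + 1) : ℝ) - τ n with hη
    set ζ : Ω → ℝ := fun ω => (w (τ (n + 1)) ω - w (τ n) ω) ^ 2 - η with hζ
    have hcoe : ((τ (n + 1) - τ n : ℝ≥0) : ℝ) = η := NNReal.coe_sub hn
    have hmz : Measurable[𝓕 (τ (n + 1))] ζ :=
      (((hw.adapted _).sub ((hw.adapted _).mono (𝓕.mono hn) le_rfl)).pow_const 2).sub_const η
    have hind : IndepFun (fun ω => Y n ω ^ 2) (fun ω => ζ ω ^ 2) P :=
      (hw.indepFun hn (hY n)).comp (φ := fun y => y ^ 2) (ψ := fun z => (z ^ 2 - η) ^ 2)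
        (by fun_prop) (by fun_prop)
    have hYm : Measurable (Y n) := (hY n).mono (𝓕.le _) le_rfl
    have hζm : Measurable ζ := hmz.mono (𝓕.le _) le_rfl
    have hint : Integrable (fun ω => Y n ω ^ 2 * ζ ω ^ 2) P :=
      hind.integrable_mul (hY2 n).integrable_sq hz2.integrable_sq
    have hYζ : MemLp (fun ω => Y n ω * ζ ω) 2 P := by
      refine (memLp_two_iff_integrable_sq (hYm.mul hζm).aestronglyMeasurable).2 ?_
      exact hint.congr (Eventually.of_forall fun ω => (mul_pow _ _ _).symm)
    refine ⟨(im.mono (𝓕.mono hn) le_rfl).add (((hY n).mono (𝓕.mono hn) le_rfl).mul hmz),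
      il.add hYζ, ?_⟩
    have hcross : ∫ ω, S ω * (Y n ω * ζ ω) ∂P = 0 := by
      have hSY : Integrable (fun ω => S ω * Y n ω) P := integrable_mul_of_memLp_two il (hY2 n)
      have hSYm : Measurable[𝓕 (τ n)] fun ω => S ω * Y n ω := im.mul (hY n)
      have e1 : IndepFun (fun ω => S ω * Y n ω) ζ P :=
        (hw.indepFun hn hSYm).comp (φ := id) (ψ := fun z => z ^ 2 - η)
          measurable_id (by fun_prop)
      have e2 : ∫ ω, ζ ω ∂P = 0 := by
        have i1 : Integrable (fun ω => (w (τ (n + 1)) ω - w (τ n) ω) ^ 2) P :=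
          (hw.memLp_inc hn 2).integrable_sq
        rw [hζ, integral_sub i1 (integrable_const _), hw.integral_inc_sq hn, hcoe]
        simp
      have e3 := e1.integral_fun_mul_eq_mul_integral hSY.aestronglyMeasurable
        hζm.aestronglyMeasurable
      rw [e2, mul_zero] at e3
      rw [← e3]
      exact integral_congr_ae (Eventually.of_forall fun ω => (mul_assoc _ _ _).symm)
    have hsq : ∫ ω, (Y n ω * ζ ω) ^ 2 ∂P ≤ C * D * η ^ 2 := by
      simp_rw [mul_pow]
      rw [hind.integral_fun_mul_eq_mul_integral (hYm.pow_const 2).aestronglyMeasurable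
        (hζm.pow_const 2).aestronglyMeasurable]
      calc _ ≤ D * (C * η ^ 2) := mul_le_mul (hD n) hzb (integral_nonneg fun _ => sq_nonneg _)
            ((integral_nonneg fun _ => sq_nonneg _).trans (hD n))
        _ = _ := by ring
    have hexp : ∀ ω, (S ω + Y n ω * ζ ω) ^ 2
        = (S ω ^ 2 + 2 * (S ω * (Y n ω * ζ ω))) + (Y n ω * ζ ω) ^ 2 := fun ω => by ring
    have i1 := il.integrable_sq
    have i2 := (integrable_mul_of_memLp_two il hYζ).const_mul 2
    have i3 : Integrable (fun ω => S ω ^ 2 + 2 * (S ω * (Y n ω * ζ ω))) P := i1.add i2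
    calc ∫ ω, (S ω + Y n ω * ζ ω) ^ 2 ∂P
        = ∫ ω, S ω ^ 2 ∂P + 2 * ∫ ω, S ω * (Y n ω * ζ ω) ∂P + ∫ ω, (Y n ω * ζ ω) ^ 2 ∂P := by
          simp_rw [hexp]
          rw [integral_add i3 hYζ.integrable_sq, integral_add i1 i2, integral_const_mul]
      _ ≤ _ := by rw [hcross, mul_add]; linarith

theorem memLp_of_norm_le_of_lintegral_le {E : Type*} [NormedAddCommGroup E] {Z : Ω → E}
    {Y : Ω → ℝ} (hY : Measurable Y) {κ C : ℝ} (hκ : 0 ≤ κ) (hC : 0 ≤ C)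
    (hle : ∀ ω, ‖Y ω‖ ≤ κ * ‖Z ω‖) (hZ : ∫⁻ ω, ‖Z ω‖ₑ ^ 2 ∂P ≤ ENNReal.ofReal C) :
    MemLp Y 2 P ∧ ∫ ω, Y ω ^ 2 ∂P ≤ κ ^ 2 * C := by
  have h1 : ∫⁻ ω, ‖Y ω‖ₑ ^ 2 ∂P ≤ ENNReal.ofReal (κ ^ 2 * C) := by
    calc _ ≤ ∫⁻ ω, ENNReal.ofReal κ ^ 2 * ‖Z ω‖ₑ ^ 2 ∂P := by
          refine lintegral_mono fun ω => ?_
          rw [← mul_pow]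
          gcongr
          rw [← ofReal_norm, ← ofReal_norm, ← ENNReal.ofReal_mul hκ]
          exact ENNReal.ofReal_le_ofReal (hle ω)
      _ ≤ ENNReal.ofReal κ ^ 2 * ENNReal.ofReal C := by
          rw [lintegral_const_mul' _ _ (by finiteness)]
          gcongr
      _ = _ := by rw [← ENNReal.ofReal_pow hκ, ← ENNReal.ofReal_mul (by positivity)]
  have h2 : MemLp Y 2 P := by
    refine ⟨hY.aestronglyMeasurable, ?_⟩
    rw [eLpNorm_lt_top_iff_lintegral_rpow_enorm_lt_top (by norm_num) (by norm_num)]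
    simpa using h1.trans_lt ENNReal.ofReal_lt_top
  refine ⟨h2, ?_⟩
  rw [integral_eq_lintegral_of_nonneg_ae (Eventually.of_forall fun ω => sq_nonneg _)
    (hY.pow_const 2).aestronglyMeasurable]
  refine ENNReal.toReal_le_of_le_ofReal (by positivity) (le_trans (le_of_eq ?_) h1)
  refine lintegral_congr fun ω => ?_
  rw [← ofReal_norm, ← ENNReal.ofReal_pow (norm_nonneg _), Real.norm_eq_abs, sq_abs]

variable {L : EuclideanSpace ℝ (Fin d) →L[ℝ] EuclideanSpace ℝ (Fin d)} {c : ℝ}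
  {s : EuclideanSpace ℝ (Fin d)}

theorem continuous_geometricBM_toNNReal (hw : IsScalarBM 𝓕 w P) (ω : Ω) :
    Continuous fun u : ℝ => geometricBM L c w s u.toNNReal ω :=
  (continuous_geometricBM hw ω).comp continuous_real_toNNReal

theorem measurable_geometricBM_toNNReal (hw : IsScalarBM 𝓕 w P) :
    Measurable fun z : Ω × ℝ => geometricBM L c w s z.2.toNNReal z.1 := by
  have h1 := measurable_real_path (X := fun u ω => geometricBM L c w s u.toNNReal ω)
    (continuous_geometricBM_toNNReal hw)
    (fun u => (measurable_geometricBM hw u.toNNReal).mono (𝓕.le _) le_rfl)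
  exact h1

theorem measurable_drift_geometricBM (hw : IsScalarBM 𝓕 w P) (t : ℝ≥0) :
    Measurable[𝓕 t] fun ω => ∫ u in (0 : ℝ)..t, L (geometricBM L c w s u.toNNReal ω) := by
  refine measurable_primitive_adapted (g := fun u ω => L (geometricBM L c w s u.toNNReal ω))
    (fun ω => L.continuous.comp (continuous_geometricBM_toNNReal hw ω)) (fun t => ?_)
    (fun u hu => ?_) t
  · have h1 := L.continuous.measurable.comp (measurable_geometricBM (L := L) (c := c) (s := s) hw t)
    simp only [Real.toNNReal_coe]
    exact h1
  · ext1 ω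
    simp only [Real.toNNReal_of_nonpos hu, Real.toNNReal_zero]

/-- The error of one Milstein step on `[a, b]`, with the exact drift integral. -/
noncomputable def milsteinError (L : EuclideanSpace ℝ (Fin d) →L[ℝ] EuclideanSpace ℝ (Fin d))
    (c : ℝ) (w : ℝ≥0 → Ω → ℝ) (s : EuclideanSpace ℝ (Fin d)) (a b : ℝ≥0) (ω : Ω) :
    EuclideanSpace ℝ (Fin d) :=
  geometricBM L c w s b ω - geometricBM L c w s a ω
    - (∫ u in (a : ℝ)..b, L (geometricBM L c w s u.toNNReal ω))
    - (w b ω - w a ω) • (c • L) (geometricBM L c w s a ω)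
    - (((w b ω - w a ω) ^ 2 - ((b : ℝ) - a)) / 2) • (c • L) ((c • L) (geometricBM L c w s a ω))

/-- The one-step error of the Milstein scheme, with the exact drift, is of order `3 / 2`. -/
theorem exists_geometricBM_step [IsProbabilityMeasure P] (hw : IsScalarBM 𝓕 w P) (V : ℝ) :
    ∃ C : ℝ, 0 ≤ C ∧ ∀ a b : ℝ≥0, a ≤ b → (b : ℝ) ≤ V →
      AEStronglyMeasurable (milsteinError L c w s a b) P ∧
      eLpNorm (milsteinError L c w s a b) 2 P ≤ ENNReal.ofReal (C * ((b - a) * Real.sqrt (b - a))) := by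
  obtain ⟨C1, hC1, h1⟩ := exists_geometricBM_remainder (L := L) (c := c) (s := s) hw V
  obtain ⟨C2, hC2, h2⟩ := exists_geometricBM_increment (L := L) (c := c) (s := s) hw V
  refine ⟨Real.sqrt C1 + ‖L‖ * Real.sqrt C2, by positivity, fun a b hab hb => ?_⟩
  have hba : 0 ≤ (b : ℝ) - a := sub_nonneg.2 hab
  have hXm : ∀ t, Measurable (geometricBM L c w s t) := fun t =>
    (measurable_geometricBM hw t).mono (𝓕.le t) le_rfl
  have hwm := hw.measurable_inc a b
  set h := (b : ℝ) - a with hh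
  set R : Ω → EuclideanSpace ℝ (Fin d) := fun ω =>
    geometricBM L c w s b ω - geometricBM L c w s a ω - h • L (geometricBM L c w s a ω)
      - (w b ω - w a ω) • (c • L) (geometricBM L c w s a ω)
      - (((w b ω - w a ω) ^ 2 - h) / 2) • (c • L) ((c • L) (geometricBM L c w s a ω)) with hR
  set D : Ω → EuclideanSpace ℝ (Fin d) := fun ω =>
    ∫ u in (a : ℝ)..b, L (geometricBM L c w s u.toNNReal ω - geometricBM L c w s a ω) with hD
  have hLm : Measurable L := L.continuous.measurable
  have hgm : Measurable fun z : Ω × ℝ =>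
      L (geometricBM L c w s z.2.toNNReal z.1 - geometricBM L c w s a z.1) :=
    hLm.comp ((measurable_geometricBM_toNNReal hw).sub ((hXm a).comp measurable_fst))
  have hRe : eLpNorm R 2 P ≤ ENNReal.ofReal (Real.sqrt C1 * (h * Real.sqrt h)) := by
    rw [eLpNorm_two_le_iff (by positivity)]
    refine (h1 a b hab hb).trans (le_of_eq ?_)
    congr 1
    rw [mul_pow, mul_pow, Real.sq_sqrt hC1, Real.sq_sqrt hba]
    ring
  have hDe : eLpNorm D 2 P ≤ ENNReal.ofReal (‖L‖ * Real.sqrt C2 * (h * Real.sqrt h)) := by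
    rw [eLpNorm_two_le_iff (by positivity)]
    have h3 := lintegral_enorm_intervalIntegral_sq_le (P := P)
      (g := fun u ω => L (geometricBM L c w s u.toNNReal ω - geometricBM L c w s a ω))
      (a := a) (b := b) (C := ENNReal.ofReal (‖L‖ ^ 2 * (C2 * h))) hgm
      (by exact_mod_cast hab) (fun u hu => by
        have hu0 : 0 ≤ u := a.coe_nonneg.trans hu.1.le
        lift u to ℝ≥0 using hu0
        rw [Real.toNNReal_coe]
        calc _ ≤ ∫⁻ ω, ENNReal.ofReal ‖L‖ ^ 2
              * ‖geometricBM L c w s u ω - geometricBM L c w s a ω‖ₑ ^ 2 ∂P := by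
              refine lintegral_mono fun ω => ?_
              rw [← mul_pow]
              gcongr
              rw [← ofReal_norm, ← ofReal_norm, ← ENNReal.ofReal_mul (norm_nonneg _)]
              exact ENNReal.ofReal_le_ofReal (L.le_opNorm _)
          _ ≤ ENNReal.ofReal ‖L‖ ^ 2 * ENNReal.ofReal (C2 * h) := by
              rw [lintegral_const_mul' _ _ (by finiteness)]
              gcongr
              refine (h2 a u (by exact_mod_cast hu.1.le) (hu.2.trans hb)).trans ?_
              refine ENNReal.ofReal_le_ofReal (mul_le_mul_of_nonneg_left ?_ hC2)
              linarith [hu.2]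
          _ = _ := by
              rw [← ENNReal.ofReal_pow (norm_nonneg _), ← ENNReal.ofReal_mul (by positivity)])
    refine h3.trans (le_of_eq ?_)
    rw [← ENNReal.ofReal_pow hba, ← ENNReal.ofReal_mul (by positivity)]
    congr 1
    rw [mul_pow, mul_pow, mul_pow, Real.sq_sqrt hC2, Real.sq_sqrt hba]
    ring
  have heq : milsteinError L c w s a b = R - D := by
    funext ω
    have e1 : D ω = (∫ u in (a : ℝ)..b, L (geometricBM L c w s u.toNNReal ω))
        - h • L (geometricBM L c w s a ω) := by
      simp only [hD, map_sub]
      have i1 : IntervalIntegrable (fun u : ℝ => L (geometricBM L c w s u.toNNReal ω)) volume a b :=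
        (L.continuous.comp (continuous_geometricBM_toNNReal hw ω)).intervalIntegrable _ _
      rw [intervalIntegral.integral_sub i1 (continuous_const.intervalIntegrable _ _),
        intervalIntegral.integral_const]
    simp only [Pi.sub_apply, hR, e1, milsteinError]
    abel
  have hDm : AEStronglyMeasurable D P := by
    have h5 := hgm.stronglyMeasurable.integral_prod_right' (ν := volume.restrict (Set.Ioc (a : ℝ) b))
    have h6 : D = fun ω => ∫ u in Set.Ioc (a : ℝ) b,
        L (geometricBM L c w s u.toNNReal ω - geometricBM L c w s a ω) := by
      funext ω
      exact intervalIntegral.integral_of_le (by exact_mod_cast hab)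
    rw [h6]
    exact h5.aestronglyMeasurable
  have hRm : AEStronglyMeasurable R P := by
    have e2 := hLm.comp (hXm a)
    have e3 := ((c • L).continuous.measurable).comp (hXm a)
    have e4 := ((c • L).continuous.measurable).comp e3
    have e5 := ((((hXm b).sub (hXm a)).sub (e2.const_smul h)).sub (hwm.smul e3)).sub
      ((((hwm.pow_const 2).sub_const h).div_const 2).smul e4)
    exact e5.aestronglyMeasurable
  rw [heq]
  refine ⟨hRm.sub hDm, ?_⟩
  refine (eLpNorm_sub_le hRm hDm (by norm_num)).trans ((add_le_add hRe hDe).trans (le_of_eq ?_))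
  rw [← ENNReal.ofReal_add (by positivity) (by positivity), add_mul]

theorem eLpNorm_two_le_of_integral_sq_le {f : Ω → ℝ} (hf : MemLp f 2 P) {c : ℝ} (hc : 0 ≤ c)
    (h : ∫ ω, f ω ^ 2 ∂P ≤ c ^ 2) : eLpNorm f 2 P ≤ ENNReal.ofReal c := by
  rw [eLpNorm_two_le_iff hc]
  refine le_trans (le_of_eq ?_) (ENNReal.ofReal_le_ofReal h)
  rw [ofReal_integral_eq_lintegral_ofReal hf.integrable_sq
    (Eventually.of_forall fun _ => sq_nonneg _)]
  refine lintegral_congr fun ω => ?_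
  rw [← ofReal_norm, ← ENNReal.ofReal_pow (norm_nonneg _), Real.norm_eq_abs, sq_abs]

/-- The Itô sums of geometric Brownian motion along a grid of mesh `δ` converge at rate `δ ^ (1 / 2)`
to the martingale part of the equation. -/
theorem exists_geometricBM_grid [IsProbabilityMeasure P] (hw : IsScalarBM 𝓕 w P) (t : ℝ≥0)
    (i : Fin d) :
    ∃ C : ℝ, 0 ≤ C ∧ ∀ τ : ℕ → ℝ≥0, Monotone τ → (∀ k, τ k ≤ t) → τ 0 = 0 → ∀ n, τ n = t →
      ∀ δ : ℝ, 0 ≤ δ → (∀ k, (τ (k + 1) : ℝ) - τ k ≤ δ) →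
      eLpNorm (fun ω => (∑ k ∈ Finset.range n, (c • L) (geometricBM L c w s (τ k) ω) i
          * (w (τ (k + 1)) ω - w (τ k) ω))
        - (geometricBM L c w s t ω i - s i
          - (∫ u in (0 : ℝ)..t, L (geometricBM L c w s u.toNNReal ω)) i)) 2 P
        ≤ ENNReal.ofReal (C * Real.sqrt δ) := by
  obtain ⟨C1, hC1, h1⟩ := exists_geometricBM_step (L := L) (c := c) (s := s) hw t
  obtain ⟨C2, hC2, h2⟩ := hw.exists_sum_sq_inc_bound t
  obtain ⟨D, hD, hX⟩ := exists_geometricBM_moment (L := L) (c := c) (s := s) hw 2 t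
  set D' : ℝ := (‖(c • L).comp (c • L)‖ / 2) ^ 2 * D with hD'
  have hD0 : 0 ≤ D' := by positivity
  refine ⟨C1 * t + Real.sqrt (C2 * D' * t), by positivity,
    fun τ hτ hτt hτ0 n hn δ hδ hmesh => ?_⟩
  have hτV : ∀ k, (τ k : ℝ) ≤ t := fun k => by exact_mod_cast hτt k
  have hinc : ∀ k, 0 ≤ (τ (k + 1) : ℝ) - τ k := fun k =>
    sub_nonneg.2 (by exact_mod_cast hτ (Nat.le_succ k))
  have hsum : ∑ k ∈ Finset.range n, ((τ (k + 1) : ℝ) - τ k) = t := by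
    rw [Finset.sum_range_sub (fun k => (τ k : ℝ)), hn, hτ0]
    simp
  set Y : ℕ → Ω → ℝ := fun k ω => (c • L) ((c • L) (geometricBM L c w s (τ k) ω)) i / 2 with hY
  have hYm : ∀ k, Measurable[𝓕 (τ k)] (Y k) := fun k => by
    have e1 := ((c • L).continuous.measurable).comp
      (measurable_geometricBM (L := L) (c := c) (s := s) hw (τ k))
    have e2 := (by fun_prop : Measurable fun x : EuclideanSpace ℝ (Fin d) => x i / 2).comp
      (((c • L).continuous.measurable).comp e1)
    exact e2
  have hYb : ∀ k, MemLp (Y k) 2 P ∧ ∫ ω, Y k ω ^ 2 ∂P ≤ D' := fun k =>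
    memLp_of_norm_le_of_lintegral_le ((hYm k).mono (𝓕.le _) le_rfl) (by positivity) hD
      (fun ω => by
        have e1 := PiLp.norm_apply_le ((c • L) ((c • L) (geometricBM L c w s (τ k) ω))) i
        have e2 := ((c • L).comp (c • L)).le_opNorm (geometricBM L c w s (τ k) ω)
        simp only [hY, norm_div, Real.norm_ofNat]
        rw [ContinuousLinearMap.comp_apply] at e2
        linarith [e1.trans e2]) (hX (τ k) (hτV k))
  obtain ⟨-, hSl, hSb⟩ := h2 τ hτ hτV Y hYm (fun k => (hYb k).1) D' (fun k => (hYb k).2) n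
  set S : Ω → ℝ := fun ω => ∑ k ∈ Finset.range n,
    Y k ω * ((w (τ (k + 1)) ω - w (τ k) ω) ^ 2 - ((τ (k + 1) : ℝ) - τ k)) with hS
  have hSe : eLpNorm S 2 P ≤ ENNReal.ofReal (Real.sqrt (C2 * D' * t) * Real.sqrt δ) := by
    refine eLpNorm_two_le_of_integral_sq_le hSl (by positivity) (hSb.trans ?_)
    rw [mul_pow, Real.sq_sqrt (by positivity), Real.sq_sqrt hδ]
    have e1 : ∑ k ∈ Finset.range n, ((τ (k + 1) : ℝ) - τ k) ^ 2 ≤ δ * t := by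
      rw [← hsum, Finset.mul_sum]
      refine Finset.sum_le_sum fun k _ => ?_
      rw [sq]
      exact mul_le_mul_of_nonneg_right (hmesh k) (hinc k)
    calc _ ≤ C2 * D' * (δ * t) := mul_le_mul_of_nonneg_left e1 (by positivity)
      _ = _ := by ring
  set F : ℕ → Ω → ℝ := fun k ω => milsteinError L c w s (τ k) (τ (k + 1)) ω i with hF
  have hFs : ∀ k, AEStronglyMeasurable (F k) P ∧ eLpNorm (F k) 2 P
      ≤ ENNReal.ofReal (C1 * (((τ (k + 1) : ℝ) - τ k) * Real.sqrt ((τ (k + 1) : ℝ) - τ k))) := by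
    intro k
    obtain ⟨e1, e2⟩ := h1 (τ k) (τ (k + 1)) (hτ (Nat.le_succ k)) (hτV _)
    refine ⟨(by fun_prop : Continuous fun x : EuclideanSpace ℝ (Fin d) => x i).comp_aestronglyMeasurable
      e1, le_trans (eLpNorm_mono fun ω => ?_) e2⟩
    exact PiLp.norm_apply_le _ i
  have hFe : eLpNorm (∑ k ∈ Finset.range n, F k) 2 P
      ≤ ENNReal.ofReal (C1 * t * Real.sqrt δ) := by
    refine (eLpNorm_sum_le (fun k _ => (hFs k).1) (by norm_num)).trans ?_
    calc _ ≤ ∑ k ∈ Finset.range n, ENNReal.ofReal (C1 * (((τ (k + 1) : ℝ) - τ k) * Real.sqrt δ)) := by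
          refine Finset.sum_le_sum fun k _ => (hFs k).2.trans (ENNReal.ofReal_le_ofReal ?_)
          have := hinc k
          gcongr
          exact hmesh k
      _ = _ := by
          rw [← ENNReal.ofReal_sum_of_nonneg fun k _ => by have := hinc k; positivity,
            ← Finset.mul_sum, ← Finset.sum_mul, hsum, mul_assoc]
  have heq : (fun ω => (∑ k ∈ Finset.range n, (c • L) (geometricBM L c w s (τ k) ω) i
          * (w (τ (k + 1)) ω - w (τ k) ω))
        - (geometricBM L c w s t ω i - s i
          - (∫ u in (0 : ℝ)..t, L (geometricBM L c w s u.toNNReal ω)) i))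
      = -(∑ k ∈ Finset.range n, F k) - S := by
    funext ω
    have i1 := (L.continuous.comp (continuous_geometricBM_toNNReal (L := L) (c := c) (s := s) hw ω))
    have e1 := intervalIntegral.sum_integral_adjacent_intervals (μ := volume) (n := n)
      (a := fun k => (τ k : ℝ)) (f := fun u : ℝ => L (geometricBM L c w s u.toNNReal ω))
      (fun k _ => i1.intervalIntegrable _ _)
    have e2 := Finset.sum_range_sub (fun k => geometricBM L c w s (τ k) ω) n
    rw [hn, hτ0] at e1 e2
    rw [geometricBM_zero] at e2
    rw [← NNReal.coe_zero, ← e1]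
    have e3 := congrArg (fun x : EuclideanSpace ℝ (Fin d) => x i) e2
    simp only [PiLp.sub_apply, WithLp.ofLp_sum, Finset.sum_apply] at e3
    simp only [Pi.sub_apply, Pi.neg_apply, Finset.sum_apply, WithLp.ofLp_sum, ← e3, hF, hS, hY,
      milsteinError]
    rw [← Finset.sum_sub_distrib, ← Finset.sum_sub_distrib, ← Finset.sum_neg_distrib,
      ← Finset.sum_sub_distrib]
    refine Finset.sum_congr rfl fun k _ => ?_
    simp only [PiLp.sub_apply, PiLp.smul_apply, smul_eq_mul]
    ring
  rw [heq]
  have hFm : AEStronglyMeasurable (∑ k ∈ Finset.range n, F k) P :=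
    Finset.aestronglyMeasurable_sum _ fun k _ => (hFs k).1
  refine (eLpNorm_sub_le hFm.neg hSl.1 (by norm_num)).trans ?_
  rw [eLpNorm_neg]
  refine (add_le_add hFe hSe).trans (le_of_eq ?_)
  rw [← ENNReal.ofReal_add (by positivity) (by positivity)]
  ring_nf

end GeometricEquation

/-! ### Solutions under linear feedback: multiplicative noise -/

section Multiplicative

variable {Ω : Type*} {mΩ : MeasurableSpace Ω} {P : Measure Ω} {𝓕 : Filtration ℝ≥0 mΩ} {d m : ℕ}
  {w : ℝ≥0 → Ω → ℝ}

theorem lintegral_lintegral_Ioc_le [SFinite P] {f : Ω → ℝ → ℝ≥0∞}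
    (hf : Measurable (Function.uncurry f)) {T : ℝ≥0} {C : ℝ≥0∞}
    (h : ∀ u ∈ Set.Ioc (0 : ℝ) T, ∫⁻ ω, f ω u ∂P ≤ C) :
    ∫⁻ ω, (∫⁻ u in Set.Ioc (0 : ℝ) T, f ω u) ∂P ≤ T * C := by
  rw [lintegral_lintegral_swap hf.aemeasurable]
  refine (setLIntegral_mono' measurableSet_Ioc h).trans (le_of_eq ?_)
  rw [setLIntegral_const, Real.volume_Ioc, sub_zero, ENNReal.ofReal_coe_nnreal, mul_comm]

theorem stepEval_of_mem {len : ℕ} {time : ℕ → ℝ≥0} (htime : Monotone time) (ξ : ℕ → Ω → ℝ)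
    {k : ℕ} (hk : k < len) {u : ℝ≥0} (hu : u ∈ Set.Ioc (time k) (time (k + 1))) (ω : Ω) :
    stepEval len time ξ u ω = ξ k ω := by
  unfold stepEval
  rw [Finset.sum_eq_single k, Set.indicator_of_mem hu]
  · intro j _ hj
    refine Set.indicator_of_notMem (fun hu' => ?_) _
    rcases lt_or_gt_of_ne hj with h | h
    · exact absurd (hu.1.trans_le hu'.2) (not_lt.2 (htime h))
    · exact absurd (hu'.1.trans_le hu.2) (not_lt.2 (htime h))
  · intro h
    exact absurd (Finset.mem_range.2 hk) h

theorem exists_grid_mem (n : ℕ) {u : ℝ≥0} (hu0 : 0 < u) (hu : u ≤ n + 1) :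
    ∃ k < (n + 1) ^ 2, u ∈ Set.Ioc ((k : ℝ≥0) / (n + 1)) (((k + 1 : ℕ) : ℝ≥0) / (n + 1)) := by
  have hn : (0 : ℝ≥0) < n + 1 := by positivity
  have h0 : 0 < ⌈u * (n + 1)⌉₊ := Nat.ceil_pos.2 (by positivity)
  obtain ⟨k, hk⟩ := Nat.exists_eq_succ_of_ne_zero h0.ne'
  refine ⟨k, ?_, ?_, ?_⟩
  · have h1 : ⌈u * (n + 1)⌉₊ ≤ (n + 1) ^ 2 := by
      rw [Nat.ceil_le]
      push_cast
      rw [sq]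
      gcongr
    omega
  · rw [div_lt_iff₀ hn]
    exact Nat.lt_ceil.1 (by omega)
  · rw [le_div_iff₀ hn]
    have := Nat.le_ceil (u * (n + 1))
    rwa [hk] at this

theorem abs_clip_le {N : ℝ} (hN : 0 ≤ N) (x : ℝ) : |max (-N) (min N x)| ≤ N := by
  rw [abs_le]
  exact ⟨le_max_left _ _, max_le (by linarith) (min_le_left _ _)⟩

theorem abs_clip_sub_le {N : ℝ} (hN : 0 < N) (x : ℝ) : |max (-N) (min N x) - x| ≤ x ^ 2 / N := by
  rw [le_div_iff₀ hN]
  rcases le_or_gt x (-N) with h | h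
  · rw [min_eq_right (by linarith), max_eq_left h, abs_of_nonneg (by linarith)]
    nlinarith
  · rcases le_or_gt x N with h' | h'
    · rw [min_eq_right h', max_eq_right h.le]
      simp [sq_nonneg]
    · rw [min_eq_left h'.le, max_eq_right (by linarith), abs_of_nonpos (by linarith)]
      nlinarith

theorem tendsto_lintegral_sq_zero {f : ℕ → Ω → ℝ} {e : ℕ → ℝ} (he0 : ∀ n, 0 ≤ e n)
    (he : Tendsto e atTop (𝓝 0)) (h : ∀ᶠ n in atTop, eLpNorm (f n) 2 P ≤ ENNReal.ofReal (e n)) :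
    Tendsto (fun n => ∫⁻ ω, ‖f n ω‖ₑ ^ 2 ∂P) atTop (𝓝 0) := by
  have h1 : Tendsto (fun n => ENNReal.ofReal (e n ^ 2)) atTop (𝓝 0) := by
    have := ENNReal.tendsto_ofReal (he.pow 2)
    simpa using this
  refine tendsto_of_tendsto_of_tendsto_of_le_of_le' tendsto_const_nhds h1
    (Eventually.of_forall fun _ => zero_le) ?_
  filter_upwards [h] with n hn
  exact (eLpNorm_two_le_iff (he0 n)).1 hn

variable {L : EuclideanSpace ℝ (Fin d) →L[ℝ] EuclideanSpace ℝ (Fin d)} {c : ℝ}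
  {s : EuclideanSpace ℝ (Fin d)}

theorem eLpNorm_clip_sub_le {E : Type*} [NormedAddCommGroup E] {Z : Ω → E} {Y : Ω → ℝ}
    {κ D N : ℝ} (hD : 0 ≤ D) (hN : 0 < N) (hle : ∀ ω, |Y ω| ≤ κ * ‖Z ω‖)
    (hZ : ∫⁻ ω, ‖Z ω‖ₑ ^ 4 ∂P ≤ ENNReal.ofReal D) :
    eLpNorm (fun ω => max (-N) (min N (Y ω)) - Y ω) 2 P
      ≤ ENNReal.ofReal (κ ^ 2 * Real.sqrt D / N) := by
  rw [eLpNorm_two_le_iff (by positivity)]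
  calc _ ≤ ∫⁻ ω, ENNReal.ofReal (κ ^ 4 / N ^ 2) * ‖Z ω‖ₑ ^ 4 ∂P := by
        refine lintegral_mono fun ω => ?_
        rw [← ofReal_norm, ← ofReal_norm, ← ENNReal.ofReal_pow (norm_nonneg _),
          ← ENNReal.ofReal_pow (norm_nonneg _), ← ENNReal.ofReal_mul (by positivity)]
        refine ENNReal.ofReal_le_ofReal ?_
        have h1 : ‖max (-N) (min N (Y ω)) - Y ω‖ ≤ (κ * ‖Z ω‖) ^ 2 / N := by
          refine (abs_clip_sub_le hN _).trans ?_
          rw [← sq_abs]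
          gcongr
          exact hle ω
        calc _ ≤ ((κ * ‖Z ω‖) ^ 2 / N) ^ 2 := by gcongr
          _ = _ := by ring
    _ ≤ ENNReal.ofReal (κ ^ 4 / N ^ 2) * ENNReal.ofReal D := by
        rw [lintegral_const_mul' _ _ (by finiteness)]
        gcongr
    _ = _ := by
        rw [← ENNReal.ofReal_mul (by positivity)]
        congr 1
        rw [div_pow, mul_pow, Real.sq_sqrt hD]
        ring

/-- The martingale part of geometric Brownian motion is the Itô integral of its diffusion
coefficient: the integrand is sampled on the grid of mesh `1 / (n + 1)` and clipped at `± (n + 1)`. -/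
theorem isItoIntegral_geometricBM [IsProbabilityMeasure P] (hw : IsScalarBM 𝓕 w P) (i : Fin d) :
    IsItoIntegral 𝓕 P w (fun t ω => (c • L) (geometricBM L c w s t ω) i)
      (fun t ω => geometricBM L c w s t ω i - s i
        - (∫ u in (0 : ℝ)..t, L (geometricBM L c w s u.toNNReal ω)) i) := by
  set H : ℝ≥0 → Ω → ℝ := fun t ω => (c • L) (geometricBM L c w s t ω) i with hH
  set κ := ‖c • L‖ with hκ
  have hκ0 : 0 ≤ κ := norm_nonneg _
  have hHle : ∀ t ω, |H t ω| ≤ κ * ‖geometricBM L c w s t ω‖ := fun t ω =>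
    (PiLp.norm_apply_le _ i).trans ((c • L).le_opNorm _)
  have hHcont : Continuous fun x : EuclideanSpace ℝ (Fin d) => (c • L) x i :=
    (by fun_prop : Continuous fun x : EuclideanSpace ℝ (Fin d) => x i).comp (c • L).continuous
  have hHF : ∀ t, Measurable[𝓕 t] (H t) := fun t => by
    have h1 := Measurable.comp hHcont.measurable
      (measurable_geometricBM (L := L) (c := c) (s := s) hw t)
    exact h1
  have hHm : ∀ t, Measurable (H t) := fun t => (hHF t).mono (𝓕.le t) le_rfl
  have hHc : ∀ ω, Continuous fun t => H t ω := fun ω =>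
    hHcont.comp (continuous_geometricBM hw ω)
  have hHu : Measurable (Function.uncurry H) :=
    measurable_uncurry_of_continuous_of_measurable hHc hHm
  have hHz : Measurable fun z : Ω × ℝ => H z.2.toNNReal z.1 := by
    have h1 := Measurable.comp hHu
      ((measurable_real_toNNReal.comp (measurable_snd (α := Ω))).prodMk measurable_fst)
    exact h1
  have hHL : ∀ t, MemLp (H t) 2 P := fun t => by
    obtain ⟨D, hD, h⟩ := exists_geometricBM_moment (L := L) (c := c) (s := s) hw 2 t
    exact (memLp_of_norm_le_of_lintegral_le (hHm t) hκ0 hD (hHle t) (h t le_rfl)).1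
  have hMm : ∀ t : ℝ≥0, Measurable fun ω => geometricBM L c w s t ω i - s i
      - (∫ u in (0 : ℝ)..t, L (geometricBM L c w s u.toNNReal ω)) i := fun t => by
    have h0 : Measurable fun x : EuclideanSpace ℝ (Fin d) => x i := by fun_prop
    have h1 := h0.comp ((measurable_geometricBM (L := L) (c := c) (s := s) hw t).mono (𝓕.le t) le_rfl)
    have h2 := h0.comp ((measurable_drift_geometricBM (L := L) (c := c) (s := s) hw t).mono
      (𝓕.le t) le_rfl)
    exact (h1.sub_const (s i)).sub h2
  let time : ℕ → ℕ → ℝ≥0 := fun n k => (k : ℝ≥0) / (n + 1)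
  have htime : ∀ n, Monotone (time n) := fun n a b hab => by
    simp only [time]
    gcongr
  have hmesh : ∀ n k, (time n (k + 1) : ℝ) - time n k = 1 / ((n : ℝ) + 1) := fun n k => by
    simp only [time]
    push_cast
    ring
  let ξ : ℕ → ℕ → Ω → ℝ := fun n k ω => max (-((n : ℝ) + 1)) (min ((n : ℝ) + 1) (H (time n k) ω))
  have hξm : ∀ n k, Measurable[𝓕 (time n k)] (ξ n k) := fun n k =>
    measurable_const.max (measurable_const.min (hHF _))
  let S : ℕ → SimpleIntegrand 𝓕 := fun n =>
    { len := (n + 1) ^ 2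
      time := time n
      time_mono := htime n
      ξ := ξ n
      measurable_ξ := hξm n
      bounded_ξ := ⟨(n : ℝ) + 1, fun k ω => abs_clip_le (by positivity) _⟩ }
  have hinv : Tendsto (fun n : ℕ => 1 / ((n : ℝ) + 1)) atTop (𝓝 0) :=
    tendsto_one_div_add_atTop_nhds_zero_nat
  have hinv2 : Tendsto (fun n : ℕ => Real.sqrt (1 / ((n : ℝ) + 1))) atTop (𝓝 0) := by
    have := (Real.continuous_sqrt.tendsto 0).comp hinv
    rwa [Real.sqrt_zero] at this
  -- the clipping error
  have hclip : ∀ T : ℝ≥0, ∃ D : ℝ, 0 ≤ D ∧ ∀ n k, time n k ≤ T →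
      eLpNorm (fun ω => ξ n k ω - H (time n k) ω) 2 P ≤ ENNReal.ofReal (D * (1 / ((n : ℝ) + 1))) := by
    intro T
    obtain ⟨D, hD, h⟩ := exists_geometricBM_moment (L := L) (c := c) (s := s) hw 4 T
    refine ⟨κ ^ 2 * Real.sqrt D, by positivity, fun n k hk => ?_⟩
    rw [mul_one_div]
    exact eLpNorm_clip_sub_le hD (by positivity) (hHle _) (h _ (by exact_mod_cast hk))
  have hlarge : ∀ T : ℝ≥0, ∀ᶠ n : ℕ in atTop, T ≤ n + 1 := fun T => by
    obtain ⟨N, hN⟩ := exists_nat_ge T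
    filter_upwards [eventually_ge_atTop N] with n hn
    have : (N : ℝ≥0) ≤ n := by exact_mod_cast hn
    exact hN.trans (this.trans (by simp))
  refine ⟨hHu, fun t => (hMm t).aemeasurable, S, fun T => ?_, fun t => ?_⟩
  · obtain ⟨D, hD, hDk⟩ := hclip T
    obtain ⟨C, hC, hCk⟩ := exists_geometricBM_increment (L := L) (c := c) (s := s) hw T
    set e : ℕ → ℝ := fun n => D * (1 / ((n : ℝ) + 1))
      + κ * Real.sqrt C * Real.sqrt (1 / ((n : ℝ) + 1)) with he
    have he0 : ∀ n, 0 ≤ e n := fun n => by positivity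
    have hel : Tendsto (fun n => (T : ℝ≥0∞) * ENNReal.ofReal (e n ^ 2)) atTop (𝓝 0) := by
      have h1 : Tendsto e atTop (𝓝 0) := by
        have := (hinv.const_mul D).add (hinv2.const_mul (κ * Real.sqrt C))
        rwa [mul_zero, mul_zero, add_zero] at this
      have h2 := ENNReal.tendsto_ofReal (h1.pow 2)
      have h3 := ENNReal.Tendsto.const_mul (a := (T : ℝ≥0∞)) h2 (Or.inr ENNReal.coe_ne_top)
      simpa using h3
    refine tendsto_of_tendsto_of_tendsto_of_le_of_le' tendsto_const_nhds hel
      (Eventually.of_forall fun _ => zero_le) ?_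
    filter_upwards [hlarge T] with n hn
    refine lintegral_lintegral_Ioc_le (f := fun ω u =>
      ‖(S n).eval u.toNNReal ω - H u.toNNReal ω‖ₑ ^ 2) ?_ fun u hu => ?_
    · have h1 : Measurable fun z : Ω × ℝ => (S n).eval z.2.toNNReal z.1 :=
        measurable_stepEval _ _ fun k => ((S n).measurable_ξ k).mono (𝓕.le _) le_rfl
      exact ((h1.sub hHz).enorm.pow_const 2)
    · lift u to ℝ≥0 using hu.1.le
      rw [Real.toNNReal_coe]
      have hu0 : 0 < u := by exact_mod_cast hu.1
      have huT : u ≤ T := by exact_mod_cast hu.2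
      obtain ⟨k, hk, hku⟩ := exists_grid_mem n hu0 (huT.trans hn)
      have e1 : ∀ ω, (S n).eval u ω = ξ n k ω := fun ω =>
        stepEval_of_mem (htime n) (ξ n) hk hku ω
      simp_rw [e1]
      rw [← eLpNorm_two_le_iff (he0 n)]
      have h2 : eLpNorm (fun ω => H (time n k) ω - H u ω) 2 P
          ≤ ENNReal.ofReal (κ * Real.sqrt C * Real.sqrt (1 / ((n : ℝ) + 1))) := by
        rw [eLpNorm_two_le_iff (by positivity)]
        calc _ ≤ ∫⁻ ω, ENNReal.ofReal (κ ^ 2) *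
              ‖geometricBM L c w s u ω - geometricBM L c w s (time n k) ω‖ₑ ^ 2 ∂P := by
              refine lintegral_mono fun ω => ?_
              rw [ENNReal.ofReal_pow hκ0, ← mul_pow]
              gcongr
              rw [← enorm_neg, ← ofReal_norm, ← ofReal_norm, ← ENNReal.ofReal_mul hκ0]
              refine ENNReal.ofReal_le_ofReal ?_
              have e2 : -(H (time n k) ω - H u ω) = (c • L) (geometricBM L c w s u ω
                  - geometricBM L c w s (time n k) ω) i := by
                rw [map_sub, PiLp.sub_apply]
                ring
              rw [e2]
              exact (PiLp.norm_apply_le _ i).trans ((c • L).le_opNorm _)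
          _ ≤ ENNReal.ofReal (κ ^ 2) * ENNReal.ofReal (C * (1 / ((n : ℝ) + 1))) := by
              rw [lintegral_const_mul' _ _ (by finiteness)]
              gcongr
              refine (hCk _ _ hku.1.le (by exact_mod_cast huT)).trans
                (ENNReal.ofReal_le_ofReal (mul_le_mul_of_nonneg_left ?_ hC))
              have e3 : (u : ℝ) ≤ time n (k + 1) := NNReal.coe_le_coe.2 hku.2
              rw [← hmesh n k]
              exact sub_le_sub_right e3 _
          _ = _ := by
              rw [← ENNReal.ofReal_mul (by positivity)]
              congr 1
              rw [mul_pow, mul_pow, Real.sq_sqrt hC, Real.sq_sqrt (by positivity)]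
              ring
      have h3 := eLpNorm_add_le (μ := P) (p := 2) (f := fun ω => ξ n k ω - H (time n k) ω)
        (g := fun ω => H (time n k) ω - H u ω)
        (((hξm n k).mono (𝓕.le _) le_rfl).sub (hHm _)).aestronglyMeasurable
        ((hHm _).sub (hHm _)).aestronglyMeasurable (by norm_num)
      have e4 : ((fun ω => ξ n k ω - H (time n k) ω) + fun ω => H (time n k) ω - H u ω)
          = fun ω => ξ n k ω - H u ω := by
        funext ω
        simp
      rw [e4] at h3
      refine h3.trans ((add_le_add (hDk n k (hku.1.le.trans huT)) h2).trans (le_of_eq ?_))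
      rw [← ENNReal.ofReal_add (by positivity) (by positivity)]
  · obtain ⟨D, hD, hDk⟩ := hclip t
    obtain ⟨C, hC, hCk⟩ := exists_geometricBM_grid (L := L) (c := c) (s := s) hw t i
    set M : Ω → ℝ := fun ω => geometricBM L c w s t ω i - s i
        - (∫ u in (0 : ℝ)..t, L (geometricBM L c w s u.toNNReal ω)) i with hM
    set e : ℕ → ℝ := fun n => Real.sqrt t * (D * (1 / ((n : ℝ) + 1)))
      + C * Real.sqrt (1 / ((n : ℝ) + 1)) with he
    have hel : Tendsto e atTop (𝓝 0) := by
      have := ((hinv.const_mul D).const_mul (Real.sqrt t)).add (hinv2.const_mul C)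
      rwa [mul_zero, mul_zero, mul_zero, add_zero] at this
    refine tendsto_lintegral_sq_zero (e := e) (fun n => by positivity) hel ?_
    filter_upwards [hlarge t] with n hn
    -- the unclipped Itô sum
    set I : Ω → ℝ := fun ω => stepIntegral ((n + 1) ^ 2) (time n) (fun k => H (time n k)) w t ω with hI
    set η : ℕ → Ω → ℝ := fun k ω => ξ n k ω - H (time n k) ω with hη
    have hηF : ∀ k, Measurable[𝓕 (time n k)] (η k) := fun k => (hξm n k).sub (hHF _)
    have hηm : ∀ k, Measurable (η k) := fun k => (hηF k).mono (𝓕.le _) le_rfl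
    have hηL : ∀ k, MemLp (η k) 2 P := fun k => ((S n).memLp_ξ k).sub (hHL _)
    have hJL := memLp_stepIntegral hw ((n + 1) ^ 2) (htime n) hηF hηL t
    have hIL : MemLp I 2 P := memLp_stepIntegral hw ((n + 1) ^ 2) (htime n)
      (fun k => hHF (time n k)) (fun k => hHL (time n k)) t
    have hJ : eLpNorm (stepIntegral ((n + 1) ^ 2) (time n) η w t) 2 P
        ≤ ENNReal.ofReal (Real.sqrt t * (D * (1 / ((n : ℝ) + 1)))) := by
      refine eLpNorm_two_le_of_integral_sq_le hJL (by positivity) ?_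
      simp_rw [sq (stepIntegral _ _ _ _ _ _)]
      rw [integral_stepIntegral_mul hw (htime n) (htime n) hηF hηL hηF hηL t]
      have hm := measurable_stepEval ((n + 1) ^ 2) (time n) hηm
      rw [integral_eq_lintegral_of_nonneg_ae (Eventually.of_forall fun _ => mul_self_nonneg _)
        (hm.mul hm).aestronglyMeasurable]
      refine ENNReal.toReal_le_of_le_ofReal (by positivity) ?_
      have e1 : ∀ z : Ω × ℝ, ENNReal.ofReal (stepEval ((n + 1) ^ 2) (time n) η z.2.toNNReal z.1 *
          stepEval ((n + 1) ^ 2) (time n) η z.2.toNNReal z.1)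
          = ‖stepEval ((n + 1) ^ 2) (time n) η z.2.toNNReal z.1‖ₑ ^ 2 := fun z => by
        rw [← ofReal_norm, ← ENNReal.ofReal_pow (norm_nonneg _), Real.norm_eq_abs, sq_abs, pow_two (stepEval _ _ _ _ _)]
      simp_rw [e1]
      rw [lintegral_prodMeasure hm]
      have h1 := lintegral_lintegral_Ioc_le (P := P) (T := t)
        (C := ENNReal.ofReal ((D * (1 / ((n : ℝ) + 1))) ^ 2)) (f := fun ω u =>
        ‖stepEval ((n + 1) ^ 2) (time n) η u.toNNReal ω‖ₑ ^ 2) (hm.enorm.pow_const 2)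
        (fun u hu => by
          lift u to ℝ≥0 using hu.1.le
          rw [Real.toNNReal_coe]
          have hu0 : 0 < u := by exact_mod_cast hu.1
          have hut : u ≤ t := by exact_mod_cast hu.2
          obtain ⟨k, hk, hku⟩ := exists_grid_mem n hu0 (hut.trans hn)
          have e2 : ∀ ω, stepEval ((n + 1) ^ 2) (time n) η u ω = η k ω := fun ω =>
            stepEval_of_mem (htime n) η hk hku ω
          simp_rw [e2]
          rw [← eLpNorm_two_le_iff (by positivity)]
          exact hDk n k (hku.1.le.trans hut))
      refine h1.trans (le_of_eq ?_)
      rw [← ENNReal.ofReal_coe_nnreal, ← ENNReal.ofReal_mul t.coe_nonneg,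
        mul_pow (Real.sqrt t), Real.sq_sqrt t.coe_nonneg]
    have hK : eLpNorm (fun ω => I ω - M ω) 2 P
        ≤ ENNReal.ofReal (C * Real.sqrt (1 / ((n : ℝ) + 1))) := by
      have h1 := hCk (fun k => min (time n k) t)
        (fun a b hab => min_le_min_right t (htime n hab)) (fun k => min_le_right _ _)
        (by simp [time]) ((n + 1) ^ 2) (by
          refine min_eq_right (hn.trans (le_of_eq ?_))
          simp only [time]
          push_cast
          rw [sq, mul_div_assoc, div_self (by positivity), mul_one])
        (1 / ((n : ℝ) + 1)) (by positivity) (fun k => by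
          rw [← hmesh n k]
          push_cast
          have hle : (time n k : ℝ) ≤ time n (k + 1) := by exact_mod_cast htime n (Nat.le_succ k)
          rcases le_total (time n k : ℝ) t with h | h
          · rw [min_eq_left h]
            exact sub_le_sub_right (min_le_left _ _) _
          · rw [min_eq_right h, min_eq_right (h.trans hle)]
            linarith)
      refine le_trans (le_of_eq ?_) h1
      congr 1
      funext ω
      simp only [hI, hM, stepIntegral]
      congr 1
      refine Finset.sum_congr rfl fun k _ => ?_
      rcases le_total (time n k) t with h | h
      · rw [min_eq_left h]
      · rw [min_eq_right h, min_eq_right (h.trans (htime n (Nat.le_succ k)))]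
        simp
    have heq : (fun ω => (S n).integral w t ω - M ω)
        = stepIntegral ((n + 1) ^ 2) (time n) η w t + fun ω => I ω - M ω := by
      funext ω
      simp only [Pi.add_apply, hI, stepIntegral, hη, SimpleIntegrand.integral, S]
      rw [← add_sub_assoc, ← Finset.sum_add_distrib]
      congr 1
      refine Finset.sum_congr rfl fun k _ => ?_
      ring
    rw [heq]
    refine (eLpNorm_add_le hJL.1 (hIL.1.sub (hMm t).aestronglyMeasurable) (by norm_num)).trans
      ((add_le_add hJ hK).trans (le_of_eq ?_))
    rw [← ENNReal.ofReal_add (by positivity) (by positivity)]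

/-- When the diffusion is a multiple of the drift, the closed loop of a linear feedback is solved by
geometric Brownian motion. -/
theorem exists_multiplicative_solution [IsProbabilityMeasure P]
    {W : ℝ≥0 → Ω → EuclideanSpace ℝ (Fin 1)}
    (hW : IsBrownianMotion 𝓕 W P) (A : Matrix (Fin d) (Fin d) ℝ) (B : Matrix (Fin d) (Fin m) ℝ)
    (c : ℝ) (Q : Matrix (Fin d) (Fin d) ℝ) (R : Matrix (Fin m) (Fin m) ℝ) (β : ℝ)
    (K : EuclideanSpace ℝ (Fin d) →ₗ[ℝ] EuclideanSpace ℝ (Fin m))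
    (s : EuclideanSpace ℝ (Fin d)) :
    ∃ X, IsClosedLoopSolution (multiplicativeLQ A B (c • A) (c • B) Q R β) 𝓕 W P K s X := by
  set L : EuclideanSpace ℝ (Fin d) →L[ℝ] EuclideanSpace ℝ (Fin d) :=
    LinearMap.toContinuousLinearMap (A.toEuclideanLin + B.toEuclideanLin ∘ₗ K) with hL
  have hLx : ∀ x, linDrift A B x (K x) = L x := fun x => by simp [linDrift, hL]
  have hcLx : ∀ x, linDrift (c • A) (c • B) x (K x) = (c • L) x := fun x => by
    simp [linDrift, hL]
  have hw := hW.component 0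
  set w : ℝ≥0 → Ω → ℝ := fun t ω => W t ω 0 with hwd
  have hm := measurable_geometricBM_toNNReal (L := L) (c := c) (s := s) hw
  have hml : ∀ T, MemLp (fun z : Ω × ℝ => geometricBM L c w s z.2.toNNReal z.1) 2
      (prodMeasure P T) := by
    intro T
    obtain ⟨D, hD, h⟩ := exists_geometricBM_moment (L := L) (c := c) (s := s) hw 2 T
    refine ⟨hm.aestronglyMeasurable, ?_⟩
    rw [eLpNorm_lt_top_iff_lintegral_rpow_enorm_lt_top (by norm_num) (by norm_num)]
    simp only [ENNReal.toReal_ofNat, ENNReal.rpow_two]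
    rw [lintegral_prod _ (hm.enorm.pow_const 2).aemeasurable]
    refine (lintegral_lintegral_Ioc_le (f := fun ω u =>
      ‖geometricBM L c w s u.toNNReal ω‖ₑ ^ 2) (hm.enorm.pow_const 2)
      (C := ENNReal.ofReal D) fun u hu => ?_).trans_lt (by finiteness)
    refine h _ ?_
    rw [Real.coe_toNNReal _ hu.1.le]
    exact hu.2
  refine ⟨geometricBM L c w s, fun t => measurable_geometricBM hw t, continuous_geometricBM hw,
    fun T => lintegral_sq_add_sq_lt_top
      (f := fun z => geometricBM L c w s z.2.toNNReal z.1)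
      (g := fun z => K (geometricBM L c w s z.2.toNNReal z.1)) (hml T)
      ((LinearMap.toContinuousLinearMap K).comp_memLp' (hml T)), ?_⟩
  refine ⟨fun i _ t ω => geometricBM L c w s t ω i - s i
        - (∫ u in (0 : ℝ)..t, L (geometricBM L c w s u.toNNReal ω)) i, fun i j => ?_,
    fun t => Eventually.of_forall fun ω i => ?_⟩
  · have h1 := isItoIntegral_geometricBM (L := L) (c := c) (s := s) hw i
    have h2 : (fun t ω => (multiplicativeLQ A B (c • A) (c • B) Q R β).diffusion
        (geometricBM L c w s t ω) (K (geometricBM L c w s t ω)) i j)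
        = fun t ω => (c • L) (geometricBM L c w s t ω) i := by
      funext t ω
      simp only [multiplicativeLQ, Matrix.of_apply, hcLx]
    rw [h2, Subsingleton.elim j 0]
    exact h1
  · have h2 : (∫ u in (0 : ℝ)..t, L (geometricBM L c w s u.toNNReal ω)) i
        = ∫ u in (0 : ℝ)..t, L (geometricBM L c w s u.toNNReal ω) i :=
      ((EuclideanSpace.proj (𝕜 := ℝ) i : EuclideanSpace ℝ (Fin d) →L[ℝ] ℝ).intervalIntegral_comp_comm
        ((L.continuous.comp (continuous_geometricBM_toNNReal hw ω)).intervalIntegrable _ _)).symm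
    simp only [multiplicativeLQ, hLx, Finset.univ_unique, Finset.sum_const, Finset.card_singleton,
      one_smul, h2]
    ring

end Multiplicative

/-! ### Quadratic forms along solutions of the two problems -/

section Balance

variable {Ω : Type*} {mΩ : MeasurableSpace Ω} {P : Measure Ω} {𝓕 : Filtration ℝ≥0 mΩ} {d m : ℕ}

theorem IsBrownianMotion.integral_inc_mul_inc {n : ℕ} {W : ℝ≥0 → Ω → EuclideanSpace ℝ (Fin n)}
    (hW : IsBrownianMotion 𝓕 W P) (t : ℝ≥0) (i k : Fin n) :
    ∫ ω, (W t ω i - W 0 ω i) * (W t ω k - W 0 ω k) ∂P = if i = k then (t : ℝ) else 0 := by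
  have hm : ∀ t, Measurable (W t) := fun t => (hW.adapted t).mono (𝓕.le t) le_rfl
  have hmi : AEMeasurable (fun ω => W t ω - W 0 ω) P := ((hm t).sub (hm 0)).aemeasurable
  have h1 := covariance_eval_multivariateGaussian (μ := (0 : EuclideanSpace ℝ (Fin n)))
    (posSemidef_smul_one (n := n) (c := (t : ℝ) - ((0 : ℝ≥0) : ℝ)) (by simp)) i k
  have hmean : ∀ i : Fin n, ∫ x, x i ∂(multivariateGaussian (0 : EuclideanSpace ℝ (Fin n))
      (((t : ℝ) - ((0 : ℝ≥0) : ℝ)) • (1 : Matrix (Fin n) (Fin n) ℝ))) = 0 := fun i => by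
    rw [← hW.increment_law 0 t zero_le, integral_map hmi (by fun_prop)]
    exact (hW.component i).integral_inc zero_le
  rw [covariance, hmean i, hmean k, ← hW.increment_law 0 t zero_le,
    integral_map hmi (by fun_prop)] at h1
  simp only [sub_zero, PiLp.sub_apply, NNReal.coe_zero, Matrix.smul_apply, Matrix.one_apply,
    smul_eq_mul, mul_ite, mul_one, mul_zero] at h1
  exact h1

variable [IsProbabilityMeasure P]

/-- The mean of a quadratic form along a solution with additive noise; the noise contributes
`σ² tr p` per unit of time. -/
theorem additive_integral_bilin_eq {A : Matrix (Fin d) (Fin d) ℝ} {B : Matrix (Fin d) (Fin m) ℝ}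
    {σ : ℝ} {Q : Matrix (Fin d) (Fin d) ℝ} {R : Matrix (Fin m) (Fin m) ℝ} {β : ℝ}
    {W : ℝ≥0 → Ω → EuclideanSpace ℝ (Fin d)}
    {π : EuclideanSpace ℝ (Fin d) → EuclideanSpace ℝ (Fin m)} {s : EuclideanSpace ℝ (Fin d)}
    {X : ℝ≥0 → Ω → EuclideanSpace ℝ (Fin d)} (hW : IsBrownianMotion 𝓕 W P)
    (hX : IsClosedLoopSolution (additiveLQ A B σ Q R β) 𝓕 W P π s X) (hπ : Measurable π)
    {p : BilinForm ℝ (EuclideanSpace ℝ (Fin d))} (hp : ∀ x y, p x y = p y x) (t : ℝ≥0) :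
    ∫ ω, p (X t ω) (X t ω) ∂P = p s s + ∫ z, (2 * p (X z.2.toNNReal z.1)
      (linDrift A B (X z.2.toNNReal z.1) (π (X z.2.toNNReal z.1)))
      + σ ^ 2 * ∑ i, p (EuclideanSpace.single i 1) (EuclideanSpace.single i 1))
        ∂(prodMeasure P t) := by
  obtain ⟨M, hM, hI⟩ := hX.exists_isItoProcess hW hπ (A := A) (B := B) rfl
  refine hX.integral_bilin_eq hW hπ (A := A) (B := B) rfl hp hI t (integrable_const _) ?_
  have h1 : ∀ i, (fun ω => ∑ j, M i j t ω) =ᵐ[P] fun ω => σ * (W t ω i - W 0 ω i) := by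
    intro i
    have h2 : ∀ᵐ ω ∂P, ∀ j, M i j t ω
        = (σ • (1 : Matrix (Fin d) (Fin d) ℝ)) i j * (W t ω j - W 0 ω j) :=
      ae_all_iff.2 fun j => (hM i j).ae_eq (hW.component j)
        (isItoIntegral_const (hW.component j) _) t
    filter_upwards [h2] with ω hω
    simp [hω, Matrix.one_apply]
  have h3 : ∀ i k, ∫ ω, (∑ j, M i j t ω) * (∑ j, M k j t ω) ∂P
      = σ ^ 2 * if i = k then (t : ℝ) else 0 := by
    intro i k
    rw [← hW.integral_inc_mul_inc t i k, ← integral_const_mul]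
    refine integral_congr_ae ?_
    filter_upwards [h1 i, h1 k] with ω hi hk
    rw [hi, hk]
    ring
  simp_rw [h3]
  have h4 : (prodMeasure P t).real Set.univ = t := by
    rw [measureReal_def, Measure.prod_apply MeasurableSet.univ]
    simp
  rw [integral_const, h4, smul_eq_mul, Finset.mul_sum, Finset.mul_sum]
  refine Finset.sum_congr rfl fun i _ => ?_
  rw [Finset.sum_eq_single i (fun k _ hk => by simp [hk.symm]) (by simp)]
  simp only [if_true]
  ring

/-- The mean of a quadratic form along a solution with multiplicative noise; the noise contributes
the form evaluated at the diffusion coefficient. -/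
theorem multiplicative_integral_bilin_eq {A : Matrix (Fin d) (Fin d) ℝ}
    {B : Matrix (Fin d) (Fin m) ℝ} {C : Matrix (Fin d) (Fin d) ℝ} {D : Matrix (Fin d) (Fin m) ℝ}
    {Q : Matrix (Fin d) (Fin d) ℝ} {R : Matrix (Fin m) (Fin m) ℝ} {β : ℝ}
    {W : ℝ≥0 → Ω → EuclideanSpace ℝ (Fin 1)}
    {π : EuclideanSpace ℝ (Fin d) → EuclideanSpace ℝ (Fin m)} {s : EuclideanSpace ℝ (Fin d)}
    {X : ℝ≥0 → Ω → EuclideanSpace ℝ (Fin d)} (hW : IsBrownianMotion 𝓕 W P)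
    (hX : IsClosedLoopSolution (multiplicativeLQ A B C D Q R β) 𝓕 W P π s X) (hπ : Measurable π)
    {p : BilinForm ℝ (EuclideanSpace ℝ (Fin d))} (hp : ∀ x y, p x y = p y x) (t : ℝ≥0) :
    Integrable (fun z => 2 * p (X z.2.toNNReal z.1)
      (linDrift A B (X z.2.toNNReal z.1) (π (X z.2.toNNReal z.1)))
      + p (linDrift C D (X z.2.toNNReal z.1) (π (X z.2.toNNReal z.1)))
        (linDrift C D (X z.2.toNNReal z.1) (π (X z.2.toNNReal z.1)))) (prodMeasure P t) ∧
    ∫ ω, p (X t ω) (X t ω) ∂P = p s s + ∫ z, (2 * p (X z.2.toNNReal z.1)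
      (linDrift A B (X z.2.toNNReal z.1) (π (X z.2.toNNReal z.1)))
      + p (linDrift C D (X z.2.toNNReal z.1) (π (X z.2.toNNReal z.1)))
        (linDrift C D (X z.2.toNNReal z.1) (π (X z.2.toNNReal z.1)))) ∂(prodMeasure P t) := by
  obtain ⟨M, hM, hI⟩ := hX.exists_isItoProcess hW hπ (A := A) (B := B) rfl
  obtain ⟨h1, h2⟩ := hX.memLp_pair hπ t
  have hlin : ∀ (A : Matrix (Fin d) (Fin d) ℝ) (B : Matrix (Fin d) (Fin m) ℝ),
      MemLp (fun z : Ω × ℝ => linDrift A B (X z.2.toNNReal z.1)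
      (π (X z.2.toNNReal z.1))) 2 (prodMeasure P t) := fun A B =>
    ((LinearMap.toContinuousLinearMap A.toEuclideanLin).comp_memLp' h1).add
      ((LinearMap.toContinuousLinearMap B.toEuclideanLin).comp_memLp' h2)
  have i1 := integrable_bilin p h1 (hlin A B)
  have i2 := integrable_bilin p (hlin C D) (hlin C D)
  refine ⟨(i1.const_mul 2).add i2, hX.integral_bilin_eq hW hπ (A := A) (B := B) rfl hp hI t i2 ?_⟩
  rw [integral_bilin p (hlin C D) (hlin C D)]
  refine Finset.sum_congr rfl fun i _ => Finset.sum_congr rfl fun k _ => ?_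
  have h3 := (hM i 0).integral_mul (hW.component 0) (hM k 0) t
  simp only [Finset.univ_unique, Fin.default_eq_zero, Finset.sum_singleton]
  rw [h3]
  rfl

end Balance

/-! ### Second moments and Lyapunov forms -/

section Lyapunov

variable {d m : ℕ}

/-- The symmetrised outer product of two vectors, as a plain function of two indices so that it lives
in a normed space. -/
noncomputable def outerForm (d : ℕ) : EuclideanSpace ℝ (Fin d) →ₗ[ℝ] EuclideanSpace ℝ (Fin d) →ₗ[ℝ]
    (Fin d → Fin d → ℝ) :=
  LinearMap.mk₂ ℝ (fun x y i k => (x i * y k + x k * y i) / 2)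
    (fun x x' y => by ext i k; simp; ring) (fun c x y => by ext i k; simp; ring)
    (fun x y y' => by ext i k; simp; ring) (fun c x y => by ext i k; simp; ring)

theorem outerForm_apply (x y : EuclideanSpace ℝ (Fin d)) (i k : Fin d) :
    outerForm d x y i k = (x i * y k + x k * y i) / 2 := rfl

/-- The generator `v ↦ G v + v Gᵀ + H v Hᵀ` of the second-moment equation of
`dX = G X dt + H X dw`. -/
noncomputable def momentGen (G H : Matrix (Fin d) (Fin d) ℝ) :
    (Fin d → Fin d → ℝ) →ₗ[ℝ] (Fin d → Fin d → ℝ) where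
  toFun v := fun i k => ∑ l, (G k l * v i l + G i l * v l k) + ∑ l, ∑ r, H i l * H k r * v l r
  map_add' v v' := by
    ext i k
    simp only [Pi.add_apply, mul_add, Finset.sum_add_distrib]
    ring
  map_smul' c v := by
    ext i k
    simp only [Pi.smul_apply, smul_eq_mul, RingHom.id_apply, mul_add, Finset.mul_sum,
      Finset.sum_add_distrib]
    congr 1
    · congr 1 <;> exact Finset.sum_congr rfl fun _ _ => by ring
    · exact Finset.sum_congr rfl fun _ _ => Finset.sum_congr rfl fun _ _ => by ring

theorem momentGen_apply (G H : Matrix (Fin d) (Fin d) ℝ) (v : Fin d → Fin d → ℝ) (i k : Fin d) :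
    momentGen G H v i k
      = ∑ l, (G k l * v i l + G i l * v l k) + ∑ l, ∑ r, H i l * H k r * v l r := rfl

theorem toEuclideanLin_eq_sum {k l : ℕ} (M : Matrix (Fin k) (Fin l) ℝ) (x : EuclideanSpace ℝ (Fin l))
    (i : Fin k) : M.toEuclideanLin x i = ∑ j, M i j * x j := by
  rfl

theorem momentGen_outerForm (G H : Matrix (Fin d) (Fin d) ℝ) (x : EuclideanSpace ℝ (Fin d)) :
    momentGen G H (outerForm d x x) = (2 : ℝ) • outerForm d x (G.toEuclideanLin x)
      + outerForm d (H.toEuclideanLin x) (H.toEuclideanLin x) := by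
  ext i k
  simp only [momentGen_apply, outerForm_apply, Pi.add_apply, Pi.smul_apply, smul_eq_mul,
    toEuclideanLin_eq_sum]
  have h1 : (∑ j, H i j * x j) * (∑ j, H k j * x j)
      = ∑ l, ∑ r, H i l * H k r * (x l * x r) := by
    rw [Finset.sum_mul_sum]
    exact Finset.sum_congr rfl fun _ _ => Finset.sum_congr rfl fun _ _ => by ring
  have h2 : ∑ l, (G k l * ((x i * x l + x l * x i) / 2) + G i l * ((x l * x k + x k * x l) / 2))
      = x i * (∑ j, G k j * x j) + x k * ∑ j, G i j * x j := by
    rw [Finset.mul_sum, Finset.mul_sum, ← Finset.sum_add_distrib]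
    exact Finset.sum_congr rfl fun _ _ => by ring
  rw [h2, mul_comm (∑ j, H k j * x j), ← mul_two, mul_div_assoc, div_self two_ne_zero, mul_one, h1]
  congr 1
  · ring
  · exact Finset.sum_congr rfl fun _ _ => Finset.sum_congr rfl fun _ _ => by ring

/-- If the second moments of `dX = G X dt + H X dw` decay, then a quadratic form decreases in mean
along its solutions. -/
theorem exists_stable_form (G H : Matrix (Fin d) (Fin d) ℝ)
    (h : ∀ x : EuclideanSpace ℝ (Fin d), ∃ v : ℝ → Fin d → Fin d → ℝ,
      (∀ t, 0 ≤ t → IntervalIntegrable v volume 0 t) ∧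
      (∀ t, 0 ≤ t → v t = outerForm d x x + ∫ u in (0 : ℝ)..t, momentGen G H (v u)) ∧
      (∀ t, 0 ≤ t → ∀ i, 0 ≤ v t i i) ∧ Tendsto v atTop (𝓝 0)) :
    ∃ S : BilinForm ℝ (EuclideanSpace ℝ (Fin d)), (∀ x y, S x y = S y x) ∧ (∀ x, 0 ≤ S x x) ∧
      ∀ x, 2 * S x (G.toEuclideanLin x) + S (H.toEuclideanLin x) (H.toEuclideanLin x)
        ≤ - ‖x‖ ^ 2 := by
  let τ : (Fin d → Fin d → ℝ) →ₗ[ℝ] ℝ :=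
    { toFun := fun v => ∑ i, v i i
      map_add' := fun v v' => by simp [Finset.sum_add_distrib]
      map_smul' := fun c v => by simp [Finset.mul_sum] }
  have hτ : ∀ v, LinearMap.toContinuousLinearMap τ v = ∑ i, v i i := fun v => rfl
  have hO : ∀ x y, outerForm d x y = outerForm d y x := fun x y => by
    ext i k
    simp only [outerForm_apply]
    ring
  obtain ⟨J, hJ0, hJ⟩ := exists_lyapunov (LinearMap.toContinuousLinearMap (momentGen G H))
    (LinearMap.toContinuousLinearMap τ) (outerForm d) hO
    (fun x => by
      rw [hτ, EuclideanSpace.real_norm_sq_eq]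
      refine Finset.sum_congr rfl fun i _ => ?_
      rw [outerForm_apply]
      ring)
    (fun x => by
      obtain ⟨v, h1, h2, h3, h4⟩ := h x
      exact ⟨v, h1, h2, fun t ht => by
        rw [hτ]
        exact Finset.sum_nonneg fun i _ => h3 t ht i, h4⟩)
  refine ⟨(outerForm d).compr₂ J.toLinearMap, fun x y => ?_, fun x => ?_, fun x => ?_⟩
  · simp only [LinearMap.compr₂_apply]
    rw [hO]
  · exact hJ0 x
  · have h1 := hJ x
    rw [LinearMap.coe_toContinuousLinearMap', momentGen_outerForm, map_add, map_smul,
      smul_eq_mul] at h1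
    exact h1

theorem hasDerivAt_exp_mulVec (G : Matrix (Fin d) (Fin d) ℝ) (x : Fin d → ℝ) (t : ℝ) :
    HasDerivAt (fun t : ℝ => NormedSpace.exp (t • G) *ᵥ x)
      (G *ᵥ (NormedSpace.exp (t • G) *ᵥ x)) t := by
  let _ : NormedRing (Matrix (Fin d) (Fin d) ℝ) := Matrix.linftyOpNormedRing
  let _ : NormedAlgebra ℝ (Matrix (Fin d) (Fin d) ℝ) := Matrix.linftyOpNormedAlgebra
  have h1 := hasDerivAt_exp_smul_const' G t
  let T : Matrix (Fin d) (Fin d) ℝ →ₗ[ℝ] (Fin d → ℝ) :=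
    { toFun := fun M => M *ᵥ x
      map_add' := fun M N => Matrix.add_mulVec M N x
      map_smul' := fun c M => Matrix.smul_mulVec c M x }
  have h2 := (LinearMap.toContinuousLinearMap T).hasFDerivAt.comp_hasDerivAt t h1
  rw [Matrix.mulVec_mulVec]
  exact h2

/-- The Lyapunov inequality for stabilizable pairs. -/
theorem Stabilizable.exists_form {A : Matrix (Fin d) (Fin d) ℝ} {B : Matrix (Fin d) (Fin m) ℝ}
    (h : Stabilizable A B) :
    ∃ (K : EuclideanSpace ℝ (Fin d) →ₗ[ℝ] EuclideanSpace ℝ (Fin m))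
      (S : BilinForm ℝ (EuclideanSpace ℝ (Fin d))), (∀ x y, S x y = S y x) ∧ (∀ x, 0 ≤ S x x) ∧
      ∀ x, 2 * S x (linDrift A B x (K x)) ≤ - ‖x‖ ^ 2 := by
  obtain ⟨K, hK⟩ := h
  set G := A + B * K with hG
  obtain ⟨S, hSs, hS0, hS⟩ := exists_stable_form G 0 (fun x => by
    set y : ℝ → EuclideanSpace ℝ (Fin d) := fun t =>
      WithLp.toLp 2 (NormedSpace.exp (t • G) *ᵥ x.ofLp) with hy
    have hyd : ∀ t i, HasDerivAt (fun t => y t i) (G.toEuclideanLin (y t) i) t := fun t i =>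
      (hasDerivAt_pi.1 (hasDerivAt_exp_mulVec G x.ofLp t)) i
    have hvd : ∀ t, HasDerivAt (fun t => outerForm d (y t) (y t))
        (momentGen G 0 (outerForm d (y t) (y t))) t := by
      intro t
      refine hasDerivAt_pi.2 fun i => hasDerivAt_pi.2 fun k => ?_
      have h1 := ((hyd t i).mul (hyd t k)).add ((hyd t k).mul (hyd t i))
      have h2 := h1.div_const 2
      refine h2.congr_deriv ?_
      rw [momentGen_outerForm, map_zero, LinearMap.zero_apply, map_zero, add_zero]
      simp only [Pi.smul_apply, outerForm_apply, smul_eq_mul]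
      ring
    have hvc : Continuous fun t => outerForm d (y t) (y t) :=
      continuous_iff_continuousAt.2 fun t => (hvd t).continuousAt
    refine ⟨fun t => outerForm d (y t) (y t), fun t _ => hvc.intervalIntegrable _ _,
      fun t _ => ?_, fun t _ i => ?_, ?_⟩
    · have h1 := intervalIntegral.integral_eq_sub_of_hasDerivAt (a := 0) (b := t)
        (fun u _ => hvd u) (((momentGen G 0).continuous_of_finiteDimensional.comp
          hvc).intervalIntegrable _ _)
      have h2 : y 0 = x := by simp [hy]
      rw [h1, h2]
      abel
    · simp only [outerForm_apply]
      nlinarith [mul_self_nonneg (y t i)]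
    · refine tendsto_pi_nhds.2 fun i => tendsto_pi_nhds.2 fun k => ?_
      have h1 : ∀ i, Tendsto (fun t => y t i) atTop (𝓝 0) := fun i =>
        tendsto_pi_nhds.1 (hK x.ofLp) i
      have h2 := (((h1 i).mul (h1 k)).add ((h1 k).mul (h1 i))).div_const 2
      simpa [outerForm_apply] using h2)
  refine ⟨K.toEuclideanLin, S, hSs, hS0, fun x => ?_⟩
  have h1 := hS x
  have h2 : linDrift A B x (K.toEuclideanLin x) = G.toEuclideanLin x := by
    have h3 : (B * K).toEuclideanLin x = B.toEuclideanLin (K.toEuclideanLin x) := by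
      rw [Matrix.toLpLin_mul (q := 2)]; rfl
    rw [linDrift, ← h3, hG, map_add, LinearMap.add_apply]
  rw [h2]
  simpa using h1

/-- The Lyapunov inequality for mean-square stabilizable systems. -/
theorem MeanSquareStabilizable.exists_form {Ω : Type*} {mΩ : MeasurableSpace Ω} {P : Measure Ω}
    [IsProbabilityMeasure P] {𝓕 : Filtration ℝ≥0 mΩ} {W : ℝ≥0 → Ω → EuclideanSpace ℝ (Fin 1)}
    (hW : IsBrownianMotion 𝓕 W P)
    {A : Matrix (Fin d) (Fin d) ℝ} {B : Matrix (Fin d) (Fin m) ℝ}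
    {C : Matrix (Fin d) (Fin d) ℝ} {D : Matrix (Fin d) (Fin m) ℝ}
    (h : MeanSquareStabilizable 𝓕 W P A B C D) :
    ∃ (K : EuclideanSpace ℝ (Fin d) →ₗ[ℝ] EuclideanSpace ℝ (Fin m))
      (S : BilinForm ℝ (EuclideanSpace ℝ (Fin d))), (∀ x y, S x y = S y x) ∧ (∀ x, 0 ≤ S x x) ∧
      ∀ x, 2 * S x (linDrift A B x (K x)) + S (linDrift C D x (K x)) (linDrift C D x (K x))
        ≤ - ‖x‖ ^ 2 := by
  obtain ⟨K, hK⟩ := h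
  have hlin : ∀ (A : Matrix (Fin d) (Fin d) ℝ) (B : Matrix (Fin d) (Fin m) ℝ) x,
      linDrift A B x (K.toEuclideanLin x) = (A + B * K).toEuclideanLin x := fun A B x => by
    have h3 : (B * K).toEuclideanLin x = B.toEuclideanLin (K.toEuclideanLin x) := by
      rw [Matrix.toLpLin_mul (q := 2)]; rfl
    rw [linDrift, ← h3, map_add, LinearMap.add_apply]
  have hKm : Measurable fun x => K.toEuclideanLin x :=
    (K.toEuclideanLin.continuous_of_finiteDimensional).measurable
  obtain ⟨S, hSs, hS0, hS⟩ := exists_stable_form (A + B * K) (C + D * K) (fun s => by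
    obtain ⟨X, hX, hlim⟩ := hK s
    have hXL : ∀ t, MemLp (X t) 2 P := hX.memLp_at hW hKm (A := A) (B := B) rfl
    set v : ℝ → Fin d → Fin d → ℝ := fun t i k =>
      ∫ ω, X t.toNNReal ω i * X t.toNNReal ω k ∂P with hv
    have hXij : ∀ (t : ℝ) i k, Integrable (fun ω => X t.toNNReal ω i * X t.toNNReal ω k) P :=
      fun t i k => integrable_mul_of_memLp_two (memLp_component (hXL _) i) (memLp_component (hXL _) k)
    have hp : ∀ i k, ∃ p : BilinForm ℝ (EuclideanSpace ℝ (Fin d)),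
        ∀ x y, p x y = outerForm d x y i k := fun i k =>
      ⟨(outerForm d).compr₂ ((LinearMap.proj (R := ℝ) (φ := fun _ : Fin d => ℝ) k).comp
        (LinearMap.proj (R := ℝ) (φ := fun _ : Fin d => Fin d → ℝ) i)), fun x y => rfl⟩
    have hvi : ∀ t : ℝ, 0 ≤ t → ∀ i k, IntervalIntegrable (fun u => v u i k) volume 0 t := by
      intro t ht i k
      refine intervalIntegrable_mean (P := P)
        (g := fun z => X z.2.toNNReal z.1 i * X z.2.toNNReal z.1 k) (fun T => ?_) t ht
      have h1 := (hX.memLp_pair hKm T).1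
      exact integrable_mul_of_memLp_two (memLp_component h1 i) (memLp_component h1 k)
    have hvI : ∀ t, 0 ≤ t → IntervalIntegrable v volume 0 t := by
      intro t ht
      rw [intervalIntegrable_iff_integrableOn_Ioc_of_le ht]
      refine Integrable.of_eval fun i => Integrable.of_eval fun k => ?_
      exact (intervalIntegrable_iff_integrableOn_Ioc_of_le ht).1 (hvi t ht i k)
    refine ⟨v, hvI, fun t ht => ?_, fun t ht i => integral_nonneg fun ω => mul_self_nonneg _, ?_⟩
    · lift t to ℝ≥0 using ht
      ext i k
      obtain ⟨p, hpe⟩ := hp i k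
      obtain ⟨h1, h2⟩ := multiplicative_integral_bilin_eq hW hX hKm (p := p)
        (fun x y => by rw [hpe, hpe, outerForm_apply, outerForm_apply]; ring) t
      rw [integral_prodMeasure_eq t h1] at h2
      have h3 : v t i k = ∫ ω, p (X t ω) (X t ω) ∂P := by
        simp only [hv, hpe, outerForm_apply, Real.toNNReal_coe]
        exact integral_congr_ae (Eventually.of_forall fun ω => by ring)
      have hcI : IntervalIntegrable (fun u => momentGen (A + B * K) (C + D * K) (v u)) volume 0 t := by
        have h4 := hvI t t.coe_nonneg
        rw [intervalIntegrable_iff_integrableOn_Ioc_of_le t.coe_nonneg] at h4 ⊢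
        exact (LinearMap.toContinuousLinearMap
          (momentGen (A + B * K) (C + D * K))).integrable_comp h4
      have h4 : (∫ u in (0 : ℝ)..t, momentGen (A + B * K) (C + D * K) (v u)) i k
          = ∫ u in (0 : ℝ)..t, momentGen (A + B * K) (C + D * K) (v u) i k := by
        have := ((ContinuousLinearMap.proj (R := ℝ) (φ := fun _ : Fin d => ℝ) k).comp
          (ContinuousLinearMap.proj (R := ℝ) (φ := fun _ : Fin d => Fin d → ℝ) i)
          ).intervalIntegral_comp_comm hcI
        exact this.symm
      rw [h3, h2, Pi.add_apply, Pi.add_apply, h4, hpe]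
      congr 1
      refine intervalIntegral.integral_congr fun u _ => ?_
      simp only [hlin, hpe]
      have e1 : ∀ x : EuclideanSpace ℝ (Fin d),
          2 * outerForm d x ((A + B * K).toEuclideanLin x) i k
          + outerForm d ((C + D * K).toEuclideanLin x) ((C + D * K).toEuclideanLin x) i k
          = ∑ l, ((A + B * K) k l * (x i * x l) + (A + B * K) i l * (x l * x k))
            + ∑ l, ∑ r, (C + D * K) i l * (C + D * K) k r * (x l * x r) := by
        intro x
        have e2 := congrFun (congrFun (momentGen_outerForm (A + B * K) (C + D * K) x) i) k
        simp only [Pi.add_apply, Pi.smul_apply, smul_eq_mul] at e2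
        rw [← e2, momentGen_apply]
        simp only [outerForm_apply]
        congr 1
        · exact Finset.sum_congr rfl fun _ _ => by ring
        · exact Finset.sum_congr rfl fun _ _ => Finset.sum_congr rfl fun _ _ => by ring
      simp_rw [e1]
      have j1 : ∀ l, Integrable (fun ω => (A + B * K) k l * (X u.toNNReal ω i * X u.toNNReal ω l)
          + (A + B * K) i l * (X u.toNNReal ω l * X u.toNNReal ω k)) P := fun l =>
        ((hXij u i l).const_mul _).add ((hXij u l k).const_mul _)
      have j2 : ∀ l r, Integrable (fun ω => (C + D * K) i l * (C + D * K) k r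
          * (X u.toNNReal ω l * X u.toNNReal ω r)) P := fun l r => (hXij u l r).const_mul _
      rw [integral_add (integrable_finsetSum _ fun l _ => j1 l)
        (integrable_finsetSum _ fun l _ => integrable_finsetSum _ fun r _ => j2 l r),
        integral_finsetSum _ fun l _ => j1 l,
        integral_finsetSum _ fun l _ => integrable_finsetSum _ fun r _ => j2 l r, momentGen_apply]
      congr 1
      · refine Finset.sum_congr rfl fun l _ => ?_
        rw [integral_add ((hXij u i l).const_mul _) ((hXij u l k).const_mul _),
          integral_const_mul, integral_const_mul]
      · refine Finset.sum_congr rfl fun l _ => ?_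
        rw [integral_finsetSum _ fun r _ => j2 l r]
        exact Finset.sum_congr rfl fun r _ => integral_const_mul _ _
    · refine tendsto_pi_nhds.2 fun i => tendsto_pi_nhds.2 fun k => ?_
      have h1 : Tendsto (fun t : ℝ => (∫⁻ ω, ‖X t.toNNReal ω‖ₑ ^ 2 ∂P).toReal) atTop (𝓝 0) := by
        have h2 := (ENNReal.tendsto_toReal (a := 0) (by simp)).comp hlim
        exact h2.comp tendsto_real_toNNReal_atTop
      refine squeeze_zero_norm (fun t => ?_) h1
      have h2 : (∫⁻ ω, ‖X t.toNNReal ω‖ₑ ^ 2 ∂P).toReal = ∫ ω, ‖X t.toNNReal ω‖ ^ 2 ∂P := by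
        rw [integral_eq_lintegral_of_nonneg_ae (Eventually.of_forall fun ω => sq_nonneg _)
          ((hXL _).1.norm.pow 2)]
        congr 1
        refine lintegral_congr fun ω => ?_
        rw [ENNReal.ofReal_pow (norm_nonneg _), ofReal_norm]
      rw [h2]
      refine norm_integral_le_of_norm_le (hXL _).integrable_norm_pow' (Eventually.of_forall fun ω => ?_)
      rw [norm_mul, sq]
      exact mul_le_mul (PiLp.norm_apply_le _ _) (PiLp.norm_apply_le _ _) (norm_nonneg _)
        (norm_nonneg _))
  refine ⟨K.toEuclideanLin, S, hSs, hS0, fun x => ?_⟩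
  rw [hlin, hlin]
  exact hS x

end Lyapunov

/-! ### Optimal policies of the two equations -/

section Assembly

variable {Ω : Type*} {mΩ : MeasurableSpace Ω} {P : Measure Ω} [IsProbabilityMeasure P]
  {𝓕 : Filtration ℝ≥0 mΩ} {d m : ℕ}

/-- The Optimal-PhiBE and the problem with additive noise have the same quadratic value and hence the
same policy. The discount is absorbed into the drift as `A - β/2`. -/
theorem exists_phiBE_policy {A : Matrix (Fin d) (Fin d) ℝ} {B : Matrix (Fin d) (Fin m) ℝ} {σ : ℝ}
    {b : EuclideanSpace ℝ (Fin d) → EuclideanSpace ℝ (Fin m) → EuclideanSpace ℝ (Fin d)}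
    (hb : ∀ s a, b s a = linDrift A B s a)
    {Q : Matrix (Fin d) (Fin d) ℝ} {R : Matrix (Fin m) (Fin m) ℝ} {β : ℝ}
    {W : ℝ≥0 → Ω → EuclideanSpace ℝ (Fin d)} (hW : IsBrownianMotion 𝓕 W P)
    (hQ : (-Q).PosDef) (hR : (-R).PosDef) (hβ : 0 ≤ β) (hσ : σ ≠ 0 → 0 < β)
    (hstab : Stabilizable (A - (β / 2) • (1 : Matrix (Fin d) (Fin d) ℝ)) B) :
    ∃ π : EuclideanSpace ℝ (Fin d) → EuclideanSpace ℝ (Fin m),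
      (∀ π', IsPhiBEPolicy (fun s a => quad Q s + quad R a) b β π' ↔ π' = π) ∧
      (∀ π', (Continuous π' ∧ IsOptimalPolicy (additiveLQ A B σ Q R β) 𝓕 W P π') ↔ π' = π) := by
  obtain ⟨K₀, S, hSs, hS0, hS⟩ := hstab.exists_form
  obtain ⟨c, hc, hcb⟩ := bilin_le_norm_sq (matForm (-Q) + (matForm (-R)).compl₁₂ K₀ K₀)
  have hA' : ∀ y, (A - (β / 2) • (1 : Matrix (Fin d) (Fin d) ℝ)).toEuclideanLin y
      = A.toEuclideanLin y - (β / 2) • y := fun y => by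
    simp
  obtain ⟨p, K, hps, hppos, hp⟩ := exists_care (matForm (-Q)) (matForm_symm hQ) (matForm_pos hQ)
    (matForm (-R)) (matForm_symm hR) (matForm_pos hR)
    (A - (β / 2) • (1 : Matrix (Fin d) (Fin d) ℝ)).toEuclideanLin B.toEuclideanLin (c • S)
    (fun x y => by simp [hSs x y])
    (fun x => by
      simp only [LinearMap.smul_apply, smul_eq_mul]
      exact mul_nonneg hc.le (hS0 x)) K₀
    (fun y => by
      have h1 := (le_abs_self _).trans (hcb y)
      have h2 := hS y
      simp only [LinearMap.add_apply, LinearMap.compl₁₂_apply, linDrift] at h1 h2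
      simp only [LinearMap.smul_apply, smul_eq_mul]
      nlinarith)
  have hp' : ∀ y a, matForm (-Q) y y + matForm (-R) a a
      + 2 * p y (A.toEuclideanLin y + B.toEuclideanLin a) - β * p y y
      = matForm (-R) (a - K y) (a - K y) := fun y a => by
    rw [← hp y a, hA', sub_add_eq_add_sub, map_sub, map_smul, smul_eq_mul]
    ring
  have hp0 : ∀ x, 0 ≤ p x x := fun x => by
    rcases eq_or_ne x 0 with rfl | h
    · simp
    · exact (hppos x h).le
  refine ⟨K, isPhiBEPolicy_iff hQ hR hβ A B hb p K hps hppos hp', ?_⟩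
  set k := σ ^ 2 * ∑ i, p (EuclideanSpace.single i 1) (EuclideanSpace.single i 1) with hk
  have hk0 : 0 ≤ k := mul_nonneg (sq_nonneg _) (Finset.sum_nonneg fun i _ => hp0 _)
  refine continuous_optimal_iff (C := additiveLQ A B σ Q R β) (matForm_pos hQ) (matForm_pos hR)
    (matForm_pos hR) hppos (fun s a => ?_) hβ hk0 (fun h => ?_) K (fun π hπ s X hX t => ?_)
    (fun s => exists_additive_solution hW A B σ Q R β K s)
  · simp only [additiveLQ, matForm_neg_self]
    ring
  · refine (hσ fun h0 => h ?_).ne'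
    simp [hk, h0]
  · rw [additive_integral_bilin_eq hW hX hπ hps t]
    congr 1
    refine integral_congr_ae (Eventually.of_forall fun z => ?_)
    have h1 := hp' (X z.2.toNNReal z.1) (π (X z.2.toNNReal z.1))
    simp only [linDrift, additiveLQ] at h1 ⊢
    linarith

/-- With drift `v` and diffusion `√Δt v` at `s`, the mean rate of change of `p`, less the discount
`1 / (Δt γ) - 1 / Δt`, is the one-step increment `γ p (s + Δt v) - p s` divided by `γ Δt`. -/
theorem discounted_step_eq {γ Δt : ℝ} (hγ : γ ≠ 0) (hΔt : 0 < Δt)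
    {p : BilinForm ℝ (EuclideanSpace ℝ (Fin d))} (hps : ∀ x y, p x y = p y x)
    (s v : EuclideanSpace ℝ (Fin d)) :
    2 * p s v + p (Real.sqrt Δt • v) (Real.sqrt Δt • v)
      = (1 / (Δt * γ) - 1 / Δt) * p s s
        + 1 / (γ * Δt) * (γ * p (s + Δt • v) (s + Δt • v) - p s s) := by
  simp only [map_add, map_smul, LinearMap.add_apply, LinearMap.smul_apply, smul_eq_mul]
  rw [← mul_assoc (Real.sqrt Δt), Real.mul_self_sqrt hΔt.le, hps v s]
  have := hΔt.ne'
  field_simp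
  ring

/-- The Optimal-BE and the problem with multiplicative noise have the same quadratic value, up to the
constant from the noise in the transition law, and hence the same policy. Mean-square
stabilizability provides the supersolution for value iteration through `discounted_step_eq`. -/
theorem exists_BE_policy {A : Matrix (Fin d) (Fin d) ℝ} {B : Matrix (Fin d) (Fin m) ℝ} {Δt : ℝ}
    (hΔt : 0 < Δt) {Q : Matrix (Fin d) (Fin d) ℝ} {R : Matrix (Fin m) (Fin m) ℝ} {γ : ℝ}
    {W : ℝ≥0 → Ω → EuclideanSpace ℝ (Fin 1)} (hW : IsBrownianMotion 𝓕 W P)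
    (hQ : (-Q).PosDef) (hR : (-R).PosDef) (hγ : 0 < γ) (hγ1 : γ ≤ 1)
    {T : EuclideanSpace ℝ (Fin d) → EuclideanSpace ℝ (Fin m) → Measure (EuclideanSpace ℝ (Fin d))}
    {μ : Measure (EuclideanSpace ℝ (Fin d))} [IsProbabilityMeasure μ]
    (hμ1 : Integrable (fun x => x) μ) (hμ0 : ∫ x, x ∂μ = 0)
    (hμ2 : Integrable (fun x => ‖x‖ ^ 2) μ) (hγμ : γ < 1 ∨ γ = 1 ∧ μ = Measure.dirac 0)
    (hT : ∀ s a, T s a = μ.map (fun x => s + Δt • linDrift A B s a + x))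
    (hstab : MeanSquareStabilizable 𝓕 W P
      (A - ((1 / (Δt * γ) - 1 / Δt) / 2) • (1 : Matrix (Fin d) (Fin d) ℝ)) B
      (Real.sqrt Δt • A) (Real.sqrt Δt • B)) :
    ∃ π : EuclideanSpace ℝ (Fin d) → EuclideanSpace ℝ (Fin m),
      (∀ π', IsBEPolicy (fun s a => quad Q s + quad R a) T γ π' ↔ π' = π) ∧
      (∀ π', (Continuous π' ∧ IsOptimalPolicy
        (multiplicativeLQ A B (Real.sqrt Δt • A) (Real.sqrt Δt • B)
          ((1 / (γ * Δt)) • Q) ((1 / (γ * Δt)) • R) (1 / (Δt * γ) - 1 / Δt)) 𝓕 W P π')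
        ↔ π' = π) := by
  have hγΔ : 0 < γ * Δt := mul_pos hγ hΔt
  set β : ℝ := 1 / (Δt * γ) - 1 / Δt with hβ
  have hβ0 : 0 ≤ β := by
    have h1 : β = (1 - γ) / (γ * Δt) := by
      rw [hβ]
      field_simp
    rw [h1]
    exact div_nonneg (by linarith) hγΔ.le
  let M : EuclideanSpace ℝ (Fin d) × EuclideanSpace ℝ (Fin m) →ₗ[ℝ] EuclideanSpace ℝ (Fin d) :=
    LinearMap.fst ℝ _ _ + Δt • (A.toEuclideanLin ∘ₗ LinearMap.fst ℝ _ _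
      + B.toEuclideanLin ∘ₗ LinearMap.snd ℝ _ _)
  have hM : ∀ s a, M (s, a) = s + Δt • linDrift A B s a := fun s a => rfl
  let N : BilinForm ℝ (EuclideanSpace ℝ (Fin d) × EuclideanSpace ℝ (Fin m)) :=
    (matForm (-Q)).compl₁₂ (LinearMap.fst ℝ _ _) (LinearMap.fst ℝ _ _)
      + (matForm (-R)).compl₁₂ (LinearMap.snd ℝ _ _) (LinearMap.snd ℝ _ _)
  have hN : ∀ x y, N x y = matForm (-Q) x.1 y.1 + matForm (-R) x.2 y.2 := fun x y => rfl
  have hnn : ∀ {n : ℕ} {D : Matrix (Fin n) (Fin n) ℝ}, D.PosDef → ∀ x, 0 ≤ matForm D x x :=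
    fun hD x => by
      rcases eq_or_ne x 0 with rfl | h
      · simp
      · exact (matForm_pos hD x h).le
  have hcs : ∀ (c : ℝ) (s : EuclideanSpace ℝ (Fin d)) (a : EuclideanSpace ℝ (Fin m)),
      linDrift (c • A) (c • B) s a = c • linDrift A B s a := fun c s a => by
    simp [linDrift]
  obtain ⟨K₀, S, hSs, hS0, hS⟩ := hstab.exists_form hW
  have hS' : ∀ s, γ * S (M (s, K₀ s)) (M (s, K₀ s)) - S s s ≤ -(γ * Δt) * ‖s‖ ^ 2 := by
    intro s
    have h1 := hS s
    have h2 := discounted_step_eq hγ.ne' hΔt hSs s (linDrift A B s (K₀ s))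
    have h3 : linDrift (A - (β / 2) • (1 : Matrix (Fin d) (Fin d) ℝ)) B s (K₀ s)
        = linDrift A B s (K₀ s) - (β / 2) • s := by
      simp [linDrift, sub_add_eq_add_sub]
    rw [hcs, h3, map_sub, map_smul, smul_eq_mul] at h1
    rw [hM]
    have h4 : 1 / (γ * Δt) * (γ * S (s + Δt • linDrift A B s (K₀ s))
        (s + Δt • linDrift A B s (K₀ s)) - S s s) ≤ -‖s‖ ^ 2 := by
      rw [← hβ] at h2
      linarith
    rw [one_div, inv_mul_le_iff₀ hγΔ] at h4
    linarith
  obtain ⟨c, hc, hcb⟩ := bilin_le_norm_sq (matForm (-Q) + (matForm (-R)).compl₁₂ K₀ K₀)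
  obtain ⟨q, p, K, hq0, hqs, hqn, hq, hlim, hps, hppos, hp⟩ := exists_riccati N
    (fun x y => by rw [hN, hN, matForm_symm hQ, matForm_symm hR])
    (fun x hx => by
      rw [hN]
      rcases eq_or_ne x.1 0 with h | h
      · have h2 : x.2 ≠ 0 := fun h2 => hx (Prod.ext h h2)
        exact add_pos_of_nonneg_of_pos (hnn hQ _) (matForm_pos hR _ h2)
      · exact add_pos_of_pos_of_nonneg (matForm_pos hQ _ h) (hnn hR _))
    (Real.sqrt γ • M) ((c / (γ * Δt)) • S)
    (fun x => by
      simp only [LinearMap.smul_apply, smul_eq_mul]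
      exact mul_nonneg (by positivity) (hS0 x)) K₀
    (fun s => by
      have h1 := (le_abs_self _).trans (hcb s)
      have h2 := mul_le_mul_of_nonneg_left (hS' s) (by positivity : 0 ≤ c / (γ * Δt))
      have h3 : c / (γ * Δt) * (-(γ * Δt) * ‖s‖ ^ 2) = -(c * ‖s‖ ^ 2) := by
        field_simp
      simp only [LinearMap.add_apply, LinearMap.compl₁₂_apply] at h1
      simp only [hN, LinearMap.smul_apply, map_smul, smul_eq_mul]
      rw [← mul_assoc (Real.sqrt γ), Real.mul_self_sqrt hγ.le]
      linarith)
  have hsq : ∀ (r : BilinForm ℝ (EuclideanSpace ℝ (Fin d))) x,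
      r ((Real.sqrt γ • M) x) ((Real.sqrt γ • M) x) = γ * r (M x) (M x) := fun r x => by
    simp only [LinearMap.smul_apply, map_smul, smul_eq_mul]
    rw [← mul_assoc, Real.mul_self_sqrt hγ.le]
  simp only [hsq, hN] at hq hp
  simp only [map_zero, zero_add] at hp
  have hp0 : ∀ x, 0 ≤ p x x := fun x => by
    rcases eq_or_ne x 0 with rfl | h
    · simp
    · exact (hppos x h).le
  refine ⟨K, isBEPolicy_iff hQ hR hγ hμ1 hμ0 hμ2 hγμ M hT q p K hq0 hq hqs hqn hlim hps hppos hp, ?_⟩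
  set e : ℝ := 1 / (γ * Δt) with he
  have he0 : 0 < e := by positivity
  let Rb : BilinForm ℝ (EuclideanSpace ℝ (Fin m)) := e • (matForm (-R)
    + γ • p.compl₁₂ (M ∘ₗ LinearMap.inr ℝ _ _) (M ∘ₗ LinearMap.inr ℝ _ _))
  have hRb : ∀ a, Rb a a = e * (matForm (-R) a a + γ * p (M (0, a)) (M (0, a))) := fun a => rfl
  refine continuous_optimal_iff (C := multiplicativeLQ A B (Real.sqrt Δt • A) (Real.sqrt Δt • B)
      (e • Q) (e • R) β) (Q := e • matForm (-Q)) (R := e • matForm (-R)) (Rb := Rb) (k := 0)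
    (fun x hx => mul_pos he0 (matForm_pos hQ x hx)) (fun x hx => mul_pos he0 (matForm_pos hR x hx))
    (fun x hx => ?_) hppos (fun s a => ?_) hβ0 le_rfl (fun h => absurd rfl h) K
    (fun π hπ s X hX t => ?_)
    (fun s => exists_multiplicative_solution hW A B (Real.sqrt Δt) (e • Q) (e • R) β K s)
  · rw [hRb]
    exact mul_pos he0 (add_pos_of_pos_of_nonneg (matForm_pos hR x hx)
      (mul_nonneg hγ.le (hp0 _)))
  · simp only [multiplicativeLQ, LinearMap.smul_apply, matForm_neg_self, quad, smul_eq_mul,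
      Matrix.smul_mulVec, dotProduct_smul]
    ring
  · rw [(multiplicative_integral_bilin_eq hW hX hπ hps t).2]
    congr 1
    refine integral_congr_ae (Eventually.of_forall fun z => ?_)
    have h1 := hp (X z.2.toNNReal z.1) (π (X z.2.toNNReal z.1))
    have h2 := discounted_step_eq hγ.ne' hΔt hps (X z.2.toNNReal z.1)
      (linDrift A B (X z.2.toNNReal z.1) (π (X z.2.toNNReal z.1)))
    simp only [hRb, hcs, LinearMap.smul_apply, smul_eq_mul]
    rw [h2, ← hM]
    simp only [multiplicativeLQ]
    linear_combination e * h1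

end Assembly

end PhiBE

theorem theorem4p1 {d m : ℕ}
    (A : Matrix (Fin d) (Fin d) ℝ) (B : Matrix (Fin d) (Fin m) ℝ) (σ Δt : ℝ)
    (hΔt : 0 < Δt) (hA : IsUnit A.det)
    {Ω : Type*} {mΩ : MeasurableSpace Ω} (P : Measure Ω) [IsProbabilityMeasure P]
    (𝓕 : Filtration ℝ≥0 mΩ) :
    -- Optimal-PhiBE of order `i`
    (∀ (Q : Matrix (Fin d) (Fin d) ℝ) (R : Matrix (Fin m) (Fin m) ℝ) (β : ℝ) (i : ℕ)
        (W : ℝ≥0 → Ω → EuclideanSpace ℝ (Fin d)),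
      PhiBE.IsBrownianMotion 𝓕 W P →
      (-Q).PosDef → (-R).PosDef → 0 ≤ β → (σ ≠ 0 → 0 < β) → 1 ≤ i →
      PhiBE.Stabilizable (PhiBE.Ahat A Δt i - (β / 2) • (1 : Matrix (Fin d) (Fin d) ℝ))
        (PhiBE.Bhat A B Δt i) →
      ∃ π : EuclideanSpace ℝ (Fin d) → EuclideanSpace ℝ (Fin m),
        (∀ π', PhiBE.IsPhiBEPolicy (fun s a => PhiBE.quad Q s + PhiBE.quad R a)
            (PhiBE.bHat (PhiBE.transition A B σ Δt) Δt i) β π' ↔ π' = π) ∧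
        (∀ π', (Continuous π' ∧
            PhiBE.IsOptimalPolicy
              (PhiBE.additiveLQ (PhiBE.Ahat A Δt i) (PhiBE.Bhat A B Δt i) σ Q R β)
              𝓕 W P π') ↔ π' = π)) ∧
    -- Optimal-BE
    (∀ (Qt : Matrix (Fin d) (Fin d) ℝ) (Rt : Matrix (Fin m) (Fin m) ℝ) (γ : ℝ)
        (W : ℝ≥0 → Ω → EuclideanSpace ℝ (Fin 1)),
      PhiBE.IsBrownianMotion 𝓕 W P →
      (-Qt).PosDef → (-Rt).PosDef → 0 < γ → γ ≤ 1 → (σ ≠ 0 → γ < 1) →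
      PhiBE.MeanSquareStabilizable 𝓕 W P
        (PhiBE.Ahat A Δt 1
          - ((1 / (Δt * γ) - 1 / Δt) / 2) • (1 : Matrix (Fin d) (Fin d) ℝ))
        (PhiBE.Bhat A B Δt 1)
        (Real.sqrt Δt • PhiBE.Ahat A Δt 1) (Real.sqrt Δt • PhiBE.Bhat A B Δt 1) →
      ∃ π : EuclideanSpace ℝ (Fin d) → EuclideanSpace ℝ (Fin m),
        (∀ π', PhiBE.IsBEPolicy (fun s a => PhiBE.quad Qt s + PhiBE.quad Rt a)
            (PhiBE.transition A B σ Δt) γ π' ↔ π' = π) ∧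
        (∀ π', (Continuous π' ∧
            PhiBE.IsOptimalPolicy
              (PhiBE.multiplicativeLQ (PhiBE.Ahat A Δt 1) (PhiBE.Bhat A B Δt 1)
                (Real.sqrt Δt • PhiBE.Ahat A Δt 1) (Real.sqrt Δt • PhiBE.Bhat A B Δt 1)
                ((1 / (γ * Δt)) • Qt) ((1 / (γ * Δt)) • Rt) (1 / (Δt * γ) - 1 / Δt))
              𝓕 W P π') ↔ π' = π)) := by
  refine ⟨fun Q R β i W hW hQ hR hβ hσ _ hstab => ?_,
    fun Q R γ W hW hQ hR hγ hγ1 hσ hstab => ?_⟩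
  · exact PhiBE.exists_phiBE_policy (fun s a => PhiBE.bHat_transition A B σ hΔt.ne' hA i s a)
      hW hQ hR hβ hσ hstab
  · set μ := multivariateGaussian (0 : EuclideanSpace ℝ (Fin d))
      ((σ ^ 2 * Δt) • PhiBE.noiseCov A Δt) with hμ
    have hμL : MemLp id 2 μ := IsGaussian.memLp_two_id
    refine PhiBE.exists_BE_policy hΔt hW hQ hR hγ hγ1 (μ := μ) IsGaussian.integrable_fun_id
      integral_id_multivariateGaussian hμL.integrable_norm_pow' ?_ (fun s a => ?_) hstab
    · rcases eq_or_ne σ 0 with h | h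
      · rcases hγ1.lt_or_eq with h1 | h1
        · exact Or.inl h1
        · refine Or.inr ⟨h1, ?_⟩
          rw [hμ, h]
          simp [multivariateGaussian]
      · exact Or.inl (hσ h)
    · rw [PhiBE.transition, PhiBE.multivariateGaussian_eq_map]
      have h1 : PhiBE.linDrift (Δt • PhiBE.Ahat A Δt 1 + 1) (Δt • PhiBE.Bhat A B Δt 1) s a
          = s + Δt • PhiBE.linDrift (PhiBE.Ahat A Δt 1) (PhiBE.Bhat A B Δt 1) s a := by
        simp only [PhiBE.linDrift, map_add, map_smul, LinearMap.add_apply, LinearMap.smul_apply,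
          Matrix.toLpLin_one, LinearMap.id_apply, smul_add]
        abel
      rw [h1]
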